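/- Let $n\ge 1$, let $\mathbb H^n=\mathbb R^n\times\mathbb R^n\times\mathbb R\ni p=(x,y,t)$ be the Heisenberg group with group law $(x,y,t)\cdot(x',y',t')=(x+x',\,y+y',\,t+t'+2\sum_{j}(x'_jy_j-x_jy'_j))$ and left-invariant frame $X_j=\partial_{x_j}+2y_j\partial_t$, $Y_j=\partial_{y_j}-2x_j\partial_t$ $(1\le j\le n)$, $T=\partial_t$, and write $Z_j=X_j$, $Z_{n+j}=Y_j$. For $r\in[1,\infty]$ let $W^{2,r}_{\mathcal H}(\mathbb H^n)$ be the space of all $\psi\in L^r(\mathbb H^n)$ (Lebesgue measure) whose weak derivatives $Z_j\psi$ and $Z_iZ_j\psi$, $1\le i,j\le 2n$, belong to $L^r(\mathbb H^n)$. Let $\bar\tau\in(0,\infty]$, let $s\in[1,\infty]$ with Hölder conjugate $s'$, let $\psi\in L^1(0,\bar\tau;W^{2,s'}_{\mathcal H}(\mathbb H^n))$, and let $b$ be the time-dependent contact vector field generated by $\psi$, $$b=-4\psi\,T+\sum_{j=1}^n\big(Y_j\psi\,X_j-X_j\psi\,Y_j\big).$$ Let $u_0\in L^s(\mathbb H^n)$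 and $c\in L^1_{\mathrm{loc}}([0,\bar\tau)\times\mathbb H^n)$, and consider the transport equation $$\partial_\tau u-\langle b,\nabla u\rangle+cu=0\ \text{ in }(0,\bar\tau)\times\mathbb H^n,\qquad u(0,\cdot)=u_0,\tag{$\mathscr T$}$$ where $\langle b,\nabla\varphi\rangle=d\varphi(b)$ and $\operatorname{div}b$ is the distributional divergence in space. * A function $u\in L^\infty(0,\bar\tau;L^s(\mathbb H^n))$ is a *distributional solution* of $(\mathscr T)$ if, for every $\varphi\in C_c^\infty([0,\bar\tau)\times\mathbb H^n)$, the space-time integrand below is integrable (which is automatic if $c\in L^1(0,\bar\tau;L^{s'}_{\mathrm{loc}}(\mathbb H^n))$ or if $s=\infty$) and $$-\int_{\mathbb H^n}u_0\,\varphi(0,\cdot)\,dp+\int_0^{\bar\tau}\!\!\int_{\mathbb H^n}u\,\big[-\partial_\tau\varphi+\langle b,\nabla\varphi\rangle+(c+\operatorname{div}b)\varphi\big]\,dp\,d\tau=0 .$$ * It is a *renormalized solution* if, for every $\beta\in C^1(\mathbb R)$, with $\beta'$ bounded in the case $s<\infty$, and every $\varphi\in C_c^\infty([0,\bar\tau)\times\mathbb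 H^n)$, the space-time integrand below is integrable and $$-\int_{\mathbb H^n}\beta(u_0)\,\varphi(0,\cdot)\,dp+\int_0^{\bar\tau}\!\!\int_{\mathbb H^n}\Big(\beta(u)\big[-\partial_\tau\varphi+\langle b,\nabla\varphi\rangle+\operatorname{div}b\,\varphi\big]+c\,u\,\beta'(u)\,\varphi\Big)\,dp\,d\tau=0 .$$ Then every distributional solution $u\in L^\infty(0,\bar\tau;L^s(\mathbb H^n))$ of $(\mathscr T)$ is a renormalized solution. In particular, $b$ has the renormalization property: $b,\operatorname{div}b\in L^1(0,\bar\tau;L^1_{\mathrm{loc}})$ and, for all $u_0\in L^\infty(\mathbb H^n)$ and $c\in L^1_{\mathrm{loc}}([0,\bar\tau)\times\mathbb H^n)$, every distributional solution $u\in L^\infty((0,\bar\tau)\times\mathbb H^n)$ of $(\mathscr T)$ is a renormalized solution (in the sense above, with $s=\infty$). -/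

import Mathlib

open MeasureTheory Set
open scoped ContDiff ENNReal

noncomputable section

/-- The underlying space `ℝⁿ × ℝⁿ × ℝ` of the `n`-th Heisenberg group; points are `(x, y, t)`.
Its `volume` is the Lebesgue measure, which is also the Haar measure of the group. -/
abbrev Heis (n : ℕ) : Type := (Fin n → ℝ) × (Fin n → ℝ) × ℝ

/-- The left-invariant horizontal frame of the group law
`(x,y,t)·(x',y',t') = (x+x', y+y', t+t'+2∑ⱼ(x'ⱼyⱼ - xⱼy'ⱼ))`:
`Sum.inl j` is `X_j = ∂_{x_j} + 2 y_j ∂_t` and `Sum.inr j` is `Y_j = ∂_{y_j} - 2 x_j ∂_t`. -/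
def horizontalFrame {n : ℕ} : Fin n ⊕ Fin n → Heis n → Heis n
  | Sum.inl j => fun p => (Pi.single j 1, 0, 2 * p.2.1 j)
  | Sum.inr j => fun p => (0, Pi.single j 1, -2 * p.1 j)

/-- The vertical left-invariant vector field `T = ∂_t`. -/
def verticalField {n : ℕ} : Heis n → Heis n := fun _ => (0, 0, 1)

/-- `g` is the weak derivative of `f` along `Z` (for a divergence-free smooth vector field `Z`). -/
def IsWeakDerivAlong {n : ℕ} (Z : Heis n → Heis n) (f g : Heis n → ℝ) : Prop :=
  LocallyIntegrable f ∧ LocallyIntegrable g ∧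
    ∀ φ : Heis n → ℝ, ContDiff ℝ ∞ φ → HasCompactSupport φ →
      ∫ p, g p * φ p = -∫ p, f p * fderiv ℝ φ p (Z p)

/-- The open time interval `(0, τ)`, where `τ = ∞` is allowed. -/
def timeInterval (τ : EReal) : Set ℝ := {t : ℝ | 0 < t ∧ (t : EReal) < τ}

/-- Lebesgue measure on `(0, τ) × ℍⁿ`. -/
def spaceTime (n : ℕ) (τ : EReal) : Measure (ℝ × Heis n) :=
  ((volume : Measure ℝ).restrict (timeInterval τ)).prod (volume : Measure (Heis n))

/-- `f ∈ L^α(0, τ; L^β(ℍⁿ))`. -/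
def MemMixed {n : ℕ} {E : Type*} [NormedAddCommGroup E] (τ : EReal) (α β : ℝ≥0∞)
    (f : ℝ → Heis n → E) : Prop :=
  AEStronglyMeasurable (Function.uncurry f) (spaceTime n τ) ∧
    eLpNorm (fun t => eLpNorm (f t) β (volume : Measure (Heis n))) α
      (volume.restrict (timeInterval τ)) < ⊤

/-- `f ∈ L^α(0, τ; L^β_loc(ℍⁿ))`. -/
def MemMixedLoc {n : ℕ} {E : Type*} [NormedAddCommGroup E] (τ : EReal) (α β : ℝ≥0∞)
    (f : ℝ → Heis n → E) : Prop :=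
  AEStronglyMeasurable (Function.uncurry f) (spaceTime n τ) ∧
    ∀ K : Set (Heis n), IsCompact K →
      eLpNorm (fun t => eLpNorm (f t) β ((volume : Measure (Heis n)).restrict K)) α
        (volume.restrict (timeInterval τ)) < ⊤

/-- `ψ ∈ L¹(0, τ; W^{2,r}_H(ℍⁿ))`: the functions `ψ`, `Z_j ψ` and `Z_i Z_j ψ` (spatial weak
derivatives, for all horizontal `Z_i`, `Z_j`) belong to `L¹(0, τ; L^r(ℍⁿ))`. -/
def MemL1HorizontalW2 {n : ℕ} (τ : EReal) (r : ℝ≥0∞) (ψ : ℝ → Heis n → ℝ) : Prop :=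
  MemMixed τ 1 r ψ ∧
    ∃ (G : Fin n ⊕ Fin n → ℝ → Heis n → ℝ)
      (H : Fin n ⊕ Fin n → Fin n ⊕ Fin n → ℝ → Heis n → ℝ),
      (∀ j, MemMixed τ 1 r (G j) ∧
        ∀ᵐ t ∂(volume.restrict (timeInterval τ)),
          IsWeakDerivAlong (horizontalFrame j) (ψ t) (G j t)) ∧
      (∀ i j, MemMixed τ 1 r (H i j) ∧
        ∀ᵐ t ∂(volume.restrict (timeInterval τ)),
          IsWeakDerivAlong (horizontalFrame i) (G j t) (H i j t))

/-- The vector field `b` on `ℍⁿ` is the contact vector field with generating function `ψ`: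
`b = -4 ψ T + ∑ⱼ (Y_jψ X_j - X_jψ Y_j)` almost everywhere, with weak derivatives of `ψ`. -/
def IsContactFieldOf {n : ℕ} (b : Heis n → Heis n) (ψ : Heis n → ℝ) : Prop :=
  ∃ G : Fin n ⊕ Fin n → Heis n → ℝ,
    (∀ j, IsWeakDerivAlong (horizontalFrame j) ψ (G j)) ∧
    ∀ᵐ p, b p = -(4 * ψ p) • verticalField p +
      ∑ j : Fin n, (G (Sum.inr j) p • horizontalFrame (Sum.inl j) p -
        G (Sum.inl j) p • horizontalFrame (Sum.inr j) p)

/-- The time-dependent version, on `(0, τ) × ℍⁿ`. -/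
def IsTimeContactFieldOf {n : ℕ} (τ : EReal) (b : ℝ → Heis n → Heis n)
    (ψ : ℝ → Heis n → ℝ) : Prop :=
  AEStronglyMeasurable (Function.uncurry b) (spaceTime n τ) ∧
    ∀ᵐ t ∂(volume.restrict (timeInterval τ)), IsContactFieldOf (b t) (ψ t)

/-- `D` is the distributional (spatial) divergence of the vector field `b`. -/
def IsDivergence {n : ℕ} (b : Heis n → Heis n) (D : Heis n → ℝ) : Prop :=
  LocallyIntegrable b ∧ LocallyIntegrable D ∧
    ∀ φ : Heis n → ℝ, ContDiff ℝ ∞ φ → HasCompactSupport φ →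
      ∫ p, fderiv ℝ φ p (b p) = -∫ p, φ p * D p

/-- `b ∈ L¹(0, τ; L^r_loc)`, with divergence `div b = D ∈ L¹(0, τ; L^r_loc)`. -/
def HasDivergenceInL1 {n : ℕ} (τ : EReal) (r : ℝ≥0∞) (b : ℝ → Heis n → Heis n)
    (D : ℝ → Heis n → ℝ) : Prop :=
  MemMixedLoc τ 1 r b ∧ MemMixedLoc τ 1 r D ∧
    ∀ᵐ t ∂(volume.restrict (timeInterval τ)), IsDivergence (b t) (D t)

/-- `c ∈ L¹_loc([0, τ) × ℍⁿ)`. -/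
def MemL1LocSpaceTime {n : ℕ} (τ : EReal) (c : ℝ → Heis n → ℝ) : Prop :=
  LocallyIntegrableOn (Function.uncurry c)
    {q : ℝ × Heis n | 0 ≤ q.1 ∧ (q.1 : EReal) < τ} volume

/-- `u₀ ∈ L^s_loc(ℍⁿ)`. -/
def MemLpLocal {n : ℕ} (s : ℝ≥0∞) (u₀ : Heis n → ℝ) : Prop :=
  ∀ K : Set (Heis n), IsCompact K → MemLp u₀ s (volume.restrict K)

/-- `φ ∈ C_c^∞([0, τ) × ℍⁿ)`, where `φ` is given together with a smooth compactly supported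
extension to `(-∞, τ) × ℍⁿ`, itself extended by zero to later times. -/
def IsTestFunction {n : ℕ} (τ : EReal) (φ : ℝ × Heis n → ℝ) : Prop :=
  ContDiff ℝ ∞ φ ∧ HasCompactSupport φ ∧
    tsupport φ ⊆ {q : ℝ × Heis n | (q.1 : EReal) < τ}

/-- Time derivative of a function on space-time. -/
def timeDeriv {n : ℕ} (φ : ℝ × Heis n → ℝ) (q : ℝ × Heis n) : ℝ :=
  fderiv ℝ φ q (1, 0)

/-- `⟨b, ∇φ⟩ = dφ(b)`, with the differential taken in the space variables. -/
def spaceDerivAlong {n : ℕ} (b : ℝ → Heis n → Heis n) (φ : ℝ × Heis n → ℝ)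
    (q : ℝ × Heis n) : ℝ :=
  fderiv ℝ φ q (0, b q.1 q.2)

/-- `u ∈ L^∞(0, τ; L^s_loc)` (`u` essentially bounded if `s = ∞`) is a distributional solution of
`∂_t u - ⟨b, ∇u⟩ + c u = 0` in `(0, τ) × ℍⁿ`, `u(0, ·) = u₀`. The coefficient `c` is only required
to be locally integrable, so that it is part of the definition that the integrand is integrable;
this is automatic if `c ∈ L¹(0, τ; L^{s'}_loc)` or if `s = ∞`. -/
def IsDistributionalSolution {n : ℕ} (τ : EReal) (s : ℝ≥0∞) (b : ℝ → Heis n → Heis n)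
    (c : ℝ → Heis n → ℝ) (u₀ : Heis n → ℝ) (u : ℝ → Heis n → ℝ) : Prop :=
  MemL1LocSpaceTime τ c ∧ MemLpLocal s u₀ ∧
  MemMixedLoc τ ⊤ s u ∧ (s = ⊤ → MemMixed τ ⊤ ⊤ u) ∧
    ∃ D : ℝ → Heis n → ℝ, HasDivergenceInL1 τ (ENNReal.conjExponent s) b D ∧
      ∀ φ : ℝ × Heis n → ℝ, IsTestFunction τ φ →
        Integrable (fun q : ℝ × Heis n => u q.1 q.2 *
          (-timeDeriv φ q + spaceDerivAlong b φ q + (c q.1 q.2 + D q.1 q.2) * φ q))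
          (spaceTime n τ) ∧
        -(∫ p, u₀ p * φ (0, p)) +
          ∫ q, u q.1 q.2 *
            (-timeDeriv φ q + spaceDerivAlong b φ q + (c q.1 q.2 + D q.1 q.2) * φ q)
            ∂(spaceTime n τ) = 0

/-- `u ∈ L^∞(0, τ; L^s)` is a renormalized solution of
`∂_t u - ⟨b, ∇u⟩ + c u = 0` in `(0, τ) × ℍⁿ`, `u(0, ·) = u₀ ∈ L^s`: for every `β ∈ C¹(ℝ)`, with
`β'` bounded unless `s = ∞`, the function `β(u)` solves
`∂_t β(u) - ⟨b, ∇β(u)⟩ + c u β'(u) = 0`, `β(u)(0, ·) = β(u₀)`, in the sense of distributions. -/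
def IsRenormalizedSolution {n : ℕ} (τ : EReal) (s : ℝ≥0∞) (b : ℝ → Heis n → Heis n)
    (c : ℝ → Heis n → ℝ) (u₀ : Heis n → ℝ) (u : ℝ → Heis n → ℝ) : Prop :=
  MemL1LocSpaceTime τ c ∧ MemLp u₀ s volume ∧ MemMixed τ ⊤ s u ∧
    ∃ D : ℝ → Heis n → ℝ, HasDivergenceInL1 τ (ENNReal.conjExponent s) b D ∧
      ∀ β : ℝ → ℝ, ContDiff ℝ 1 β → (s ≠ ⊤ → ∃ M : ℝ, ∀ x, |deriv β x| ≤ M) →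
        ∀ φ : ℝ × Heis n → ℝ, IsTestFunction τ φ →
          Integrable (fun q : ℝ × Heis n => β (u q.1 q.2) *
              (-timeDeriv φ q + spaceDerivAlong b φ q + D q.1 q.2 * φ q) +
              c q.1 q.2 * u q.1 q.2 * deriv β (u q.1 q.2) * φ q) (spaceTime n τ) ∧
          -(∫ p, β (u₀ p) * φ (0, p)) +
            ∫ q, (β (u q.1 q.2) *
              (-timeDeriv φ q + spaceDerivAlong b φ q + D q.1 q.2 * φ q) +
              c q.1 q.2 * u q.1 q.2 * deriv β (u q.1 q.2) * φ q) ∂(spaceTime n τ) = 0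

/-- The renormalization property of `b`: `b` and `div b` belong to `L¹(0, τ; L¹_loc)`, and for all
bounded initial data and all locally integrable `c`, every bounded distributional solution is a
renormalized solution. -/
def HasRenormalizationProperty {n : ℕ} (τ : EReal) (b : ℝ → Heis n → Heis n) : Prop :=
  (∃ D : ℝ → Heis n → ℝ, HasDivergenceInL1 τ 1 b D) ∧
    ∀ (u₀ : Heis n → ℝ) (c : ℝ → Heis n → ℝ) (u : ℝ → Heis n → ℝ),
      MemLp u₀ ⊤ volume → MemL1LocSpaceTime τ c → MemMixed τ ⊤ ⊤ u →
      IsDistributionalSolution τ ⊤ b c u₀ u → IsRenormalizedSolution τ ⊤ b c u₀ u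

end

/-! The proof is the DiPerna–Lions scheme, with Euclidean convolution replaced by convolution on the
group. Put u_ε(p) = ∫ u(q) κ_ε(q⁻¹p) dq, where κ_ε lives on a box of size ε in the horizontal and ε²
in the central direction. A left-invariant field acting in p falls on κ_ε as a left-invariant field.
The same field acting in q on q ↦ κ_ε(q⁻¹p) becomes minus a right-invariant field of κ_ε. Hence, for
each fixed p, t ↦ u_ε(t,p) is a weak solution of a scalar ODE with integrable right-hand side, so it
agrees a.e. with an absolutely continuous function and the chain rule is available. No mollification
in time is needed. Integrating in p, and by parts in space, gives the renormalized equation for u_ε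
with an additional term β'(u_ε) r_ε (`IsWeakTransport.renormalized_mollified`). Everything depends
on showing that the commutator r_ε tends to 0 in L¹_loc.

Let B be the vector of components of b in the left-invariant frame, ω the symplectic form
`symplForm`, and w = q⁻¹p. The commutator kernel is dκ_w(left field of B(p) − right field of B(q)) +
div b(q) κ(w). The central component of B contributes −4(ψ(qw) − ψ(q)) Tκ(w). The mismatch between
left and right fields contributes 2ω(w, B(q)) Tκ(w), and for a contact field this equals 4 ∑ w_j
Z_jψ(q) Tκ(w). Together they form −4 times the first-order Taylor remainder of ψ. This remainder has
order ε², which balances Tκ ~ ε⁻², while the increments of Z_jψ have order ε against Zκ ~ ε⁻¹. This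
is the structural reason why two horizontal derivatives of ψ suffice.

Next, the second-order Taylor polynomial of ψ and the first-order ones of Z_jψ are split off
(`commutatorKernel_eq`). The remainders are o(ε²) and o(ε) by `wInt_taylor_two` and
`wInt_taylor_one`. The polynomials leave terms u(q) Z_iZ_jψ(q) P(w) and u(q) Tψ(q) P(w), whose
kernels P are bounded in L¹ uniformly in ε and have integral zero (`integral_kernelH`,
`integral_kernelS`); it is the divergence term that makes the means vanish. Such terms tend to 0 by
continuity of translations in L¹. The combined estimate is `lintegral_commutator_le`.

All smallness is measured by weighted quantities ∬ |f| |F(q h) − F(q)|, with a truncation of u as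
weight f in the Taylor remainders. Translations are not continuous in L^∞, but these weighted
quantities still tend to 0 when one factor is only bounded and the other integrable
(`tendsto_lintegral_mul_translate`), so that all s ∈ [1,∞] are handled together.

The limit ε → 0 on a bounded time interval is `IsWeakTransport.renormalized`. Passing to measurable
representatives, restricting to a finite slab, and truncating β when s = ∞ then give
`isRenormalizedSolution_of_contactData`. -/

noncomputable section

/-- The symplectic form appearing in the group law of the Heisenberg group. -/
def symplForm {n : ℕ} (p q : Heis n) : ℝ := 2 * ∑ j, (q.1 j * p.2.1 j - p.1 j * q.2.1 j)

/-- The element `(0, 0, c)` of the centre. -/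
def vert {n : ℕ} (c : ℝ) : Heis n := (0, 0, c)

/-- The group law of the Heisenberg group. -/
def hmul {n : ℕ} (p q : Heis n) : Heis n := p + q + vert (symplForm p q)

infixl:70 " ⊙ " => hmul

/-- The left-invariant vector field with value `v` at the origin. -/
def leftField {n : ℕ} (v p : Heis n) : Heis n := v + vert (symplForm p v)

/-- The right-invariant vector field with value `v` at the origin. -/
def rightField {n : ℕ} (v p : Heis n) : Heis n := v + vert (symplForm v p)

/-! ### Algebra and smoothness of the group law and of the invariant fields. -/

section algebra

variable {n : ℕ}

lemma vert_add (a b : ℝ) : (vert (a + b) : Heis n) = vert a + vert b := by simp [vert]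
lemma vert_smul (a b : ℝ) : (vert (a * b) : Heis n) = a • vert b := by simp [vert]
@[simp] lemma vert_zero : (vert 0 : Heis n) = 0 := rfl

lemma symplForm_add_left (p p' q : Heis n) :
    symplForm (p + p') q = symplForm p q + symplForm p' q := by
  simp only [symplForm, ← mul_add, ← Finset.sum_add_distrib, Prod.fst_add, Prod.snd_add,
    Pi.add_apply]
  congr 1; exact Finset.sum_congr rfl fun j _ => by ring

lemma symplForm_swap (p q : Heis n) : symplForm p q = -symplForm q p := by
  simp only [symplForm, ← mul_neg, ← Finset.sum_neg_distrib]
  congr 1; exact Finset.sum_congr rfl fun j _ => by ring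

lemma symplForm_add_right (p q q' : Heis n) :
    symplForm p (q + q') = symplForm p q + symplForm p q' := by
  rw [symplForm_swap, symplForm_add_left, symplForm_swap q, symplForm_swap q']; ring

lemma symplForm_smul_left (a : ℝ) (p q : Heis n) : symplForm (a • p) q = a * symplForm p q := by
  simp only [symplForm, Finset.mul_sum, Prod.smul_fst, Prod.smul_snd, Pi.smul_apply, smul_eq_mul]
  exact Finset.sum_congr rfl fun j _ => by ring

lemma symplForm_smul_right (a : ℝ) (p q : Heis n) : symplForm p (a • q) = a * symplForm p q := by
  rw [symplForm_swap, symplForm_smul_left, symplForm_swap q]; ring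

@[simp] lemma symplForm_self (p : Heis n) : symplForm p p = 0 := by
  have := symplForm_swap p p; linarith

@[simp] lemma symplForm_vert_right (p : Heis n) (c : ℝ) : symplForm p (vert c) = 0 := by
  simp [symplForm, vert]

@[simp] lemma symplForm_vert_left (p : Heis n) (c : ℝ) : symplForm (vert c) p = 0 := by
  simp [symplForm, vert]

@[simp] lemma symplForm_zero_right (p : Heis n) : symplForm p 0 = 0 := by
  simp [symplForm]

@[simp] lemma symplForm_zero_left (p : Heis n) : symplForm 0 p = 0 := by
  simp [symplForm]

lemma symplForm_neg_left (p q : Heis n) : symplForm (-p) q = -symplForm p q := by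
  simpa using symplForm_smul_left (-1) p q

lemma symplForm_neg_right (p q : Heis n) : symplForm p (-q) = -symplForm p q := by
  simpa using symplForm_smul_right (-1) p q

lemma hmul_assoc (p q r : Heis n) : p ⊙ q ⊙ r = p ⊙ (q ⊙ r) := by
  simp only [hmul, symplForm_add_left, symplForm_add_right, symplForm_vert_left,
    symplForm_vert_right, vert_add, vert_zero]
  abel

@[simp] lemma hmul_zero (p : Heis n) : p ⊙ 0 = p := by simp [hmul]
@[simp] lemma zero_hmul (p : Heis n) : 0 ⊙ p = p := by simp [hmul]
@[simp] lemma neg_hmul_self (p : Heis n) : (-p) ⊙ p = 0 := by simp [hmul, symplForm_neg_left]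
@[simp] lemma hmul_neg_self (p : Heis n) : p ⊙ (-p) = 0 := by simp [hmul, symplForm_neg_right]
@[simp] lemma neg_hmul_cancel_left (p q : Heis n) : (-p) ⊙ (p ⊙ q) = q := by
  rw [← hmul_assoc]; simp
@[simp] lemma hmul_neg_cancel_left (p q : Heis n) : p ⊙ ((-p) ⊙ q) = q := by
  rw [← hmul_assoc]; simp
@[simp] lemma hmul_neg_cancel_right (p q : Heis n) : p ⊙ q ⊙ (-q) = p := by
  rw [hmul_assoc]; simp
@[simp] lemma neg_hmul_cancel_right (p q : Heis n) : p ⊙ (-q) ⊙ q = p := by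
  rw [hmul_assoc]; simp

lemma neg_hmul_rev (p q : Heis n) : -(p ⊙ q) = (-q) ⊙ (-p) := by
  have h := symplForm_swap p q
  simp only [hmul, symplForm_neg_left, symplForm_neg_right, neg_neg, h, neg_add]
  have : (vert (-symplForm q p) : Heis n) = - vert (symplForm q p) := by simp [vert]
  rw [this, neg_neg]; abel

/-- One-parameter subgroups act by moving along Euclidean lines, so a left-invariant derivative is
an ordinary directional derivative. Every passage between the group law and `fderiv` rests on this.
-/
lemma hmul_smul_eq (p v : Heis n) (θ : ℝ) : p ⊙ (θ • v) = p + θ • leftField v p := by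
  simp [hmul, leftField, symplForm_smul_right, vert_smul, add_assoc]

lemma smul_hmul_eq (p v : Heis n) (θ : ℝ) : (θ • v) ⊙ p = p + θ • rightField v p := by
  simp only [hmul, rightField, symplForm_smul_left, vert_smul, smul_add]; abel

lemma leftField_add (v w p : Heis n) : leftField (v + w) p = leftField v p + leftField w p := by
  simp only [leftField, symplForm_add_right, vert_add]; abel

lemma leftField_smul (a : ℝ) (v p : Heis n) : leftField (a • v) p = a • leftField v p := by
  simp only [leftField, symplForm_smul_right, vert_smul, smul_add]

/-- The horizontal basis of the Lie algebra. -/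
def hbasis {n : ℕ} : Fin n ⊕ Fin n → Heis n
  | Sum.inl j => (Pi.single j 1, 0, 0)
  | Sum.inr j => (0, Pi.single j 1, 0)

lemma horizontalFrame_eq (j : Fin n ⊕ Fin n) :
    horizontalFrame (n := n) j = leftField (hbasis j) := by
  funext p
  rcases j with j | j <;>
    simp [horizontalFrame, hbasis, leftField, symplForm, vert, Pi.single_apply]

/-- The horizontal coordinates. -/
def hcoord {n : ℕ} (j : Fin n ⊕ Fin n) (p : Heis n) : ℝ := Sum.elim p.1 p.2.1 j

lemma sum_hcoord_smul_hbasis (p : Heis n) :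
    ∑ j, hcoord j p • hbasis j + vert p.2.2 = p := by
  rw [Fintype.sum_sum_type]
  ext j <;> simp [hcoord, hbasis, vert, Prod.fst_sum, Prod.snd_sum, Finset.sum_apply,
    Pi.single_apply]

lemma continuous_symplForm : Continuous fun z : Heis n × Heis n => symplForm z.1 z.2 := by
  unfold symplForm; fun_prop

lemma contDiff_symplForm : ContDiff ℝ ∞ fun z : Heis n × Heis n => symplForm z.1 z.2 := by
  unfold symplForm; fun_prop

lemma contDiff_vert : ContDiff ℝ ∞ (vert : ℝ → Heis n) := by
  unfold vert; fun_prop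

lemma contDiff_hmul : ContDiff ℝ ∞ fun z : Heis n × Heis n => z.1 ⊙ z.2 := by
  unfold hmul
  exact (contDiff_fst.add contDiff_snd).add (contDiff_vert.comp contDiff_symplForm)

@[fun_prop]
lemma ContDiff.hmul {E : Type*} [NormedAddCommGroup E] [NormedSpace ℝ E] {f g : E → Heis n}
    (hf : ContDiff ℝ ∞ f) (hg : ContDiff ℝ ∞ g) : ContDiff ℝ ∞ fun x => f x ⊙ g x :=
  contDiff_hmul.comp (hf.prodMk hg)

@[fun_prop]
lemma Continuous.hmul {E : Type*} [TopologicalSpace E] {f g : E → Heis n}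
    (hf : Continuous f) (hg : Continuous g) : Continuous fun x => f x ⊙ g x :=
  contDiff_hmul.continuous.comp (hf.prodMk hg)

@[fun_prop]
lemma Measurable.hmul {E : Type*} [MeasurableSpace E] {f g : E → Heis n}
    (hf : Measurable f) (hg : Measurable g) : Measurable fun x => f x ⊙ g x :=
  contDiff_hmul.continuous.measurable.comp (hf.prodMk hg)

@[fun_prop]
lemma ContDiff.leftField {E : Type*} [NormedAddCommGroup E] [NormedSpace ℝ E] {f g : E → Heis n}
    (hf : ContDiff ℝ ∞ f) (hg : ContDiff ℝ ∞ g) : ContDiff ℝ ∞ fun x => leftField (f x) (g x) :=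
  hf.add (contDiff_vert.comp (contDiff_symplForm.comp (hg.prodMk hf)))

@[fun_prop]
lemma Continuous.leftField {E : Type*} [TopologicalSpace E] {f g : E → Heis n}
    (hf : Continuous f) (hg : Continuous g) : Continuous fun x => leftField (f x) (g x) :=
  hf.add (contDiff_vert.continuous.comp (continuous_symplForm.comp (hg.prodMk hf)))

end algebra

/-! ### Bi-invariance of Lebesgue measure. -/

section haar

variable {n : ℕ}

/-- The map is triangular: x and y are translated by constants and t by an amount depending on (x,
y) only. It is therefore an iterated skew product of translations. -/
lemma measurePreserving_hmul_right (h : Heis n) :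
    MeasurePreserving (fun q : Heis n => q ⊙ h) volume volume := by
  have key : ∀ x : Fin n → ℝ, MeasurePreserving (fun r : (Fin n → ℝ) × ℝ =>
      (r.1 + h.2.1, r.2 + h.2.2 + symplForm (x, r.1, r.2) h)) volume volume := by
    intro x
    refine (measurePreserving_add_right volume h.2.1).skew_product (μa := volume)
      (μc := (volume : Measure ℝ)) (μd := volume) (g := fun y c => c + h.2.2 + symplForm (x, y, c) h)
      ?_ (ae_of_all _ fun y => ?_)
    · simp only [symplForm]; unfold Function.uncurry; fun_prop
    · have : (fun c : ℝ => c + h.2.2 + symplForm (x, y, c) h)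
          = fun c => c + (h.2.2 + symplForm (x, y, 0) h) := by
        funext c; simp only [symplForm]; ring
      simpa [this] using (measurePreserving_add_right volume (h.2.2 + symplForm (x, y, 0) h)).map_eq
  have := (measurePreserving_add_right (volume : Measure (Fin n → ℝ)) h.1).skew_product
      (μc := (volume : Measure ((Fin n → ℝ) × ℝ))) (μd := volume)
      (g := fun x r => (r.1 + h.2.1, r.2 + h.2.2 + symplForm (x, r.1, r.2) h))
      (by simp only [symplForm]; unfold Function.uncurry; fun_prop)
      (ae_of_all _ fun x => (key x).map_eq)
  have e : (fun q : Heis n => q ⊙ h) = fun p : (Fin n → ℝ) × (Fin n → ℝ) × ℝ =>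
      (p.1 + h.1, p.2.1 + h.2.1, p.2.2 + h.2.2 + symplForm (p.1, p.2.1, p.2.2) h) := by
    funext q; simp [hmul, vert, Prod.ext_iff]
  rw [e]; exact this

lemma measurePreserving_neg_heis : MeasurePreserving (fun q : Heis n => -q) volume volume :=
  (Measure.measurePreserving_neg (volume : Measure (Fin n → ℝ))).prod
    ((Measure.measurePreserving_neg (volume : Measure (Fin n → ℝ))).prod
      (Measure.measurePreserving_neg (volume : Measure ℝ)))

/-- Inversion is q ↦ −q, which preserves Lebesgue measure and exchanges left and right translations.
-/
lemma measurePreserving_hmul_left (h : Heis n) :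
    MeasurePreserving (fun q : Heis n => h ⊙ q) volume volume := by
  have := measurePreserving_neg_heis.comp ((measurePreserving_hmul_right (-h)).comp
    (measurePreserving_neg_heis (n := n)))
  convert this using 1
  funext q; simp [Function.comp, neg_hmul_rev]

lemma measurePreserving_neg_hmul (p : Heis n) :
    MeasurePreserving (fun q : Heis n => (-q) ⊙ p) volume volume :=
  (measurePreserving_hmul_right p).comp measurePreserving_neg_heis

/-- Right translation as a homeomorphism. -/
def hmulRight (h : Heis n) : Heis n ≃ₜ Heis n where
  toFun q := q ⊙ h
  invFun q := q ⊙ (-h)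
  left_inv q := by simp
  right_inv q := by simp
  continuous_toFun := by fun_prop
  continuous_invFun := by fun_prop

/-- Left translation as a homeomorphism. -/
def hmulLeft (h : Heis n) : Heis n ≃ₜ Heis n where
  toFun q := h ⊙ q
  invFun q := (-h) ⊙ q
  left_inv q := by simp
  right_inv q := by simp
  continuous_toFun := by fun_prop
  continuous_invFun := by fun_prop

/-- The map `q ↦ q⁻¹ ⊙ p` as a homeomorphism. -/
def negHmul (p : Heis n) : Heis n ≃ₜ Heis n where
  toFun q := (-q) ⊙ p
  invFun q := p ⊙ (-q)
  left_inv q := by simp [neg_hmul_rev]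
  right_inv q := by simp [neg_hmul_rev]
  continuous_toFun := by fun_prop
  continuous_invFun := by fun_prop

lemma integral_hmul_right {E : Type*} [NormedAddCommGroup E] [NormedSpace ℝ E]
    (f : Heis n → E) (h : Heis n) : ∫ q, f (q ⊙ h) = ∫ q, f q :=
  (measurePreserving_hmul_right h).integral_comp (hmulRight h).measurableEmbedding f

lemma integral_neg_hmul {E : Type*} [NormedAddCommGroup E] [NormedSpace ℝ E]
    (f : Heis n → E) (p : Heis n) : ∫ q, f ((-q) ⊙ p) = ∫ q, f q :=
  (measurePreserving_neg_hmul p).integral_comp (negHmul p).measurableEmbedding f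

lemma lintegral_hmul_left (f : Heis n → ℝ≥0∞) (h : Heis n) : ∫⁻ q, f (h ⊙ q) = ∫⁻ q, f q :=
  (measurePreserving_hmul_left h).lintegral_comp_emb (hmulLeft h).measurableEmbedding f

lemma lintegral_neg_hmul (f : Heis n → ℝ≥0∞) (p : Heis n) : ∫⁻ q, f ((-q) ⊙ p) = ∫⁻ q, f q :=
  (measurePreserving_neg_hmul p).lintegral_comp_emb (negHmul p).measurableEmbedding f

end haar

/-- A mollification kernel adapted to the scale `ε` of the Heisenberg dilations. -/
structure AdaptedKernel {n : ℕ} (C : ℝ≥0∞) (ε : ℝ) (κ : Heis n → ℝ) : Prop where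
  contDiff : ContDiff ℝ ∞ κ
  hasCompactSupport : HasCompactSupport κ
  integral_eq_one : ∫ w, κ w = 1
  lintegral_le : ∫⁻ w, ‖κ w‖ₑ ≤ C
  hcoord_le : ∀ w ∈ tsupport κ, ∀ j, |hcoord j w| ≤ ε
  vert_le : ∀ w ∈ tsupport κ, |w.2.2| ≤ ε ^ 2
  lintegral_left_le : ∀ j, ENNReal.ofReal ε *
    ∫⁻ w, ‖fderiv ℝ κ w (leftField (hbasis j) w)‖ₑ ≤ C
  lintegral_vert_le : ENNReal.ofReal (ε ^ 2) * ∫⁻ w, ‖fderiv ℝ κ w (vert 1)‖ₑ ≤ C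

/-! ### Dilations and kernels adapted to them. -/

section

variable {n : ℕ}

instance : (volume : Measure (Heis n)).IsAddHaarMeasure := by
  have : (volume : Measure ((Fin n → ℝ) × ℝ)).IsAddHaarMeasure :=
    Measure.prod.instIsAddHaarMeasure volume volume
  exact Measure.prod.instIsAddHaarMeasure volume volume

/-- The Heisenberg dilations. -/
def heisDilation (n : ℕ) (a : ℝ) : Heis n →L[ℝ] Heis n :=
  (a • ContinuousLinearMap.fst ℝ _ _).prod
    ((a • (ContinuousLinearMap.fst ℝ _ _).comp (ContinuousLinearMap.snd ℝ _ _)).prod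
      (a ^ 2 • (ContinuousLinearMap.snd ℝ _ _).comp (ContinuousLinearMap.snd ℝ _ _)))

lemma heisDilation_apply (a : ℝ) (w : Heis n) :
    heisDilation n a w = (a • w.1, a • w.2.1, a ^ 2 * w.2.2) := rfl

/-- The symplectic form scales by a², exactly like the central coordinate, so the horizontal fields
are homogeneous of degree one. -/
lemma heisDilation_leftField_hbasis (a : ℝ) (j : Fin n ⊕ Fin n) (w : Heis n) :
    heisDilation n a (leftField (hbasis j) w) =
      a • leftField (hbasis j) (heisDilation n a w) := by
  rcases j with j | j <;>
    simp [heisDilation_apply, hbasis, leftField, symplForm, vert, Pi.single_apply] <;> ring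

/-- The value of the Jacobian plays no role, since kernels are normalised afterwards. Only that it
is a finite nonzero constant is used. -/
lemma map_heisDilation (a : ℝ) (ha : a ≠ 0) : ∃ c : ℝ≥0∞, c ≠ 0 ∧ c ≠ ⊤ ∧
    Measure.map (heisDilation n a) (volume : Measure (Heis n)) = c • volume := by
  have hdet : LinearMap.det (heisDilation n a : Heis n →ₗ[ℝ] Heis n) ≠ 0 := by
    have : (heisDilation n a : Heis n →ₗ[ℝ] Heis n) ∘ₗ
        (heisDilation n a⁻¹ : Heis n →ₗ[ℝ] Heis n) = LinearMap.id := by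
      refine LinearMap.ext fun w => ?_
      simp [heisDilation_apply, smul_smul, ha]
    have h2 := congrArg LinearMap.det this
    rw [LinearMap.det_comp, LinearMap.det_id] at h2
    exact left_ne_zero_of_mul_eq_one h2
  refine ⟨_, ?_, ENNReal.ofReal_ne_top,
    Measure.map_linearMap_addHaar_eq_smul_addHaar volume hdet⟩
  simpa using hdet

/-- One fixed bump is dilated and normalised. By homogeneity a horizontal derivative costs ε⁻¹ and
the central one ε⁻², and this is compensated by the factors ε and ε² in the definition, which leaves
a constant independent of ε. -/
lemma exists_adaptedKernel (n : ℕ) : ∃ C : ℝ≥0∞, C ≠ ⊤ ∧ ∀ ε : ℝ, 0 < ε →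
    ∃ κ : Heis n → ℝ, AdaptedKernel C ε κ := by
  let B : ContDiffBump (0 : Heis n) := ⟨1 / 2, 1, by norm_num, by norm_num⟩
  set k : Heis n → ℝ := B.normed volume with hk
  have hks : ContDiff ℝ ∞ k := B.contDiff_normed
  have hkc : HasCompactSupport k := B.hasCompactSupport_normed
  have hkt : tsupport k = Metric.closedBall 0 1 := B.tsupport_normed_eq
  have hfk : Continuous (fderiv ℝ k) := hks.continuous_fderiv (by simp)
  have hfin : ∀ F : Heis n → Heis n, Continuous F → ∫⁻ w, ‖fderiv ℝ k w (F w)‖ₑ ≠ ⊤ := by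
    intro F hF
    have hc : Continuous fun w => fderiv ℝ k w (F w) := hfk.clm_apply hF
    have : Integrable fun w => fderiv ℝ k w (F w) := by
      refine hc.integrable_of_hasCompactSupport ?_
      refine (hkc.fderiv ℝ).mono ?_
      intro w hw h0
      exact hw (by simp [h0])
    exact this.2.ne
  have hk1 : ∫⁻ w, ‖k w‖ₑ ≠ ⊤ := (hks.continuous.integrable_of_hasCompactSupport hkc).2.ne
  -- The constant is the sum of all the L¹ norms of the undilated bump that have to be controlled.
  refine ⟨(∫⁻ w, ‖k w‖ₑ) + (∑ j, ∫⁻ w, ‖fderiv ℝ k w (leftField (hbasis j) w)‖ₑ)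
    + ∫⁻ w, ‖fderiv ℝ k w (vert 1)‖ₑ, ?_, ?_⟩
  · refine ENNReal.add_ne_top.2 ⟨ENNReal.add_ne_top.2 ⟨hk1, ?_⟩, hfin _ continuous_const⟩
    exact ENNReal.sum_ne_top.2 fun j _ => hfin _ (by fun_prop)
  intro ε hε
  obtain ⟨c, hc0, hct, hmap⟩ := map_heisDilation (n := n) ε⁻¹ (inv_ne_zero hε.ne')
  set δ := heisDilation n ε⁻¹ with hδ
  have hlint : ∀ F : Heis n → ℝ≥0∞, Measurable F → ∫⁻ w, F (δ w) = c * ∫⁻ w, F w := by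
    intro F hF
    rw [← lintegral_map hF δ.continuous.measurable, hmap, lintegral_smul_measure, smul_eq_mul]
  have hint : ∫ w, k (δ w) = c.toReal := by
    rw [← integral_map (φ := δ) δ.continuous.measurable.aemeasurable
      hks.continuous.aestronglyMeasurable, hmap, integral_smul_measure, hk, B.integral_normed,
      smul_eq_mul, mul_one]
  have hcr : 0 < c.toReal := ENNReal.toReal_pos hc0 hct
  have hJ : ‖(c.toReal)⁻¹‖ₑ = c⁻¹ := by
    rw [Real.enorm_eq_ofReal (by positivity), ENNReal.ofReal_inv_of_pos hcr,
      ENNReal.ofReal_toReal hct]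
  have hder : ∀ w v, fderiv ℝ (fun w => (c.toReal)⁻¹ * k (δ w)) w v
      = (c.toReal)⁻¹ * fderiv ℝ k (δ w) (δ v) := by
    intro w v
    have h1 : HasFDerivAt k (fderiv ℝ k (δ w)) (δ w) :=
      (hks.differentiable (by simp)).differentiableAt.hasFDerivAt
    have := (h1.comp w δ.hasFDerivAt).const_mul (c.toReal)⁻¹
    have e := this.fderiv
    simp only [Function.comp_def] at e
    rw [e]; simp
  have hscale : ∀ F : Heis n → ℝ, Continuous F →
      ∫⁻ w, ‖(c.toReal)⁻¹ * F (δ w)‖ₑ = ∫⁻ w, ‖F w‖ₑ := by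
    intro F hF
    simp only [enorm_mul, hJ]
    rw [lintegral_const_mul _ (by have := hF.measurable; fun_prop), hlint (fun w => ‖F w‖ₑ)
      (by have := hF.measurable; fun_prop), ← mul_assoc,
      ENNReal.inv_mul_cancel hc0 hct, one_mul]
  have hsupp : ∀ w ∈ tsupport (fun w => (c.toReal)⁻¹ * k (δ w)), δ w ∈ Metric.closedBall 0 1 := by
    intro w hw
    rw [← hkt]
    have h1 : tsupport (fun w => (c.toReal)⁻¹ * k (δ w)) ⊆ tsupport (fun w => k (δ w)) :=
      tsupport_mul_subset_right
    exact tsupport_comp_subset_preimage k δ.continuous (h1 hw)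
  have hnorm : ∀ w ∈ tsupport (fun w => (c.toReal)⁻¹ * k (δ w)),
      (∀ j, |hcoord j w| ≤ ε) ∧ |w.2.2| ≤ ε ^ 2 := by
    intro w hw
    have h := hsupp w hw
    rw [mem_closedBall_zero_iff, hδ, heisDilation_apply, Prod.norm_def, Prod.norm_def] at h
    simp only [max_le_iff] at h
    obtain ⟨h1, h2, h3⟩ := h
    have hx : ∀ x : ℝ, ‖ε⁻¹ * x‖ ≤ 1 → |x| ≤ ε := by
      intro x hx
      rw [norm_mul, norm_inv, Real.norm_of_nonneg hε.le, inv_mul_le_iff₀ hε] at hx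
      simpa using hx
    refine ⟨fun j => ?_, ?_⟩
    · rcases j with j | j
      · exact hx _ ((norm_le_pi_norm _ j).trans h1)
      · exact hx _ ((norm_le_pi_norm _ j).trans h2)
    · rw [norm_mul, norm_pow, norm_inv, Real.norm_of_nonneg hε.le, inv_pow,
        inv_mul_le_iff₀ (by positivity)] at h3
      simpa using h3
  have hcs : HasCompactSupport (fun w => (c.toReal)⁻¹ * k (δ w)) := by
    refine HasCompactSupport.of_support_subset_isCompact
      (isCompact_closedBall (0 : Heis n) (max ε (ε ^ 2))) ?_
    intro w hw
    obtain ⟨h1, h2⟩ := hnorm w (subset_tsupport _ hw)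
    rw [mem_closedBall_zero_iff, Prod.norm_def, Prod.norm_def]
    refine max_le ?_ (max_le ?_ ?_)
    · exact (pi_norm_le_iff_of_nonneg (by positivity)).2 fun j =>
        (h1 (Sum.inl j)).trans (le_max_left _ _)
    · exact (pi_norm_le_iff_of_nonneg (by positivity)).2 fun j =>
        (h1 (Sum.inr j)).trans (le_max_left _ _)
    · exact h2.trans (le_max_right _ _)
  refine ⟨fun w => (c.toReal)⁻¹ * k (δ w), ⟨?_, hcs, ?_, ?_, fun w hw => (hnorm w hw).1,
    fun w hw => (hnorm w hw).2, fun j => ?_, ?_⟩⟩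
  · exact contDiff_const.mul (hks.comp δ.contDiff)
  · rw [integral_const_mul, hint, inv_mul_cancel₀ hcr.ne']
  · rw [hscale k hks.continuous, add_assoc]; exact le_self_add
  · have : ∀ w, ‖fderiv ℝ (fun w => (c.toReal)⁻¹ * k (δ w)) w (leftField (hbasis j) w)‖ₑ
        = ‖ε⁻¹‖ₑ * ‖(c.toReal)⁻¹ * (fun w => fderiv ℝ k w (leftField (hbasis j) w)) (δ w)‖ₑ := by
      intro w
      rw [hder, hδ, heisDilation_leftField_hbasis, ← hδ, map_smul, ← enorm_mul]
      simp only [smul_eq_mul]; congr 1; ring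
    simp only [this]
    have hcont : Continuous fun w : Heis n => fderiv ℝ k w (leftField (hbasis j) w) :=
      hfk.clm_apply (by fun_prop)
    rw [lintegral_const_mul' _ _ (by simp), hscale _ hcont, ← mul_assoc,
      ← Real.enorm_of_nonneg hε.le, ← enorm_mul, mul_inv_cancel₀ hε.ne', enorm_one, one_mul]
    refine le_trans ?_ (le_add_right le_add_self)
    exact Finset.single_le_sum (f := fun j => ∫⁻ w, ‖fderiv ℝ k w (leftField (hbasis j) w)‖ₑ)
      (fun _ _ => zero_le) (Finset.mem_univ j)
  · have : ∀ w, ‖fderiv ℝ (fun w => (c.toReal)⁻¹ * k (δ w)) w (vert 1)‖ₑ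
        = ‖(ε ^ 2)⁻¹‖ₑ * ‖(c.toReal)⁻¹ * (fun w => fderiv ℝ k w (vert 1)) (δ w)‖ₑ := by
      intro w
      have : δ (vert 1) = (ε ^ 2)⁻¹ • vert 1 := by simp [hδ, heisDilation_apply, vert]
      rw [hder, this, map_smul, ← enorm_mul]
      simp only [smul_eq_mul]; congr 1; ring
    simp only [this]
    have hcont : Continuous fun w : Heis n => fderiv ℝ k w (vert 1) :=
      hfk.clm_apply (by fun_prop)
    rw [lintegral_const_mul' _ _ (by simp), hscale _ hcont, ← mul_assoc,
      ← Real.enorm_of_nonneg (by positivity : 0 ≤ ε ^ 2), ← enorm_mul,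
      mul_inv_cancel₀ (by positivity), enorm_one, one_mul]
    exact le_add_self

end

/-! ### Continuity of right translations in Lᵖ and in weighted L¹. -/

section translation

open Filter Topology

variable {n : ℕ}

lemma Measurable.comp_uncurry {X Y Z W : Type*} [MeasurableSpace X] [MeasurableSpace Y]
    [MeasurableSpace Z] [MeasurableSpace W] {g : X → Y → Z} (hg : Measurable (Function.uncurry g))
    {a : W → X} {b : W → Y} (ha : Measurable a) (hb : Measurable b) :
    Measurable fun z => g (a z) (b z) := hg.comp (ha.prodMk hb)

/-- For finite exponents this is Tonelli. For r = ∞ the sublevel set {≤ a} consists of the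
parameters at which the section of a measurable set is null. -/
lemma measurable_eLpNorm_section {α β : Type*} [MeasurableSpace α] [MeasurableSpace β]
    {μ : Measure β} [SFinite μ] {f : α → β → ℝ} (hf : Measurable (Function.uncurry f))
    (r : ℝ≥0∞) : Measurable fun t => eLpNorm (f t) r μ := by
  by_cases h0 : r = 0
  · simp [h0]
  by_cases ht : r = ⊤
  · subst ht
    refine measurable_of_Iic fun a => ?_
    have : (fun t => eLpNorm (f t) ⊤ μ) ⁻¹' Iic a
        = (fun t => μ (Prod.mk t ⁻¹' {z | a < ‖Function.uncurry f z‖ₑ})) ⁻¹' {0} := by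
      ext t
      simp only [eLpNorm_exponent_top, mem_preimage, mem_Iic, mem_singleton_iff, eLpNormEssSup]
      constructor
      · intro h
        have h1 := ae_le_essSup (f := fun x => ‖f t x‖ₑ) (μ := μ)
        have h2 : ∀ᵐ x ∂μ, ‖f t x‖ₑ ≤ a := h1.mono fun x hx => hx.trans h
        rw [ae_iff] at h2
        simpa [Function.uncurry] using h2
      · intro h
        refine essSup_le_of_ae_le a ?_
        change ∀ᵐ x ∂μ, ‖f t x‖ₑ ≤ a
        rw [ae_iff]
        simpa [Function.uncurry] using h
    rw [this]
    exact measurable_measure_prodMk_left (measurableSet_lt measurable_const hf.enorm)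
      (measurableSet_singleton 0)
  · simp only [eLpNorm_eq_lintegral_rpow_enorm_toReal h0 ht]
    refine Measurable.pow_const ?_ _
    exact Measurable.lintegral_prod_right' (f := fun z => ‖Function.uncurry f z‖ₑ ^ r.toReal)
      (hf.enorm.pow_const _)

/-- Right translations preserve measure and depend continuously on h in the compact-open topology,
so composition with them is continuous on Lᵖ for finite exponents. -/
lemma tendsto_eLpNorm_translate {r : ℝ≥0∞} (hr1 : 1 ≤ r) (hr : r ≠ ⊤) {f : Heis n → ℝ}
    (hf : MemLp f r volume) :
    Tendsto (fun h => eLpNorm (fun q => f (q ⊙ h) - f q) r volume) (𝓝 0) (𝓝 0) := by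
  have : Fact (1 ≤ r) := ⟨hr1⟩
  let g : Heis n → C(Heis n, Heis n) := fun h => ⟨fun q => q ⊙ h, by fun_prop⟩
  have hg : Continuous g := by
    refine ContinuousMap.continuous_of_continuous_uncurry _ ?_
    simp only [g, ContinuousMap.coe_mk]
    fun_prop
  have hgm : ∀ h, MeasurePreserving (g h) volume volume := fun h => measurePreserving_hmul_right h
  have h1 : Tendsto (fun h => Lp.compMeasurePreserving (g h) (hgm h) hf.toLp) (𝓝 0)
      (𝓝 (Lp.compMeasurePreserving (g 0) (hgm 0) hf.toLp)) :=
    tendsto_const_nhds.compMeasurePreservingLp (hg.tendsto 0) _ _ hr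
  have h2 := (tendsto_iff_edist_tendsto_0.1 h1)
  refine h2.congr fun h => ?_
  rw [Lp.toLp_compMeasurePreserving, Lp.toLp_compMeasurePreserving, Lp.edist_toLp_toLp]
  refine eLpNorm_congr_ae (ae_of_all _ fun q => ?_)
  simp [g]

lemma eLpNorm_translate {r : ℝ≥0∞} {f : Heis n → ℝ} (hf : AEStronglyMeasurable f volume)
    (h : Heis n) : eLpNorm (fun q => f (q ⊙ h)) r volume = eLpNorm f r volume :=
  eLpNorm_comp_measurePreserving hf (measurePreserving_hmul_right h)

lemma lintegral_enorm_mul_le {α : Type*} [MeasurableSpace α] {μ : Measure α} {s s' : ℝ≥0∞}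
    [ENNReal.HolderConjugate s s'] {f g : α → ℝ} (hf : AEStronglyMeasurable f μ)
    (hg : AEStronglyMeasurable g μ) :
    ∫⁻ q, ‖f q‖ₑ * ‖g q‖ₑ ∂μ ≤ eLpNorm f s μ * eLpNorm g s' μ := by
  have := eLpNorm_smul_le_mul_eLpNorm (p := s) (q := s') (r := 1) hg hf
  rw [eLpNorm_one_eq_lintegral_enorm] at this
  simpa [enorm_mul] using this

lemma lintegral_hmul_right (f : Heis n → ℝ≥0∞) (h : Heis n) : ∫⁻ q, f (q ⊙ h) = ∫⁻ q, f q :=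
  (measurePreserving_hmul_right h).lintegral_comp_emb (hmulRight h).measurableEmbedding f

/-- Only the product form survives at s' = ∞, where g itself need not be translation continuous.
There, with τ the translation, f (τg − g) = −(τf − f) τg + (τ(fg) − fg), and both f and fg belong to
L¹. For s' < ∞ Hölder's inequality suffices. -/
lemma tendsto_lintegral_mul_translate {s s' : ℝ≥0∞} [hs : ENNReal.HolderConjugate s s']
    {f g : Heis n → ℝ} (hf : MemLp f s volume) (hg : MemLp g s' volume)
    (hfm : Measurable f) (hgm : Measurable g) :
    Tendsto (fun h => ∫⁻ q, ‖f q‖ₑ * ‖g (q ⊙ h) - g q‖ₑ) (𝓝 0) (𝓝 0) := by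
  have hs1 : 1 ≤ s := ENNReal.HolderConjugate.one_le s s'
  have hs1' : 1 ≤ s' := ENNReal.HolderConjugate.one_le s' s
  by_cases hs' : s' = ⊤
  · have hs1e : s = 1 := by
      exact (ENNReal.HolderConjugate.eq_top_iff_eq_one s' s).1 hs'
    subst hs'
    subst hs1e
    have hfg : MemLp (fun q => f q * g q) 1 volume := hg.mul hf
    have t1 := ENNReal.Tendsto.mul_const (b := eLpNorm g ⊤ volume)
      (tendsto_eLpNorm_translate le_rfl (by simp) hf) (Or.inr hg.2.ne)
    have t2 := tendsto_eLpNorm_translate le_rfl (by simp) hfg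
    have t3 := t1.add t2
    simp only [zero_mul, add_zero] at t3
    refine tendsto_of_tendsto_of_tendsto_of_le_of_le tendsto_const_nhds t3
      (fun _ => zero_le) fun h => ?_
    have e1 : AEStronglyMeasurable (fun q => f (q ⊙ h) - f q) volume := by
      apply Measurable.aestronglyMeasurable; fun_prop
    have e2 : AEStronglyMeasurable (fun q => g (q ⊙ h)) volume := by
      apply Measurable.aestronglyMeasurable; fun_prop
    calc ∫⁻ q, ‖f q‖ₑ * ‖g (q ⊙ h) - g q‖ₑ
        ≤ ∫⁻ q, (‖f (q ⊙ h) - f q‖ₑ * ‖g (q ⊙ h)‖ₑ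
          + ‖f (q ⊙ h) * g (q ⊙ h) - f q * g q‖ₑ) := by
          refine lintegral_mono fun q => ?_
          rw [← enorm_mul, ← enorm_mul]
          have : f q * (g (q ⊙ h) - g q) = -((f (q ⊙ h) - f q) * g (q ⊙ h))
            + (f (q ⊙ h) * g (q ⊙ h) - f q * g q) := by ring
          rw [this]
          refine (enorm_add_le _ _).trans ?_
          rw [enorm_neg]
      _ = (∫⁻ q, ‖f (q ⊙ h) - f q‖ₑ * ‖g (q ⊙ h)‖ₑ)
          + ∫⁻ q, ‖f (q ⊙ h) * g (q ⊙ h) - f q * g q‖ₑ := by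
          rw [lintegral_add_left]; fun_prop
      _ ≤ _ := by
          refine add_le_add ?_ ?_
          · refine (lintegral_enorm_mul_le (s := 1) (s' := ⊤) e1 e2).trans ?_
            rw [eLpNorm_translate hg.1]
          · rw [eLpNorm_one_eq_lintegral_enorm]
  · have t1 := ENNReal.Tendsto.const_mul (a := eLpNorm f s volume)
      (tendsto_eLpNorm_translate hs1' hs' hg) (Or.inr hf.2.ne)
    rw [mul_zero] at t1
    refine tendsto_of_tendsto_of_tendsto_of_le_of_le tendsto_const_nhds t1
      (fun _ => zero_le) fun h => ?_
    refine lintegral_enorm_mul_le hf.1 ?_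
    apply Measurable.aestronglyMeasurable; fun_prop

/-- The weighted `L¹` norm `∬ |f| |F|` on space-time. -/
def wInt (ν : Measure ℝ) (f F : ℝ → Heis n → ℝ) : ℝ≥0∞ :=
  ∫⁻ z, ‖f z.1 z.2‖ₑ * ‖F z.1 z.2‖ₑ ∂(ν.prod volume)

/-- Dominated convergence in time from the statement at fixed time. Since translations preserve
norms, twice the product of the norms of f(t) and g(t) on a larger compact set dominates. -/
lemma tendsto_wInt_translate {ν : Measure ℝ} [SFinite ν] {s s' : ℝ≥0∞}
    [ENNReal.HolderConjugate s s'] {f g : ℝ → Heis n → ℝ}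
    (hfm : Measurable (Function.uncurry f)) (hgm : Measurable (Function.uncurry g))
    (hf : ∀ K : Set (Heis n), IsCompact K → ∀ᵐ t ∂ν, eLpNorm (f t) s (volume.restrict K) < ⊤)
    (hg : ∀ K : Set (Heis n), IsCompact K → ∀ᵐ t ∂ν, eLpNorm (g t) s' (volume.restrict K) < ⊤)
    (hfg : ∀ K : Set (Heis n), IsCompact K →
      ∫⁻ t, eLpNorm (f t) s (volume.restrict K) * eLpNorm (g t) s' (volume.restrict K) ∂ν < ⊤)
    {K : Set (Heis n)} (hK : IsCompact K) (hfK : ∀ t q, q ∉ K → f t q = 0) :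
    Tendsto (fun h => wInt ν f fun t q => g t (q ⊙ h) - g t q) (𝓝 0) (𝓝 0) := by
  -- `K'` contains `K` and all its translates by the unit ball. Truncating g to `K'` makes it
  -- globally L^{s'} and changes nothing for small h, as f vanishes off `K`.
  set K' : Set (Heis n) := (fun z : Heis n × Heis n => z.1 ⊙ z.2) '' (K ×ˢ Metric.closedBall 0 1)
    with hK'
  have hK'c : IsCompact K' := (hK.prod (isCompact_closedBall 0 1)).image (by fun_prop)
  have hKK' : K ⊆ K' := fun q hq => ⟨(q, 0), ⟨hq, by simp⟩, by simp⟩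
  have hK'm : MeasurableSet K' := hK'c.measurableSet
  set g' : ℝ → Heis n → ℝ := fun t => K'.indicator (g t) with hg'
  have hg'm : Measurable (Function.uncurry g') := by
    have : Function.uncurry g' = (Prod.snd ⁻¹' K').indicator (Function.uncurry g) := by
      funext z; simp only [Function.uncurry, hg', indicator]; rfl
    rw [this]; exact hgm.indicator (measurable_snd hK'm)
  have hft : ∀ t, Measurable (f t) := fun t => hfm.comp measurable_prodMk_left
  have hgt : ∀ t, Measurable (g' t) := fun t => hg'm.comp measurable_prodMk_left
  have hf2 : ∀ t, eLpNorm (f t) s volume = eLpNorm (f t) s (volume.restrict K') := by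
    intro t
    rw [← eLpNorm_indicator_eq_eLpNorm_restrict hK'm]
    congr 1; symm
    rw [indicator_eq_self]
    intro q hq; by_contra h; exact hq (hfK t q fun h2 => h (hKK' h2))
  have hg2 : ∀ t, eLpNorm (g' t) s' volume = eLpNorm (g t) s' (volume.restrict K') := by
    intro t
    rw [hg', eLpNorm_indicator_eq_eLpNorm_restrict hK'm]
  have hs1' : 1 ≤ s' := ENNReal.HolderConjugate.one_le s' s
  have key : Tendsto (fun h => ∫⁻ t, (∫⁻ q, ‖f t q‖ₑ * ‖g' t (q ⊙ h) - g' t q‖ₑ) ∂ν) (𝓝 0)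
      (𝓝 (∫⁻ _, 0 ∂ν)) := by
    refine tendsto_lintegral_filter_of_dominated_convergence
      (fun t => 2 * (eLpNorm (f t) s (volume.restrict K') * eLpNorm (g t) s' (volume.restrict K')))
      (Eventually.of_forall fun h => ?_) (Eventually.of_forall fun h => ae_of_all _ fun t => ?_)
      ?_ ?_
    · refine Measurable.lintegral_prod_right'
        (f := fun z : ℝ × Heis n => ‖f z.1 z.2‖ₑ * ‖g' z.1 (z.2 ⊙ h) - g' z.1 z.2‖ₑ) ?_
      have e1 : Measurable fun z : ℝ × Heis n => g' z.1 (z.2 ⊙ h) :=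
        hg'm.comp_uncurry measurable_fst (by fun_prop)
      have e2 : Measurable fun z : ℝ × Heis n => g' z.1 z.2 := hg'm
      have e3 : Measurable fun z : ℝ × Heis n => f z.1 z.2 := hfm
      fun_prop
    · have e1 : Measurable fun q => g' t (q ⊙ h) := (hgt t).comp (by fun_prop)
      refine (lintegral_enorm_mul_le (s := s) (s' := s') (hft t).aestronglyMeasurable
        (e1.sub (hgt t)).aestronglyMeasurable).trans ?_
      rw [hf2, mul_left_comm]
      gcongr
      refine (eLpNorm_sub_le e1.aestronglyMeasurable (hgt t).aestronglyMeasurable hs1').trans ?_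
      rw [eLpNorm_translate (hgt t).aestronglyMeasurable, hg2, two_mul]
    · rw [lintegral_const_mul' _ _ (by simp)]
      exact ENNReal.mul_ne_top (by simp) (hfg K' hK'c).ne
    · filter_upwards [hf K' hK'c, hg K' hK'c] with t h1 h2
      exact tendsto_lintegral_mul_translate (s := s) (s' := s')
        ⟨(hft t).aestronglyMeasurable, by rwa [hf2]⟩ ⟨(hgt t).aestronglyMeasurable, by rwa [hg2]⟩
        (hft t) (hgt t)
  rw [lintegral_zero] at key
  refine key.congr' ?_
  filter_upwards [Metric.closedBall_mem_nhds (0 : Heis n) one_pos] with h hh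
  have e1 : Measurable fun z : ℝ × Heis n => g z.1 (z.2 ⊙ h) :=
    hgm.comp_uncurry measurable_fst (by fun_prop)
  have e2 : Measurable fun z : ℝ × Heis n => g z.1 z.2 := hgm
  have e3 : Measurable fun z : ℝ × Heis n => f z.1 z.2 := hfm
  rw [wInt, lintegral_prod _ (Measurable.aemeasurable (by fun_prop))]
  refine lintegral_congr fun t => lintegral_congr fun q => ?_
  by_cases hq : q ∈ K
  · have h1 : q ⊙ h ∈ K' := ⟨(q, h), ⟨hq, hh⟩, rfl⟩
    simp [hg', hKK' hq, h1]
  · simp [hfK t q hq]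

end translation

/-! ### The fundamental theorem of calculus for weak derivatives along left-invariant fields. -/

section weakDeriv

variable {n : ℕ}

lemma hasDerivAt_along {φ : Heis n → ℝ} (hφ : Differentiable ℝ φ) (q v : Heis n) (θ : ℝ) :
    HasDerivAt (fun θ : ℝ => φ (q ⊙ (θ • v)))
      (fderiv ℝ φ (q ⊙ (θ • v)) (leftField v q)) θ := by
  simp only [hmul_smul_eq]
  have h1 : HasDerivAt (fun θ : ℝ => q + θ • leftField v q) (leftField v q) θ := by
    simpa using ((hasDerivAt_id θ).smul_const (leftField v q)).const_add q
  exact (hφ _).hasFDerivAt.comp_hasDerivAt θ h1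

lemma hmul_smul_smul (q v : Heis n) (ε θ : ℝ) : q ⊙ (ε • v) ⊙ (θ • v) = q ⊙ ((ε + θ) • v) := by
  rw [hmul_assoc]
  simp [hmul, symplForm_smul_left, symplForm_smul_right, add_smul]

/-- Right translation by exp(θv) does not commute with all left-invariant fields, but it commutes
with the one generated by v, because the two elements lie in one one-parameter subgroup. -/
lemma fderiv_comp_hmul_smul {φ : Heis n → ℝ} (hφ : ContDiff ℝ ∞ φ) (q v : Heis n) (θ : ℝ) :
    fderiv ℝ (fun q => φ (q ⊙ (θ • v))) q (leftField v q)
      = fderiv ℝ φ (q ⊙ (θ • v)) (leftField v q) := by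
  have hd : Differentiable ℝ φ := hφ.differentiable (by simp)
  have hd2 : Differentiable ℝ (fun q => φ (q ⊙ (θ • v))) :=
    (hφ.comp (by fun_prop : ContDiff ℝ ∞ fun q : Heis n => q ⊙ (θ • v))).differentiable (by simp)
  have h1 := hasDerivAt_along hd2 q v 0
  have h2 : HasDerivAt (fun ε : ℝ => φ (q ⊙ (ε • v) ⊙ (θ • v)))
      (fderiv ℝ φ (q ⊙ (θ • v)) (leftField v q)) 0 := by
    have h3 : HasDerivAt (fun ε : ℝ => φ (q ⊙ ((ε + θ) • v)))
        (fderiv ℝ φ (q ⊙ ((0 + θ) • v)) (leftField v q)) 0 :=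
      (hasDerivAt_along hd q v (0 + θ)).comp_add_const 0 θ
    rw [zero_add] at h3
    convert h3 using 2 with ε
    rw [hmul_smul_smul]
  simp only [zero_smul, hmul_zero] at h1
  exact h1.unique h2

lemma hasCompactSupport_comp_hmul {φ : Heis n → ℝ} (hφ : HasCompactSupport φ) (h : Heis n) :
    HasCompactSupport fun q => φ (q ⊙ h) :=
  hφ.comp_homeomorph (hmulRight h)

lemma integrable_translate_prod {g : Heis n → ℝ} (hg : LocallyIntegrable g) (hgm : Measurable g)
    (v : Heis n) {K : Set (Heis n)} (hK : IsCompact K) :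
    Integrable (fun z : ℝ × Heis n => g (z.2 ⊙ (z.1 • v)))
      ((volume.restrict (Ioc (0 : ℝ) 1)).prod (volume.restrict K)) := by
  have hm : Measurable fun z : ℝ × Heis n => g (z.2 ⊙ (z.1 • v)) := hgm.comp (by fun_prop)
  refine ⟨hm.aestronglyMeasurable, ?_⟩
  set K' : Set (Heis n) := (fun z : ℝ × Heis n => z.2 ⊙ (z.1 • v)) '' (Icc 0 1 ×ˢ K)
  have hK' : IsCompact K' := (isCompact_Icc.prod hK).image (by fun_prop)
  rw [hasFiniteIntegral_iff_enorm, lintegral_prod _ hm.enorm.aemeasurable]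
  have hle : ∀ θ ∈ Ioc (0 : ℝ) 1, ∫⁻ q in K, ‖g (q ⊙ (θ • v))‖ₑ ≤ ∫⁻ q in K', ‖g q‖ₑ := by
    intro θ hθ
    rw [← lintegral_indicator hK.measurableSet, ← lintegral_indicator hK'.measurableSet,
      ← lintegral_hmul_right (K'.indicator fun q => ‖g q‖ₑ) (θ • v)]
    refine lintegral_mono fun q => ?_
    by_cases hq : q ∈ K
    · have : q ⊙ (θ • v) ∈ K' := ⟨(θ, q), ⟨⟨hθ.1.le, hθ.2⟩, hq⟩, rfl⟩
      simp [hq, this]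
    · simp [hq]
  calc ∫⁻ θ in Ioc (0 : ℝ) 1, ∫⁻ q in K, ‖g (q ⊙ (θ • v))‖ₑ
      ≤ ∫⁻ θ in Ioc (0 : ℝ) 1, ∫⁻ q in K', ‖g q‖ₑ :=
        setLIntegral_mono' measurableSet_Ioc hle
    _ = ∫⁻ q in K', ‖g q‖ₑ := by simp
    _ < ⊤ := (hg.integrableOn_isCompact hK').2

lemma ae_integrable_translate {g : Heis n → ℝ} (hg : LocallyIntegrable g) (hgm : Measurable g)
    (v : Heis n) : ∀ᵐ q, IntegrableOn (fun θ : ℝ => g (q ⊙ (θ • v))) (Ioc 0 1) := by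
  have h : ∀ k : ℕ, ∀ᵐ q ∂(volume.restrict (Metric.closedBall (0 : Heis n) k)),
      IntegrableOn (fun θ : ℝ => g (q ⊙ (θ • v))) (Ioc 0 1) := fun k =>
    (integrable_translate_prod hg hgm v (isCompact_closedBall 0 (k : ℝ))).prod_left_ae
  have h2 := ae_all_iff.2 fun k => (ae_restrict_iff' measurableSet_closedBall).1 (h k)
  filter_upwards [h2] with q hq
  obtain ⟨k, hk⟩ := exists_nat_ge ‖q‖
  exact hq k (by simpa using hk)

lemma locallyIntegrable_integral_translate {g : Heis n → ℝ} (hg : LocallyIntegrable g)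
    (hgm : Measurable g) (v : Heis n) :
    LocallyIntegrable fun q => ∫ θ in Ioc (0 : ℝ) 1, g (q ⊙ (θ • v)) := by
  rw [locallyIntegrable_iff]
  intro K hK
  exact (integrable_translate_prod hg hgm v hK).integral_prod_right

lemma LocallyIntegrable.comp_hmul_right {g : Heis n → ℝ} (hg : LocallyIntegrable g) (h : Heis n) :
    LocallyIntegrable fun q => g (q ⊙ h) := by
  rw [locallyIntegrable_iff]
  intro K hK
  have h1 := hg.integrableOn_isCompact (hK.image (hmulRight h).continuous)
  exact ((measurePreserving_hmul_right h).integrableOn_image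
    (hmulRight h).measurableEmbedding).1 h1

lemma integrable_mul_of_hasCompactSupport {g φ : Heis n → ℝ} (hg : LocallyIntegrable g)
    (hφ : Continuous φ) (hc : HasCompactSupport φ) : Integrable fun q => g q * φ q := by
  simpa using hg.integrable_smul_right_of_hasCompactSupport hφ hc

lemma IsWeakDerivAlong.integral_mul_comp_hmul {v : Heis n} {g gv : Heis n → ℝ}
    (h : IsWeakDerivAlong (leftField v) g gv) {φ : Heis n → ℝ} (hφ : ContDiff ℝ ∞ φ)
    (hc : HasCompactSupport φ) (θ : ℝ) :
    ∫ q, gv q * φ (q ⊙ (θ • v)) = -∫ q, g q * fderiv ℝ φ (q ⊙ (θ • v)) (leftField v q) := by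
  rw [h.2.2 (fun q => φ (q ⊙ (θ • v))) (hφ.comp (by fun_prop))
    (hasCompactSupport_comp_hmul hc _)]
  simp only [fderiv_comp_hmul_smul hφ]

/-- By duality: translation invariance moves the increment onto the test function, where the
fundamental theorem is classical. The weak formulation then moves the derivative back to g for each
θ, and Fubini concludes. -/
lemma IsWeakDerivAlong.sub_eq_integral {v : Heis n} {g gv : Heis n → ℝ}
    (h : IsWeakDerivAlong (leftField v) g gv) (hg : Measurable g) (hgv : Measurable gv) :
    ∀ᵐ q, g (q ⊙ v) - g q = ∫ θ in Ioc (0 : ℝ) 1, gv (q ⊙ (θ • v)) := by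
  refine ae_eq_of_integral_contDiff_smul_eq ((LocallyIntegrable.comp_hmul_right h.1 v).sub h.1)
    (locallyIntegrable_integral_translate h.2.1 hgv v) fun φ hφ hc => ?_
  have hφc : Continuous φ := hφ.continuous
  have hφd : Differentiable ℝ φ := hφ.differentiable (by simp)
  have hneg : ∀ q : Heis n, ∀ θ : ℝ, q ⊙ (θ • v) ⊙ (-θ • v) = q := by
    intro q θ; rw [neg_smul]; simp
  -- A single compact set outside which all the translated test functions vanish, uniformly in θ ∈
  -- [0,1]. It makes the Fubini hypotheses checkable.
  set K : Set (Heis n) := (fun z : ℝ × Heis n => z.2 ⊙ (z.1 • v)) '' (Icc 0 1 ×ˢ tsupport φ) with hK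
  have hKc : IsCompact K := (isCompact_Icc.prod hc).image (by fun_prop)
  have hfd : Continuous (fderiv ℝ φ) := hφ.continuous_fderiv (by simp)
  have hzero : ∀ θ ∈ Icc (0 : ℝ) 1, ∀ q, q ∉ K → q ⊙ (-θ • v) ∉ tsupport φ := by
    intro θ hθ q hq hmem
    refine hq ⟨(θ, q ⊙ (-θ • v)), ⟨hθ, hmem⟩, ?_⟩
    simp only [neg_smul]; simp
  have hdz : ∀ θ ∈ Icc (0 : ℝ) 1, ∀ q, q ∉ K → fderiv ℝ φ (q ⊙ (-θ • v)) = 0 := by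
    intro θ hθ q hq
    exact image_eq_zero_of_notMem_tsupport
      (fun h' => hzero θ hθ q hq (tsupport_fderiv_subset ℝ h'))
  -- move the translation to the test function
  have i1 : Integrable fun q => g q * φ (q ⊙ (-(1 : ℝ) • v)) :=
    integrable_mul_of_hasCompactSupport h.1 (by fun_prop) (hasCompactSupport_comp_hmul hc _)
  have i2 : Integrable fun q => g q * φ q := integrable_mul_of_hasCompactSupport h.1 hφc hc
  have i3 : Integrable fun q => g (q ⊙ v) * φ q :=
    integrable_mul_of_hasCompactSupport (LocallyIntegrable.comp_hmul_right h.1 v) hφc hc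
  have s1 : ∫ q, φ q • (g (q ⊙ v) - g q) = ∫ q, g q * (φ (q ⊙ (-(1 : ℝ) • v)) - φ q) := by
    have e1 : ∫ q, g (q ⊙ v) * φ q = ∫ q, g q * φ (q ⊙ (-(1 : ℝ) • v)) := by
      rw [← integral_hmul_right (fun q => g q * φ (q ⊙ (-(1 : ℝ) • v))) v]
      refine integral_congr_ae (ae_of_all _ fun q => ?_)
      simp
    have e2 : (fun q => φ q • (g (q ⊙ v) - g q)) = fun q => g (q ⊙ v) * φ q - g q * φ q := by
      funext q; simp only [smul_eq_mul]; ring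
    have e3 : (fun q => g q * (φ (q ⊙ (-(1 : ℝ) • v)) - φ q))
        = fun q => g q * φ (q ⊙ (-(1 : ℝ) • v)) - g q * φ q := by
      funext q; ring
    rw [e2, e3, integral_sub i3 i2, integral_sub i1 i2, e1]
  -- fundamental theorem of calculus for the test function
  have s2 : ∀ q, φ (q ⊙ (-(1 : ℝ) • v)) - φ q
      = ∫ θ in Ioc (0 : ℝ) 1, -fderiv ℝ φ (q ⊙ (-θ • v)) (leftField v q) := by
    intro q
    rw [← intervalIntegral.integral_of_le zero_le_one]
    have hd : ∀ θ ∈ uIcc (0 : ℝ) 1, HasDerivAt (fun θ : ℝ => φ (q ⊙ (-θ • v)))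
        (-fderiv ℝ φ (q ⊙ (-θ • v)) (leftField v q)) θ := by
      intro θ _
      have := (hasDerivAt_along hφd q v (-θ)).scomp θ (hasDerivAt_neg θ)
      simpa [Function.comp_def] using this
    rw [intervalIntegral.integral_eq_sub_of_hasDerivAt hd]
    · simp
    · refine Continuous.intervalIntegrable ?_ _ _
      exact ((hfd.comp (by fun_prop)).clm_apply continuous_const).neg
  -- bound of the derivative of the test function
  obtain ⟨M, hM⟩ : ∃ M, ∀ θ ∈ Icc (0 : ℝ) 1, ∀ q ∈ K,
      ‖fderiv ℝ φ (q ⊙ (-θ • v)) (leftField v q)‖ ≤ M := by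
    have hcont : Continuous fun z : ℝ × Heis n =>
        fderiv ℝ φ (z.2 ⊙ (-z.1 • v)) (leftField v z.2) :=
      (hfd.comp (by fun_prop)).clm_apply (by fun_prop)
    obtain ⟨M, hM⟩ := (isCompact_Icc.prod hKc).exists_bound_of_continuousOn
      (s := Icc (0 : ℝ) 1 ×ˢ K) hcont.continuousOn
    exact ⟨M, fun θ hθ q hq => hM (θ, q) ⟨hθ, hq⟩⟩
  have hprod : Integrable (fun z : Heis n × ℝ =>
      g z.1 * -fderiv ℝ φ (z.1 ⊙ (-z.2 • v)) (leftField v z.1))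
      (volume.prod (volume.restrict (Ioc (0 : ℝ) 1))) := by
    have hdom : Integrable (fun z : Heis n × ℝ => (K.indicator (fun q => ‖g q‖) z.1) * M)
        (volume.prod (volume.restrict (Ioc (0 : ℝ) 1))) :=
      Integrable.mul_prod ((integrable_indicator_iff hKc.measurableSet).2
        (h.1.integrableOn_isCompact hKc).norm) (integrable_const M)
    refine hdom.mono ?_ ?_
    · have : Continuous fun z : Heis n × ℝ =>
          -fderiv ℝ φ (z.1 ⊙ (-z.2 • v)) (leftField v z.1) :=
        ((hfd.comp (by fun_prop)).clm_apply (by fun_prop)).neg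
      exact ((hg.comp measurable_fst).mul this.measurable).aestronglyMeasurable
    · have hae : ∀ᵐ z ∂((volume : Measure (Heis n)).prod (volume.restrict (Ioc (0 : ℝ) 1))),
          z.2 ∈ Ioc (0 : ℝ) 1 := by
        have := (Measure.quasiMeasurePreserving_snd (μ := (volume : Measure (Heis n)))
          (ν := volume.restrict (Ioc (0 : ℝ) 1))).ae (ae_restrict_mem measurableSet_Ioc)
        exact this
      filter_upwards [hae] with z hz
      have hz' : z.2 ∈ Icc (0 : ℝ) 1 := ⟨hz.1.le, hz.2⟩
      by_cases hq : z.1 ∈ K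
      · have hb := hM z.2 hz' z.1 hq
        have hM0 : 0 ≤ M := (norm_nonneg _).trans hb
        simp only [norm_mul, norm_neg, indicator_of_mem hq, norm_norm, Real.norm_of_nonneg hM0]
        gcongr
      · rw [hdz z.2 hz' z.1 hq]; simp [hq]
  have hprod2 : Integrable (fun z : Heis n × ℝ => φ z.1 * gv (z.1 ⊙ (z.2 • v)))
      (volume.prod (volume.restrict (Ioc (0 : ℝ) 1))) := by
    have h1 := (integrable_translate_prod h.2.1 hgv v hc.isCompact).swap
    obtain ⟨C, hC⟩ := hφc.bounded_above_of_compact_support hc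
    have h2 := h1.bdd_mul (f := fun z : Heis n × ℝ => φ z.1) (c := C)
      (by fun_prop) (ae_of_all _ fun z => hC z.1)
    have e : (volume.restrict (tsupport φ)).prod (volume.restrict (Ioc (0 : ℝ) 1))
        = ((volume : Measure (Heis n)).prod (volume.restrict (Ioc (0 : ℝ) 1))).restrict
          (tsupport φ ×ˢ univ) := by
      rw [← Measure.prod_restrict, Measure.restrict_univ]
    rw [e] at h2
    refine (integrableOn_iff_integrable_of_support_subset ?_).1 h2
    intro z hz
    refine ⟨?_, trivial⟩
    by_contra hn
    exact hz (by simp [image_eq_zero_of_notMem_tsupport hn])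
  calc ∫ q, φ q • (g (q ⊙ v) - g q)
      = ∫ q, ∫ θ in Ioc (0 : ℝ) 1, g q * -fderiv ℝ φ (q ⊙ (-θ • v)) (leftField v q) := by
        rw [s1]
        refine integral_congr_ae (ae_of_all _ fun q => ?_)
        simp only [s2 q]
        rw [integral_const_mul]
    _ = ∫ θ in Ioc (0 : ℝ) 1, ∫ q, g q * -fderiv ℝ φ (q ⊙ (-θ • v)) (leftField v q) :=
        integral_integral_swap hprod
    _ = ∫ θ in Ioc (0 : ℝ) 1, ∫ q, φ q * gv (q ⊙ (θ • v)) := by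
        refine integral_congr_ae (ae_of_all _ fun θ => ?_)
        have e1 := h.integral_mul_comp_hmul hφ hc (-θ)
        simp only [mul_neg, integral_neg]
        rw [← e1, ← integral_hmul_right _ (θ • v)]
        refine integral_congr_ae (ae_of_all _ fun q => ?_)
        simp only [hneg, mul_comm]
    _ = ∫ q, ∫ θ in Ioc (0 : ℝ) 1, φ q * gv (q ⊙ (θ • v)) :=
        (integral_integral_swap hprod2).symm
    _ = ∫ q, φ q • ∫ θ in Ioc (0 : ℝ) 1, gv (q ⊙ (θ • v)) := by
        refine integral_congr_ae (ae_of_all _ fun q => ?_)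
        simp only [integral_const_mul, smul_eq_mul]

end weakDeriv

/-! ### Linear operations on weak derivatives and the vertical derivative as a commutator. -/

section weakDerivAlgebra

variable {n : ℕ}

lemma hasCompactSupport_fderiv_apply {φ : Heis n → ℝ} (hc : HasCompactSupport φ)
    (V : Heis n → Heis n) : HasCompactSupport fun p => fderiv ℝ φ p (V p) := by
  refine (hc.fderiv ℝ).mono fun p hp h0 => hp ?_
  simp [h0]

lemma integrable_mul_fderiv {g φ : Heis n → ℝ} (hg : LocallyIntegrable g) (hφ : ContDiff ℝ ∞ φ)
    (hc : HasCompactSupport φ) (v : Heis n) :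
    Integrable fun p => g p * fderiv ℝ φ p (leftField v p) :=
  integrable_mul_of_hasCompactSupport hg
    ((hφ.continuous_fderiv (by simp)).clm_apply (by fun_prop)) (hasCompactSupport_fderiv_apply hc _)

lemma IsWeakDerivAlong.add_field {v w : Heis n} {g gv gw : Heis n → ℝ}
    (h : IsWeakDerivAlong (leftField v) g gv) (h' : IsWeakDerivAlong (leftField w) g gw) :
    IsWeakDerivAlong (leftField (v + w)) g fun p => gv p + gw p := by
  refine ⟨h.1, h.2.1.add h'.2.1, fun φ hφ hc => ?_⟩
  simp only [leftField_add, map_add, mul_add, add_mul]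
  rw [integral_add (integrable_mul_of_hasCompactSupport h.2.1 hφ.continuous hc)
    (integrable_mul_of_hasCompactSupport h'.2.1 hφ.continuous hc),
    integral_add (integrable_mul_fderiv h.1 hφ hc v) (integrable_mul_fderiv h.1 hφ hc w),
    h.2.2 φ hφ hc, h'.2.2 φ hφ hc]
  ring

lemma IsWeakDerivAlong.smul_field {v : Heis n} {g gv : Heis n → ℝ}
    (h : IsWeakDerivAlong (leftField v) g gv) (a : ℝ) :
    IsWeakDerivAlong (leftField (a • v)) g fun p => a * gv p := by
  refine ⟨h.1, h.2.1.smul a, fun φ hφ hc => ?_⟩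
  simp only [leftField_smul, map_smul, smul_eq_mul, mul_assoc, mul_left_comm _ a]
  rw [integral_const_mul, integral_const_mul, h.2.2 φ hφ hc]
  ring

lemma IsWeakDerivAlong.sum_field {ι : Type*} (s : Finset ι) {v : ι → Heis n} {g : Heis n → ℝ}
    {G : ι → Heis n → ℝ} (hg : LocallyIntegrable g)
    (h : ∀ j ∈ s, IsWeakDerivAlong (leftField (v j)) g (G j)) (a : ι → ℝ) :
    IsWeakDerivAlong (leftField (∑ j ∈ s, a j • v j)) g fun p => ∑ j ∈ s, a j * G j p := by
  classical
  induction s using Finset.induction_on with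
  | empty =>
    refine ⟨hg, by simpa using locallyIntegrable_const (μ := volume) (X := Heis n) (0 : ℝ),
      fun φ hφ hc => ?_⟩
    simp [leftField]
  | insert i s hi ih =>
    simp only [Finset.sum_insert hi]
    exact ((h i (Finset.mem_insert_self i s)).smul_field (a i)).add_field
      (ih fun j hj => h j (Finset.mem_insert_of_mem hj))

lemma IsWeakDerivAlong.add_fun {Z : Heis n → Heis n} (hZ : Continuous Z) {f g fv gv : Heis n → ℝ}
    (h : IsWeakDerivAlong Z f fv) (h' : IsWeakDerivAlong Z g gv) :
    IsWeakDerivAlong Z (fun p => f p + g p) fun p => fv p + gv p := by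
  refine ⟨h.1.add h'.1, h.2.1.add h'.2.1, fun φ hφ hc => ?_⟩
  have hi : ∀ k : Heis n → ℝ, LocallyIntegrable k →
      Integrable fun p => k p * fderiv ℝ φ p (Z p) := fun k hk =>
    integrable_mul_of_hasCompactSupport hk
      ((hφ.continuous_fderiv (by simp)).clm_apply hZ) (hasCompactSupport_fderiv_apply hc _)
  simp only [add_mul]
  rw [integral_add (integrable_mul_of_hasCompactSupport h.2.1 hφ.continuous hc)
    (integrable_mul_of_hasCompactSupport h'.2.1 hφ.continuous hc),
    integral_add (hi _ h.1) (hi _ h'.1), h.2.2 φ hφ hc, h'.2.2 φ hφ hc]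
  ring

lemma IsWeakDerivAlong.const_mul_fun {Z : Heis n → Heis n} {f fv : Heis n → ℝ}
    (h : IsWeakDerivAlong Z f fv) (a : ℝ) :
    IsWeakDerivAlong Z (fun p => a * f p) fun p => a * fv p := by
  refine ⟨h.1.smul a, h.2.1.smul a, fun φ hφ hc => ?_⟩
  simp only [mul_assoc]
  rw [integral_const_mul, integral_const_mul, h.2.2 φ hφ hc]
  ring

lemma IsWeakDerivAlong.sum_fun {ι : Type*} (s : Finset ι) {Z : Heis n → Heis n} (hZ : Continuous Z)
    {g gv : ι → Heis n → ℝ} (h : ∀ j ∈ s, IsWeakDerivAlong Z (g j) (gv j)) (a : ι → ℝ) :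
    IsWeakDerivAlong Z (fun p => ∑ j ∈ s, a j * g j p) fun p => ∑ j ∈ s, a j * gv j p := by
  classical
  induction s using Finset.induction_on with
  | empty =>
    have := locallyIntegrable_const (μ := volume) (X := Heis n) (0 : ℝ)
    exact ⟨by simpa using this, by simpa using this, fun φ hφ hc => by simp⟩
  | insert i s hi ih =>
    simp only [Finset.sum_insert hi]
    exact ((h i (Finset.mem_insert_self i s)).const_mul_fun (a i)).add_fun hZ
      (ih fun j hj => h j (Finset.mem_insert_of_mem hj))

/-- Derivatives along the frame determine those along every direction without central component, by
linearity of the field in its value at the origin. -/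
lemma IsWeakDerivAlong.horizontal {g : Heis n → ℝ} {G : Fin n ⊕ Fin n → Heis n → ℝ}
    (hg : LocallyIntegrable g) (h : ∀ j, IsWeakDerivAlong (leftField (hbasis j)) g (G j))
    {v : Heis n} (hv : v.2.2 = 0) :
    IsWeakDerivAlong (leftField v) g fun p => ∑ j, hcoord j v * G j p := by
  have := IsWeakDerivAlong.sum_field Finset.univ (v := hbasis) hg (fun j _ => h j)
    fun j => hcoord j v
  have e := sum_hcoord_smul_hbasis v
  rw [hv, vert_zero, add_zero] at e
  rwa [e] at this

lemma IsWeakDerivAlong.ae_unique {Z : Heis n → Heis n} {f g g' : Heis n → ℝ}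
    (h : IsWeakDerivAlong Z f g) (h' : IsWeakDerivAlong Z f g') : g =ᵐ[volume] g' := by
  refine ae_eq_of_integral_contDiff_smul_eq h.2.1 h'.2.1 fun φ hφ hc => ?_
  simp only [smul_eq_mul, mul_comm (φ _)]
  rw [h.2.2 φ hφ hc, h'.2.2 φ hφ hc]

lemma IsWeakDerivAlong.congr_ae {Z : Heis n → Heis n} {f g f' g' : Heis n → ℝ}
    (h : IsWeakDerivAlong Z f g) (hf : f =ᵐ[volume] f') (hg : g =ᵐ[volume] g') :
    IsWeakDerivAlong Z f' g' := by
  refine ⟨h.1.congr hf, h.2.1.congr hg, fun φ hφ hc => ?_⟩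
  have e1 : ∫ p, g' p * φ p = ∫ p, g p * φ p :=
    integral_congr_ae (hg.mono fun p hp => by simp only [hp])
  have e2 : ∫ p, f' p * fderiv ℝ φ p (Z p) = ∫ p, f p * fderiv ℝ φ p (Z p) :=
    integral_congr_ae (hf.mono fun p hp => by simp only [hp])
  rw [e1, e2]
  exact h.2.2 φ hφ hc

lemma contDiff_leftDeriv {φ : Heis n → ℝ} (hφ : ContDiff ℝ ∞ φ) (v : Heis n) :
    ContDiff ℝ ∞ fun p => fderiv ℝ φ p (leftField v p) :=
  (hφ.fderiv_right (m := ∞) (by simp)).clm_apply (by fun_prop)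

/-- The second differential is symmetric and drops out. What remains comes from differentiating the
coefficients of the fields, which are affine in p with linear part ω(·, w) T; antisymmetry of ω
doubles it. -/
lemma leftDeriv_commutator {φ : Heis n → ℝ} (hφ : ContDiff ℝ ∞ φ) (v w p : Heis n) :
    fderiv ℝ (fun p => fderiv ℝ φ p (leftField w p)) p (leftField v p)
      - fderiv ℝ (fun p => fderiv ℝ φ p (leftField v p)) p (leftField w p)
      = 2 * symplForm v w * fderiv ℝ φ p (vert 1) := by
  have hf : ContDiff ℝ ∞ (fderiv ℝ φ) := hφ.fderiv_right (m := ∞) (by simp)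
  have hd : DifferentiableAt ℝ (fderiv ℝ φ) p := (hf.differentiable (by simp)) p
  have key : ∀ v w : Heis n, fderiv ℝ (fun p => fderiv ℝ φ p (leftField w p)) p (leftField v p)
      = fderiv ℝ (fderiv ℝ φ) p (leftField v p) (leftField w p)
        + symplForm v w * fderiv ℝ φ p (vert 1) := by
    intro v w
    have hlw : Differentiable ℝ fun p : Heis n => leftField w p :=
      (by fun_prop : ContDiff ℝ ∞ fun p : Heis n => leftField w p).differentiable (by simp)
    rw [fderiv_clm_apply hd (hlw p)]
    have e : fderiv ℝ (fun p : Heis n => leftField w p) p (leftField v p)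
        = symplForm v w • vert 1 := by
      have h2 : HasDerivAt (fun θ : ℝ => leftField w (p + θ • leftField v p))
          (symplForm v w • vert 1) 0 := by
        have e3 : (fun θ : ℝ => leftField w (p + θ • leftField v p))
            = fun θ : ℝ => leftField w p + θ • (symplForm v w • vert 1) := by
          funext θ
          simp only [leftField, symplForm_add_left, symplForm_smul_left, symplForm_vert_left,
            add_zero, vert_add, add_assoc]
          rw [smul_smul, ← vert_smul, mul_one]
        rw [e3]
        simpa using ((hasDerivAt_id (0 : ℝ)).smul_const
          (symplForm v w • (vert 1 : Heis n))).const_add (leftField w p)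
      have h4 : HasDerivAt (fun θ : ℝ => p + θ • leftField v p) (leftField v p) 0 := by
        simpa using ((hasDerivAt_id (0 : ℝ)).smul_const (leftField v p)).const_add p
      have h5 : HasDerivAt (fun θ : ℝ => leftField w (p + θ • leftField v p))
          (fderiv ℝ (fun p : Heis n => leftField w p) p (leftField v p)) 0 := by
        have := (hlw (p + (0 : ℝ) • leftField v p)).hasFDerivAt.comp_hasDerivAt (0 : ℝ) h4
        simpa [Function.comp_def] using this
      exact h5.unique h2
    simp only [add_apply, ContinuousLinearMap.comp_apply,
      ContinuousLinearMap.flip_apply, e, map_smul, smul_eq_mul]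
    ring
  have hsymm : IsSymmSndFDerivAt ℝ φ p :=
    hφ.contDiffAt.isSymmSndFDerivAt (by simp; exact WithTop.coe_le_coe.2 (le_top : (2 : ℕ∞) ≤ ⊤))
  rw [key v w, key w v, hsymm.eq (leftField v p) (leftField w p), symplForm_swap w v]
  ring

lemma leftField_vert_one (p : Heis n) : leftField (vert 1) p = vert 1 := by simp [leftField]

lemma symplForm_hbasis (j : Fin n) :
    symplForm (hbasis (Sum.inl j)) (hbasis (Sum.inr j) : Heis n) = -2 := by
  simp [symplForm, hbasis, Pi.single_apply]

/-- The commutator `[X_j, Y_j] = -4 T`, in the weak sense. -/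
lemma IsWeakDerivAlong.vertical {g : Heis n → ℝ} {G : Fin n ⊕ Fin n → Heis n → ℝ}
    {H : Fin n ⊕ Fin n → Fin n ⊕ Fin n → Heis n → ℝ}
    (hG : ∀ j, IsWeakDerivAlong (leftField (hbasis j)) g (G j))
    (hH : ∀ i j, IsWeakDerivAlong (leftField (hbasis i)) (G j) (H i j)) (k : Fin n) :
    IsWeakDerivAlong (leftField (vert 1)) g fun p =>
      -(1 / 4) * (H (Sum.inl k) (Sum.inr k) p - H (Sum.inr k) (Sum.inl k) p) := by
  set X := Sum.inl (β := Fin n) k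
  set Y := Sum.inr (α := Fin n) k
  refine ⟨(hG X).1, ((hH X Y).2.1.sub (hH Y X).2.1).smul (-(1 / 4) : ℝ), fun φ hφ hc => ?_⟩
  have hXφ := contDiff_leftDeriv hφ (hbasis X)
  have hYφ := contDiff_leftDeriv hφ (hbasis Y)
  have hXc := hasCompactSupport_fderiv_apply hc (leftField (hbasis X))
  have hYc := hasCompactSupport_fderiv_apply hc (leftField (hbasis Y))
  have e1 := (hH X Y).2.2 φ hφ hc
  have e2 := (hG Y).2.2 _ hXφ hXc
  have e3 := (hH Y X).2.2 φ hφ hc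
  have e4 := (hG X).2.2 _ hYφ hYc
  have e5 : ∀ p, g p * fderiv ℝ φ p (leftField (vert 1) p) = -(1 / 4) *
      (g p * fderiv ℝ (fun p => fderiv ℝ φ p (leftField (hbasis Y) p)) p (leftField (hbasis X) p)
      - g p * fderiv ℝ (fun p => fderiv ℝ φ p (leftField (hbasis X) p)) p
        (leftField (hbasis Y) p)) := by
    intro p
    have := leftDeriv_commutator hφ (hbasis X) (hbasis Y) p
    rw [symplForm_hbasis] at this
    rw [leftField_vert_one, ← mul_sub, this]
    ring
  simp only [e5, mul_assoc]
  rw [integral_const_mul, integral_const_mul]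
  simp only [sub_mul]
  rw [integral_sub (integrable_mul_of_hasCompactSupport (hH X Y).2.1 hφ.continuous hc)
    (integrable_mul_of_hasCompactSupport (hH Y X).2.1 hφ.continuous hc),
    integral_sub (integrable_mul_fderiv (hG X).1 hYφ hYc _)
      (integrable_mul_fderiv (hG X).1 hXφ hXc _)]
  linarith

end weakDerivAlgebra

/-! ### Taylor estimates in weighted L¹ at the scale of the dilations. -/

section taylor

variable {n : ℕ} {ν : Measure ℝ}

lemma wInt_add_le {f F G : ℝ → Heis n → ℝ} (hf : Measurable (Function.uncurry f))
    (hF : Measurable (Function.uncurry F)) :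
    wInt ν f (fun t q => F t q + G t q) ≤ wInt ν f F + wInt ν f G := by
  have e1 : Measurable fun z : ℝ × Heis n => f z.1 z.2 := hf
  have e2 : Measurable fun z : ℝ × Heis n => F z.1 z.2 := hF
  rw [wInt, wInt, wInt, ← lintegral_add_left (by fun_prop)]
  refine lintegral_mono fun z => ?_
  rw [← mul_add]
  gcongr
  exact enorm_add_le _ _

lemma wInt_const_mul {f F : ℝ → Heis n → ℝ} (a : ℝ) :
    wInt ν f (fun t q => a * F t q) = ‖a‖ₑ * wInt ν f F := by
  rw [wInt, wInt, ← lintegral_const_mul' _ _ (by simp)]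
  refine lintegral_congr fun z => ?_
  rw [enorm_mul]; ring

lemma wInt_sum_le {ι : Type*} (s : Finset ι) {f : ℝ → Heis n → ℝ} {F : ι → ℝ → Heis n → ℝ}
    (hf : Measurable (Function.uncurry f)) (hF : ∀ i ∈ s, Measurable (Function.uncurry (F i))) :
    wInt ν f (fun t q => ∑ i ∈ s, F i t q) ≤ ∑ i ∈ s, wInt ν f (F i) := by
  classical
  induction s using Finset.induction_on with
  | empty => simp [wInt]
  | insert i s hi ih =>
    simp only [Finset.sum_insert hi]
    refine (wInt_add_le hf (hF i (Finset.mem_insert_self i s))).trans ?_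
    gcongr
    exact ih fun j hj => hF j (Finset.mem_insert_of_mem hj)

lemma ae_comp_hmul_right {P : Heis n → Prop} (h : ∀ᵐ q, P q) (w : Heis n) : ∀ᵐ q, P (q ⊙ w) :=
  (measurePreserving_hmul_right w).quasiMeasurePreserving.ae h

/-- Taylor's formula in weighted `L¹`: an increment along `v` is controlled by the oscillation of
the derivative. -/
lemma wInt_increment_le [SFinite ν] {f g gv a b : ℝ → Heis n → ℝ}
    (hf : Measurable (Function.uncurry f))
    (hg : Measurable (Function.uncurry g)) (hgv : Measurable (Function.uncurry gv))
    (ha : Measurable (Function.uncurry a)) (hb : Measurable (Function.uncurry b))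
    {v h : Heis n} (hw : ∀ᵐ t ∂ν, IsWeakDerivAlong (leftField v) (g t) (gv t)) {B : ℝ≥0∞}
    (hB : ∀ θ ∈ Ioc (0 : ℝ) 1,
      wInt ν f (fun t q => gv t (q ⊙ h ⊙ (θ • v)) - (a t q + θ * b t q)) ≤ B) :
    wInt ν f (fun t q => g t (q ⊙ h ⊙ v) - g t (q ⊙ h) - (a t q + 1 / 2 * b t q)) ≤ B := by
  have mf : Measurable fun z : ℝ × Heis n => f z.1 z.2 := hf
  have ma : Measurable fun z : ℝ × Heis n => a z.1 z.2 := ha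
  have mb : Measurable fun z : ℝ × Heis n => b z.1 z.2 := hb
  have mg1 : Measurable fun z : ℝ × Heis n => g z.1 (z.2 ⊙ h ⊙ v) :=
    hg.comp_uncurry measurable_fst (by fun_prop)
  have mg2 : Measurable fun z : ℝ × Heis n => g z.1 (z.2 ⊙ h) :=
    hg.comp_uncurry measurable_fst (by fun_prop)
  have mgv : Measurable fun y : (ℝ × Heis n) × ℝ => gv y.1.1 (y.1.2 ⊙ h ⊙ (y.2 • v)) :=
    hgv.comp_uncurry (by fun_prop) (by fun_prop)
  have ma' : Measurable fun y : (ℝ × Heis n) × ℝ => a y.1.1 y.1.2 :=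
    ha.comp_uncurry (by fun_prop) (by fun_prop)
  have mb' : Measurable fun y : (ℝ × Heis n) × ℝ => b y.1.1 y.1.2 :=
    hb.comp_uncurry (by fun_prop) (by fun_prop)
  have mf' : Measurable fun y : (ℝ × Heis n) × ℝ => f y.1.1 y.1.2 :=
    hf.comp_uncurry (by fun_prop) (by fun_prop)
  have hpt : ∀ᵐ t ∂ν, ∀ᵐ q, ‖f t q‖ₑ * ‖g t (q ⊙ h ⊙ v) - g t (q ⊙ h) - (a t q + 1 / 2 * b t q)‖ₑ
      ≤ ∫⁻ θ in Ioc (0 : ℝ) 1,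
        ‖f t q‖ₑ * ‖gv t (q ⊙ h ⊙ (θ • v)) - (a t q + θ * b t q)‖ₑ := by
    filter_upwards [hw] with t ht
    have mgt : Measurable (g t) := hg.comp measurable_prodMk_left
    have mgvt : Measurable (gv t) := hgv.comp measurable_prodMk_left
    filter_upwards [ae_comp_hmul_right (ht.sub_eq_integral mgt mgvt) h,
      ae_comp_hmul_right (ae_integrable_translate ht.2.1 mgvt v) h] with q h1 h2
    rw [h1, lintegral_const_mul' _ _ (by simp)]
    gcongr
    -- The factor 1/2 is ∫₀¹ θ dθ. The derivative along the segment is compared with an affine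
    -- function a + θ b of the parameter: b = 0 gives first-order estimates, and b equal to the
    -- second derivative gives second-order ones.
    have e : a t q + 1 / 2 * b t q = ∫ θ in Ioc (0 : ℝ) 1, (a t q + θ * b t q) := by
      have i1 : IntervalIntegrable (fun θ : ℝ => θ * b t q) volume 0 1 :=
        Continuous.intervalIntegrable (by fun_prop) _ _
      rw [← intervalIntegral.integral_of_le zero_le_one,
        intervalIntegral.integral_add (by simp) i1, intervalIntegral.integral_mul_const]
      simp
    have hint : IntegrableOn (fun θ : ℝ => a t q + θ * b t q) (Ioc 0 1) :=
      (Continuous.integrableOn_Ioc (by fun_prop))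
    rw [e, ← integral_sub h2 hint]
    exact enorm_integral_le_lintegral_enorm _
  calc wInt ν f (fun t q => g t (q ⊙ h ⊙ v) - g t (q ⊙ h) - (a t q + 1 / 2 * b t q))
      = ∫⁻ t, (∫⁻ q, ‖f t q‖ₑ *
          ‖g t (q ⊙ h ⊙ v) - g t (q ⊙ h) - (a t q + 1 / 2 * b t q)‖ₑ) ∂ν := by
        rw [wInt, lintegral_prod _ (Measurable.aemeasurable (by fun_prop))]
    _ ≤ ∫⁻ t, (∫⁻ q, ∫⁻ θ in Ioc (0 : ℝ) 1,
          ‖f t q‖ₑ * ‖gv t (q ⊙ h ⊙ (θ • v)) - (a t q + θ * b t q)‖ₑ) ∂ν :=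
        lintegral_mono_ae (hpt.mono fun t ht => lintegral_mono_ae ht)
    _ = ∫⁻ z, (∫⁻ θ in Ioc (0 : ℝ) 1,
          ‖f z.1 z.2‖ₑ * ‖gv z.1 (z.2 ⊙ h ⊙ (θ • v)) - (a z.1 z.2 + θ * b z.1 z.2)‖ₑ)
          ∂(ν.prod volume) := by
        rw [lintegral_prod _ (Measurable.aemeasurable (Measurable.lintegral_prod_right' (f := fun
          y : (ℝ × Heis n) × ℝ => ‖f y.1.1 y.1.2‖ₑ * ‖gv y.1.1 (y.1.2 ⊙ h ⊙ (y.2 • v))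
            - (a y.1.1 y.1.2 + y.2 * b y.1.1 y.1.2)‖ₑ) (by fun_prop)))]
    _ = ∫⁻ θ in Ioc (0 : ℝ) 1, wInt ν f
          (fun t q => gv t (q ⊙ h ⊙ (θ • v)) - (a t q + θ * b t q)) := by
        rw [lintegral_lintegral_swap (Measurable.aemeasurable (by
          unfold Function.uncurry; fun_prop))]
        rfl
    _ ≤ ∫⁻ _ in Ioc (0 : ℝ) 1, B := setLIntegral_mono' measurableSet_Ioc hB
    _ = B := by simp

/-- The box of scale `ε` in the Heisenberg group. -/
def heisBox (n : ℕ) (ε : ℝ) : Set (Heis n) := {h | (∀ j, |hcoord j h| ≤ ε) ∧ |h.2.2| ≤ ε ^ 2}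

lemma measurable_translate_sub {A : ℝ → Heis n → ℝ} (hA : Measurable (Function.uncurry A))
    (h : Heis n) : Measurable (Function.uncurry fun t q => A t (q ⊙ h) - A t q) := by
  have e1 : Measurable fun z : ℝ × Heis n => A z.1 (z.2 ⊙ h) :=
    hA.comp_uncurry measurable_fst (by fun_prop)
  exact e1.sub hA

/-- The derivative along v is ∑ v_j G_j, and on the segment each G_j is compared with its value at q
rather than at q ⊙ h. The increments along the sides of a polygonal path then share the same
coefficients and can be added. -/
lemma wInt_increment_horizontal_le [SFinite ν] {f g : ℝ → Heis n → ℝ}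
    {G : Fin n ⊕ Fin n → ℝ → Heis n → ℝ}
    (hf : Measurable (Function.uncurry f))
    (hg : Measurable (Function.uncurry g)) (hG : ∀ j, Measurable (Function.uncurry (G j)))
    (hgl : ∀ᵐ t ∂ν, LocallyIntegrable (g t))
    (hw : ∀ j, ∀ᵐ t ∂ν, IsWeakDerivAlong (leftField (hbasis j)) (g t) (G j t)) {η : ℝ≥0∞}
    {v h : Heis n} (hv : v.2.2 = 0)
    (hη : ∀ j, ∀ θ ∈ Ioc (0 : ℝ) 1,
      wInt ν f (fun t q => G j t (q ⊙ (h ⊙ (θ • v))) - G j t q) ≤ η) :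
    wInt ν f (fun t q => g t (q ⊙ h ⊙ v) - g t (q ⊙ h) - ∑ j, hcoord j v * G j t q)
      ≤ (∑ j, ‖hcoord j v‖ₑ) * η := by
  have hGv : Measurable (Function.uncurry fun t q => ∑ j, hcoord j v * G j t q) := by
    refine Finset.measurable_sum _ fun j _ => ?_
    exact (hG j).const_mul _
  have hw' : ∀ᵐ t ∂ν, IsWeakDerivAlong (leftField v) (g t)
      (fun q => ∑ j, hcoord j v * G j t q) := by
    filter_upwards [ae_all_iff.2 hw, hgl] with t ht htl
    exact IsWeakDerivAlong.horizontal htl ht hv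
  have key := wInt_increment_le (ν := ν) (f := f) (g := g) (h := h) (v := v)
    (gv := fun t q => ∑ j, hcoord j v * G j t q) (a := fun t q => ∑ j, hcoord j v * G j t q)
    (b := fun _ _ => 0) hf hg hGv hGv measurable_const hw' (B := (∑ j, ‖hcoord j v‖ₑ) * η) ?_
  · simpa using key
  intro θ hθ
  have e : (fun (t : ℝ) q => (∑ j, hcoord j v * G j t (q ⊙ h ⊙ (θ • v)))
      - ((∑ j, hcoord j v * G j t q) + θ * 0))
      = fun (t : ℝ) q => ∑ j, hcoord j v * (G j t (q ⊙ (h ⊙ (θ • v))) - G j t q) := by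
    funext t q
    simp only [mul_zero, add_zero, mul_sub, Finset.sum_sub_distrib, hmul_assoc]
  rw [e]
  refine (wInt_sum_le _ hf fun j _ => (measurable_translate_sub (hG j) _).const_mul _).trans ?_
  rw [Finset.sum_mul]
  refine Finset.sum_le_sum fun j _ => ?_
  rw [wInt_const_mul]
  gcongr
  exact hη j θ hθ

/-- The point with `X_k`-coordinate `x`, `Y_k`-coordinate `y` and central coordinate `c`. -/
def planePt (k : Fin n) (x y c : ℝ) : Heis n :=
  x • hbasis (Sum.inl k) + y • hbasis (Sum.inr k) + vert c

lemma planePt_hmul (k : Fin n) (x y c x' y' c' : ℝ) :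
    planePt k x y c ⊙ planePt k x' y' c'
      = planePt k (x + x') (y + y') (c + c' + 2 * (x' * y - x * y')) := by
  have h1 := symplForm_hbasis k
  have h2 := symplForm_swap (hbasis (Sum.inr k) : Heis n) (hbasis (Sum.inl k))
  have e : symplForm (planePt k x y c) (planePt k x' y' c') = 2 * (x' * y - x * y') := by
    simp only [planePt, symplForm_add_left, symplForm_add_right, symplForm_smul_left,
      symplForm_smul_right, symplForm_self, symplForm_vert_left, symplForm_vert_right, h2, h1]
    ring
  rw [hmul, e]
  simp only [planePt, add_smul, vert_add]
  abel

lemma planePt_smul (k : Fin n) (θ x y c : ℝ) :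
    θ • planePt k x y c = planePt k (θ * x) (θ * y) (θ * c) := by
  simp only [planePt, smul_add, smul_smul, vert_smul]

lemma planePt_zero_zero (k : Fin n) (c : ℝ) : planePt k 0 0 c = vert c := by simp [planePt]

lemma hcoord_planePt (k : Fin n) (x y c : ℝ) (j : Fin n ⊕ Fin n) :
    hcoord j (planePt k x y c) = x * (if j = Sum.inl k then 1 else 0)
      + y * (if j = Sum.inr k then 1 else 0) := by
  rcases j with j | j <;> simp [hcoord, planePt, hbasis, vert, Pi.single_apply]

lemma planePt_mem_heisBox (k : Fin n) {x y c ε : ℝ} (hx : |x| ≤ ε) (hy : |y| ≤ ε)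
    (hc : |c| ≤ ε ^ 2) : planePt k x y c ∈ heisBox n ε := by
  have hε : 0 ≤ ε := (abs_nonneg x).trans hx
  refine ⟨fun j => ?_, ?_⟩
  · rw [hcoord_planePt]
    rcases j with j | j
    · by_cases h : j = k <;> simp [h, hx, hε]
    · by_cases h : j = k <;> simp [h, hy, hε]
  · simpa [planePt, hbasis, vert] using hc

lemma sum_enorm_hcoord_planePt_le (k : Fin n) (x y c : ℝ) :
    ∑ j, ‖hcoord j (planePt k x y c)‖ₑ ≤ ‖x‖ₑ + ‖y‖ₑ := by
  simp only [hcoord_planePt]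
  calc ∑ j, ‖x * (if j = Sum.inl k then 1 else 0) + y * (if j = Sum.inr k then (1 : ℝ) else 0)‖ₑ
      ≤ ∑ j : Fin n ⊕ Fin n, ((if j = Sum.inl k then ‖x‖ₑ else 0)
        + (if j = Sum.inr k then ‖y‖ₑ else 0)) := by
        refine Finset.sum_le_sum fun j _ => (enorm_add_le _ _).trans ?_
        gcongr <;> split_ifs <;> simp
    _ = ‖x‖ₑ + ‖y‖ₑ := by
        rw [Finset.sum_add_distrib, Finset.sum_ite_eq' Finset.univ, Finset.sum_ite_eq' Finset.univ]
        simp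

lemma horizontal_add_vert (w : Heis n) : vert w.2.2 ⊙ (w.1, w.2.1, 0) = w := by
  simp [hmul, vert, symplForm]

lemma enorm_le_ofReal_of_abs_le {x ε : ℝ} (h : |x| ≤ ε) : ‖x‖ₑ ≤ ENNReal.ofReal ε := by
  rw [← ofReal_norm]; exact ENNReal.ofReal_le_ofReal h

/-- First order Taylor estimate at scale `ε`, for functions with horizontal derivatives only. -/
lemma wInt_taylor_one [SFinite ν] (k : Fin n) {f g : ℝ → Heis n → ℝ}
    {G : Fin n ⊕ Fin n → ℝ → Heis n → ℝ}
    (hf : Measurable (Function.uncurry f))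
    (hg : Measurable (Function.uncurry g)) (hG : ∀ j, Measurable (Function.uncurry (G j)))
    (hgl : ∀ᵐ t ∂ν, LocallyIntegrable (g t))
    (hw : ∀ j, ∀ᵐ t ∂ν, IsWeakDerivAlong (leftField (hbasis j)) (g t) (G j t)) {η : ℝ≥0∞} {ε : ℝ}
    (hε : 0 < ε)
    (hη : ∀ j, ∀ h ∈ heisBox n ε, wInt ν f (fun t q => G j t (q ⊙ h) - G j t q) ≤ η)
    {w : Heis n} (hwε : w ∈ heisBox n ε) :
    wInt ν f (fun t q => g t (q ⊙ w) - g t q - ∑ j, hcoord j w * G j t q)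
      ≤ (2 * n + 4) * ENNReal.ofReal ε * η := by
  obtain ⟨hw1, hw2⟩ := hwε
  set c := w.2.2 with hc
  -- No derivative along T is available here, so the central displacement c is realised by the
  -- horizontal loop a X, b Y, −a X, −b Y, which ends at the central element −4ab. Taking a = ε/2
  -- forces b = −c/(2ε), and |c| ≤ ε² gives |b| ≤ ε/2. The central coordinate along the loop stays
  -- below 4|ab| ≤ ε², so the path never leaves the box.
  set a : ℝ := ε / 2 with ha
  set b : ℝ := -c / (2 * ε) with hb
  have habc : -4 * (a * b) = c := by rw [ha, hb]; field_simp; ring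
  have ha' : |a| ≤ ε / 2 := by rw [ha, abs_of_pos (by positivity)]
  have hb' : |b| ≤ ε / 2 := by
    rw [hb, abs_div, abs_neg, abs_of_pos (by positivity : 0 < 2 * ε), div_le_iff₀ (by positivity)]
    nlinarith
  have hab : |a * b| ≤ ε ^ 2 / 4 := by
    rw [abs_mul]; nlinarith [abs_nonneg a, abs_nonneg b]
  set v : Heis n := (w.1, w.2.1, 0) with hv
  have step : ∀ h s : Heis n, s.2.2 = 0 → (∀ θ ∈ Ioc (0 : ℝ) 1, h ⊙ (θ • s) ∈ heisBox n ε) →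
      wInt ν f (fun t q => g t (q ⊙ h ⊙ s) - g t (q ⊙ h) - ∑ j, hcoord j s * G j t q)
        ≤ (∑ j, ‖hcoord j s‖ₑ) * η := fun h s hs hbox =>
    wInt_increment_horizontal_le hf hg hG hgl hw hs fun j θ hθ => hη j _ (hbox θ hθ)
  have meas : ∀ h s : Heis n, Measurable (Function.uncurry
      fun t q => g t (q ⊙ h ⊙ s) - g t (q ⊙ h) - ∑ j, hcoord j s * G j t q) := by
    intro h s
    have e1 : Measurable fun z : ℝ × Heis n => g z.1 (z.2 ⊙ h ⊙ s) :=
      hg.comp_uncurry measurable_fst (by fun_prop)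
    have e2 : Measurable fun z : ℝ × Heis n => g z.1 (z.2 ⊙ h) :=
      hg.comp_uncurry measurable_fst (by fun_prop)
    exact (e1.sub e2).sub (Finset.measurable_sum _ fun j _ => (hG j).const_mul _)
  have small : ∀ x y : ℝ, |x| ≤ ε / 2 → |y| ≤ ε / 2 →
      (∑ j, ‖hcoord j (planePt k x y 0)‖ₑ) * η ≤ ENNReal.ofReal ε * η := by
    intro x y hx hy
    gcongr
    refine (sum_enorm_hcoord_planePt_le k x y 0).trans ?_
    calc ‖x‖ₑ + ‖y‖ₑ ≤ ENNReal.ofReal (ε / 2) + ENNReal.ofReal (ε / 2) :=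
          add_le_add (enorm_le_ofReal_of_abs_le hx) (enorm_le_ofReal_of_abs_le hy)
      _ = ENNReal.ofReal ε := by rw [← ENNReal.ofReal_add (by positivity) (by positivity)]; simp
  have p22 : ∀ x y : ℝ, (planePt k x y 0 : Heis n).2.2 = 0 := by
    intro x y; simp [planePt, hbasis, vert]
  have hε2 : ε / 2 ≤ ε := by linarith
  have habθ : ∀ θ ∈ Ioc (0 : ℝ) 1, |θ * (a * b)| ≤ ε ^ 2 / 4 := by
    intro θ hθ
    rw [abs_mul, abs_of_pos hθ.1]
    nlinarith [hθ.2, abs_nonneg (a * b), hθ.1]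
  have hθx : ∀ x : ℝ, |x| ≤ ε / 2 → ∀ θ ∈ Ioc (0 : ℝ) 1, |θ * x| ≤ ε ∧ |x - θ * x| ≤ ε := by
    intro x hx θ hθ
    have e : x - θ * x = (1 - θ) * x := by ring
    rw [e, abs_mul, abs_mul, abs_of_pos hθ.1, abs_of_nonneg (by linarith [hθ.2] : 0 ≤ 1 - θ)]
    constructor <;> nlinarith [hθ.1, hθ.2, abs_nonneg x]
  have s1 := (step (planePt k 0 0 0) (planePt k a 0 0) (p22 _ _) fun θ hθ => by
    rw [planePt_smul, planePt_hmul]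
    refine planePt_mem_heisBox k ?_ ?_ ?_
    · simpa using (hθx a ha' θ hθ).1
    · simpa using hε.le
    · simpa using by positivity).trans (small a 0 ha' (by simpa using by positivity))
  have s2 := (step (planePt k a 0 0) (planePt k 0 b 0) (p22 _ _) fun θ hθ => by
    rw [planePt_smul, planePt_hmul]
    refine planePt_mem_heisBox k ?_ ?_ ?_
    · simpa using ha'.trans hε2
    · simpa using (hθx b hb' θ hθ).1
    · have e : (0 : ℝ) + θ * 0 + 2 * (θ * 0 * 0 - a * (θ * b)) = -2 * (θ * (a * b)) := by ring
      rw [e, abs_mul (-2)]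
      have := habθ θ hθ
      rw [abs_neg, abs_two]
      linarith [sq_nonneg ε]).trans (small 0 b (by simpa using by positivity) hb')
  have s3 := (step (planePt k a b (-2 * (a * b))) (planePt k (-a) 0 0) (p22 _ _) fun θ hθ => by
    rw [planePt_smul, planePt_hmul]
    refine planePt_mem_heisBox k ?_ ?_ ?_
    · have := (hθx a ha' θ hθ).2
      rwa [mul_neg, ← sub_eq_add_neg]
    · simpa using hb'.trans hε2
    · have e : -2 * (a * b) + θ * 0 + 2 * (θ * -a * b - a * (θ * 0))
          = -2 * (a * b) + -2 * (θ * (a * b)) := by ring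
      rw [e]
      have h1 := habθ θ hθ
      refine (abs_add_le _ _).trans ?_
      rw [abs_mul (-2), abs_mul (-2), abs_neg, abs_two]
      linarith).trans (small (-a) 0 (by simpa using ha') (by simpa using by positivity))
  have s4 := (step (planePt k 0 b (-4 * (a * b))) (planePt k 0 (-b) 0) (p22 _ _) fun θ hθ => by
    rw [planePt_smul, planePt_hmul]
    refine planePt_mem_heisBox k ?_ ?_ ?_
    · simpa using hε.le
    · have := (hθx b hb' θ hθ).2
      rwa [mul_neg, ← sub_eq_add_neg]
    · have e : -4 * (a * b) + θ * 0 + 2 * (θ * 0 * b - 0 * (θ * -b)) = c := by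
        rw [← habc]; ring
      rwa [e]).trans (small 0 (-b) (by simpa using by positivity) (by simpa using hb'))
  -- The last leg is the horizontal part of w, with 2n coordinates of size at most ε. Each of the
  -- four sides of the loop costs ε η, which explains the constant 2n + 4.
  have s5 : wInt ν f (fun t q => g t (q ⊙ vert c ⊙ v) - g t (q ⊙ vert c)
      - ∑ j, hcoord j v * G j t q) ≤ (2 * n) * ENNReal.ofReal ε * η := by
    refine (step (vert c) v rfl fun θ hθ => ?_).trans ?_
    · have e : (vert c ⊙ (θ • v) : Heis n) = (θ • w.1, θ • w.2.1, c) := by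
        simp [hmul, vert, hv, symplForm]
      rw [e]
      refine ⟨fun j => ?_, hw2⟩
      have e2 : hcoord j (θ • w.1, θ • w.2.1, c) = θ * hcoord j w := by
        rcases j with j | j <;> simp [hcoord]
      rw [e2, abs_mul, abs_of_pos hθ.1]
      nlinarith [hw1 j, hθ.1, hθ.2, abs_nonneg (hcoord j w)]
    · gcongr
      have e2 : ∀ j, ‖hcoord j v‖ₑ ≤ ENNReal.ofReal ε := fun j =>
        enorm_le_ofReal_of_abs_le (by rcases j with j | j <;> exact hw1 _)
      refine (Finset.sum_le_sum fun j _ => e2 j).trans ?_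
      simp only [Finset.sum_const, Finset.card_univ, Fintype.card_sum, Fintype.card_fin,
        nsmul_eq_mul]
      rw [two_mul]; push_cast; exact le_rfl
  have m := meas
  -- The increments telescope. The first-order terms of opposite sides of the loop cancel, and only
  -- those of the final horizontal leg are left.
  have decomp : (fun t q => g t (q ⊙ w) - g t q - ∑ j, hcoord j w * G j t q)
      = fun (t : ℝ) q =>
        (g t (q ⊙ planePt k 0 0 0 ⊙ planePt k a 0 0) - g t (q ⊙ planePt k 0 0 0)
          - ∑ j, hcoord j (planePt k a 0 0) * G j t q)
        + ((g t (q ⊙ planePt k a 0 0 ⊙ planePt k 0 b 0) - g t (q ⊙ planePt k a 0 0)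
          - ∑ j, hcoord j (planePt k 0 b 0) * G j t q)
        + ((g t (q ⊙ planePt k a b (-2 * (a * b)) ⊙ planePt k (-a) 0 0)
          - g t (q ⊙ planePt k a b (-2 * (a * b)))
          - ∑ j, hcoord j (planePt k (-a) 0 0) * G j t q)
        + ((g t (q ⊙ planePt k 0 b (-4 * (a * b)) ⊙ planePt k 0 (-b) 0)
          - g t (q ⊙ planePt k 0 b (-4 * (a * b)))
          - ∑ j, hcoord j (planePt k 0 (-b) 0) * G j t q)
        + (g t (q ⊙ vert c ⊙ v) - g t (q ⊙ vert c) - ∑ j, hcoord j v * G j t q)))) := by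
    funext t q
    have q1 : q ⊙ planePt k 0 0 0 ⊙ planePt k a 0 0 = q ⊙ planePt k a 0 0 := by
      rw [planePt_zero_zero]; simp
    have q2 : q ⊙ planePt k a 0 0 ⊙ planePt k 0 b 0 = q ⊙ planePt k a b (-2 * (a * b)) := by
      rw [hmul_assoc, planePt_hmul]; congr 2 <;> ring
    have q3 : q ⊙ planePt k a b (-2 * (a * b)) ⊙ planePt k (-a) 0 0
        = q ⊙ planePt k 0 b (-4 * (a * b)) := by
      rw [hmul_assoc, planePt_hmul]; congr 2 <;> ring
    have q4 : q ⊙ planePt k 0 b (-4 * (a * b)) ⊙ planePt k 0 (-b) 0 = q ⊙ vert c := by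
      rw [hmul_assoc, planePt_hmul, ← planePt_zero_zero k, ← habc]; congr 2 <;> ring
    have q5 : q ⊙ vert c ⊙ v = q ⊙ w := by rw [hmul_assoc, horizontal_add_vert]
    have q0 : q ⊙ planePt k 0 0 0 = q := by rw [planePt_zero_zero]; simp
    have hs : ∀ (x y : ℝ), ∑ j, hcoord j (planePt k x y 0) * G j t q
        = x * G (Sum.inl k) t q + y * G (Sum.inr k) t q := by
      intro x y
      simp only [hcoord_planePt, add_mul, Finset.sum_add_distrib, mul_ite, mul_one, mul_zero,
        ite_mul, zero_mul, Finset.sum_ite_eq', Finset.mem_univ, if_true]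
    have hwv : ∀ j, hcoord j w = hcoord j v := by
      intro j; rcases j with j | j <;> rfl
    rw [q1, q2, q3, q4, q5, q0, hs, hs, hs, hs]
    simp only [hwv]
    ring
  rw [decomp]
  refine (wInt_add_le hf (m _ _)).trans ?_
  refine (add_le_add s1 ((wInt_add_le hf (m _ _)).trans (add_le_add s2
    ((wInt_add_le hf (m _ _)).trans (add_le_add s3
      ((wInt_add_le hf (m _ _)).trans (add_le_add s4 s5))))))).trans (le_of_eq ?_)
  ring

/-- Second order Taylor estimate at scale `ε`. -/
lemma wInt_taylor_two [SFinite ν] {f g S : ℝ → Heis n → ℝ}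
    {G : Fin n ⊕ Fin n → ℝ → Heis n → ℝ} {H : Fin n ⊕ Fin n → Fin n ⊕ Fin n → ℝ → Heis n → ℝ}
    (hf : Measurable (Function.uncurry f))
    (hg : Measurable (Function.uncurry g)) (hS : Measurable (Function.uncurry S))
    (hG : ∀ j, Measurable (Function.uncurry (G j)))
    (hH : ∀ i j, Measurable (Function.uncurry (H i j)))
    (hgl : ∀ᵐ t ∂ν, LocallyIntegrable (g t)) (hGl : ∀ j, ∀ᵐ t ∂ν, LocallyIntegrable (G j t))
    (hwG : ∀ j, ∀ᵐ t ∂ν, IsWeakDerivAlong (leftField (hbasis j)) (g t) (G j t))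
    (hwH : ∀ i j, ∀ᵐ t ∂ν, IsWeakDerivAlong (leftField (hbasis i)) (G j t) (H i j t))
    (hwS : ∀ᵐ t ∂ν, IsWeakDerivAlong (leftField (vert 1)) (g t) (S t)) {η : ℝ≥0∞} {ε : ℝ}
    (hε : 0 < ε)
    (hηH : ∀ i j, ∀ h ∈ heisBox n ε, wInt ν f (fun t q => H i j t (q ⊙ h) - H i j t q) ≤ η)
    (hηS : ∀ h ∈ heisBox n ε, wInt ν f (fun t q => S t (q ⊙ h) - S t q) ≤ η)
    {w : Heis n} (hwε : w ∈ heisBox n ε) :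
    wInt ν f (fun t q => g t (q ⊙ w) - g t q - ∑ j, hcoord j w * G j t q
        - 1 / 2 * ∑ j, hcoord j w * ∑ i, hcoord i w * H i j t q - w.2.2 * S t q)
      ≤ ((2 * n) ^ 2 + 1) * ENNReal.ofReal (ε ^ 2) * η := by
  obtain ⟨hw1, hw2⟩ := hwε
  set c := w.2.2 with hc
  set v : Heis n := (w.1, w.2.1, 0) with hv
  have hvw : ∀ j, hcoord j v = hcoord j w := by intro j; rcases j with j | j <;> rfl
  have hθv : ∀ (θ : ℝ) j, hcoord j (θ • v) = θ * hcoord j w := by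
    intro θ j; rcases j with j | j <;> simp [hcoord, hv]
  have hbox : ∀ θ : ℝ, 0 ≤ θ → θ ≤ 1 → ∀ c' : ℝ, |c'| ≤ ε ^ 2 →
      (θ • v) ⊙ vert c' ∈ heisBox n ε := by
    intro θ h0 h1 c' hc'
    have e : (θ • v) ⊙ vert c' = (θ • w.1, θ • w.2.1, c') := by simp [hmul, vert, hv, symplForm]
    rw [e]
    refine ⟨fun j => ?_, hc'⟩
    have e2 : hcoord j (θ • w.1, θ • w.2.1, c') = θ * hcoord j w := by
      rcases j with j | j <;> simp [hcoord]
    rw [e2, abs_mul, abs_of_nonneg h0]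
    nlinarith [hw1 j, abs_nonneg (hcoord j w)]
  have mGv : Measurable (Function.uncurry fun t q => ∑ j, hcoord j w * G j t q) :=
    Finset.measurable_sum _ fun j _ => (hG j).const_mul _
  have mHv : Measurable (Function.uncurry
      fun t q => ∑ j, hcoord j w * ∑ i, hcoord i w * H i j t q) :=
    Finset.measurable_sum _ fun j _ => (Finset.measurable_sum _ fun i _ =>
      (hH i j).const_mul _).const_mul _
  have hwv : ∀ᵐ t ∂ν, IsWeakDerivAlong (leftField v) (g t)
      (fun q => ∑ j, hcoord j w * G j t q) := by
    filter_upwards [ae_all_iff.2 hwG, hgl] with t ht htl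
    simpa only [hvw] using IsWeakDerivAlong.horizontal htl ht (v := v) rfl
  have hwvv : ∀ᵐ t ∂ν, IsWeakDerivAlong (leftField v) (fun q => ∑ j, hcoord j w * G j t q)
      (fun q => ∑ j, hcoord j w * ∑ i, hcoord i w * H i j t q) := by
    filter_upwards [ae_all_iff.2 fun i => ae_all_iff.2 (hwH i), ae_all_iff.2 hGl] with t ht htl
    refine IsWeakDerivAlong.sum_fun _ (by fun_prop) (fun j _ => ?_) _
    simpa only [hvw] using IsWeakDerivAlong.horizontal (htl j) (fun i => ht i j) (v := v) rfl
  have hsum : ∑ _j : Fin n ⊕ Fin n, ENNReal.ofReal ε = 2 * n * ENNReal.ofReal ε := by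
    simp only [Finset.sum_const, Finset.card_univ, Fintype.card_sum, Fintype.card_fin, nsmul_eq_mul]
    rw [two_mul]; push_cast; rfl
  -- oscillation of the second derivative along `v`
  have hosc : ∀ θ ∈ Ioc (0 : ℝ) 1, wInt ν f
      (fun t q => (∑ j, hcoord j w * ∑ i, hcoord i w * H i j t (q ⊙ (θ • v)))
        - ∑ j, hcoord j w * ∑ i, hcoord i w * H i j t q)
      ≤ (2 * n) ^ 2 * ENNReal.ofReal (ε ^ 2) * η := by
    intro θ hθ
    have e : (fun (t : ℝ) q => (∑ j, hcoord j w * ∑ i, hcoord i w * H i j t (q ⊙ (θ • v)))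
        - ∑ j, hcoord j w * ∑ i, hcoord i w * H i j t q)
        = fun (t : ℝ) q => ∑ j, hcoord j w * ∑ i, hcoord i w *
          (H i j t (q ⊙ (θ • v)) - H i j t q) := by
      funext t q
      simp only [mul_sub, Finset.sum_sub_distrib]
    rw [e]
    have hθb : θ • v ∈ heisBox n ε := by
      simpa using hbox θ hθ.1.le hθ.2 0 (by simpa using by positivity)
    refine (wInt_sum_le _ hf fun j _ => (Finset.measurable_sum _ fun i _ =>
      (measurable_translate_sub (hH i j) _).const_mul _).const_mul _).trans ?_
    calc ∑ j, wInt ν f (fun t q => hcoord j w * ∑ i, hcoord i w *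
          (H i j t (q ⊙ (θ • v)) - H i j t q))
        ≤ ∑ _j : Fin n ⊕ Fin n, ENNReal.ofReal ε *
            ∑ _i : Fin n ⊕ Fin n, ENNReal.ofReal ε * η := by
          refine Finset.sum_le_sum fun j _ => ?_
          rw [wInt_const_mul]
          refine mul_le_mul' (enorm_le_ofReal_of_abs_le (hw1 j)) ?_
          refine (wInt_sum_le _ hf fun i _ =>
            (measurable_translate_sub (hH i j) _).const_mul _).trans ?_
          refine Finset.sum_le_sum fun i _ => ?_
          rw [wInt_const_mul]
          exact mul_le_mul' (enorm_le_ofReal_of_abs_le (hw1 i)) (hηH i j _ hθb)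
      _ = (2 * n) ^ 2 * ENNReal.ofReal (ε ^ 2) * η := by
          rw [← Finset.sum_mul, ← Finset.sum_mul, hsum, ENNReal.ofReal_pow hε.le]; ring
  -- second order increment along `v`
  have second : wInt ν f (fun t q => g t (q ⊙ (0 : Heis n) ⊙ v) - g t (q ⊙ (0 : Heis n))
      - ((∑ j, hcoord j w * G j t q)
        + 1 / 2 * ∑ j, hcoord j w * ∑ i, hcoord i w * H i j t q))
      ≤ (2 * n) ^ 2 * ENNReal.ofReal (ε ^ 2) * η := by
    refine wInt_increment_le hf hg mGv mGv mHv hwv fun θ hθ => ?_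
    have hwvθ : ∀ᵐ t ∂ν, IsWeakDerivAlong (leftField (θ • v)) (fun q => ∑ j, hcoord j w * G j t q)
        (fun q => θ * ∑ j, hcoord j w * ∑ i, hcoord i w * H i j t q) :=
      hwvv.mono fun t ht => ht.smul_field θ
    have mθ : Measurable (Function.uncurry
        fun t q => θ * ∑ j, hcoord j w * ∑ i, hcoord i w * H i j t q) := mHv.const_mul θ
    -- The estimate is iterated: the first derivative along v is expanded in turn along the shorter
    -- segment θv. The two parameters multiply to θ'θ ∈ (0,1], where the oscillation of the second
    -- derivative is already bounded.
    have key := wInt_increment_le (ν := ν) (h := 0) (v := θ • v) (f := f) (b := fun _ _ => 0)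
      hf mGv mθ mθ measurable_const hwvθ (B := (2 * n) ^ 2 * ENNReal.ofReal (ε ^ 2) * η) ?_
    · refine le_trans (le_of_eq ?_) key
      congr 1; funext t q
      simp only [hmul_zero, mul_zero, add_zero]; ring
    intro θ' hθ'
    have h2 := hosc (θ' * θ) ⟨mul_pos hθ'.1 hθ.1, by nlinarith [hθ'.1, hθ'.2, hθ.1, hθ.2]⟩
    have e : (fun (t : ℝ) q =>
        θ * (∑ j, hcoord j w * ∑ i, hcoord i w * H i j t (q ⊙ 0 ⊙ (θ' • θ • v)))
          - (θ * (∑ j, hcoord j w * ∑ i, hcoord i w * H i j t q) + θ' * 0))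
        = fun (t : ℝ) q => θ *
          ((∑ j, hcoord j w * ∑ i, hcoord i w * H i j t (q ⊙ ((θ' * θ) • v)))
          - ∑ j, hcoord j w * ∑ i, hcoord i w * H i j t q) := by
      funext t q
      simp only [hmul_zero, smul_smul, mul_zero, add_zero, mul_sub]
    rw [e, wInt_const_mul]
    calc ‖θ‖ₑ * _ ≤ 1 * _ := mul_le_mul' (by
            rw [Real.enorm_of_nonneg hθ.1.le]; simpa using hθ.2) h2
      _ = _ := one_mul _
  -- vertical increment
  have vertical : wInt ν f (fun t q => g t (q ⊙ v ⊙ vert c) - g t (q ⊙ v)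
      - (c * S t q + 1 / 2 * (0 : ℝ))) ≤ ENNReal.ofReal (ε ^ 2) * η := by
    have hwc : ∀ᵐ t ∂ν, IsWeakDerivAlong (leftField (vert c)) (g t) (fun q => c * S t q) := by
      filter_upwards [hwS] with t ht
      have := ht.smul_field c
      rwa [← vert_smul, mul_one] at this
    have mcS : Measurable (Function.uncurry fun t q => c * S t q) := hS.const_mul c
    -- First order is enough in the central direction, whose displacement is already of size ε².
    refine wInt_increment_le (b := fun _ _ => 0) hf hg mcS mcS
      measurable_const hwc fun θ hθ => ?_
    have e : (fun (t : ℝ) q => c * S t (q ⊙ v ⊙ (θ • vert c)) - (c * S t q + θ * 0))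
        = fun (t : ℝ) q => c * (S t (q ⊙ (v ⊙ vert (θ * c))) - S t q) := by
      funext t q
      rw [hmul_assoc, ← vert_smul]; ring
    rw [e, wInt_const_mul]
    refine mul_le_mul' (enorm_le_ofReal_of_abs_le hw2) (hηS _ ?_)
    have := hbox 1 zero_le_one le_rfl (θ * c) (by
      rw [abs_mul, abs_of_pos hθ.1]; nlinarith [hθ.1, hθ.2, abs_nonneg c])
    simpa using this
  have m1 : Measurable (Function.uncurry fun t q => g t (q ⊙ (0 : Heis n) ⊙ v)
      - g t (q ⊙ (0 : Heis n)) - ((∑ j, hcoord j w * G j t q)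
        + 1 / 2 * ∑ j, hcoord j w * ∑ i, hcoord i w * H i j t q)) := by
    have e1 : Measurable fun z : ℝ × Heis n => g z.1 (z.2 ⊙ (0 : Heis n) ⊙ v) :=
      hg.comp_uncurry measurable_fst (by fun_prop)
    have e2 : Measurable fun z : ℝ × Heis n => g z.1 (z.2 ⊙ (0 : Heis n)) :=
      hg.comp_uncurry measurable_fst (by fun_prop)
    exact (e1.sub e2).sub (mGv.add (mHv.const_mul _))
  have e : (fun t q => g t (q ⊙ w) - g t q - ∑ j, hcoord j w * G j t q
        - 1 / 2 * ∑ j, hcoord j w * ∑ i, hcoord i w * H i j t q - c * S t q)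
      = fun (t : ℝ) q => (g t (q ⊙ (0 : Heis n) ⊙ v) - g t (q ⊙ (0 : Heis n))
        - ((∑ j, hcoord j w * G j t q)
          + 1 / 2 * ∑ j, hcoord j w * ∑ i, hcoord i w * H i j t q))
        + (g t (q ⊙ v ⊙ vert c) - g t (q ⊙ v) - (c * S t q + 1 / 2 * (0 : ℝ))) := by
    funext t q
    have q1 : q ⊙ v ⊙ vert c = q ⊙ w := by
      rw [hmul_assoc]; congr 1
      simp [hmul, vert, hv, hc, symplForm]
    rw [q1]
    simp only [hmul_zero]
    ring
  rw [e]
  refine ((wInt_add_le hf m1).trans (add_le_add second vertical)).trans (le_of_eq ?_)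
  ring

end taylor

/-! ### Integrals against translated kernels and integration by parts for left-invariant fields. -/

section commutator

variable {n : ℕ} {ν : Measure ℝ}

/-- Change of variables `p = q ⊙ w` in a triple integral. -/
lemma lintegral_lintegral_neg_hmul_source [SFinite ν] {Φ : (ℝ × Heis n) → Heis n → ℝ≥0∞}
    (hΦ : Measurable (Function.uncurry Φ)) :
    ∫⁻ z : ℝ × Heis n, (∫⁻ q, Φ (z.1, q) ((-q) ⊙ z.2)) ∂(ν.prod volume)
      = ∫⁻ w, (∫⁻ z, Φ z w ∂(ν.prod volume)) := by
  have m1 : Measurable fun y : (ℝ × Heis n) × Heis n => Φ (y.1.1, y.2) ((-y.2) ⊙ y.1.2) :=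
    hΦ.comp_uncurry (by fun_prop) (by fun_prop)
  rw [lintegral_prod _ (Measurable.aemeasurable (Measurable.lintegral_prod_right' m1))]
  have e1 : ∀ t, ∫⁻ p, ∫⁻ q, Φ (t, q) ((-q) ⊙ p) = ∫⁻ q, ∫⁻ w, Φ (t, q) w := by
    intro t
    rw [lintegral_lintegral_swap (Measurable.aemeasurable (by
      exact m1.comp (g := fun y : (ℝ × Heis n) × Heis n => Φ (y.1.1, y.2) ((-y.2) ⊙ y.1.2))
        (f := fun y : Heis n × Heis n => ((t, y.1), y.2)) (by fun_prop)))]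
    refine lintegral_congr fun q => ?_
    exact lintegral_hmul_left (fun w => Φ (t, q) w) (-q)
  simp only [e1]
  rw [← lintegral_lintegral_swap hΦ.aemeasurable]
  exact (lintegral_prod (fun z => ∫⁻ w, Φ z w) (Measurable.aemeasurable
    (Measurable.lintegral_prod_right' (f := Function.uncurry Φ) hΦ))).symm

/-- The counterpart with the weight at the target point p: for fixed p, the map q ↦ q⁻¹p preserves
the measure, and Tonelli does the rest. -/
lemma lintegral_lintegral_neg_hmul_target [SFinite ν] {Φ : (ℝ × Heis n) → Heis n → ℝ≥0∞}
    (hΦ : Measurable (Function.uncurry Φ)) :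
    ∫⁻ z : ℝ × Heis n, (∫⁻ q, Φ z ((-q) ⊙ z.2)) ∂(ν.prod volume)
      = ∫⁻ w, (∫⁻ z, Φ z w ∂(ν.prod volume)) := by
  simp only [lintegral_neg_hmul]
  exact lintegral_lintegral_swap hΦ.aemeasurable

/-- Mollification by a kernel `P` is controlled by the oscillation under translations. -/
lemma lintegral_mollify_sub_le [SFinite ν] {f g : ℝ → Heis n → ℝ} {P : Heis n → ℝ}
    (hf : Measurable (Function.uncurry f)) (hg : Measurable (Function.uncurry g))
    (hP : Measurable P) :
    ∫⁻ z : ℝ × Heis n, ‖f z.1 z.2‖ₑ * (∫⁻ q, ‖(g z.1 q - g z.1 z.2) * P ((-q) ⊙ z.2)‖ₑ) ∂(ν.prod volume)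
      ≤ ∫⁻ w, ‖P w‖ₑ * wInt ν f (fun t q => g t (q ⊙ (-w)) - g t q) := by
  have m1 : Measurable fun y : (ℝ × Heis n) × Heis n => f y.1.1 y.1.2 :=
    hf.comp_uncurry (by fun_prop) (by fun_prop)
  have m2 : Measurable fun y : (ℝ × Heis n) × Heis n => g y.1.1 y.1.2 :=
    hg.comp_uncurry (by fun_prop) (by fun_prop)
  have m3 : Measurable fun y : (ℝ × Heis n) × Heis n => g y.1.1 (y.1.2 ⊙ (-y.2)) :=
    hg.comp_uncurry (by fun_prop) (by fun_prop)
  have m4 : Measurable fun y : (ℝ × Heis n) × Heis n => P y.2 := hP.comp measurable_snd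
  have key := lintegral_lintegral_neg_hmul_target (ν := ν) (n := n)
    (Φ := fun z w => ‖P w‖ₑ * (‖f z.1 z.2‖ₑ * ‖g z.1 (z.2 ⊙ (-w)) - g z.1 z.2‖ₑ))
    (by unfold Function.uncurry; fun_prop)
  refine le_of_eq ?_
  calc _ = ∫⁻ z : ℝ × Heis n, (∫⁻ q, ‖P ((-q) ⊙ z.2)‖ₑ *
        (‖f z.1 z.2‖ₑ * ‖g z.1 (z.2 ⊙ (-((-q) ⊙ z.2))) - g z.1 z.2‖ₑ)) ∂(ν.prod volume) := by
        refine lintegral_congr fun z => ?_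
        rw [← lintegral_const_mul' _ _ (by simp)]
        refine lintegral_congr fun q => ?_
        rw [neg_hmul_rev, neg_neg, hmul_neg_cancel_left, enorm_mul]
        ring
    _ = _ := key
    _ = _ := by
        refine lintegral_congr fun w => ?_
        rw [lintegral_const_mul' _ _ (by simp)]
        rfl

/-- The bound on `N` is needed only where the kernel does not vanish, that is, at displacements
inside its support. -/
lemma lintegral_kernel_mul_le {P : Heis n → ℝ} {N : Heis n → ℝ≥0∞} {η : ℝ≥0∞}
    (hP : Measurable P) (h : ∀ w, P w ≠ 0 → N w ≤ η) :
    ∫⁻ w, ‖P w‖ₑ * N w ≤ (∫⁻ w, ‖P w‖ₑ) * η := by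
  rw [← lintegral_mul_const _ hP.enorm]
  refine lintegral_mono fun w => ?_
  by_cases hw : P w = 0
  · simp [hw]
  · exact mul_le_mul' le_rfl (h w hw)

/-- An integral `∫ R(t, q, p) dq` with kernel `R` split into a small part and mean-zero kernels. -/
lemma lintegral_enorm_integral_le [SFinite ν] {ι : Type*} [Fintype ι] {f χ : ℝ → Heis n → ℝ}
    {U : ℝ → Heis n → ℝ} {A : ι → ℝ → Heis n → ℝ} {P : ι → Heis n → ℝ} {R : (ℝ × Heis n) → Heis n → ℝ}
    {R1 : (ℝ × Heis n) → Heis n → ℝ}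
    (hχ : Measurable (Function.uncurry χ)) (hA : ∀ m, Measurable (Function.uncurry (A m)))
    (hP : ∀ m, Measurable (P m)) (hPi : ∀ m, Integrable (P m)) (hP0 : ∀ m, ∫ w, P m w = 0)
    (hR1 : Measurable (Function.uncurry R1)) (hU : Measurable (Function.uncurry U))
    (hf : Measurable (Function.uncurry f))
    (hR : ∀ z q, R z q = U z.1 q * R1 (z.1, q) ((-q) ⊙ z.2)
      + ∑ m, A m z.1 q * P m ((-q) ⊙ z.2))
    (hχf : ∀ t p q, R1 (t, q) ((-q) ⊙ p) ≠ 0 → ‖χ t p‖ₑ * ‖U t q‖ₑ ≤ ‖f t q‖ₑ) :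
    ∫⁻ z : ℝ × Heis n, ‖χ z.1 z.2‖ₑ * ‖∫ q, R z q‖ₑ ∂(ν.prod volume)
      ≤ (∫⁻ w, (∫⁻ z : ℝ × Heis n, ‖f z.1 z.2‖ₑ * ‖R1 z w‖ₑ ∂(ν.prod volume)))
        + ∑ m, ∫⁻ w, ‖P m w‖ₑ * wInt ν χ (fun t q => A m t (q ⊙ (-w)) - A m t q) := by
  have mχ : Measurable fun z : ℝ × Heis n => χ z.1 z.2 := hχ
  have mR1 : Measurable fun y : (ℝ × Heis n) × Heis n =>
      U y.1.1 y.2 * R1 (y.1.1, y.2) ((-y.2) ⊙ y.1.2) :=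
    (hU.comp_uncurry (by fun_prop) (by fun_prop)).mul
      (hR1.comp_uncurry (by fun_prop) (by fun_prop))
  have mχ' : Measurable fun y : (ℝ × Heis n) × Heis n => χ y.1.1 y.1.2 :=
    hχ.comp_uncurry (by fun_prop) (by fun_prop)
  have mf' : Measurable fun y : (ℝ × Heis n) × Heis n => f y.1.1 y.1.2 :=
    hf.comp_uncurry (by fun_prop) (by fun_prop)
  have mR1' : Measurable fun y : (ℝ × Heis n) × Heis n => R1 y.1 y.2 := hR1
  have mAP : ∀ m, Measurable fun y : (ℝ × Heis n) × Heis n =>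
      (A m y.1.1 y.2 - A m y.1.1 y.1.2) * P m ((-y.2) ⊙ y.1.2) := by
    intro m
    have e1 : Measurable fun y : (ℝ × Heis n) × Heis n => A m y.1.1 y.2 :=
      (hA m).comp_uncurry (by fun_prop) (by fun_prop)
    have e2 : Measurable fun y : (ℝ × Heis n) × Heis n => A m y.1.1 y.1.2 :=
      (hA m).comp_uncurry (by fun_prop) (by fun_prop)
    have e3 : Measurable fun y : (ℝ × Heis n) × Heis n => P m ((-y.2) ⊙ y.1.2) :=
      (hP m).comp (by fun_prop)
    exact (e1.sub e2).mul e3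
  have hpt : ∀ z : ℝ × Heis n, ‖∫ q, R z q‖ₑ ≤ (∫⁻ q, ‖U z.1 q * R1 (z.1, q) ((-q) ⊙ z.2)‖ₑ)
      + ∑ m, ∫⁻ q, ‖(A m z.1 q - A m z.1 z.2) * P m ((-q) ⊙ z.2)‖ₑ := by
    intro z
    by_cases hi : Integrable (R z)
    · have hPz : ∀ m, Integrable fun q => A m z.1 z.2 * P m ((-q) ⊙ z.2) := fun m =>
        ((measurePreserving_neg_hmul z.2).integrable_comp_of_integrable (hPi m)).const_mul _
      -- Because the kernels have mean zero, the values of the coefficients frozen at the target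
      -- point may be subtracted free of charge. This turns the coefficients into increments.
      have h0 : ∫ q, ∑ m, A m z.1 z.2 * P m ((-q) ⊙ z.2) = 0 := by
        rw [integral_finsetSum _ fun m _ => hPz m]
        refine Finset.sum_eq_zero fun m _ => ?_
        rw [integral_const_mul, integral_neg_hmul, hP0, mul_zero]
      have e : ∫ q, R z q = ∫ q, (U z.1 q * R1 (z.1, q) ((-q) ⊙ z.2)
          + ∑ m, (A m z.1 q - A m z.1 z.2) * P m ((-q) ⊙ z.2)) := by
        rw [← sub_zero (∫ q, R z q), ← h0, ← integral_sub hi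
          (integrable_finsetSum _ fun m _ => hPz m)]
        refine integral_congr_ae (ae_of_all _ fun q => ?_)
        simp only [hR, sub_mul, Finset.sum_sub_distrib]
        ring
      rw [e]
      refine (enorm_integral_le_lintegral_enorm _).trans ?_
      have mz : Measurable fun q => ‖U z.1 q * R1 (z.1, q) ((-q) ⊙ z.2)‖ₑ :=
        (mR1.comp (measurable_prodMk_left (x := z))).enorm
      have mz2 : ∀ m, Measurable fun q =>
          ‖(A m z.1 q - A m z.1 z.2) * P m ((-q) ⊙ z.2)‖ₑ := fun m =>
        ((mAP m).comp (measurable_prodMk_left (x := z))).enorm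
      rw [← lintegral_finsetSum _ fun m _ => mz2 m, ← lintegral_add_left mz]
      refine lintegral_mono fun q => (enorm_add_le _ _).trans ?_
      gcongr
      exact enorm_sum_le _ _
    -- If the integrand is not integrable, the Bochner integral is 0 by convention and the bound is
    -- trivial.
    · rw [integral_undef hi]; simp
  have m2 : ∀ m, Measurable fun z : ℝ × Heis n => ‖χ z.1 z.2‖ₑ *
      ∫⁻ q, ‖(A m z.1 q - A m z.1 z.2) * P m ((-q) ⊙ z.2)‖ₑ := fun m =>
    mχ.enorm.mul (Measurable.lintegral_prod_right' (f := fun y : (ℝ × Heis n) × Heis n =>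
      ‖(A m y.1.1 y.2 - A m y.1.1 y.1.2) * P m ((-y.2) ⊙ y.1.2)‖ₑ) (mAP m).enorm)
  calc _ ≤ ∫⁻ z : ℝ × Heis n, ((∫⁻ q, ‖f z.1 q‖ₑ * ‖R1 (z.1, q) ((-q) ⊙ z.2)‖ₑ)
        + ∑ m, ‖χ z.1 z.2‖ₑ * ∫⁻ q, ‖(A m z.1 q - A m z.1 z.2) * P m ((-q) ⊙ z.2)‖ₑ)
        ∂(ν.prod volume) := by
        refine lintegral_mono fun z => ?_
        refine (mul_le_mul' le_rfl (hpt z)).trans ?_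
        rw [mul_add, Finset.mul_sum, ← lintegral_const_mul' _ _ (by simp)]
        refine add_le_add (lintegral_mono fun q => ?_) le_rfl
        by_cases h0 : R1 (z.1, q) ((-q) ⊙ z.2) = 0
        · simp [h0]
        · simp only [enorm_mul]
          rw [← mul_assoc]
          exact mul_le_mul' (hχf z.1 z.2 q h0) le_rfl
    _ = ∫⁻ z : ℝ × Heis n, (∫⁻ q, ‖f z.1 q‖ₑ * ‖R1 (z.1, q) ((-q) ⊙ z.2)‖ₑ) ∂(ν.prod volume)
        + ∑ m, ∫⁻ z : ℝ × Heis n, ‖χ z.1 z.2‖ₑ *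
          (∫⁻ q, ‖(A m z.1 q - A m z.1 z.2) * P m ((-q) ⊙ z.2)‖ₑ) ∂(ν.prod volume) := by
        rw [lintegral_add_right _ (Finset.measurable_sum _ fun m _ => m2 m),
          lintegral_finsetSum _ fun m _ => m2 m]
    _ ≤ _ := by
        refine add_le_add (le_of_eq ?_)
          (Finset.sum_le_sum fun m _ => lintegral_mollify_sub_le (ν := ν) hχ (hA m) (hP m))
        exact lintegral_lintegral_neg_hmul_source
          (Φ := fun z w => ‖f z.1 z.2‖ₑ * ‖R1 z w‖ₑ) (by unfold Function.uncurry; fun_prop)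

/-- The integral of a left-invariant derivative of a test function vanishes. -/
lemma integral_leftDeriv_eq_zero {F : Heis n → ℝ} (hF : ContDiff ℝ ∞ F) (hc : HasCompactSupport F)
    (v : Heis n) : ∫ p, fderiv ℝ F p (leftField v p) = 0 := by
  have hFd : Differentiable ℝ F := hF.differentiable (by simp)
  have hcf : Continuous (fderiv ℝ F) := hF.continuous_fderiv (by simp)
  set L : Heis n → ℝ := fun p => symplForm p v with hL
  have hLs : ContDiff ℝ ∞ L := contDiff_symplForm.comp (contDiff_id.prodMk contDiff_const)
  have hLd : Differentiable ℝ L := hLs.differentiable (by simp)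
  have i1 : ∀ w : Heis n, Integrable fun p => fderiv ℝ F p w := fun w =>
    (hcf.clm_apply continuous_const).integrable_of_hasCompactSupport
      (hasCompactSupport_fderiv_apply hc fun _ => w)
  have i2 : Integrable fun p => L p * fderiv ℝ F p (vert 1) :=
    (hLs.continuous.mul (hcf.clm_apply continuous_const)).integrable_of_hasCompactSupport
      ((hasCompactSupport_fderiv_apply hc fun _ => vert 1).mul_left)
  -- The T-coefficient ω(p, v) of the field does not depend on t, so the field is divergence free.
  have hz : ∀ p, fderiv ℝ L p (vert 1) = 0 := by
    intro p
    have h1 : HasDerivAt (fun θ : ℝ => L (p + θ • vert 1)) (fderiv ℝ L p (vert 1)) 0 := by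
      have h4 : HasDerivAt (fun θ : ℝ => p + θ • (vert 1 : Heis n)) (vert 1) 0 := by
        simpa using ((hasDerivAt_id (0 : ℝ)).smul_const (vert 1 : Heis n)).const_add p
      have := (hLd (p + (0 : ℝ) • vert 1)).hasFDerivAt.comp_hasDerivAt (0 : ℝ) h4
      simpa [Function.comp_def] using this
    have h2 : (fun θ : ℝ => L (p + θ • vert 1)) = fun _ => L p := by
      funext θ; simp [hL, symplForm_add_left, symplForm_smul_left]
    rw [h2] at h1
    exact h1.unique (hasDerivAt_const _ _)
  have z1 : ∫ p, fderiv ℝ F p v = 0 := by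
    have := integral_mul_fderiv_eq_neg_fderiv_mul_of_integrable (μ := (volume : Measure (Heis n)))
      (f := fun _ => (1 : ℝ)) (g := F) (v := v) (by simp)
      (by simpa using i1 v) (by simpa using hF.continuous.integrable_of_hasCompactSupport hc)
      (fun _ _ => by fun_prop) (fun x _ => hFd x)
    simpa using this
  have z2 : ∫ p, L p * fderiv ℝ F p (vert 1) = 0 := by
    rw [integral_mul_fderiv_eq_neg_fderiv_mul_of_integrable (μ := (volume : Measure (Heis n)))
      (by simp [hz]) i2 ((hLs.continuous.mul hF.continuous).integrable_of_hasCompactSupport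
        hc.mul_left) (fun x _ => hLd x) (fun x _ => hFd x)]
    simp [hz]
  have e : (fun p => fderiv ℝ F p (leftField v p))
      = fun p => fderiv ℝ F p v + L p * fderiv ℝ F p (vert 1) := by
    funext p
    have : leftField v p = v + L p • vert 1 := by rw [← vert_smul, mul_one]; rfl
    rw [this, map_add, map_smul, smul_eq_mul]
  rw [e, integral_add (i1 v) i2, z1, z2, add_zero]

lemma integral_mul_leftDeriv {L κ : Heis n → ℝ} (hL : ContDiff ℝ ∞ L) (hκ : ContDiff ℝ ∞ κ)
    (hc : HasCompactSupport κ) (v : Heis n) :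
    ∫ p, L p * fderiv ℝ κ p (leftField v p) = -∫ p, fderiv ℝ L p (leftField v p) * κ p := by
  have h0 := integral_leftDeriv_eq_zero (hL.mul hκ) hc.mul_left v
  have i1 : Integrable fun p => L p * fderiv ℝ κ p (leftField v p) :=
    (hL.continuous.mul ((hκ.continuous_fderiv (by simp)).clm_apply
      (by fun_prop))).integrable_of_hasCompactSupport
      (hasCompactSupport_fderiv_apply hc _).mul_left
  have i2 : Integrable fun p => fderiv ℝ L p (leftField v p) * κ p :=
    (((hL.continuous_fderiv (by simp)).clm_apply (by fun_prop)).mul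
      hκ.continuous).integrable_of_hasCompactSupport hc.mul_left
  have e : (fun p => fderiv ℝ (fun x => L x * κ x) p (leftField v p))
      = fun p => L p * fderiv ℝ κ p (leftField v p) + fderiv ℝ L p (leftField v p) * κ p := by
    funext p
    rw [fderiv_fun_mul (hL.differentiable (by simp) p) (hκ.differentiable (by simp) p)]
    simp [mul_comm]
  rw [e, integral_add i1 i2] at h0
  linarith

/-- The horizontal coordinates, as linear forms. -/
def hcoordL (j : Fin n ⊕ Fin n) : Heis n →L[ℝ] ℝ :=
  Sum.elim (fun k => (ContinuousLinearMap.proj k).comp (ContinuousLinearMap.fst ℝ _ _))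
    (fun k => (ContinuousLinearMap.proj k).comp
      ((ContinuousLinearMap.fst ℝ _ _).comp (ContinuousLinearMap.snd ℝ _ _))) j

lemma hcoordL_apply (j : Fin n ⊕ Fin n) (p : Heis n) : hcoordL j p = hcoord j p := by
  rcases j with j | j <;> rfl

lemma fderiv_hcoord (j : Fin n ⊕ Fin n) (p v : Heis n) :
    fderiv ℝ (hcoord j) p v = hcoord j v := by
  have : (hcoord j : Heis n → ℝ) = hcoordL j := by funext p; exact (hcoordL_apply j p).symm
  rw [this, ContinuousLinearMap.fderiv]

lemma contDiff_hcoord (j : Fin n ⊕ Fin n) : ContDiff ℝ ∞ (hcoord j : Heis n → ℝ) := by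
  have : (hcoord j : Heis n → ℝ) = hcoordL j := by funext p; exact (hcoordL_apply j p).symm
  rw [this]; exact (hcoordL j).contDiff

lemma hcoord_leftField_hbasis (i j : Fin n ⊕ Fin n) (p : Heis n) :
    hcoord i (leftField (hbasis j) p) = if i = j then 1 else 0 := by
  rcases i with i | i <;> rcases j with j | j <;>
    simp [hcoord, leftField, hbasis, vert, Pi.single_apply]

lemma hcoord_vert (j : Fin n ⊕ Fin n) (c : ℝ) : hcoord j (vert c : Heis n) = 0 := by
  rcases j with j | j <;> simp [hcoord, vert]

lemma hcoord_neg (j : Fin n ⊕ Fin n) (p : Heis n) : hcoord j (-p) = -hcoord j p := by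
  rcases j with j | j <;> simp [hcoord]

lemma neg_mem_heisBox {ε : ℝ} {w : Heis n} (hw : w ∈ heisBox n ε) : -w ∈ heisBox n ε :=
  ⟨fun j => by rw [hcoord_neg, abs_neg]; exact hw.1 j, by simpa using hw.2⟩

end commutator

/-! ### The commutator kernel of a contact field and the commutator estimate. -/

section contact

variable {n : ℕ} {ν : Measure ℝ}

/-- The sign in the pairing of `X_j` with `Y_j`. -/
def contactSign {n : ℕ} : Fin n ⊕ Fin n → ℝ := Sum.elim (fun _ => 1) (fun _ => -1)

/-- The components, in the left-invariant frame, of the contact field generated by `ψ`, with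
horizontal gradient `G`. -/
def contactVec {n : ℕ} (ψ : Heis n → ℝ) (G : Fin n ⊕ Fin n → Heis n → ℝ) (q : Heis n) : Heis n :=
  (fun k => G (Sum.inr k) q, fun k => -G (Sum.inl k) q, -(4 * ψ q))

lemma hcoord_contactVec (ψ : Heis n → ℝ) (G : Fin n ⊕ Fin n → Heis n → ℝ) (j : Fin n ⊕ Fin n)
    (q : Heis n) : hcoord j (contactVec ψ G q) = contactSign j * G j.swap q := by
  rcases j with j | j <;> simp [hcoord, contactVec, contactSign]

/-- The divergence of the contact field, from the second derivatives of the generating function. -/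
def contactDiv {n : ℕ} (H : Fin n ⊕ Fin n → Fin n ⊕ Fin n → Heis n → ℝ) (S : Heis n → ℝ)
    (q : Heis n) : ℝ := ∑ i, contactSign i * H i i.swap q - 4 * S q

/-- The kernels multiplying the horizontal second derivatives in the commutator. -/
def kernelH {n : ℕ} (κ : Heis n → ℝ) (i j : Fin n ⊕ Fin n) (w : Heis n) : ℝ :=
  contactSign j.swap * hcoord i w * fderiv ℝ κ w (leftField (hbasis j.swap) w)
    - 2 * (hcoord i w * hcoord j w) * fderiv ℝ κ w (vert 1)
    + (if j = i.swap then contactSign i else 0) * κ w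

/-- The kernel multiplying the vertical derivative in the commutator. -/
def kernelS {n : ℕ} (κ : Heis n → ℝ) (w : Heis n) : ℝ :=
  -4 * (w.2.2 * fderiv ℝ κ w (vert 1)) - 4 * κ w

/-- The commutator kernel. -/
def commutatorKernel {n : ℕ} (κ ψ : Heis n → ℝ) (G : Fin n ⊕ Fin n → Heis n → ℝ)
    (D : Heis n → ℝ) (q p : Heis n) : ℝ :=
  fderiv ℝ κ ((-q) ⊙ p) (leftField (contactVec ψ G p) ((-q) ⊙ p))
    - fderiv ℝ κ ((-q) ⊙ p) (rightField (contactVec ψ G q) ((-q) ⊙ p)) + D q * κ ((-q) ⊙ p)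

lemma leftField_eq_sum (a w : Heis n) :
    leftField a w = ∑ j, hcoord j a • leftField (hbasis j) w + a.2.2 • vert 1 := by
  conv_lhs => rw [← sum_hcoord_smul_hbasis a]
  rw [leftField_add]
  congr 1
  · have : ∀ s : Finset (Fin n ⊕ Fin n), leftField (∑ j ∈ s, hcoord j a • hbasis j) w
        = ∑ j ∈ s, hcoord j a • leftField (hbasis j) w := by
      classical
      intro s
      induction s using Finset.induction_on with
      | empty => simp [leftField]
      | insert i s hi ih => rw [Finset.sum_insert hi, Finset.sum_insert hi, leftField_add,
          leftField_smul, ih]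
    exact this _
  · rw [← vert_smul, mul_one]
    simp [leftField]

lemma clm_leftField (L : Heis n →L[ℝ] ℝ) (a w : Heis n) :
    L (leftField a w) = ∑ j, hcoord j a * L (leftField (hbasis j) w) + a.2.2 * L (vert 1) := by
  rw [leftField_eq_sum]
  simp

/-- Left and right fields with the same value at the origin differ by a central term, twice the
symplectic form. In the commutator it is this term that completes the increment of ψ to a Taylor
remainder. -/
lemma leftField_sub_rightField (a a' w : Heis n) :
    leftField a w - rightField a' w = leftField (a - a') w + vert (2 * symplForm w a') := by
  have h1 : symplForm w (a - a') = symplForm w a - symplForm w a' := by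
    rw [sub_eq_add_neg, symplForm_add_right, symplForm_neg_right, sub_eq_add_neg]
  have h2 : symplForm a' w = -symplForm w a' := symplForm_swap _ _
  have h3 : (vert (2 * symplForm w a') : Heis n) = vert (symplForm w a') + vert (symplForm w a') := by
    rw [← vert_add, two_mul]
  have h4 : ∀ c d : ℝ, (vert (c - d) : Heis n) = vert c - vert d := fun c d => by simp [vert]
  have h5 : ∀ c : ℝ, (vert (-c) : Heis n) = -vert c := fun c => by simp [vert]
  simp only [leftField, rightField, h1, h2, h3, h4, h5]
  abel

/-- The horizontal part of a contact field is the symplectic gradient of ψ, so pairing it with w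
through ω returns the horizontal derivative of ψ in the direction w. This fails for a general field,
and it is where the contact structure is used. -/
lemma symplForm_contactVec (ψ : Heis n → ℝ) (G : Fin n ⊕ Fin n → Heis n → ℝ) (w q : Heis n) :
    symplForm w (contactVec ψ G q) = 2 * ∑ j, hcoord j w * G j q := by
  rw [Fintype.sum_sum_type, ← Finset.sum_add_distrib]
  simp only [symplForm, contactVec, hcoord, Sum.elim_inl, Sum.elim_inr]
  congr 1
  exact Finset.sum_congr rfl fun j _ => by ring

lemma sum_swap_comm {M : Type*} [AddCommMonoid M] (f : Fin n ⊕ Fin n → M) :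
    ∑ j : Fin n ⊕ Fin n, f j.swap = ∑ j, f j :=
  Equiv.sum_comp (Equiv.sumComm (Fin n) (Fin n)) f

/-- The pointwise decomposition of the commutator kernel. -/
lemma commutatorKernel_eq (κ ψ : Heis n → ℝ) (G : Fin n ⊕ Fin n → Heis n → ℝ)
    (H : Fin n ⊕ Fin n → Fin n ⊕ Fin n → Heis n → ℝ) (S : Heis n → ℝ) (q w : Heis n) :
    commutatorKernel κ ψ G (contactDiv H S) q (q ⊙ w)
      = (∑ j, contactSign j.swap * (G j (q ⊙ w) - G j q - ∑ i, hcoord i w * H i j q)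
          * fderiv ℝ κ w (leftField (hbasis j.swap) w)
        - 4 * (ψ (q ⊙ w) - ψ q - ∑ j, hcoord j w * G j q
          - 1 / 2 * ∑ j, hcoord j w * ∑ i, hcoord i w * H i j q - w.2.2 * S q)
          * fderiv ℝ κ w (vert 1))
        + (∑ i, ∑ j, H i j q * kernelH κ i j w + S q * kernelS κ w) := by
  -- The central component gives −4(ψ(qw) − ψ(q)) and the left/right mismatch gives 4 ∑ w_j G_j(q).
  -- They combine into −4 times a first-order remainder multiplying Tκ.
  have h0 : commutatorKernel κ ψ G (contactDiv H S) q (q ⊙ w)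
      = ∑ j, contactSign j.swap * (G j (q ⊙ w) - G j q) * fderiv ℝ κ w (leftField (hbasis j.swap) w)
        - 4 * (ψ (q ⊙ w) - ψ q - ∑ j, hcoord j w * G j q) * fderiv ℝ κ w (vert 1)
        + contactDiv H S q * κ w := by
    rw [commutatorKernel, neg_hmul_cancel_left, ← map_sub, leftField_sub_rightField, map_add,
      clm_leftField, symplForm_contactVec]
    have e1 : ∀ j, hcoord j (contactVec ψ G (q ⊙ w) - contactVec ψ G q)
        = contactSign j * (G j.swap (q ⊙ w) - G j.swap q) := by
      intro j
      rw [mul_sub, ← hcoord_contactVec ψ, ← hcoord_contactVec ψ]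
      rcases j with j | j <;> simp [hcoord]
    have e2 : (contactVec ψ G (q ⊙ w) - contactVec ψ G q).2.2 = -4 * (ψ (q ⊙ w) - ψ q) := by
      simp only [contactVec, Prod.snd_sub]; ring
    have e3 : ∀ c : ℝ, (vert c : Heis n) = c • vert 1 := fun c => by rw [← vert_smul, mul_one]
    simp only [e1, e2]
    rw [e3 (2 * (2 * ∑ j, hcoord j w * G j q)), map_smul, smul_eq_mul, ← sum_swap_comm fun j => contactSign j.swap *
      (G j (q ⊙ w) - G j q) * fderiv ℝ κ w (leftField (hbasis j.swap) w)]
    simp only [Sum.swap_swap]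
    ring
  -- The Taylor polynomials that were subtracted, together with the divergence, are regrouped
  -- according to the coefficient H_ij(q). The coefficient −2 is −4 times the Taylor factor 1/2.
  have h1 : ∑ i, ∑ j, H i j q * kernelH κ i j w
      = (∑ j, contactSign j.swap * (∑ i, hcoord i w * H i j q)
          * fderiv ℝ κ w (leftField (hbasis j.swap) w))
        - 2 * (∑ j, hcoord j w * ∑ i, hcoord i w * H i j q) * fderiv ℝ κ w (vert 1)
        + (∑ i, contactSign i * H i i.swap q) * κ w := by
    have f1 : ∀ i, ∑ j, H i j q * ((if j = i.swap then contactSign i else 0) * κ w)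
        = contactSign i * H i i.swap q * κ w := by
      intro i
      rw [Finset.sum_eq_single i.swap]
      · simp; ring
      · intro b _ hb; simp [hb]
      · simp
    have f2 : ∑ i, ∑ j, H i j q * (contactSign j.swap * hcoord i w *
          fderiv ℝ κ w (leftField (hbasis j.swap) w))
        = ∑ j, contactSign j.swap * (∑ i, hcoord i w * H i j q)
          * fderiv ℝ κ w (leftField (hbasis j.swap) w) := by
      rw [Finset.sum_comm]
      refine Finset.sum_congr rfl fun j _ => ?_
      rw [Finset.mul_sum, Finset.sum_mul]
      exact Finset.sum_congr rfl fun i _ => by ring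
    have f3 : ∑ i, ∑ j, H i j q * (2 * (hcoord i w * hcoord j w) * fderiv ℝ κ w (vert 1))
        = 2 * (∑ j, hcoord j w * ∑ i, hcoord i w * H i j q) * fderiv ℝ κ w (vert 1) := by
      rw [Finset.sum_comm, Finset.mul_sum, Finset.sum_mul]
      refine Finset.sum_congr rfl fun j _ => ?_
      rw [Finset.mul_sum, Finset.mul_sum, Finset.sum_mul]
      exact Finset.sum_congr rfl fun i _ => by ring
    simp only [kernelH, mul_add, mul_sub, Finset.sum_add_distrib, Finset.sum_sub_distrib]
    rw [f2, f3]
    simp only [f1, Finset.sum_mul]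
  rw [h0, h1, kernelS, contactDiv]
  simp only [mul_sub, sub_mul, Finset.sum_sub_distrib]
  ring

/-! ### Vanishing means of the residual kernels. -/

section kernels

variable {κ : Heis n → ℝ}

lemma integrable_mul_leftDeriv (hκ : ContDiff ℝ ∞ κ) (hc : HasCompactSupport κ) {L : Heis n → ℝ}
    (hL : Continuous L) (v : Heis n) :
    Integrable fun w => L w * fderiv ℝ κ w (leftField v w) :=
  (hL.mul ((hκ.continuous_fderiv (by simp)).clm_apply
    (by fun_prop))).integrable_of_hasCompactSupport (hasCompactSupport_fderiv_apply hc _).mul_left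

/-- Integration by parts: T annihilates the horizontal coordinates, so the middle term has mean
zero. The field Z_{j.swap} applied to w_i is 1 or 0 according to whether i = j.swap, and the
resulting multiple of ∫ κ is cancelled by the term coming from the divergence. -/
lemma integral_kernelH (hκ : ContDiff ℝ ∞ κ) (hc : HasCompactSupport κ) (i j : Fin n ⊕ Fin n) :
    Integrable (kernelH κ i j) ∧ (∫ w, κ w = 1 → ∫ w, kernelH κ i j w = 0) := by
  have hci := (contDiff_hcoord (n := n) i)
  have hcj := (contDiff_hcoord (n := n) j)
  have i1 := integrable_mul_leftDeriv hκ hc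
    (contDiff_const (c := contactSign j.swap) |>.mul hci).continuous (hbasis j.swap)
  have i2 := integrable_mul_leftDeriv hκ hc
    (contDiff_const (c := (2 : ℝ)) |>.mul (hci.mul hcj)).continuous (vert 1)
  have i3 : Integrable fun w => (if j = i.swap then contactSign i else 0) * κ w :=
    (hκ.continuous.integrable_of_hasCompactSupport hc).const_mul _
  simp only [leftField_vert_one] at i2
  refine ⟨(i1.sub i2).add i3, fun h1 => ?_⟩
  have e1 := integral_mul_leftDeriv (contDiff_const (c := contactSign j.swap) |>.mul hci) hκ hc
    (hbasis j.swap)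
  have e2 := integral_mul_leftDeriv (contDiff_const (c := (2 : ℝ)) |>.mul (hci.mul hcj)) hκ hc
    (vert 1)
  have d1 : ∀ w, fderiv ℝ (fun w => contactSign j.swap * hcoord i w) w
      (leftField (hbasis j.swap) w) = if j = i.swap then contactSign j.swap else 0 := by
    intro w
    rw [fderiv_const_mul (hci.differentiable (by simp) w)]
    simp only [smul_apply, fderiv_hcoord, hcoord_leftField_hbasis, smul_eq_mul]
    have : i = j.swap ↔ j = i.swap := by
      constructor <;> (intro h; rw [h, Sum.swap_swap])
    simp [this]
  have d2 : ∀ w, fderiv ℝ (fun w => 2 * (hcoord i w * hcoord j w)) w (leftField (vert 1) w) = 0 := by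
    intro w
    rw [fderiv_const_mul ((hci.mul hcj).differentiable (by simp) w),
      fderiv_fun_mul (hci.differentiable (by simp) w) (hcj.differentiable (by simp) w)]
    simp [fderiv_hcoord, hcoord_vert, leftField_vert_one]
  simp only [leftField_vert_one] at e2
  simp only [leftField_vert_one] at d2
  simp only [d1, integral_const_mul, h1] at e1
  simp only [d2, zero_mul, integral_zero, neg_zero] at e2
  have : ∫ w, kernelH κ i j w = ∫ w, ((contactSign j.swap * hcoord i w *
      fderiv ℝ κ w (leftField (hbasis j.swap) w)
    - 2 * (hcoord i w * hcoord j w) * fderiv ℝ κ w (vert 1))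
    + (if j = i.swap then contactSign i else 0) * κ w) := rfl
  have i12 : Integrable fun w => contactSign j.swap * hcoord i w *
      fderiv ℝ κ w (leftField (hbasis j.swap) w)
      - 2 * (hcoord i w * hcoord j w) * fderiv ℝ κ w (vert 1) := i1.sub i2
  rw [this, integral_add i12 i3, integral_sub i1 i2, e1, e2, integral_const_mul, h1]
  by_cases h : j = i.swap
  · subst h; simp
  · simp [h]

/-- Since T applied to the central coordinate is 1, the first term integrates to +4 ∫ κ, which the
divergence term −4κ cancels. -/
lemma integral_kernelS (hκ : ContDiff ℝ ∞ κ) (hc : HasCompactSupport κ) :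
    Integrable (kernelS κ) ∧ (∫ w, κ w = 1 → ∫ w, kernelS κ w = 0) := by
  have hL : ContDiff ℝ ∞ fun w : Heis n => w.2.2 := by fun_prop
  have i1 := integrable_mul_leftDeriv hκ hc hL.continuous (vert 1)
  simp only [leftField_vert_one] at i1
  have i3 : Integrable fun w => 4 * κ w :=
    (hκ.continuous.integrable_of_hasCompactSupport hc).const_mul _
  refine ⟨(i1.const_mul (-4)).sub i3, fun h1 => ?_⟩
  have e1 := integral_mul_leftDeriv hL hκ hc (vert 1)
  have d1 : ∀ w : Heis n, fderiv ℝ (fun w : Heis n => w.2.2) w (vert 1) = 1 := by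
    intro w
    have : (fun w : Heis n => w.2.2) = ⇑((ContinuousLinearMap.snd ℝ (Fin n → ℝ) ℝ).comp
      (ContinuousLinearMap.snd ℝ (Fin n → ℝ) ((Fin n → ℝ) × ℝ))) := rfl
    rw [this, ContinuousLinearMap.fderiv]
    simp [vert]
  simp only [leftField_vert_one, d1, one_mul, h1] at e1
  have : ∫ w, kernelS κ w = ∫ w, (-4 * (w.2.2 * fderiv ℝ κ w (vert 1)) - 4 * κ w) := rfl
  rw [this, integral_sub (i1.const_mul _) i3, integral_const_mul, integral_const_mul, e1, h1]
  ring

end kernels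

lemma enorm_contactSign (j : Fin n ⊕ Fin n) : ‖contactSign j‖ₑ = 1 := by
  rcases j with j | j <;> simp [contactSign]

lemma AdaptedKernel.mem_heisBox {C : ℝ≥0∞} {ε : ℝ} {κ : Heis n → ℝ} (hκ : AdaptedKernel C ε κ)
    {w : Heis n} (hw : w ∈ tsupport κ) : w ∈ heisBox n ε :=
  ⟨hκ.hcoord_le w hw, hκ.vert_le w hw⟩

lemma fderiv_eq_zero_of_notMem_tsupport {κ : Heis n → ℝ} {w : Heis n} (hw : w ∉ tsupport κ) :
    fderiv ℝ κ w = 0 :=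
  image_eq_zero_of_notMem_tsupport fun h => hw (tsupport_fderiv_subset ℝ h)

/-- Each monomial has the homogeneity that compensates the derivative beside it: w_i ~ ε against Zκ
~ ε⁻¹ and w_i w_j ~ ε² against Tκ ~ ε⁻². The three terms contribute C, 2C and C. -/
lemma AdaptedKernel.lintegral_kernelH_le {C : ℝ≥0∞} {ε : ℝ} (hε : 0 < ε) {κ : Heis n → ℝ}
    (hκ : AdaptedKernel C ε κ) (i j : Fin n ⊕ Fin n) : ∫⁻ w, ‖kernelH κ i j w‖ₑ ≤ 4 * C := by
  have hfd := hκ.contDiff.continuous_fderiv (by simp)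
  have m1 : Measurable fun w => ‖fderiv ℝ κ w (leftField (hbasis j.swap) w)‖ₑ :=
    (hfd.clm_apply (by fun_prop)).measurable.enorm
  have m2 : Measurable fun w => ‖fderiv ℝ κ w (vert 1)‖ₑ :=
    (hfd.clm_apply continuous_const).measurable.enorm
  calc ∫⁻ w, ‖kernelH κ i j w‖ₑ
      ≤ ∫⁻ w, (ENNReal.ofReal ε * ‖fderiv ℝ κ w (leftField (hbasis j.swap) w)‖ₑ
        + 2 * (ENNReal.ofReal (ε ^ 2) * ‖fderiv ℝ κ w (vert 1)‖ₑ) + ‖κ w‖ₑ) := by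
        refine lintegral_mono fun w => ?_
        by_cases hw : w ∈ tsupport κ
        · have h1 := hκ.hcoord_le w hw
          refine (enorm_add_le _ _).trans (add_le_add (enorm_sub_le.trans (add_le_add ?_ ?_)) ?_)
          · rw [enorm_mul, enorm_mul, enorm_contactSign, one_mul]
            exact mul_le_mul' (enorm_le_ofReal_of_abs_le (h1 i)) le_rfl
          · rw [enorm_mul, enorm_mul, mul_assoc]
            refine mul_le_mul' (by simp [enorm_eq_nnnorm]) (mul_le_mul' ?_ le_rfl)
            refine enorm_le_ofReal_of_abs_le ?_
            rw [abs_mul, sq]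
            exact mul_le_mul (h1 i) (h1 j) (abs_nonneg _) hε.le
          · rw [enorm_mul]
            refine (mul_le_mul' (b := 1) ?_ le_rfl).trans_eq (one_mul _)
            split_ifs
            · rw [enorm_contactSign]
            · simp
        · simp [kernelH, fderiv_eq_zero_of_notMem_tsupport hw,
            image_eq_zero_of_notMem_tsupport hw]
    _ = ENNReal.ofReal ε * (∫⁻ w, ‖fderiv ℝ κ w (leftField (hbasis j.swap) w)‖ₑ)
        + 2 * (ENNReal.ofReal (ε ^ 2) * ∫⁻ w, ‖fderiv ℝ κ w (vert 1)‖ₑ) + ∫⁻ w, ‖κ w‖ₑ := by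
        rw [lintegral_add_left (by fun_prop), lintegral_add_left (by fun_prop),
          lintegral_const_mul _ m1, lintegral_const_mul _ (by fun_prop), lintegral_const_mul _ m2]
    _ ≤ C + 2 * C + C := by
        gcongr
        · exact hκ.lintegral_left_le _
        · exact hκ.lintegral_vert_le
        · exact hκ.lintegral_le
    _ = 4 * C := by ring

lemma AdaptedKernel.lintegral_kernelS_le {C : ℝ≥0∞} {ε : ℝ} {κ : Heis n → ℝ}
    (hκ : AdaptedKernel C ε κ) : ∫⁻ w, ‖kernelS κ w‖ₑ ≤ 8 * C := by
  have hfd := hκ.contDiff.continuous_fderiv (by simp)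
  have m2 : Measurable fun w => ‖fderiv ℝ κ w (vert 1)‖ₑ :=
    (hfd.clm_apply continuous_const).measurable.enorm
  have m3 : Measurable fun w => ‖κ w‖ₑ := hκ.contDiff.continuous.measurable.enorm
  calc ∫⁻ w, ‖kernelS κ w‖ₑ
      ≤ ∫⁻ w, (4 * (ENNReal.ofReal (ε ^ 2) * ‖fderiv ℝ κ w (vert 1)‖ₑ) + 4 * ‖κ w‖ₑ) := by
        refine lintegral_mono fun w => ?_
        by_cases hw : w ∈ tsupport κ
        · refine enorm_sub_le.trans (add_le_add ?_ ?_)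
          · rw [enorm_mul, enorm_mul]
            refine mul_le_mul' (by simp [enorm_eq_nnnorm]) (mul_le_mul' ?_ le_rfl)
            exact enorm_le_ofReal_of_abs_le (hκ.vert_le w hw)
          · rw [enorm_mul]
            exact mul_le_mul' (by simp [enorm_eq_nnnorm]) le_rfl
        · simp [kernelS, fderiv_eq_zero_of_notMem_tsupport hw,
            image_eq_zero_of_notMem_tsupport hw]
    _ = 4 * (ENNReal.ofReal (ε ^ 2) * ∫⁻ w, ‖fderiv ℝ κ w (vert 1)‖ₑ) + 4 * ∫⁻ w, ‖κ w‖ₑ := by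
        rw [lintegral_add_left (by fun_prop),
          lintegral_const_mul _ (by fun_prop), lintegral_const_mul _ m2, lintegral_const_mul _ m3]
    _ ≤ 4 * C + 4 * C := by
        gcongr
        · exact hκ.lintegral_vert_le
        · exact hκ.lintegral_le
    _ = 8 * C := by ring

/-- The constant in the commutator estimate. -/
def commutatorConst (n : ℕ) (C : ℝ≥0∞) : ℝ≥0∞ :=
  (2 * n * (2 * n + 4) + 4 * ((2 * n) ^ 2 + 1) + (2 * n) ^ 2 * 4 + 8) * C

/-- The commutator estimate: the commutator of the contact field with a group mollification is
controlled by oscillations of the second derivatives of the generating function. -/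
lemma lintegral_commutator_le [SFinite ν] (k : Fin n) {f χ u ψ S : ℝ → Heis n → ℝ}
    {G : Fin n ⊕ Fin n → ℝ → Heis n → ℝ} {H : Fin n ⊕ Fin n → Fin n ⊕ Fin n → ℝ → Heis n → ℝ}
    (hf : Measurable (Function.uncurry f)) (hχ : Measurable (Function.uncurry χ))
    (hu : Measurable (Function.uncurry u))
    (hψ : Measurable (Function.uncurry ψ)) (hS : Measurable (Function.uncurry S))
    (hG : ∀ j, Measurable (Function.uncurry (G j)))
    (hH : ∀ i j, Measurable (Function.uncurry (H i j)))
    (hwG : ∀ j, ∀ᵐ t ∂ν, IsWeakDerivAlong (leftField (hbasis j)) (ψ t) (G j t))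
    (hwH : ∀ i j, ∀ᵐ t ∂ν, IsWeakDerivAlong (leftField (hbasis i)) (G j t) (H i j t))
    (hwS : ∀ᵐ t ∂ν, IsWeakDerivAlong (leftField (vert 1)) (ψ t) (S t)) {η C : ℝ≥0∞} {ε : ℝ}
    (hε : 0 < ε) {κ : Heis n → ℝ} (hκ : AdaptedKernel C ε κ)
    (hχf : ∀ t p q, (-q) ⊙ p ∈ tsupport κ → ‖χ t p‖ₑ * ‖u t q‖ₑ ≤ ‖f t q‖ₑ)
    (hηH : ∀ i j, ∀ h ∈ heisBox n ε, wInt ν f (fun t q => H i j t (q ⊙ h) - H i j t q) ≤ η)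
    (hηS : ∀ h ∈ heisBox n ε, wInt ν f (fun t q => S t (q ⊙ h) - S t q) ≤ η)
    (hηuH : ∀ i j, ∀ h ∈ heisBox n ε,
      wInt ν χ (fun t q => u t (q ⊙ h) * H i j t (q ⊙ h) - u t q * H i j t q) ≤ η)
    (hηuS : ∀ h ∈ heisBox n ε,
      wInt ν χ (fun t q => u t (q ⊙ h) * S t (q ⊙ h) - u t q * S t q) ≤ η) :
    ∫⁻ z : ℝ × Heis n, ‖χ z.1 z.2‖ₑ * ‖∫ q, u z.1 q * commutatorKernel κ (ψ z.1)
        (fun j => G j z.1) (contactDiv (fun i j => H i j z.1) (S z.1)) q z.2‖ₑ ∂(ν.prod volume)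
      ≤ commutatorConst n C * η := by
  have hfd := hκ.contDiff.continuous_fderiv (by simp)
  have mZ : ∀ j, Measurable fun w => fderiv ℝ κ w (leftField (hbasis j) w) := fun j =>
    (hfd.clm_apply (by fun_prop)).measurable
  have mT : Measurable fun w => fderiv ℝ κ w (vert 1) := (hfd.clm_apply continuous_const).measurable
  have mc : ∀ j, Measurable (hcoord j : Heis n → ℝ) := fun j =>
    (contDiff_hcoord j).continuous.measurable
  set E1 : Fin n ⊕ Fin n → Heis n → ℝ → Heis n → ℝ := fun j w t q =>
    G j t (q ⊙ w) - G j t q - ∑ i, hcoord i w * H i j t q with hE1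
  set E2 : Heis n → ℝ → Heis n → ℝ := fun w t q =>
    ψ t (q ⊙ w) - ψ t q - ∑ j, hcoord j w * G j t q
      - 1 / 2 * ∑ j, hcoord j w * ∑ i, hcoord i w * H i j t q - w.2.2 * S t q with hE2
  have mG1 : ∀ j, Measurable fun y : (ℝ × Heis n) × Heis n => G j y.1.1 (y.1.2 ⊙ y.2) := fun j =>
    (hG j).comp_uncurry (by fun_prop) (by fun_prop)
  have mG2 : ∀ j, Measurable fun y : (ℝ × Heis n) × Heis n => G j y.1.1 y.1.2 := fun j =>
    (hG j).comp_uncurry (by fun_prop) (by fun_prop)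
  have mH2 : ∀ i j, Measurable fun y : (ℝ × Heis n) × Heis n => H i j y.1.1 y.1.2 := fun i j =>
    (hH i j).comp_uncurry (by fun_prop) (by fun_prop)
  have mc2 : ∀ j, Measurable fun y : (ℝ × Heis n) × Heis n => hcoord j y.2 := fun j =>
    (mc j).comp measurable_snd
  have mE1 : ∀ j, Measurable fun y : (ℝ × Heis n) × Heis n => E1 j y.2 y.1.1 y.1.2 := fun j =>
    ((mG1 j).sub (mG2 j)).sub (Finset.measurable_sum _ fun i _ => (mc2 i).mul (mH2 i j))
  have mE2 : Measurable fun y : (ℝ × Heis n) × Heis n => E2 y.2 y.1.1 y.1.2 := by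
    have a1 : Measurable fun y : (ℝ × Heis n) × Heis n => ψ y.1.1 (y.1.2 ⊙ y.2) :=
      hψ.comp_uncurry (by fun_prop) (by fun_prop)
    have a2 : Measurable fun y : (ℝ × Heis n) × Heis n => ψ y.1.1 y.1.2 :=
      hψ.comp_uncurry (by fun_prop) (by fun_prop)
    have a3 : Measurable fun y : (ℝ × Heis n) × Heis n => S y.1.1 y.1.2 :=
      hS.comp_uncurry (by fun_prop) (by fun_prop)
    exact (((a1.sub a2).sub (Finset.measurable_sum _ fun j _ => (mc2 j).mul (mG2 j))).sub
      ((Finset.measurable_sum _ fun j _ => (mc2 j).mul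
        (Finset.measurable_sum _ fun i _ => (mc2 i).mul (mH2 i j))).const_mul _)).sub
      ((by fun_prop : Measurable fun y : (ℝ × Heis n) × Heis n => y.2.2.2).mul a3)
  -- `R1` gathers the Taylor remainders, small by themselves. The families `A` and `P` below gather
  -- the coefficients u H, u S and their mean-zero kernels, which are small only after integration.
  set R1 : (ℝ × Heis n) → Heis n → ℝ := fun z w =>
    ∑ j, contactSign j.swap * E1 j w z.1 z.2 * fderiv ℝ κ w (leftField (hbasis j.swap) w)
      - 4 * E2 w z.1 z.2 * fderiv ℝ κ w (vert 1) with hR1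
  have mR1 : Measurable (Function.uncurry R1) :=
    (Finset.measurable_sum _ fun j _ => ((mE1 j).const_mul _).mul
      ((mZ j.swap).comp measurable_snd)).sub ((mE2.const_mul _).mul (mT.comp measurable_snd))
  set A : Option ((Fin n ⊕ Fin n) × (Fin n ⊕ Fin n)) → ℝ → Heis n → ℝ := fun m t q =>
    u t q * m.elim (S t q) fun ij => H ij.1 ij.2 t q with hA
  set P : Option ((Fin n ⊕ Fin n) × (Fin n ⊕ Fin n)) → Heis n → ℝ := fun m w =>
    m.elim (kernelS κ w) fun ij => kernelH κ ij.1 ij.2 w with hP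
  have hPi : ∀ m, Integrable (P m) ∧ (∫ w, κ w = 1 → ∫ w, P m w = 0) := by
    rintro (_ | ⟨i, j⟩)
    · exact integral_kernelS hκ.contDiff hκ.hasCompactSupport
    · exact integral_kernelH hκ.contDiff hκ.hasCompactSupport i j
  have mP : ∀ m, Measurable (P m) := by
    rintro (_ | ⟨i, j⟩)
    · have : Measurable fun w : Heis n => w.2.2 := by fun_prop
      exact ((this.mul mT).const_mul _).sub (hκ.contDiff.continuous.measurable.const_mul _)
    · exact ((((mc i).const_mul _).mul (mZ _)).sub ((((mc i).mul (mc j)).const_mul _).mul mT)).add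
        (hκ.contDiff.continuous.measurable.const_mul _)
  have mA : ∀ m, Measurable (Function.uncurry (A m)) := by
    rintro (_ | ⟨i, j⟩)
    · exact hu.mul hS
    · exact hu.mul (hH i j)
  have hsplit : ∀ (z : ℝ × Heis n) q, u z.1 q * commutatorKernel κ (ψ z.1)
      (fun j => G j z.1) (contactDiv (fun i j => H i j z.1) (S z.1)) q z.2
      = u z.1 q * R1 (z.1, q) ((-q) ⊙ z.2) + ∑ m, A m z.1 q * P m ((-q) ⊙ z.2) := by
    intro z q
    have := commutatorKernel_eq κ (ψ z.1) (fun j => G j z.1) (fun i j => H i j z.1) (S z.1) q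
      ((-q) ⊙ z.2)
    rw [hmul_neg_cancel_left] at this
    rw [this, mul_add, Fintype.sum_option, Fintype.sum_prod_type]
    simp only [hR1, hE1, hE2, hA, hP, hmul_neg_cancel_left, Option.elim]
    congr 1
    rw [mul_add, Finset.mul_sum, add_comm]
    congr 1
    · ring
    · refine Finset.sum_congr rfl fun i _ => ?_
      rw [Finset.mul_sum]
      exact Finset.sum_congr rfl fun j _ => by ring
  refine (lintegral_enorm_integral_le (f := f) hχ mA mP (fun m => (hPi m).1)
    (fun m => (hPi m).2 hκ.integral_eq_one) mR1 hu hf hsplit fun t p q h => ?_).trans ?_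
  · refine hχf t p q ?_
    by_contra hn
    exact h (by simp [hR1, fderiv_eq_zero_of_notMem_tsupport hn])
  have hGl : ∀ j, ∀ᵐ t ∂ν, LocallyIntegrable (G j t) := fun j =>
    (hwH (Sum.inl k) j).mono fun t ht => ht.1
  have hψl : ∀ᵐ t ∂ν, LocallyIntegrable (ψ t) := hwS.mono fun t ht => ht.1
  -- The first-order estimate is applied to each G_j, whose horizontal derivatives are the H_ij, and
  -- the second-order one to ψ. The resulting powers ε and ε² are kept next to Zκ and Tκ, where the
  -- L¹ bounds of the kernel absorb them.
  have b1 : ∀ w, ∫⁻ z : ℝ × Heis n, ‖f z.1 z.2‖ₑ * ‖R1 z w‖ₑ ∂(ν.prod volume)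
      ≤ ∑ j, (2 * n + 4) * η * (ENNReal.ofReal ε *
          ‖fderiv ℝ κ w (leftField (hbasis (Sum.swap j)) w)‖ₑ)
        + 4 * ((2 * n) ^ 2 + 1) * η * (ENNReal.ofReal (ε ^ 2) * ‖fderiv ℝ κ w (vert 1)‖ₑ) := by
    intro w
    by_cases hw : w ∈ tsupport κ
    · have hwb := hκ.mem_heisBox hw
      have m1 : ∀ j, Measurable (Function.uncurry (E1 j w)) := fun j =>
        (mE1 j).comp (f := fun z : ℝ × Heis n => (z, w)) (by fun_prop)
      have e : (fun t q => R1 (t, q) w) = fun t q =>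
          (∑ j, (contactSign (Sum.swap j) * fderiv ℝ κ w (leftField (hbasis j.swap) w))
            * E1 j w t q) + (-4 * fderiv ℝ κ w (vert 1)) * E2 w t q := by
        funext t q
        simp only [hR1]
        rw [sub_eq_add_neg]
        congr 1
        · exact Finset.sum_congr rfl fun j _ => by ring
        · ring
      change wInt ν f (fun t q => R1 (t, q) w) ≤ _
      rw [e]
      have m1' : ∀ j, Measurable (Function.uncurry fun t q =>
          (contactSign (Sum.swap j) * fderiv ℝ κ w (leftField (hbasis j.swap) w))
            * E1 j w t q) := fun j => (m1 j).const_mul _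
      have mS : Measurable (Function.uncurry fun t q =>
          ∑ j, (contactSign (Sum.swap j) * fderiv ℝ κ w (leftField (hbasis j.swap) w))
            * E1 j w t q) := Finset.measurable_sum Finset.univ fun j _ => m1' j
      refine (wInt_add_le hf mS).trans ?_
      refine add_le_add ((wInt_sum_le Finset.univ hf fun j _ => m1' j).trans
        (Finset.sum_le_sum fun j _ => ?_)) ?_
      · rw [wInt_const_mul, enorm_mul, enorm_contactSign, one_mul]
        refine (mul_le_mul' le_rfl (wInt_taylor_one k hf (hG j) (fun i => hH i j) (hGl j)
          (fun i => hwH i j) hε (fun i => hηH i j) hwb)).trans_eq ?_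
        ring
      · rw [wInt_const_mul, enorm_mul]
        refine (mul_le_mul' le_rfl (wInt_taylor_two hf hψ hS hG hH hψl hGl hwG hwH hwS hε hηH hηS
          hwb)).trans_eq ?_
        have : ‖(-4 : ℝ)‖ₑ = 4 := by simp [enorm_eq_nnnorm]
        rw [this]
        ring
    · simp [hR1, fderiv_eq_zero_of_notMem_tsupport hw]
  have b2 : ∀ m, ∫⁻ w, ‖P m w‖ₑ * wInt ν χ (fun t q => A m t (q ⊙ (-w)) - A m t q)
      ≤ (∫⁻ w, ‖P m w‖ₑ) * η := by
    intro m
    refine lintegral_kernel_mul_le (mP m) fun w hw => ?_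
    have hwt : w ∈ tsupport κ := by
      by_contra hn
      refine hw ?_
      rcases m with _ | ⟨i, j⟩ <;>
        simp [hP, kernelS, kernelH, fderiv_eq_zero_of_notMem_tsupport hn,
          image_eq_zero_of_notMem_tsupport hn]
    have hb := neg_mem_heisBox (hκ.mem_heisBox hwt)
    rcases m with _ | ⟨i, j⟩
    · exact hηuS _ hb
    · exact hηuH i j _ hb
  have hcard : ∀ c : ℝ≥0∞, ∑ _j : Fin n ⊕ Fin n, c = 2 * n * c := by
    intro c
    simp only [Finset.sum_const, Finset.card_univ, Fintype.card_sum, Fintype.card_fin, nsmul_eq_mul]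
    rw [two_mul]; push_cast; rfl
  calc _ ≤ (∫⁻ w, (∑ j, (2 * n + 4) * η * (ENNReal.ofReal ε *
          ‖fderiv ℝ κ w (leftField (hbasis (Sum.swap j)) w)‖ₑ)
        + 4 * ((2 * n) ^ 2 + 1) * η * (ENNReal.ofReal (ε ^ 2) * ‖fderiv ℝ κ w (vert 1)‖ₑ)))
        + ∑ m, (∫⁻ w, ‖P m w‖ₑ) * η :=
        add_le_add (lintegral_mono b1) (Finset.sum_le_sum fun m _ => b2 m)
    _ = (∑ j, (2 * n + 4) * η * (ENNReal.ofReal ε *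
          ∫⁻ w, ‖fderiv ℝ κ w (leftField (hbasis (Sum.swap j)) w)‖ₑ)
        + 4 * ((2 * n) ^ 2 + 1) * η * (ENNReal.ofReal (ε ^ 2) * ∫⁻ w, ‖fderiv ℝ κ w (vert 1)‖ₑ))
        + ∑ m, (∫⁻ w, ‖P m w‖ₑ) * η := by
        congr 1
        rw [lintegral_add_right _ (((mT.enorm).const_mul _).const_mul _),
          lintegral_finsetSum _ fun j _ => (((mZ _).enorm).const_mul _).const_mul _,
          lintegral_const_mul _ ((mT.enorm).const_mul _), lintegral_const_mul _ mT.enorm]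
        congr 1
        refine Finset.sum_congr rfl fun j _ => ?_
        rw [lintegral_const_mul _ (((mZ _).enorm).const_mul _), lintegral_const_mul _ (mZ _).enorm]
    -- These four contributions are the four summands of `commutatorConst`: remainders of the G_j,
    -- remainder of ψ, the kernel of S, and the (2n)² kernels of the H_ij.
    _ ≤ (∑ _j : Fin n ⊕ Fin n, (2 * n + 4) * η * C + 4 * ((2 * n) ^ 2 + 1) * η * C)
        + (8 * C * η + ∑ _i : Fin n ⊕ Fin n, ∑ _j : Fin n ⊕ Fin n, 4 * C * η) := by
        rw [Fintype.sum_option, Fintype.sum_prod_type]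
        gcongr with j _ i _ j _
        · exact hκ.lintegral_left_le _
        · exact hκ.lintegral_vert_le
        · exact hκ.lintegral_kernelS_le
        · exact hκ.lintegral_kernelH_le hε i j
    _ = commutatorConst n C * η := by
        simp only [hcard, commutatorConst]
        ring

end contact

/-! ### The chain rule for weak solutions of scalar ODEs with integrable right-hand side. -/

section chainRule

open scoped NNReal

lemma LipschitzWith.comp_absolutelyContinuousOnInterval {K : ℝ≥0} {β V : ℝ → ℝ} {a b : ℝ}
    (hβ : LipschitzWith K β) (hV : AbsolutelyContinuousOnInterval V a b) :
    AbsolutelyContinuousOnInterval (fun t => β (V t)) a b := by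
  have h0 : Filter.Tendsto (fun E : ℕ × (ℕ → ℝ × ℝ) =>
      (K : ℝ) * ∑ i ∈ Finset.range E.1, dist (V (E.2 i).1) (V (E.2 i).2))
      (AbsolutelyContinuousOnInterval.totalLengthFilter ⊓
        Filter.principal (AbsolutelyContinuousOnInterval.disjWithin a b)) (nhds 0) := by
    simpa using Filter.Tendsto.const_mul (K : ℝ) hV
  refine squeeze_zero (fun E => Finset.sum_nonneg fun _ _ => dist_nonneg) (fun E => ?_) h0
  rw [Finset.mul_sum]
  exact Finset.sum_le_sum fun i _ => hβ.dist_le_mul _ _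

lemma lipschitzWith_of_abs_deriv_le {β : ℝ → ℝ} (hβ : ContDiff ℝ 1 β) {M : ℝ}
    (hM : ∀ x, |deriv β x| ≤ M) : LipschitzWith M.toNNReal β := by
  refine lipschitzWith_of_nnnorm_deriv_le (hβ.differentiable (by simp)) fun x => ?_
  rw [← NNReal.coe_le_coe, coe_nnnorm, Real.norm_eq_abs,
    Real.coe_toNNReal _ ((abs_nonneg _).trans (hM x))]
  exact hM x

/-- Integration by parts on `(0, T]` for a composition with an indefinite integral. -/
lemma integral_comp_primitive_mul_deriv {T : ℝ} {g : ℝ → ℝ} (hg : Integrable g)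
    {β : ℝ → ℝ} (hβ : ContDiff ℝ 1 β) {M : ℝ} (hM : ∀ x, |deriv β x| ≤ M) {η : ℝ → ℝ}
    (hη : ContDiff ℝ ∞ η) (hηT : η T = 0) (v₀ : ℝ) :
    ∫ t in (0 : ℝ)..T, β (v₀ - ∫ r in (0 : ℝ)..t, g r) * deriv η t
      = -(β v₀ * η 0) + ∫ t in (0 : ℝ)..T,
          deriv β (v₀ - ∫ r in (0 : ℝ)..t, g r) * g t * η t := by
  have hVac : AbsolutelyContinuousOnInterval (fun t => v₀ - ∫ r in (0 : ℝ)..t, g r) 0 T := by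
    refine AbsolutelyContinuousOnInterval.sub ?_
      (hg.intervalIntegrable.absolutelyContinuousOnInterval_intervalIntegral (by simp))
    exact (LipschitzWith.const v₀).lipschitzOnWith.absolutelyContinuousOnInterval
  have hβac := (lipschitzWith_of_abs_deriv_le hβ hM).comp_absolutelyContinuousOnInterval hVac
  have hηac : AbsolutelyContinuousOnInterval η 0 T :=
    (hη.of_le (by exact_mod_cast le_top)).contDiffOn.absolutelyContinuousOnInterval
  rw [hβac.integral_mul_deriv_eq_deriv_mul hηac, hηT, mul_zero, zero_sub,
    intervalIntegral.integral_same, sub_zero, sub_eq_add_neg, ← intervalIntegral.integral_neg]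
  congr 1
  refine intervalIntegral.integral_congr_ae ?_
  filter_upwards [LocallyIntegrable.ae_hasDerivAt_integral hg.locallyIntegrable] with t ht _
  have h1 : HasDerivAt (fun t => v₀ - ∫ r in (0 : ℝ)..t, g r) (-g t) t := (ht 0).const_sub v₀
  have h2 := ((hβ.differentiable (by simp)) (v₀ - ∫ r in (0 : ℝ)..t, g r)).hasDerivAt.comp t h1
  have h3 : deriv (fun t => β (v₀ - ∫ r in (0 : ℝ)..t, g r)) t = _ := h2.deriv
  rw [h3]
  ring

/-- Smooth compactly supported functions which are `1` on a given compact set. -/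
lemma exists_contDiff_cutoff {E : Type*} [NormedAddCommGroup E] [NormedSpace ℝ E]
    [FiniteDimensional ℝ E] {K : Set E} (hK : IsCompact K) :
    ∃ θ : E → ℝ, ContDiff ℝ ∞ θ ∧ HasCompactSupport θ ∧ (∀ x, |θ x| ≤ 1) ∧ ∀ x ∈ K, θ x = 1 := by
  obtain ⟨R, hR⟩ := hK.isBounded.subset_closedBall (0 : E)
  let θ : ContDiffBump (0 : E) := ⟨max R 1, max R 1 + 1, by positivity, by linarith⟩
  refine ⟨θ, θ.contDiff, θ.hasCompactSupport, fun x => ?_, fun x hx => ?_⟩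
  · rw [abs_of_nonneg θ.nonneg]
    exact θ.le_one
  · exact θ.one_of_mem_closedBall (Metric.closedBall_subset_closedBall (le_max_left _ _) (hR hx))

lemma contDiff_primitive {χ : ℝ → ℝ} (hχ : ContDiff ℝ ∞ χ) (a : ℝ) :
    ContDiff ℝ ∞ fun t => ∫ r in a..t, χ r := by
  have hd : ∀ t, HasDerivAt (fun t => ∫ r in a..t, χ r) (χ t) t := fun t =>
    intervalIntegral.integral_hasDerivAt_right (hχ.continuous.intervalIntegrable _ _)
      hχ.continuous.stronglyMeasurable.stronglyMeasurableAtFilter hχ.continuous.continuousAt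
  rw [contDiff_infty_iff_deriv]
  refine ⟨fun t => (hd t).differentiableAt, ?_⟩
  rwa [show deriv (fun t => ∫ r in a..t, χ r) = χ from funext fun t => (hd t).deriv]

/-- A weak solution of `v' = -G`, `v(0) = v₀` on `(0, T)` is an indefinite integral. -/
lemma ae_eq_primitive_of_weak {T : ℝ} (hT : 0 < T) {v g : ℝ → ℝ} {v₀ : ℝ}
    (hv : IntegrableOn v (Ioc 0 T)) (hg : Integrable g)
    (h : ∀ η : ℝ → ℝ, ContDiff ℝ ∞ η → HasCompactSupport η → tsupport η ⊆ Iio T →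
      -(v₀ * η 0) - (∫ t in Ioc 0 T, v t * deriv η t) + ∫ t in Ioc 0 T, g t * η t = 0) :
    ∀ᵐ t ∂(volume.restrict (Ioc 0 T)), v t = v₀ - ∫ r in (0 : ℝ)..t, g r := by
  have hVc : Continuous fun t => v₀ - ∫ r in (0 : ℝ)..t, g r :=
    continuous_const.sub (intervalIntegral.continuous_primitive
      (fun a b => hg.intervalIntegrable) 0)
  have hV : IntegrableOn (fun t => v₀ - ∫ r in (0 : ℝ)..t, g r) (Ioc 0 T) :=
    (hVc.integrableOn_Icc).mono_set Ioc_subset_Icc_self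
  have key : ∀ χ : ℝ → ℝ, ContDiff ℝ ∞ χ → HasCompactSupport χ → tsupport χ ⊆ Ioo 0 T →
      ∫ t, χ t • (Ioc 0 T).indicator (fun t => v t - (v₀ - ∫ r in (0 : ℝ)..t, g r)) t = 0 := by
    intro χ hχ hχc hχs
    obtain ⟨θ, hθ, hθc, -, hθ1⟩ :=
      exists_contDiff_cutoff (isCompact_Icc (a := (-1 : ℝ)) (b := T + 1))
    obtain ⟨T₀, hT₀, hχT⟩ : ∃ T₀ < T, tsupport χ ⊆ Iic T₀ := by
      rcases (tsupport χ).eq_empty_or_nonempty with h0 | h0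
      · exact ⟨0, hT, by simp [h0]⟩
      · have hm := hχc.isCompact.sSup_mem h0
        exact ⟨_, (hχs hm).2, fun t ht => le_csSup hχc.isCompact.bddAbove ht⟩
    have hχ0 : ∀ t, T₀ < t → χ t = 0 := fun t ht =>
      image_eq_zero_of_notMem_tsupport fun hn => absurd (hχT hn) (not_le.2 ht)
    have hP0 : ∀ t, T₀ < t → ∫ r in T..t, χ r = 0 := fun t ht => by
      refine (intervalIntegral.integral_congr (g := fun _ => (0 : ℝ)) fun r hr => ?_).trans (by simp)
      exact hχ0 r (lt_of_lt_of_le (lt_min hT₀ ht) hr.1)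
    -- A test function with derivative χ on (0,T]. The primitive is based at T, so it vanishes
    -- beyond the support of χ, and θ cuts it off at negative times. Its value at 0 need not vanish,
    -- and in this way the initial datum enters.
    have hη : ContDiff ℝ ∞ fun t => θ t * ∫ r in T..t, χ r := hθ.mul (contDiff_primitive hχ T)
    have hηc : HasCompactSupport fun t => θ t * ∫ r in T..t, χ r := hθc.mul_right
    have hηs : tsupport (fun t => θ t * ∫ r in T..t, χ r) ⊆ Iio T := by
      refine (closure_minimal (fun t ht => ?_) isClosed_Iic).trans (Iic_subset_Iio.2 hT₀)
      by_contra hn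
      exact ht (by simp only [hP0 t (not_le.1 hn), mul_zero])
    have hηd : ∀ t ∈ Ioc 0 T, deriv (fun t => θ t * ∫ r in T..t, χ r) t = χ t := by
      intro t ht
      have he : (fun t => θ t * ∫ r in T..t, χ r) =ᶠ[nhds t] fun t => ∫ r in T..t, χ r := by
        filter_upwards [Icc_mem_nhds (show (-1 : ℝ) < t by linarith [ht.1])
          (show t < T + 1 by linarith [ht.2])] with r hr
        rw [hθ1 r hr, one_mul]
      rw [he.deriv_eq]
      exact (intervalIntegral.integral_hasDerivAt_right (hχ.continuous.intervalIntegrable _ _)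
        hχ.continuous.stronglyMeasurable.stronglyMeasurableAtFilter
        hχ.continuous.continuousAt).deriv
    have h1 := h _ hη hηc hηs
    -- The case β = id says that the indefinite integral satisfies the same weak equation.
    -- Subtracting the two kills the initial and source terms.
    have h2 := integral_comp_primitive_mul_deriv (T := T) hg (β := id) contDiff_id (M := 1)
      (fun x => by simp) (η := fun t => θ t * ∫ r in T..t, χ r) hη (by simp) v₀
    rw [intervalIntegral.integral_of_le hT.le, intervalIntegral.integral_of_le hT.le] at h2
    simp only [deriv_id, one_mul, id] at h2
    obtain ⟨C, hC⟩ := hχc.exists_bound_of_continuous hχ.continuous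
    have hvχ : IntegrableOn (fun t => v t * χ t) (Ioc 0 T) :=
      Integrable.mul_bdd hv hχ.continuous.aestronglyMeasurable (Filter.Eventually.of_forall hC)
    have hVχ : IntegrableOn (fun t => (v₀ - ∫ r in (0 : ℝ)..t, g r) * χ t) (Ioc 0 T) :=
      Integrable.mul_bdd hV hχ.continuous.aestronglyMeasurable (Filter.Eventually.of_forall hC)
    rw [setIntegral_congr_fun measurableSet_Ioc fun t ht => by rw [hηd t ht]] at h1 h2
    have h3 : ∫ t, χ t • (Ioc 0 T).indicator (fun t => v t - (v₀ - ∫ r in (0 : ℝ)..t, g r)) t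
        = ∫ t in Ioc 0 T, (v t * χ t - (v₀ - ∫ r in (0 : ℝ)..t, g r) * χ t) := by
      rw [← integral_indicator measurableSet_Ioc]
      refine integral_congr_ae (Filter.Eventually.of_forall fun t => ?_)
      by_cases ht : t ∈ Ioc 0 T
      · simp only [indicator_of_mem ht, smul_eq_mul]
        ring
      · simp only [indicator_of_notMem ht, smul_zero]
    rw [h3, integral_sub hvχ hVχ]
    linarith
  have hli : LocallyIntegrableOn
      ((Ioc 0 T).indicator fun t => v t - (v₀ - ∫ r in (0 : ℝ)..t, g r)) (Ioo 0 T) :=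
    ((integrable_indicator_iff measurableSet_Ioc).2 (hv.sub hV)).locallyIntegrable
      |>.locallyIntegrableOn _
  have h1 := isOpen_Ioo.ae_eq_zero_of_integral_contDiff_smul_eq_zero hli key
  rw [← Measure.restrict_congr_set (Ioo_ae_eq_Ioc (a := (0 : ℝ)) (b := T)),
    ae_restrict_iff' measurableSet_Ioo]
  filter_upwards [h1] with t ht htm
  have := ht htm
  rw [indicator_of_mem (Ioo_subset_Ioc_self htm)] at this
  linarith

/-- The chain rule for weak solutions of `v' = -G`, `v(0) = v₀`. -/
lemma weak_chain_rule {T : ℝ} (hT : 0 < T) {v G : ℝ → ℝ} {v₀ : ℝ}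
    (hv : IntegrableOn v (Ioc 0 T)) (hG : IntegrableOn G (Ioc 0 T))
    (h : ∀ η : ℝ → ℝ, ContDiff ℝ ∞ η → HasCompactSupport η → tsupport η ⊆ Iio T →
      -(v₀ * η 0) - (∫ t in Ioc 0 T, v t * deriv η t) + ∫ t in Ioc 0 T, G t * η t = 0)
    {β : ℝ → ℝ} (hβ : ContDiff ℝ 1 β) {M : ℝ} (hM : ∀ x, |deriv β x| ≤ M) {η : ℝ → ℝ}
    (hη : ContDiff ℝ ∞ η) (hηT : η T = 0) :
    -(β v₀ * η 0) - (∫ t in Ioc 0 T, β (v t) * deriv η t)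
      + ∫ t in Ioc 0 T, deriv β (v t) * G t * η t = 0 := by
  -- Extension by zero makes the right-hand side integrable on the whole line, as the primitive
  -- requires; nothing changes on (0,T].
  have hg : Integrable ((Ioc 0 T).indicator G) := (integrable_indicator_iff measurableSet_Ioc).2 hG
  have h' : ∀ F : ℝ → ℝ, ∫ t in Ioc 0 T, (Ioc 0 T).indicator G t * F t
      = ∫ t in Ioc 0 T, G t * F t := fun F =>
    setIntegral_congr_fun measurableSet_Ioc fun t ht => by simp [indicator_of_mem ht]
  have hae := ae_eq_primitive_of_weak hT hv hg fun η h1 h2 h3 => by rw [h']; exact h η h1 h2 h3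
  have hIBP := integral_comp_primitive_mul_deriv hg hβ hM hη hηT v₀
  rw [intervalIntegral.integral_of_le hT.le, intervalIntegral.integral_of_le hT.le] at hIBP
  have e1 : ∫ t in Ioc 0 T, β (v t) * deriv η t = _ :=
    (integral_congr_ae (hae.mono fun t ht => by rw [ht])).trans hIBP
  have e2 : ∫ t in Ioc 0 T, deriv β (v t) * G t * η t
      = ∫ t in Ioc 0 T, deriv β (v₀ - ∫ r in (0 : ℝ)..t, (Ioc 0 T).indicator G r)
        * (Ioc 0 T).indicator G t * η t := by
    refine integral_congr_ae ?_
    filter_upwards [hae, ae_restrict_mem measurableSet_Ioc] with t ht htm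
    rw [ht, indicator_of_mem htm]
  rw [e1, e2]
  ring

end chainRule

/-! ### Group mollification and its interaction with invariant fields. -/

section mollify

variable {n : ℕ}

open scoped Convolution

/-- Group convolution with the kernel `κ`. -/
def mollify {n : ℕ} (κ f : Heis n → ℝ) (p : Heis n) : ℝ := ∫ q, f q * κ ((-q) ⊙ p)

/-- Group convolution is a Euclidean convolution evaluated at 0, with p as a parameter of the
kernel. Smoothness in p then follows from differentiation of convolutions with parameters. -/
lemma mollify_eq_convolution (κ f : Heis n → ℝ) (p : Heis n) :
    mollify κ f p = (f ⋆[ContinuousLinearMap.lsmul ℝ ℝ, volume] fun x => κ (x ⊙ p)) 0 := by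
  simp [mollify, convolution_def]

lemma exists_isCompact_support_hmul {κ : Heis n → ℝ} (hc : HasCompactSupport κ) (p₀ : Heis n) :
    ∃ k : Set (Heis n), IsCompact k ∧ ∀ p x, p ∈ Metric.ball p₀ 1 → x ∉ k → κ (x ⊙ p) = 0 := by
  refine ⟨(fun z : Heis n × Heis n => z.1 ⊙ (-z.2)) '' (tsupport κ ×ˢ Metric.closedBall p₀ 1),
    (hc.isCompact.prod (isCompact_closedBall _ _)).image (by fun_prop), fun p x hp hx => ?_⟩
  by_contra hn
  exact hx ⟨(x ⊙ p, p), ⟨subset_closure hn, Metric.ball_subset_closedBall hp⟩, by simp⟩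

lemma contDiff_mollify {κ f : Heis n → ℝ} (hf : LocallyIntegrable f) (hκ : ContDiff ℝ ∞ κ)
    (hc : HasCompactSupport κ) : ContDiff ℝ 1 (mollify κ f) := by
  rw [contDiff_iff_contDiffAt]
  intro p₀
  obtain ⟨k, hk, hk0⟩ := exists_isCompact_support_hmul hc p₀
  have hg : ContDiff ℝ ∞ fun z : Heis n × Heis n => κ (z.2 ⊙ z.1) := hκ.comp (by fun_prop)
  have := contDiffOn_convolution_right_with_param_comp (n := 1) (μ := volume)
    (ContinuousLinearMap.lsmul ℝ ℝ) (v := fun _ : Heis n => (0 : Heis n))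
    (g := fun p x => κ (x ⊙ p)) contDiffOn_const Metric.isOpen_ball hk hk0 hf
    (hg.of_le (by exact_mod_cast le_top)).contDiffOn
  rw [show mollify κ f = _ from funext (mollify_eq_convolution κ f)]
  exact this.contDiffAt (Metric.isOpen_ball.mem_nhds (Metric.mem_ball_self one_pos))

/-- The increment exp(θv) is attached on the right and is not affected by the left factor q. -/
lemma fderiv_comp_hmul_leftField {κ : Heis n → ℝ} (hκ : Differentiable ℝ κ) (q p v : Heis n) :
    fderiv ℝ (fun p => κ (q ⊙ p)) p (leftField v p) = fderiv ℝ κ (q ⊙ p) (leftField v (q ⊙ p)) := by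
  have hd : DifferentiableAt ℝ (fun p => κ (q ⊙ p)) p :=
    (hκ _).comp p ((by fun_prop : ContDiff ℝ ∞ fun p : Heis n => q ⊙ p).differentiable (by simp) p)
  have h1 : HasDerivAt (fun θ : ℝ => p + θ • leftField v p) (leftField v p) 0 := by
    simpa using ((hasDerivAt_id (0 : ℝ)).smul_const (leftField v p)).const_add p
  have h2 := (hd.hasFDerivAt.comp_hasDerivAt_of_eq 0 h1 (by simp)).deriv
  have h3 := (hasDerivAt_along hκ (q ⊙ p) v 0).deriv
  rw [← h2, zero_smul, hmul_zero] at *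
  rw [← h3]
  congr 1
  funext θ
  simp only [Function.comp_apply]
  rw [← hmul_smul_eq, hmul_assoc]

lemma fderiv_mollify {κ f : Heis n → ℝ} (hf : LocallyIntegrable f) (hκ : ContDiff ℝ ∞ κ)
    (hc : HasCompactSupport κ) (p v : Heis n) :
    fderiv ℝ (mollify κ f) p (leftField v p)
      = ∫ q, f q * fderiv ℝ κ ((-q) ⊙ p) (leftField v ((-q) ⊙ p)) := by
  obtain ⟨k, hk, hk0⟩ := exists_isCompact_support_hmul hc p
  have hg : ContDiff ℝ ∞ fun z : Heis n × Heis n => κ (z.2 ⊙ z.1) := hκ.comp (by fun_prop)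
  have h1 := hasFDerivAt_convolution_right_with_param (μ := volume)
    (ContinuousLinearMap.lsmul ℝ ℝ) (g := fun p x => κ (x ⊙ p)) Metric.isOpen_ball hk hk0 hf
    (hg.of_le (by exact_mod_cast le_top)).contDiffOn (p, 0) (Metric.mem_ball_self one_pos)
  have h2 : HasFDerivAt (fun p : Heis n => (p, (0 : Heis n)))
      (ContinuousLinearMap.inl ℝ (Heis n) (Heis n)) p :=
    (hasFDerivAt_id p).prodMk (hasFDerivAt_const _ _)
  have h3 := HasFDerivAt.comp p h1 h2
  have h4 : HasFDerivAt (mollify κ f) _ p :=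
    h3.congr_of_eventuallyEq (Filter.Eventually.of_forall (mollify_eq_convolution κ f))
  have hF : Continuous fun x : Heis n => fderiv ℝ (fun z : Heis n × Heis n => κ (z.2 ⊙ z.1)) (p, x) :=
    (hg.continuous_fderiv (by simp)).comp (by fun_prop)
  have hFc : HasCompactSupport fun x : Heis n =>
      fderiv ℝ (fun z : Heis n × Heis n => κ (z.2 ⊙ z.1)) (p, x) := by
    refine HasCompactSupport.intro hk fun x hx => ?_
    have : (fun z : Heis n × Heis n => κ (z.2 ⊙ z.1)) =ᶠ[nhds (p, x)] fun _ => 0 := by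
      filter_upwards [(Metric.isOpen_ball.prod hk.isClosed.isOpen_compl).mem_nhds
        (⟨Metric.mem_ball_self one_pos, hx⟩ : (p, x) ∈ Metric.ball p 1 ×ˢ kᶜ)] with z hz
      exact hk0 _ _ hz.1 hz.2
    rw [this.fderiv_eq]
    simp
  rw [h4.fderiv, ContinuousLinearMap.comp_apply, ContinuousLinearMap.inl_apply]
  refine (convolution_precompR_apply (ContinuousLinearMap.lsmul ℝ ℝ) hf hFc hF 0
    (leftField v p, (0 : Heis n))).trans ?_
  rw [convolution_def]
  refine integral_congr_ae (Filter.Eventually.of_forall fun q => ?_)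
  simp only [ContinuousLinearMap.lsmul_apply, smul_eq_mul, zero_sub]
  congr 1
  rw [← fderiv_comp_hmul_leftField (hκ.differentiable (by simp))]
  have h7 : HasFDerivAt (fun p : Heis n => (p, -q))
      (ContinuousLinearMap.inl ℝ (Heis n) (Heis n)) p :=
    (hasFDerivAt_id p).prodMk (hasFDerivAt_const _ _)
  have h5 := (HasFDerivAt.comp p (hg.differentiable (by simp) (p, -q)).hasFDerivAt h7).fderiv
  have h6 : fderiv ℝ (fun p => κ ((-q) ⊙ p)) p = _ := h5
  rw [h6]
  simp

/-- (q exp(θv))⁻¹ p = exp(−θv) q⁻¹p: inversion carries the increment to the left of the argument of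
κ and reverses its sign. -/
lemma fderiv_kernel_rightField {κ : Heis n → ℝ} (hκ : Differentiable ℝ κ) (q p v : Heis n) :
    fderiv ℝ (fun q => κ ((-q) ⊙ p)) q (leftField v q)
      = -fderiv ℝ κ ((-q) ⊙ p) (rightField v ((-q) ⊙ p)) := by
  have hd : DifferentiableAt ℝ (fun q => κ ((-q) ⊙ p)) q :=
    (hκ _).comp q ((by fun_prop : ContDiff ℝ ∞ fun q : Heis n => (-q) ⊙ p).differentiable
      (by simp) q)
  have h1 : HasDerivAt (fun θ : ℝ => q + θ • leftField v q) (leftField v q) 0 := by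
    simpa using ((hasDerivAt_id (0 : ℝ)).smul_const (leftField v q)).const_add q
  have h2 := (hd.hasFDerivAt.comp_hasDerivAt_of_eq 0 h1 (by simp)).deriv
  have h4 : HasDerivAt (fun θ : ℝ => (-q) ⊙ p + θ • -rightField v ((-q) ⊙ p))
      (-rightField v ((-q) ⊙ p)) 0 := by
    simpa using ((hasDerivAt_id (0 : ℝ)).smul_const (-rightField v ((-q) ⊙ p))).const_add
      ((-q) ⊙ p)
  have h3 := ((hκ ((-q) ⊙ p)).hasFDerivAt.comp_hasDerivAt_of_eq 0 h4 (by simp)).deriv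
  rw [← h2, ← map_neg, ← h3]
  congr 1
  funext θ
  have : (-(θ • v)) ⊙ ((-q) ⊙ p) = (-q) ⊙ p + θ • -rightField v ((-q) ⊙ p) := by
    rw [← neg_smul, smul_hmul_eq]
    simp
  simp only [Function.comp_apply]
  rw [← hmul_smul_eq, neg_hmul_rev, hmul_assoc, this]

end mollify

/-! ### Testing the divergence with C¹ functions. -/

section divergence

variable {n : ℕ}

open scoped Convolution

instance : (volume : Measure (Heis n)).IsNegInvariant := ⟨measurePreserving_neg_heis.map_eq⟩

/-- Smooth compactly supported functions are `C¹`-dense among `C¹` compactly supported ones. -/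
lemma exists_contDiff_approx {Φ : Heis n → ℝ} (hΦ : ContDiff ℝ 1 Φ) (hc : HasCompactSupport Φ)
    {ε : ℝ} (hε : 0 < ε) : ∃ Φ' : Heis n → ℝ, ContDiff ℝ ∞ Φ' ∧
      tsupport Φ' ⊆ Metric.cthickening 1 (tsupport Φ) ∧ (∀ p, |Φ' p - Φ p| ≤ ε) ∧
      ∀ p, ‖fderiv ℝ Φ' p - fderiv ℝ Φ p‖ ≤ ε := by
  have h1 := hc.uniformContinuous_of_continuous hΦ.continuous
  have hfc := hΦ.continuous_fderiv one_ne_zero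
  have h2 := (hc.fderiv ℝ).uniformContinuous_of_continuous hfc
  rw [Metric.uniformContinuous_iff] at h1 h2
  obtain ⟨δ₁, hδ₁, h1⟩ := h1 ε hε
  obtain ⟨δ₂, hδ₂, h2⟩ := h2 ε hε
  have hδ : 0 < min (min δ₁ δ₂) 1 := by positivity
  let ρ : ContDiffBump (0 : Heis n) := ⟨min (min δ₁ δ₂) 1 / 2, min (min δ₁ δ₂) 1, by positivity,
    by linarith⟩
  have hr : ρ.rOut = min (min δ₁ δ₂) 1 := rfl
  have hlρ : LocallyIntegrable (ρ.normed volume) := ρ.continuous_normed.locallyIntegrable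
  refine ⟨ρ.normed volume ⋆[ContinuousLinearMap.lsmul ℝ ℝ, volume] Φ, ?_, ?_, fun p => ?_,
    fun p => ?_⟩
  · exact ρ.hasCompactSupport_normed.contDiff_convolution_left _ ρ.contDiff_normed
      hΦ.continuous.locallyIntegrable
  · refine closure_minimal ?_ Metric.isClosed_cthickening
    refine (support_convolution_subset _).trans ?_
    rintro _ ⟨x, hx, y, hy, rfl⟩
    refine Metric.mem_cthickening_of_dist_le _ y _ _ (subset_closure hy) ?_
    rw [ρ.support_normed_eq] at hx
    rw [dist_eq_norm, add_sub_cancel_right]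
    have := mem_ball_zero_iff.1 hx
    rw [hr] at this
    exact (this.trans_le (min_le_right _ _)).le
  · rw [← Real.dist_eq]
    refine ρ.dist_normed_convolution_le hΦ.continuous.aestronglyMeasurable fun x hx => (h1 ?_).le
    exact (Metric.mem_ball.1 hx).trans_le ((min_le_left _ _).trans (min_le_left _ _))
  · rw [(hc.hasFDerivAt_convolution_right (ContinuousLinearMap.lsmul ℝ ℝ) hlρ hΦ p).fderiv,
      ← dist_eq_norm]
    have : ((ρ.normed volume) ⋆[(ContinuousLinearMap.lsmul ℝ ℝ).precompR (Heis n), volume]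
        fderiv ℝ Φ) p = ((ρ.normed volume) ⋆[ContinuousLinearMap.lsmul ℝ ℝ, volume]
        fderiv ℝ Φ) p := by
      refine integral_congr_ae (Filter.Eventually.of_forall fun x => ?_)
      exact ContinuousLinearMap.ext fun v => by simp [ContinuousLinearMap.precompR_apply]
    rw [this]
    refine ρ.dist_normed_convolution_le hfc.aestronglyMeasurable fun x hx => (h2 ?_).le
    exact (Metric.mem_ball.1 hx).trans_le ((min_le_left _ _).trans (min_le_right _ _))

lemma Integrable.clm_apply_of_integrableOn {X : Type*} [MeasurableSpace X] {μ : Measure X}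
    {E : Type*} [NormedAddCommGroup E] [NormedSpace ℝ E] {L : X → E →L[ℝ] ℝ} {b : X → E}
    {K : Set X} (hK : MeasurableSet K) (hL : AEStronglyMeasurable L μ)
    (hb : AEStronglyMeasurable b μ) {C : ℝ} (hC : ∀ p, ‖L p‖ ≤ C) (h0 : ∀ p ∉ K, L p = 0)
    (hbK : IntegrableOn b K μ) : Integrable (fun p => L p (b p)) μ := by
  refine (((integrable_indicator_iff hK).2 hbK.norm).const_mul C).mono'
    (isBoundedBilinearMap_apply.continuous.comp_aestronglyMeasurable (hL.prodMk hb))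
    (Filter.Eventually.of_forall fun p => ?_)
  by_cases hp : p ∈ K
  · rw [indicator_of_mem hp]
    exact (L p).le_of_opNorm_le (hC p) _
  · simp [h0 p hp, indicator_of_notMem hp]

/-- The divergence can be tested with `C¹` functions. -/
lemma IsDivergence.integral_eq {b : Heis n → Heis n} {D : Heis n → ℝ} (h : IsDivergence b D)
    {Φ : Heis n → ℝ} (hΦ : ContDiff ℝ 1 Φ) (hc : HasCompactSupport Φ) :
    ∫ p, fderiv ℝ Φ p (b p) = -∫ p, Φ p * D p := by
  obtain ⟨hb, hD, hφ⟩ := h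
  set K := Metric.cthickening 1 (tsupport Φ) with hK
  have hKc : IsCompact K := hc.isCompact.cthickening
  have hsub : tsupport Φ ⊆ K := Metric.self_subset_cthickening _
  have hbK := (hb.integrableOn_isCompact hKc).norm
  have hDK := (hD.integrableOn_isCompact hKc).norm
  have hfi : ∀ Ψ : Heis n → ℝ, ContDiff ℝ 1 Ψ → tsupport Ψ ⊆ K →
      Integrable (fun p => fderiv ℝ Ψ p (b p)) ∧ Integrable (fun p => Ψ p * D p) := by
    intro Ψ hΨ hs
    have hc' : HasCompactSupport Ψ := hKc.of_isClosed_subset (isClosed_tsupport _) hs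
    have hfc := hΨ.continuous_fderiv one_ne_zero
    obtain ⟨C, hC⟩ := (hc'.fderiv ℝ).exists_bound_of_continuous hfc
    refine ⟨Integrable.clm_apply_of_integrableOn hKc.measurableSet hfc.aestronglyMeasurable
      hb.aestronglyMeasurable hC (fun p hp => ?_) (hb.integrableOn_isCompact hKc), ?_⟩
    · exact image_eq_zero_of_notMem_tsupport fun hn => hp (hs (tsupport_fderiv_subset ℝ hn))
    · simpa only [mul_comm] using integrable_mul_of_hasCompactSupport hD hΨ.continuous hc'
  -- The smooth approximants are all supported in one compact set K and are C¹-close to Φ. The error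
  -- is therefore at most ε times the L¹(K) norms of b and D.
  have key : ∀ ε > 0, |(∫ p, fderiv ℝ Φ p (b p)) - -∫ p, Φ p * D p|
      ≤ ε * ((∫ p in K, ‖b p‖) + ∫ p in K, ‖D p‖) := by
    intro ε hε
    obtain ⟨Φ', h1, h2, h3, h4⟩ := exists_contDiff_approx hΦ hc hε
    have h5 : ContDiff ℝ 1 Φ' := h1.of_le (by exact_mod_cast le_top)
    obtain ⟨i1, i2⟩ := hfi Φ hΦ hsub
    obtain ⟨i3, i4⟩ := hfi Φ' h5 h2
    have e := hφ Φ' h1 (hKc.of_isClosed_subset (isClosed_tsupport _) h2)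
    have e1 : (∫ p, fderiv ℝ Φ p (b p)) - -∫ p, Φ p * D p
        = (∫ p, (fderiv ℝ Φ p (b p) - fderiv ℝ Φ' p (b p))) + ∫ p, (Φ p * D p - Φ' p * D p) := by
      rw [integral_sub i1 i3, integral_sub i2 i4, e]
      ring
    have h6 : ∀ p ∉ K, fderiv ℝ Φ p = 0 ∧ fderiv ℝ Φ' p = 0 ∧ Φ p = 0 ∧ Φ' p = 0 := fun p hp =>
      ⟨image_eq_zero_of_notMem_tsupport fun hn => hp (hsub (tsupport_fderiv_subset ℝ hn)),
        image_eq_zero_of_notMem_tsupport fun hn => hp (h2 (tsupport_fderiv_subset ℝ hn)),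
        image_eq_zero_of_notMem_tsupport fun hn => hp (hsub hn),
        image_eq_zero_of_notMem_tsupport fun hn => hp (h2 hn)⟩
    rw [e1, mul_add, ← integral_const_mul, ← integral_const_mul,
      ← integral_indicator hKc.measurableSet, ← integral_indicator hKc.measurableSet]
    refine (abs_add_le _ _).trans (add_le_add ?_ ?_)
    · rw [← Real.norm_eq_abs]
      refine norm_integral_le_of_norm_le
        ((integrable_indicator_iff hKc.measurableSet).2 (hbK.const_mul ε))
        (Filter.Eventually.of_forall fun p => ?_)
      by_cases hp : p ∈ K
      · rw [indicator_of_mem hp, norm_sub_rev, ← sub_apply]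
        exact ContinuousLinearMap.le_of_opNorm_le _ (h4 p) _
      · simp [indicator_of_notMem hp, h6 p hp]
    · rw [← Real.norm_eq_abs]
      refine norm_integral_le_of_norm_le
        ((integrable_indicator_iff hKc.measurableSet).2 (hDK.const_mul ε))
        (Filter.Eventually.of_forall fun p => ?_)
      by_cases hp : p ∈ K
      · rw [indicator_of_mem hp, ← sub_mul, norm_mul, Real.norm_eq_abs, abs_sub_comm]
        exact mul_le_mul_of_nonneg_right (h3 p) (norm_nonneg _)
      · simp [indicator_of_notMem hp, h6 p hp]
  set A := (∫ p in K, ‖b p‖) + ∫ p in K, ‖D p‖ with hA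
  have hA0 : 0 ≤ A := add_nonneg (integral_nonneg fun _ => norm_nonneg _)
    (integral_nonneg fun _ => norm_nonneg _)
  refine sub_eq_zero.1 (abs_eq_zero.1 (le_antisymm (le_of_forall_pos_le_add fun δ hδ => ?_)
    (abs_nonneg _)))
  refine (key (δ / (A + 1)) (by positivity)).trans ?_
  rw [zero_add, div_mul_eq_mul_div, div_le_iff₀ (by positivity)]
  nlinarith

end divergence

/-! ### Time-dependent locally integrable functions and their mollifications. -/

section parametric

variable {n : ℕ} {ν : Measure ℝ}

/-- Measurable functions on space-time which are integrable on `ℝ × K` for all compact `K`. -/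
def LocInt {n : ℕ} (ν : Measure ℝ) (F : ℝ → Heis n → ℝ) : Prop :=
  Measurable (Function.uncurry F) ∧
    ∀ K : Set (Heis n), IsCompact K → Integrable (Function.uncurry F) (ν.prod (volume.restrict K))

lemma prod_restrict_right [SFinite ν] (K : Set (Heis n)) :
    ν.prod ((volume : Measure (Heis n)).restrict K)
      = (ν.prod volume).restrict (univ ×ˢ K) := by
  rw [← Measure.prod_restrict, Measure.restrict_univ]

lemma LocInt.add {F F' : ℝ → Heis n → ℝ} (h : LocInt ν F) (h' : LocInt ν F') :
    LocInt ν fun t q => F t q + F' t q :=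
  ⟨h.1.add h'.1, fun K hK => (h.2 K hK).add (h'.2 K hK)⟩

lemma LocInt.sub {F F' : ℝ → Heis n → ℝ} (h : LocInt ν F) (h' : LocInt ν F') :
    LocInt ν fun t q => F t q - F' t q :=
  ⟨h.1.sub h'.1, fun K hK => (h.2 K hK).sub (h'.2 K hK)⟩

lemma LocInt.sum {ι : Type*} (s : Finset ι) {F : ι → ℝ → Heis n → ℝ} (h : ∀ i ∈ s, LocInt ν (F i)) :
    LocInt ν fun t q => ∑ i ∈ s, F i t q :=
  ⟨Finset.measurable_fun_sum s fun i hi => (h i hi).1,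
    fun K hK => integrable_finsetSum s fun i hi => (h i hi).2 K hK⟩

/-- A locally integrable function times a locally bounded one. -/
lemma LocInt.mul_bdd [SFinite ν] {F g : ℝ → Heis n → ℝ} (h : LocInt ν F)
    (hg : Measurable (Function.uncurry g))
    (hb : ∀ K : Set (Heis n), IsCompact K → ∃ C : ℝ, ∀ᵐ t ∂ν, ∀ q ∈ K, |g t q| ≤ C) :
    LocInt ν fun t q => F t q * g t q := by
  refine ⟨h.1.mul hg, fun K hK => ?_⟩
  obtain ⟨C, hC⟩ := hb K hK
  refine Integrable.mul_bdd (c := C) (h.2 K hK) hg.aestronglyMeasurable ?_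
  have h1 : ∀ᵐ z : ℝ × Heis n ∂(ν.prod (volume.restrict K)), ∀ q ∈ K, |g z.1 q| ≤ C :=
    Measure.quasiMeasurePreserving_fst.ae hC
  have h2 : ∀ᵐ z : ℝ × Heis n ∂(ν.prod (volume.restrict K)), z.2 ∈ K :=
    Measure.quasiMeasurePreserving_snd.ae (ae_restrict_mem hK.measurableSet)
  filter_upwards [h1, h2] with z hz1 hz2
  exact hz1 _ hz2

/-- A locally integrable function times a bounded one with compact support in space. -/
lemma LocInt.integrable_mul [SFinite ν] {F g : ℝ → Heis n → ℝ} (h : LocInt ν F)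
    (hg : Measurable (Function.uncurry g)) {C : ℝ} (hb : ∀ t q, |g t q| ≤ C)
    {K : Set (Heis n)} (hK : IsCompact K) (h0 : ∀ t, ∀ q ∉ K, g t q = 0) :
    Integrable (fun z : ℝ × Heis n => F z.1 z.2 * g z.1 z.2) (ν.prod volume) := by
  have h1 : Integrable (fun z : ℝ × Heis n => F z.1 z.2 * g z.1 z.2)
      (ν.prod (volume.restrict K)) :=
    Integrable.mul_bdd (c := C) (h.2 K hK) hg.aestronglyMeasurable
      (Filter.Eventually.of_forall fun z => hb _ _)
  rw [prod_restrict_right] at h1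
  refine (integrableOn_iff_integrable_of_support_subset fun z hz => ?_).1 h1
  refine ⟨mem_univ _, by_contra fun hn => hz ?_⟩
  simp [h0 _ _ hn]

lemma LocInt.ae_locallyIntegrable [SFinite ν] {F : ℝ → Heis n → ℝ} (h : LocInt ν F) :
    ∀ᵐ t ∂ν, LocallyIntegrable (F t) := by
  have h1 : ∀ᵐ t ∂ν, ∀ m : ℕ, IntegrableOn (F t) (Metric.closedBall (0 : Heis n) m) :=
    ae_all_iff.2 fun m => (h.2 _ (isCompact_closedBall _ _)).prod_right_ae
  filter_upwards [h1] with t ht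
  rw [locallyIntegrable_iff]
  intro K hK
  obtain ⟨R, hR⟩ := hK.isBounded.subset_closedBall (0 : Heis n)
  obtain ⟨m, hm⟩ := exists_nat_ge R
  exact (ht m).mono_set (hR.trans (Metric.closedBall_subset_closedBall hm))

/-- Local bounds for mollified functions. -/
lemma exists_enorm_mollify_le {k : Heis n → ℝ} (hk : Continuous k) (hc : HasCompactSupport k)
    {K : Set (Heis n)} (hK : IsCompact K) :
    ∃ C : ℝ, ∃ K' : Set (Heis n), IsCompact K' ∧
      (∀ p ∈ K, ∀ q, (-q) ⊙ p ∈ tsupport k → q ∈ K') ∧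
      ∀ f : Heis n → ℝ, ∀ p ∈ K,
        ‖mollify k f p‖ₑ ≤ ENNReal.ofReal C * ∫⁻ q in K', ‖f q‖ₑ := by
  obtain ⟨C, hC⟩ := hc.exists_bound_of_continuous hk
  refine ⟨C, (fun z : Heis n × Heis n => z.1 ⊙ (-z.2)) '' (K ×ˢ tsupport k),
    (hK.prod hc.isCompact).image (by fun_prop), fun p hp q hq => ?_, fun f p hp => ?_⟩
  · exact ⟨(p, (-q) ⊙ p), ⟨hp, hq⟩, by simp [neg_hmul_rev]⟩
  set K' := (fun z : Heis n × Heis n => z.1 ⊙ (-z.2)) '' (K ×ˢ tsupport k) with hK'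
  have hK'm : MeasurableSet K' := ((hK.prod hc.isCompact).image (by fun_prop)).measurableSet
  refine (enorm_integral_le_lintegral_enorm _).trans ?_
  rw [← lintegral_const_mul' _ _ ENNReal.ofReal_ne_top, ← lintegral_indicator hK'm]
  refine lintegral_mono fun q => ?_
  by_cases hq : (-q) ⊙ p ∈ tsupport k
  · have : q ∈ K' := ⟨(p, (-q) ⊙ p), ⟨hp, hq⟩, by simp [neg_hmul_rev]⟩
    rw [indicator_of_mem this, enorm_mul, mul_comm]
    gcongr
    rw [← ofReal_norm]
    exact ENNReal.ofReal_le_ofReal (hC _)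
  · simp [image_eq_zero_of_notMem_tsupport hq]

lemma measurable_mollify {F : ℝ → Heis n → ℝ} (hF : Measurable (Function.uncurry F))
    {k : Heis n → ℝ} (hk : Continuous k) :
    Measurable (Function.uncurry fun t p => mollify k (F t) p) := by
  have h1 : Measurable fun y : (ℝ × Heis n) × Heis n => F y.1.1 y.2 :=
    hF.comp_uncurry (by fun_prop) (by fun_prop)
  have h2 : Measurable fun y : (ℝ × Heis n) × Heis n => F y.1.1 y.2 * k ((-y.2) ⊙ y.1.2) :=
    h1.mul (hk.measurable.comp (by fun_prop))
  exact (h2.stronglyMeasurable.integral_prod_right (ν := volume)).measurable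

lemma LocInt.mollify [SFinite ν] {F : ℝ → Heis n → ℝ} (h : LocInt ν F) {k : Heis n → ℝ}
    (hk : Continuous k) (hc : HasCompactSupport k) :
    LocInt ν fun t p => mollify k (F t) p := by
  refine ⟨measurable_mollify h.1 hk, fun K hK => ⟨(measurable_mollify h.1 hk).aestronglyMeasurable,
    ?_⟩⟩
  obtain ⟨C, K', hK', -, hb⟩ := exists_enorm_mollify_le hk hc hK
  have hm : Measurable fun z : ℝ × Heis n => ‖_root_.mollify k (F z.1) z.2‖ₑ :=
    (measurable_mollify h.1 hk).enorm
  have hm' : Measurable fun z : ℝ × Heis n => ‖F z.1 z.2‖ₑ := h.1.enorm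
  have h2 := (h.2 K' hK').hasFiniteIntegral
  rw [HasFiniteIntegral] at h2 ⊢
  change ∫⁻ z : ℝ × Heis n, ‖F z.1 z.2‖ₑ ∂_ < ⊤ at h2
  rw [lintegral_prod _ hm'.aemeasurable] at h2
  change ∫⁻ z : ℝ × Heis n, ‖_root_.mollify k (F z.1) z.2‖ₑ ∂_ < ⊤
  rw [lintegral_prod _ hm.aemeasurable]
  calc ∫⁻ t, (∫⁻ p in K, ‖_root_.mollify k (F t) p‖ₑ) ∂ν
      ≤ ∫⁻ t, (ENNReal.ofReal C * volume K) * (∫⁻ q in K', ‖F t q‖ₑ) ∂ν := by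
        refine lintegral_mono fun t => ?_
        refine (setLIntegral_mono' hK.measurableSet fun p hp => hb (F t) p hp).trans_eq ?_
        rw [setLIntegral_const]
        ring
    _ < ⊤ := by
        rw [lintegral_const_mul' _ _ (ENNReal.mul_ne_top ENNReal.ofReal_ne_top
          (hK.measure_lt_top (μ := volume)).ne)]
        exact ENNReal.mul_lt_top (ENNReal.mul_lt_top ENNReal.ofReal_lt_top
          (hK.measure_lt_top (μ := volume))) h2

/-- Mollification of a time-uniformly locally integrable function is locally bounded. -/
lemma ae_abs_mollify_le {F : ℝ → Heis n → ℝ}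
    (h : ∀ K : Set (Heis n), IsCompact K → ∃ N : ℝ, ∀ᵐ t ∂ν,
      ∫⁻ q in K, ‖F t q‖ₑ ≤ ENNReal.ofReal N) {k : Heis n → ℝ} (hk : Continuous k)
    (hc : HasCompactSupport k) {K : Set (Heis n)} (hK : IsCompact K) :
    ∃ C : ℝ, ∀ᵐ t ∂ν, ∀ p ∈ K, |mollify k (F t) p| ≤ C := by
  obtain ⟨C, K', hK', -, hb⟩ := exists_enorm_mollify_le hk hc hK
  obtain ⟨N, hN⟩ := h K' hK'
  refine ⟨(ENNReal.ofReal C * ENNReal.ofReal N).toReal, hN.mono fun t ht p hp => ?_⟩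
  have h1 := (hb (F t) p hp).trans (mul_le_mul' le_rfl ht)
  rw [← Real.norm_eq_abs, ← toReal_enorm]
  exact ENNReal.toReal_mono (by finiteness) h1

lemma integrable_mul_kernel {F : ℝ → Heis n → ℝ} [SFinite ν] (h : LocInt ν F) {k : Heis n → ℝ}
    (hk : Continuous k) (hc : HasCompactSupport k) (p : Heis n) {η : ℝ → ℝ} (hη : Measurable η)
    {C : ℝ} (hC : ∀ t, |η t| ≤ C) :
    Integrable (fun z : ℝ × Heis n => F z.1 z.2 * (k ((-z.2) ⊙ p) * η z.1)) (ν.prod volume) := by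
  obtain ⟨C', hC'⟩ := hc.exists_bound_of_continuous hk
  obtain ⟨-, K', hK', hs, -⟩ := exists_enorm_mollify_le hk hc (isCompact_singleton (x := p))
  refine h.integrable_mul (g := fun t q => k ((-q) ⊙ p) * η t) (C := C' * C) ?_ (fun t q => ?_) hK'
    fun t q hq => ?_
  · exact ((hk.comp (by fun_prop : Continuous fun q : Heis n => (-q) ⊙ p)).measurable.comp
      measurable_snd).mul (hη.comp measurable_fst)
  · rw [abs_mul]
    exact mul_le_mul (hC' ((-q) ⊙ p)) (hC t) (abs_nonneg _) ((norm_nonneg _).trans (hC' 0))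
  · rw [image_eq_zero_of_notMem_tsupport fun hn => hq (hs p rfl q hn), zero_mul]

/-- Fubini: testing in space-time with κ(q⁻¹p) η(t) amounts to testing the mollified function at p
in time. -/
lemma integral_mul_kernel {F : ℝ → Heis n → ℝ} [SFinite ν] (h : LocInt ν F) {k : Heis n → ℝ}
    (hk : Continuous k) (hc : HasCompactSupport k) (p : Heis n) {η : ℝ → ℝ} (hη : Measurable η)
    {C : ℝ} (hC : ∀ t, |η t| ≤ C) :
    ∫ z : ℝ × Heis n, F z.1 z.2 * (k ((-z.2) ⊙ p) * η z.1) ∂(ν.prod volume)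
      = ∫ t, mollify k (F t) p * η t ∂ν := by
  rw [integral_prod _ (integrable_mul_kernel h hk hc p hη hC)]
  refine integral_congr_ae (Filter.Eventually.of_forall fun t => ?_)
  simp only [_root_.mollify, ← integral_mul_const]
  exact integral_congr_ae (Filter.Eventually.of_forall fun q => by ring)

lemma integrable_mollify_time {F : ℝ → Heis n → ℝ} [SFinite ν] (h : LocInt ν F) {k : Heis n → ℝ}
    (hk : Continuous k) (hc : HasCompactSupport k) (p : Heis n) :
    Integrable (fun t => mollify k (F t) p) ν := by
  have := (integrable_mul_kernel h hk hc p (η := fun _ => 1) measurable_const (C := 1)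
    (by simp)).integral_prod_left
  simpa [_root_.mollify] using this

end parametric

/-! ### The ODE in time satisfied by the mollified solution at a fixed point. -/

section mollifiedEquation

variable {n : ℕ}

lemma clm_rightField (L : Heis n →L[ℝ] ℝ) (a w : Heis n) :
    L (rightField a w) = ∑ j, hcoord j a * L (rightField (hbasis j) w) + a.2.2 * L (vert 1) := by
  -- By antisymmetry of ω a right field at w is a left field at −w, so the frame expansion need not
  -- be redone.
  have e : ∀ v : Heis n, rightField v w = leftField v (-w) := fun v => by
    simp only [rightField, leftField, symplForm_neg_left, ← symplForm_swap]
  simp only [e, clm_leftField L a (-w)]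

/-- The kernels of the mollified derivatives along right- and left-invariant fields. -/
def rightKernel {n : ℕ} (κ : Heis n → ℝ) (v w : Heis n) : ℝ := fderiv ℝ κ w (rightField v w)

/-- The kernels of the mollified derivatives along left-invariant fields. -/
def leftKernel {n : ℕ} (κ : Heis n → ℝ) (v w : Heis n) : ℝ := fderiv ℝ κ w (leftField v w)

lemma continuous_rightKernel {κ : Heis n → ℝ} (hκ : ContDiff ℝ ∞ κ) (v : Heis n) :
    Continuous (rightKernel κ v) :=
  (hκ.continuous_fderiv (by simp)).clm_apply
    (continuous_const.add (contDiff_vert.continuous.comp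
      (continuous_symplForm.comp (by fun_prop : Continuous fun w : Heis n => (v, w)))))

lemma continuous_leftKernel {κ : Heis n → ℝ} (hκ : ContDiff ℝ ∞ κ) (v : Heis n) :
    Continuous (leftKernel κ v) :=
  (hκ.continuous_fderiv (by simp)).clm_apply (by fun_prop)

lemma hasCompactSupport_rightKernel {κ : Heis n → ℝ} (hc : HasCompactSupport κ) (v : Heis n) :
    HasCompactSupport (rightKernel κ v) := hasCompactSupport_fderiv_apply hc _

lemma hasCompactSupport_leftKernel {κ : Heis n → ℝ} (hc : HasCompactSupport κ) (v : Heis n) :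
    HasCompactSupport (leftKernel κ v) := hasCompactSupport_fderiv_apply hc _

/-- The weak formulation of the transport equation on `(0, T] × ℍⁿ`; the field is given by its
components `B` in the left-invariant frame. -/
def IsWeakTransport {n : ℕ} (T : ℝ) (B : ℝ → Heis n → Heis n) (D c u : ℝ → Heis n → ℝ)
    (u₀ : Heis n → ℝ) : Prop :=
  ∀ φ : ℝ × Heis n → ℝ, ContDiff ℝ ∞ φ → HasCompactSupport φ → tsupport φ ⊆ {z | z.1 < T} →
    -(∫ p, u₀ p * φ (0, p)) + ∫ z : ℝ × Heis n, u z.1 z.2 * (-timeDeriv φ z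
      + fderiv ℝ φ z (0, leftField (B z.1 z.2) z.2) + (c z.1 z.2 + D z.1 z.2) * φ z)
      ∂((volume.restrict (Ioc 0 T)).prod volume) = 0

/-- Integrability of the coefficients and of their products with the solution. -/
structure TransportIntegrability {n : ℕ} (ν : Measure ℝ) (B : ℝ → Heis n → Heis n)
    (D c u : ℝ → Heis n → ℝ) (u₀ : Heis n → ℝ) : Prop where
  hor : ∀ j, LocInt ν fun t q => hcoord j (B t q)
  ver : LocInt ν fun t q => (B t q).2.2
  div : LocInt ν D
  sol : LocInt ν u
  sol_bound : ∀ K : Set (Heis n), IsCompact K → ∃ N : ℝ, ∀ᵐ t ∂ν,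
    ∫⁻ q in K, ‖u t q‖ₑ ≤ ENNReal.ofReal N
  sol_hor : ∀ j, LocInt ν fun t q => u t q * hcoord j (B t q)
  sol_ver : LocInt ν fun t q => u t q * (B t q).2.2
  sol_div : LocInt ν fun t q => u t q * D t q
  sol_zero : LocInt ν fun t q => c t q * u t q
  init : LocallyIntegrable u₀

/-- The right-hand side of the mollified equation. -/
def mollifiedSource {n : ℕ} (κ : Heis n → ℝ) (B : ℝ → Heis n → Heis n) (D c u : ℝ → Heis n → ℝ)
    (t : ℝ) (p : Heis n) : ℝ :=
  mollify κ (fun q => c t q * u t q) p + mollify κ (fun q => u t q * D t q) p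
    - (∑ j, mollify (rightKernel κ (hbasis j)) (fun q => u t q * hcoord j (B t q)) p
      + mollify (leftKernel κ (vert 1)) (fun q => u t q * (B t q).2.2) p)

variable {T : ℝ} {B : ℝ → Heis n → Heis n} {D c u : ℝ → Heis n → ℝ} {u₀ : Heis n → ℝ}
  {κ : Heis n → ℝ}

lemma TransportIntegrability.locInt_mollifiedSource {ν : Measure ℝ} [SFinite ν]
    (h : TransportIntegrability ν B D c u u₀)
    (hκ : ContDiff ℝ ∞ κ) (hc : HasCompactSupport κ) : LocInt ν (mollifiedSource κ B D c u) :=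
  ((h.sol_zero.mollify hκ.continuous hc).add (h.sol_div.mollify hκ.continuous hc)).sub
    ((LocInt.sum _ fun j _ => (h.sol_hor j).mollify (continuous_rightKernel hκ _)
      (hasCompactSupport_rightKernel hc _)).add (h.sol_ver.mollify (continuous_leftKernel hκ _)
      (hasCompactSupport_leftKernel hc _)))

lemma fderiv_prod_mul {η : ℝ → ℝ} {k : Heis n → ℝ} (hη : ContDiff ℝ ∞ η) (hk : ContDiff ℝ ∞ k)
    (z : ℝ × Heis n) (a : ℝ) (V : Heis n) :
    fderiv ℝ (fun z : ℝ × Heis n => η z.1 * k z.2) z (a, V)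
      = η z.1 * fderiv ℝ k z.2 V + a * deriv η z.1 * k z.2 := by
  have h1 : HasFDerivAt (fun z : ℝ × Heis n => η z.1) _ z :=
    ((hη.differentiable (by simp) z.1).hasFDerivAt).comp z hasFDerivAt_fst
  have h2 : HasFDerivAt (fun z : ℝ × Heis n => k z.2) _ z :=
    ((hk.differentiable (by simp) z.2).hasFDerivAt).comp z hasFDerivAt_snd
  have h0 : fderiv ℝ (fun z : ℝ × Heis n => η z.1 * k z.2) z = _ := (h1.mul h2).fderiv
  rw [h0]
  have h3 : fderiv ℝ η z.1 a = a * deriv η z.1 := by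
    rw [← fderiv_apply_one_eq_deriv, ← smul_eq_mul, ← map_smul, smul_eq_mul, mul_one]
  simp [h3]
  ring

lemma integral_add_sub_add {α : Type*} [MeasurableSpace α] {μ : Measure α} {a b s d : α → ℝ}
    (ha : Integrable a μ) (hb : Integrable b μ) (hs : Integrable s μ) (hd : Integrable d μ) :
    ∫ x, (a x + b x - (s x + d x)) ∂μ
      = (∫ x, a x ∂μ) + (∫ x, b x ∂μ) - ((∫ x, s x ∂μ) + ∫ x, d x ∂μ) := by
  have h1 : ∫ x, (a x + b x - (s x + d x)) ∂μ = (∫ x, (a x + b x) ∂μ) - ∫ x, (s x + d x) ∂μ :=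
    integral_sub (ha.add hb) (hs.add hd)
  rw [h1, integral_add ha hb, integral_add hs hd]

/-- The equation is tested with η(t) κ(q⁻¹p), where p is a parameter. The identity holds at every p,
not merely almost every one, which lets the chain rule be applied point by point. -/
lemma IsWeakTransport.mollified (hw : IsWeakTransport T B D c u u₀)
    (h : TransportIntegrability (volume.restrict (Ioc 0 T)) B D c u u₀) (hκ : ContDiff ℝ ∞ κ)
    (hc : HasCompactSupport κ) (p : Heis n) {η : ℝ → ℝ} (hη : ContDiff ℝ ∞ η)
    (hηc : HasCompactSupport η) (hηT : tsupport η ⊆ Iio T) :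
    -(mollify κ u₀ p * η 0) - (∫ t in Ioc 0 T, mollify κ (u t) p * deriv η t)
      + ∫ t in Ioc 0 T, mollifiedSource κ B D c u t p * η t = 0 := by
  set k : Heis n → ℝ := fun q => κ ((-q) ⊙ p) with hk
  have hkd : ContDiff ℝ ∞ k := hκ.comp (by fun_prop)
  have hkc : HasCompactSupport k :=
    hc.comp_homeomorph (negHmul p)
  have hφ : ContDiff ℝ ∞ fun z : ℝ × Heis n => η z.1 * k z.2 :=
    (hη.comp contDiff_fst).mul (hkd.comp contDiff_snd)
  have hφc : HasCompactSupport fun z : ℝ × Heis n => η z.1 * k z.2 := by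
    refine HasCompactSupport.intro (hηc.isCompact.prod hkc.isCompact) fun z hz => ?_
    by_contra hn
    exact hz ⟨subset_closure (left_ne_zero_of_mul hn), subset_closure (right_ne_zero_of_mul hn)⟩
  have hφT : tsupport (fun z : ℝ × Heis n => η z.1 * k z.2) ⊆ {z | z.1 < T} := by
    refine (closure_minimal (fun z hz => ?_) ((isClosed_tsupport η).preimage continuous_fst)).trans
      fun z hz => hηT hz
    exact subset_closure (left_ne_zero_of_mul hz)
  have e := hw _ hφ hφc hφT
  obtain ⟨C, hC⟩ := hηc.exists_bound_of_continuous hη.continuous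
  have hη'c : Continuous (deriv η) := hη.continuous_deriv (by simp)
  obtain ⟨C', hC'⟩ := hηc.deriv.exists_bound_of_continuous hη'c
  have hm := hη.continuous.measurable
  have hm' := hη'c.measurable
  have hκc := hκ.continuous
  have hr := fun j : Fin n ⊕ Fin n => continuous_rightKernel hκ (hbasis j)
  have hrc := fun j : Fin n ⊕ Fin n => hasCompactSupport_rightKernel hc (hbasis j)
  have hv := continuous_leftKernel hκ (vert 1)
  have hvc := hasCompactSupport_leftKernel hc (vert 1 : Heis n)
  have i1 := integrable_mul_kernel h.sol hκc hc p hm' hC'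
  have i2 := integrable_mul_kernel h.sol_zero hκc hc p hm hC
  have i3 := integrable_mul_kernel h.sol_div hκc hc p hm hC
  have i4 := fun j => integrable_mul_kernel (h.sol_hor j) (hr j) (hrc j) p hm hC
  have i5 := integrable_mul_kernel h.sol_ver hv hvc p hm hC
  have j1 := integral_mul_kernel h.sol hκc hc p hm' hC'
  have j2 := integral_mul_kernel h.sol_zero hκc hc p hm hC
  have j3 := integral_mul_kernel h.sol_div hκc hc p hm hC
  have j4 := fun j => integral_mul_kernel (h.sol_hor j) (hr j) (hrc j) p hm hC
  have j5 := integral_mul_kernel h.sol_ver hv hvc p hm hC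
  have l := fun {F : ℝ → Heis n → ℝ} (hF : LocInt (volume.restrict (Ioc 0 T)) F)
    {k : Heis n → ℝ} (h1 : Continuous k) (h2 : HasCompactSupport k) =>
    Integrable.mul_bdd (integrable_mollify_time hF h1 h2 p) hm.aestronglyMeasurable
      (Filter.Eventually.of_forall hC)
  -- The spatial derivative of the test function has become minus a right-invariant derivative of κ.
  -- This is the origin of the minus sign before the field terms in the source.
  have e1 : ∀ z : ℝ × Heis n, u z.1 z.2 * (-timeDeriv (fun z => η z.1 * k z.2) z
      + fderiv ℝ (fun z : ℝ × Heis n => η z.1 * k z.2) z (0, leftField (B z.1 z.2) z.2)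
      + (c z.1 z.2 + D z.1 z.2) * (η z.1 * k z.2))
      = c z.1 z.2 * u z.1 z.2 * (κ ((-z.2) ⊙ p) * η z.1)
        + u z.1 z.2 * D z.1 z.2 * (κ ((-z.2) ⊙ p) * η z.1)
        - (∑ j, u z.1 z.2 * hcoord j (B z.1 z.2)
            * (rightKernel κ (hbasis j) ((-z.2) ⊙ p) * η z.1)
          + u z.1 z.2 * (B z.1 z.2).2.2 * (leftKernel κ (vert 1) ((-z.2) ⊙ p) * η z.1))
        - u z.1 z.2 * (κ ((-z.2) ⊙ p) * deriv η z.1) := by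
    intro z
    rw [timeDeriv, fderiv_prod_mul hη hkd, fderiv_prod_mul hη hkd,
      fderiv_kernel_rightField (hκ.differentiable (by simp)), clm_rightField]
    simp only [map_zero, mul_zero, zero_mul, zero_add, add_zero, one_mul, hk, rightKernel,
      leftKernel, leftField_vert_one]
    have : ∑ j, u z.1 z.2 * hcoord j (B z.1 z.2)
        * (fderiv ℝ κ ((-z.2) ⊙ p) (rightField (hbasis j) ((-z.2) ⊙ p)) * η z.1)
        = u z.1 z.2 * η z.1 * ∑ j, hcoord j (B z.1 z.2) *
          fderiv ℝ κ ((-z.2) ⊙ p) (rightField (hbasis j) ((-z.2) ⊙ p)) := by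
      rw [Finset.mul_sum]
      exact Finset.sum_congr rfl fun j _ => by ring
    rw [this]
    ring
  rw [integral_congr_ae (Filter.Eventually.of_forall e1)] at e
  have i4s := integrable_finsetSum Finset.univ fun j _ => i4 j
  have f1 : ∫ z : ℝ × Heis n, (c z.1 z.2 * u z.1 z.2 * (κ ((-z.2) ⊙ p) * η z.1)
        + u z.1 z.2 * D z.1 z.2 * (κ ((-z.2) ⊙ p) * η z.1)
        - (∑ j, u z.1 z.2 * hcoord j (B z.1 z.2)
            * (rightKernel κ (hbasis j) ((-z.2) ⊙ p) * η z.1)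
          + u z.1 z.2 * (B z.1 z.2).2.2 * (leftKernel κ (vert 1) ((-z.2) ⊙ p) * η z.1))
        - u z.1 z.2 * (κ ((-z.2) ⊙ p) * deriv η z.1))
        ∂((volume.restrict (Ioc 0 T)).prod volume) = _ :=
    integral_sub ((i2.add i3).sub (i4s.add i5)) i1
  rw [f1, j1] at e
  have f2 := integral_add_sub_add i2 i3 i4s i5
  rw [integral_finsetSum _ fun j _ => i4 j, j2, j3, j5, Finset.sum_congr rfl fun j _ => j4 j] at f2
  have l4s := integrable_finsetSum Finset.univ fun j _ => l (h.sol_hor j) (hr j) (hrc j)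
  have f3 := integral_add_sub_add (l h.sol_zero hκc hc) (l h.sol_div hκc hc) l4s
    (l h.sol_ver hv hvc)
  rw [integral_finsetSum _ fun j _ => l (h.sol_hor j) (hr j) (hrc j)] at f3
  have e2 : ∫ t in Ioc 0 T, mollifiedSource κ B D c u t p * η t = _ :=
    (integral_congr_ae (Filter.Eventually.of_forall fun t => by
      simp only [mollifiedSource, sub_mul, add_mul, Finset.sum_mul])).trans f3
  have e3 : ∫ q, u₀ q * (η 0 * k q) = mollify κ u₀ p * η 0 := by
    rw [mollify, ← integral_mul_const]
    exact integral_congr_ae (Filter.Eventually.of_forall fun q => by simp only [hk]; ring)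
  simp only [hk] at e3
  simp only at e
  rw [e2]
  erw [f2] at e
  linarith

end mollifiedEquation

/-! ### Chain rule and integration by parts for the mollified equation. -/

section renormalizedMollified

variable {n : ℕ}

lemma LocInt.integrable_mul_of_hasCompactSupport {ν : Measure ℝ} [SFinite ν]
    {F : ℝ → Heis n → ℝ} (h : LocInt ν F) {g : ℝ × Heis n → ℝ} (hg : Continuous g)
    (hc : HasCompactSupport g) :
    Integrable (fun z : ℝ × Heis n => F z.1 z.2 * g z) (ν.prod volume) := by
  obtain ⟨C, hC⟩ := hc.exists_bound_of_continuous hg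
  refine h.integrable_mul (g := fun t q => g (t, q)) (C := C) hg.measurable (fun t q => hC _)
    (hc.isCompact.image continuous_snd) fun t q hq => ?_
  exact image_eq_zero_of_notMem_tsupport fun hn => hq ⟨_, hn, rfl⟩

/-- The derivative of the mollified function along the field with components `B`. -/
def mollifiedDeriv {n : ℕ} (κ : Heis n → ℝ) (B : ℝ → Heis n → Heis n) (u : ℝ → Heis n → ℝ)
    (t : ℝ) (p : Heis n) : ℝ :=
  ∑ j, hcoord j (B t p) * mollify (leftKernel κ (hbasis j)) (u t) p
    + (B t p).2.2 * mollify (leftKernel κ (vert 1)) (u t) p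

/-- The commutator of mollification and transport. -/
def mollifiedCommutator {n : ℕ} (κ : Heis n → ℝ) (B : ℝ → Heis n → Heis n)
    (D u : ℝ → Heis n → ℝ) (t : ℝ) (p : Heis n) : ℝ :=
  mollifiedDeriv κ B u t p + mollify κ (fun q => u t q * D t q) p
    - (∑ j, mollify (rightKernel κ (hbasis j)) (fun q => u t q * hcoord j (B t q)) p
      + mollify (leftKernel κ (vert 1)) (fun q => u t q * (B t q).2.2) p)

lemma mollifiedSource_eq (κ : Heis n → ℝ) (B : ℝ → Heis n → Heis n) (D c u : ℝ → Heis n → ℝ)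
    (t : ℝ) (p : Heis n) : mollifiedSource κ B D c u t p =
      mollify κ (fun q => c t q * u t q) p + mollifiedCommutator κ B D u t p
        - mollifiedDeriv κ B u t p := by
  rw [mollifiedSource, mollifiedCommutator]
  ring

lemma fderiv_mollify_leftField {κ : Heis n → ℝ} (hκ : ContDiff ℝ ∞ κ) (hc : HasCompactSupport κ)
    {B : ℝ → Heis n → Heis n} {u : ℝ → Heis n → ℝ} {t : ℝ} (hu : LocallyIntegrable (u t))
    (p : Heis n) : fderiv ℝ (mollify κ (u t)) p (leftField (B t p) p) = mollifiedDeriv κ B u t p := by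
  have h : ∀ v, fderiv ℝ (mollify κ (u t)) p (leftField v p) = mollify (leftKernel κ v) (u t) p :=
    fun v => fderiv_mollify hu hκ hc p v
  have h2 := h (vert 1)
  rw [leftField_vert_one] at h2
  rw [clm_leftField, mollifiedDeriv, h2]
  simp only [h]

lemma abs_le_of_abs_deriv_le {β : ℝ → ℝ} (hβ : ContDiff ℝ 1 β) {M : ℝ}
    (hM : ∀ x, |deriv β x| ≤ M) (x : ℝ) : |β x| ≤ |β 0| + M * |x| := by
  have h := (lipschitzWith_of_abs_deriv_le hβ hM).dist_le_mul x 0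
  rw [Real.coe_toNNReal _ ((abs_nonneg _).trans (hM 0)), Real.dist_eq, Real.dist_eq,
    sub_zero] at h
  have := abs_sub_abs_le_abs_sub (β x) (β 0)
  linarith

lemma measurable_deriv_of_contDiff {β : ℝ → ℝ} (hβ : ContDiff ℝ 1 β) : Measurable (deriv β) :=
  (hβ.continuous_deriv le_rfl).measurable

/-- β grows at most linearly. Finiteness of the time measure is needed for the constant β(0). -/
lemma LocInt.comp_lipschitz {ν : Measure ℝ} [IsFiniteMeasure ν] {F : ℝ → Heis n → ℝ}
    (h : LocInt ν F) {β : ℝ → ℝ} (hβ : ContDiff ℝ 1 β) {M : ℝ} (hM : ∀ x, |deriv β x| ≤ M) :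
    LocInt ν fun t q => β (F t q) := by
  refine ⟨hβ.continuous.measurable.comp h.1, fun K hK => ?_⟩
  have : IsFiniteMeasure ((volume : Measure (Heis n)).restrict K) :=
    ⟨by simpa using hK.measure_lt_top⟩
  refine ((integrable_const |β 0|).add ((h.2 K hK).norm.const_mul M)).mono'
    (hβ.continuous.measurable.comp h.1).aestronglyMeasurable
    (Filter.Eventually.of_forall fun z => ?_)
  exact abs_le_of_abs_deriv_le hβ hM _

variable {T : ℝ} {B : ℝ → Heis n → Heis n} {D c u : ℝ → Heis n → ℝ} {u₀ : Heis n → ℝ}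
  {κ : Heis n → ℝ}

section

variable {ν : Measure ℝ} [SFinite ν]

/-- The components of the field are only integrable in time, but the mollified derivatives of u are
bounded on compact sets uniformly in time, because u is L^∞ in time with values in L¹_loc. -/
lemma TransportIntegrability.locInt_mollifiedDeriv
    (h : TransportIntegrability ν B D c u u₀)
    (hκ : ContDiff ℝ ∞ κ) (hc : HasCompactSupport κ) : LocInt ν (mollifiedDeriv κ B u) := by
  have h1 : ∀ v : Heis n, Measurable (Function.uncurry fun t p => mollify (leftKernel κ v) (u t) p) :=
    fun v => measurable_mollify h.sol.1 (continuous_leftKernel hκ v)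
  have h2 := fun (v : Heis n) (K : Set (Heis n)) (hK : IsCompact K) =>
    ae_abs_mollify_le h.sol_bound (continuous_leftKernel hκ v) (hasCompactSupport_leftKernel hc v) hK
  exact (LocInt.sum _ fun j _ => (h.hor j).mul_bdd (h1 _) (h2 _)).add (h.ver.mul_bdd (h1 _) (h2 _))

lemma TransportIntegrability.locInt_mollifiedCommutator
    (h : TransportIntegrability ν B D c u u₀)
    (hκ : ContDiff ℝ ∞ κ) (hc : HasCompactSupport κ) : LocInt ν (mollifiedCommutator κ B D u) :=
  ((h.locInt_mollifiedDeriv hκ hc).add (h.sol_div.mollify hκ.continuous hc)).sub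
    ((LocInt.sum _ fun j _ => (h.sol_hor j).mollify (continuous_rightKernel hκ _)
      (hasCompactSupport_rightKernel hc _)).add (h.sol_ver.mollify (continuous_leftKernel hκ _)
      (hasCompactSupport_leftKernel hc _)))

lemma fderiv_space_leftField {φ : ℝ × Heis n → ℝ} (z : ℝ × Heis n) (a : Heis n) :
    fderiv ℝ φ z (0, leftField a z.2)
      = ∑ j, hcoord j a * fderiv ℝ φ z (0, leftField (hbasis j) z.2)
        + a.2.2 * fderiv ℝ φ z (0, vert 1) := by
  have := clm_leftField ((fderiv ℝ φ z).comp (ContinuousLinearMap.inr ℝ ℝ (Heis n))) a z.2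
  simpa using this

/-- Integrability of a bounded function against the adjoint transport operator. -/
lemma integrable_mul_adjoint {g : ℝ → Heis n → ℝ}
    (hhor : ∀ j, LocInt ν fun t q => hcoord j (B t q) * g t q)
    (hver : LocInt ν fun t q => (B t q).2.2 * g t q) (hdiv : LocInt ν fun t q => D t q * g t q)
    {φ : ℝ × Heis n → ℝ} (hφ : ContDiff ℝ ∞ φ) (hφc : HasCompactSupport φ) :
    Integrable (fun z : ℝ × Heis n => g z.1 z.2 *
      (fderiv ℝ φ z (0, leftField (B z.1 z.2) z.2) + D z.1 z.2 * φ z)) (ν.prod volume) := by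
  have hfc := hφ.continuous_fderiv (by simp)
  have hs : ∀ V : ℝ × Heis n → ℝ × Heis n, HasCompactSupport fun z => fderiv ℝ φ z (V z) :=
    fun V => (hφc.fderiv ℝ).mono fun z hz h0 => hz (by simp [h0])
  have i1 := fun j : Fin n ⊕ Fin n => (hhor j).integrable_mul_of_hasCompactSupport
    (g := fun z => fderiv ℝ φ z (0, leftField (hbasis j) z.2))
    (hfc.clm_apply (by fun_prop)) (hs _)
  have i2 := hver.integrable_mul_of_hasCompactSupport
    (g := fun z => fderiv ℝ φ z (0, vert 1)) (hfc.clm_apply (by fun_prop)) (hs _)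
  have i3 := hdiv.integrable_mul_of_hasCompactSupport hφ.continuous hφc
  refine (((integrable_finsetSum Finset.univ fun j _ => i1 j).add i2).add i3).congr
    (Filter.Eventually.of_forall fun z => ?_)
  simp only [Pi.add_apply]
  rw [fderiv_space_leftField, mul_add, mul_add, Finset.mul_sum]
  congr 1
  · congr 1
    · exact Finset.sum_congr rfl fun j _ => by ring
    · ring
  · ring

lemma integrable_mul_timeDeriv {g : ℝ → Heis n → ℝ} (hg : LocInt ν g) {φ : ℝ × Heis n → ℝ}
    (hφ : ContDiff ℝ ∞ φ) (hφc : HasCompactSupport φ) :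
    Integrable (fun z : ℝ × Heis n => g z.1 z.2 * timeDeriv φ z) (ν.prod volume) :=
  hg.integrable_mul_of_hasCompactSupport ((hφ.continuous_fderiv (by simp)).clm_apply (by fun_prop))
    ((hφc.fderiv ℝ).mono fun z hz h0 => hz (by simp [timeDeriv, h0]))

end

lemma deriv_section {φ : ℝ × Heis n → ℝ} (hφ : ContDiff ℝ ∞ φ) (t : ℝ) (p : Heis n) :
    deriv (fun t => φ (t, p)) t = timeDeriv φ (t, p) := by
  have h1 : HasDerivAt (fun t : ℝ => (t, p)) ((1 : ℝ), (0 : Heis n)) t :=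
    (hasDerivAt_id t).prodMk (hasDerivAt_const t p)
  exact (((hφ.differentiable (by simp) (t, p)).hasFDerivAt).comp_hasDerivAt t h1).deriv

lemma fderiv_section {φ : ℝ × Heis n → ℝ} (hφ : ContDiff ℝ ∞ φ) (t : ℝ) (p V : Heis n) :
    fderiv ℝ (fun p => φ (t, p)) p V = fderiv ℝ φ (t, p) (0, V) := by
  have h1 : HasFDerivAt (fun p : Heis n => (t, p)) (ContinuousLinearMap.inr ℝ ℝ (Heis n)) p :=
    (hasFDerivAt_const t p).prodMk (hasFDerivAt_id p)
  have h2 := ((hφ.differentiable (by simp) (t, p)).hasFDerivAt.comp p h1).fderiv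
  have h3 : fderiv ℝ (fun p => φ (t, p)) p = _ := h2
  rw [h3]
  simp

lemma hasCompactSupport_section {φ : ℝ × Heis n → ℝ} (hφc : HasCompactSupport φ) (t : ℝ) :
    HasCompactSupport fun p => φ (t, p) :=
  HasCompactSupport.intro (hφc.isCompact.image continuous_snd) fun _ hp =>
    image_eq_zero_of_notMem_tsupport fun hn => hp ⟨_, hn, rfl⟩

/-- Integration by parts in space for the mollified equation. -/
lemma integral_deriv_mollify_mul {b : Heis n → Heis n} {d f : Heis n → ℝ}
    (hdiv : IsDivergence b d) (hf : LocallyIntegrable f) (hκ : ContDiff ℝ ∞ κ)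
    (hc : HasCompactSupport κ) {β : ℝ → ℝ} (hβ : ContDiff ℝ 1 β) {φ : Heis n → ℝ}
    (hφ : ContDiff ℝ ∞ φ) (hφc : HasCompactSupport φ) :
    ∫ p, deriv β (mollify κ f p) * φ p * fderiv ℝ (mollify κ f) p (b p)
      = -∫ p, β (mollify κ f p) * (fderiv ℝ φ p (b p) + d p * φ p) := by
  have hm := contDiff_mollify hf hκ hc
  have hφ1 : ContDiff ℝ 1 φ := hφ.of_le (by exact_mod_cast le_top)
  have hβm : ContDiff ℝ 1 fun p => β (mollify κ f p) := hβ.comp hm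
  -- The divergence is tested with β(u_ε) φ, which is merely C¹ because β is.
  have hΦ : ContDiff ℝ 1 fun p => β (mollify κ f p) * φ p := hβm.mul hφ1
  have hΦc : HasCompactSupport fun p => β (mollify κ f p) * φ p := hφc.mul_left
  have e := hdiv.integral_eq hΦ hΦc
  have i1 : Integrable fun p => d p * (β (mollify κ f p) * φ p) :=
    integrable_mul_of_hasCompactSupport hdiv.2.1 hΦ.continuous hΦc
  have clm : ∀ L : Heis n → Heis n →L[ℝ] ℝ, Continuous L → (∀ p ∉ tsupport φ, L p = 0) →
      Integrable fun p => L p (b p) := by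
    intro L hL h0
    have hLc : HasCompactSupport L := HasCompactSupport.intro hφc.isCompact h0
    obtain ⟨C, hC⟩ := hLc.exists_bound_of_continuous hL
    exact Integrable.clm_apply_of_integrableOn hφc.isCompact.measurableSet hL.aestronglyMeasurable
      hdiv.1.aestronglyMeasurable hC h0 (hdiv.1.integrableOn_isCompact hφc.isCompact)
  have i2 : Integrable fun p => (β (mollify κ f p) • fderiv ℝ φ p) (b p) :=
    clm _ (hβm.continuous.smul (hφ1.continuous_fderiv one_ne_zero)) fun p hp => by
      rw [fderiv_eq_zero_of_notMem_tsupport hp, smul_zero]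
  have i3 : Integrable fun p => ((deriv β (mollify κ f p) * φ p) • fderiv ℝ (mollify κ f) p) (b p) :=
    clm _ ((((hβ.continuous_deriv le_rfl).comp hm.continuous).mul hφ.continuous).smul
      (hm.continuous_fderiv one_ne_zero)) fun p hp => by
      rw [image_eq_zero_of_notMem_tsupport hp, mul_zero, zero_smul]
  have hd : ∀ p, fderiv ℝ (fun p => β (mollify κ f p) * φ p) p (b p)
      = (β (mollify κ f p) • fderiv ℝ φ p) (b p)
        + ((deriv β (mollify κ f p) * φ p) • fderiv ℝ (mollify κ f) p) (b p) := by
    intro p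
    have h1 : HasFDerivAt (fun p => β (mollify κ f p))
        (deriv β (mollify κ f p) • fderiv ℝ (mollify κ f) p) p :=
      ((hβ.differentiable one_ne_zero _).hasDerivAt).comp_hasFDerivAt p
        (hm.differentiable one_ne_zero p).hasFDerivAt
    have h2 : fderiv ℝ (fun p => β (mollify κ f p) * φ p) p = _ :=
      (h1.mul (hφ1.differentiable one_ne_zero p).hasFDerivAt).fderiv
    rw [h2]
    simp only [add_apply, smul_apply, smul_eq_mul]
    ring
  rw [integral_congr_ae (Filter.Eventually.of_forall hd), integral_add i2 i3] at e
  have e2 : ∫ p, β (mollify κ f p) * (fderiv ℝ φ p (b p) + d p * φ p)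
      = (∫ p, (β (mollify κ f p) • fderiv ℝ φ p) (b p)) + ∫ p, d p * (β (mollify κ f p) * φ p) := by
    rw [← integral_add i2 i1]
    exact integral_congr_ae (Filter.Eventually.of_forall fun p => by
      simp only [smul_apply, smul_eq_mul]; ring)
  have e3 : ∫ p, β (mollify κ f p) * φ p * d p = ∫ p, d p * (β (mollify κ f p) * φ p) :=
    integral_congr_ae (Filter.Eventually.of_forall fun p => by ring)
  rw [e2]
  simp only [smul_apply, smul_eq_mul] at e ⊢
  linarith

/-- The renormalized equation for the mollified solution. -/
lemma IsWeakTransport.renormalized_mollified (hT : 0 < T) (hw : IsWeakTransport T B D c u u₀)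
    (h : TransportIntegrability (volume.restrict (Ioc 0 T)) B D c u u₀)
    (hdiv : ∀ᵐ t ∂(volume.restrict (Ioc 0 T)),
      IsDivergence (fun p => leftField (B t p) p) (D t))
    (hκ : ContDiff ℝ ∞ κ) (hc : HasCompactSupport κ) {β : ℝ → ℝ} (hβ : ContDiff ℝ 1 β) {M : ℝ}
    (hM : ∀ x, |deriv β x| ≤ M) {φ : ℝ × Heis n → ℝ} (hφ : ContDiff ℝ ∞ φ)
    (hφc : HasCompactSupport φ) (hφT : tsupport φ ⊆ {z | z.1 < T}) :
    -(∫ p, β (mollify κ u₀ p) * φ (0, p))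
      + (∫ z : ℝ × Heis n, β (mollify κ (u z.1) z.2) * (-timeDeriv φ z
          + fderiv ℝ φ z (0, leftField (B z.1 z.2) z.2) + D z.1 z.2 * φ z)
          ∂((volume.restrict (Ioc 0 T)).prod volume))
      + ∫ z : ℝ × Heis n, deriv β (mollify κ (u z.1) z.2) * φ z *
          (mollify κ (fun q => c z.1 q * u z.1 q) z.2 + mollifiedCommutator κ B D u z.1 z.2)
          ∂((volume.restrict (Ioc 0 T)).prod volume) = 0 := by
  set ν : Measure ℝ := volume.restrict (Ioc 0 T) with hν
  set v : ℝ → Heis n → ℝ := fun t => mollify κ (u t) with hv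
  have hκc := hκ.continuous
  have hvL : LocInt ν v := h.sol.mollify hκc hc
  have hβv : LocInt ν fun t p => β (v t p) := hvL.comp_lipschitz hβ hM
  have hβ'm : Measurable (Function.uncurry fun t p => deriv β (v t p)) :=
    (measurable_deriv_of_contDiff hβ).comp hvL.1
  have hβ'b : ∀ K : Set (Heis n), IsCompact K → ∃ C : ℝ, ∀ᵐ t ∂ν, ∀ q ∈ K,
      |deriv β (v t q)| ≤ C := fun K _ => ⟨M, Filter.Eventually.of_forall fun t q _ => hM _⟩
  have hβb : ∀ K : Set (Heis n), IsCompact K → ∃ C : ℝ, ∀ᵐ t ∂ν, ∀ q ∈ K, |β (v t q)| ≤ C := by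
    intro K hK
    obtain ⟨C, hC⟩ := ae_abs_mollify_le h.sol_bound hκc hc hK
    refine ⟨|β 0| + M * C, hC.mono fun t ht q hq => (abs_le_of_abs_deriv_le hβ hM _).trans ?_⟩
    have := mul_le_mul_of_nonneg_left (ht q hq) ((abs_nonneg _).trans (hM 0))
    simpa [hv] using this
  have hS := h.locInt_mollifiedSource hκ hc
  have hcu := h.sol_zero.mollify hκc hc
  have hC := h.locInt_mollifiedCommutator hκ hc
  have hE := h.locInt_mollifiedDeriv hκ hc
  have iβ : ∀ {F : ℝ → Heis n → ℝ}, LocInt ν F →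
      Integrable (fun z : ℝ × Heis n => deriv β (v z.1 z.2) * φ z * F z.1 z.2) (ν.prod volume) :=
    fun hF => ((hF.mul_bdd hβ'm hβ'b).integrable_mul_of_hasCompactSupport hφ.continuous hφc).congr
      (Filter.Eventually.of_forall fun z => by ring)
  have i1 := integrable_mul_timeDeriv hβv hφ hφc
  have i2 := iβ hS
  have i3 := integrable_mul_adjoint (fun j => (h.hor j).mul_bdd hβv.1 hβb)
    (h.ver.mul_bdd hβv.1 hβb) (h.div.mul_bdd hβv.1 hβb) hφ hφc
  -- The chain rule in time at each p, with test function t ↦ φ(t,p), is integrated over p by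
  -- Fubini.
  have step1 : -(∫ p, β (mollify κ u₀ p) * φ (0, p))
      - (∫ z : ℝ × Heis n, β (v z.1 z.2) * timeDeriv φ z ∂(ν.prod volume))
      + ∫ z : ℝ × Heis n, deriv β (v z.1 z.2) * φ z * mollifiedSource κ B D c u z.1 z.2
          ∂(ν.prod volume) = 0 := by
    have hp : ∀ p, -(β (mollify κ u₀ p) * φ (0, p)) - (∫ t, β (v t p) * timeDeriv φ (t, p) ∂ν)
        + ∫ t, deriv β (v t p) * φ (t, p) * mollifiedSource κ B D c u t p ∂ν = 0 := by
      intro p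
      have hS1 : Integrable (fun t => mollifiedSource κ B D c u t p) ν := by
        refine Integrable.sub (Integrable.add ?_ ?_) (Integrable.add (integrable_finsetSum _
          fun j _ => ?_) ?_)
        · exact integrable_mollify_time h.sol_zero hκc hc p
        · exact integrable_mollify_time h.sol_div hκc hc p
        · exact integrable_mollify_time (h.sol_hor j) (continuous_rightKernel hκ _)
            (hasCompactSupport_rightKernel hc _) p
        · exact integrable_mollify_time h.sol_ver (continuous_leftKernel hκ _)
            (hasCompactSupport_leftKernel hc _) p
      have := weak_chain_rule hT (integrable_mollify_time h.sol hκc hc p) hS1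
        (fun η h1 h2 h3 => hw.mollified h hκ hc p h1 h2 h3) hβ hM (η := fun t => φ (t, p))
        (hφ.comp (by fun_prop)) (image_eq_zero_of_notMem_tsupport fun hn =>
          lt_irrefl T (hφT hn))
      simp only [deriv_section hφ] at this
      refine Eq.trans ?_ this
      congr 1
      exact integral_congr_ae (Filter.Eventually.of_forall fun t => by simp only [hv]; ring)
    have i0 : Integrable fun p => β (mollify κ u₀ p) * φ (0, p) :=
      integrable_mul_of_hasCompactSupport
        ((hβ.continuous.comp (contDiff_mollify h.init hκ hc).continuous).locallyIntegrable)
        (hφ.continuous.comp (by fun_prop)) (hasCompactSupport_section hφc 0)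
    have i1' := i1.integral_prod_right
    have i2' := i2.integral_prod_right
    have i0' : Integrable fun p => -(β (mollify κ u₀ p) * φ (0, p)) := i0.neg
    have i01 : Integrable fun p => -(β (mollify κ u₀ p) * φ (0, p))
        - ∫ t, β (v t p) * timeDeriv φ (t, p) ∂ν := i0'.sub i1'
    rw [integral_prod_symm _ i1, integral_prod_symm _ i2, ← integral_neg,
      ← integral_sub i0' i1', ← integral_add i01 i2']
    exact (integral_congr_ae (Filter.Eventually.of_forall hp)).trans (integral_zero _ _)
  -- The source equals mollified c u plus the commutator minus the transport derivative of u_ε. The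
  -- last of these is integrated by parts in space at almost every time, which restores the adjoint
  -- operator acting on φ.
  have step2 : ∫ z : ℝ × Heis n, deriv β (v z.1 z.2) * φ z * mollifiedDeriv κ B u z.1 z.2
      ∂(ν.prod volume) = -∫ z : ℝ × Heis n, β (v z.1 z.2) *
        (fderiv ℝ φ z (0, leftField (B z.1 z.2) z.2) + D z.1 z.2 * φ z) ∂(ν.prod volume) := by
    rw [integral_prod _ (iβ hE), integral_prod _ i3, ← integral_neg]
    refine integral_congr_ae ?_
    filter_upwards [hdiv, h.sol.ae_locallyIntegrable] with t ht hut
    have := integral_deriv_mollify_mul ht hut hκ hc hβ (φ := fun p => φ (t, p))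
      (hφ.comp (by fun_prop)) (hasCompactSupport_section hφc t)
    simp only [fderiv_section hφ, fderiv_mollify_leftField hκ hc hut] at this
    exact this
  have iB := iβ (hcu.add hC)
  have e1 : ∫ z : ℝ × Heis n, deriv β (v z.1 z.2) * φ z * mollifiedSource κ B D c u z.1 z.2
      ∂(ν.prod volume) = (∫ z : ℝ × Heis n, deriv β (v z.1 z.2) * φ z *
          (mollify κ (fun q => c z.1 q * u z.1 q) z.2 + mollifiedCommutator κ B D u z.1 z.2)
          ∂(ν.prod volume))
        - ∫ z : ℝ × Heis n, deriv β (v z.1 z.2) * φ z * mollifiedDeriv κ B u z.1 z.2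
          ∂(ν.prod volume) := by
    rw [← integral_sub iB (iβ hE)]
    exact integral_congr_ae (Filter.Eventually.of_forall fun z => by
      simp only [mollifiedSource_eq]; ring)
  have e2 : ∫ z : ℝ × Heis n, β (v z.1 z.2) * (-timeDeriv φ z
          + fderiv ℝ φ z (0, leftField (B z.1 z.2) z.2) + D z.1 z.2 * φ z) ∂(ν.prod volume)
      = (∫ z : ℝ × Heis n, β (v z.1 z.2) *
        (fderiv ℝ φ z (0, leftField (B z.1 z.2) z.2) + D z.1 z.2 * φ z) ∂(ν.prod volume))
        - ∫ z : ℝ × Heis n, β (v z.1 z.2) * timeDeriv φ z ∂(ν.prod volume) := by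
    rw [← integral_sub i3 i1]
    exact integral_congr_ae (Filter.Eventually.of_forall fun z => by ring)
  rw [e2]
  rw [e1, step2] at step1
  linarith

end renormalizedMollified

/-! ### Mixed local Lebesgue spaces, and the contact field and its divergence in them. -/

section mixed

variable {n : ℕ} {ν : Measure ℝ} {s s' : ℝ≥0∞}

/-- Measurable functions in `L¹(ν; L^r_loc)`. -/
def MixedInt {n : ℕ} (ν : Measure ℝ) (r : ℝ≥0∞) (X : ℝ → Heis n → ℝ) : Prop :=
  Measurable (Function.uncurry X) ∧ ∀ K : Set (Heis n), IsCompact K →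
    ∫⁻ t, eLpNorm (X t) r (volume.restrict K) ∂ν < ⊤

/-- Measurable functions in `L^∞(ν; L^r_loc)`. -/
def MixedBdd {n : ℕ} (ν : Measure ℝ) (r : ℝ≥0∞) (X : ℝ → Heis n → ℝ) : Prop :=
  Measurable (Function.uncurry X) ∧ ∀ K : Set (Heis n), IsCompact K →
    ∃ N : ℝ, ∀ᵐ t ∂ν, eLpNorm (X t) r (volume.restrict K) ≤ ENNReal.ofReal N

lemma measurable_section {X : ℝ → Heis n → ℝ} (hX : Measurable (Function.uncurry X)) (t : ℝ) :
    Measurable (X t) := hX.of_uncurry_left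

lemma MixedInt.add {r : ℝ≥0∞} (hr : 1 ≤ r) {X Y : ℝ → Heis n → ℝ} (hX : MixedInt ν r X)
    (hY : MixedInt ν r Y) : MixedInt ν r fun t q => X t q + Y t q := by
  refine ⟨hX.1.add hY.1, fun K hK => ?_⟩
  refine lt_of_le_of_lt (lintegral_mono fun t => eLpNorm_add_le
    (measurable_section hX.1 t).aestronglyMeasurable
    (measurable_section hY.1 t).aestronglyMeasurable hr) ?_
  rw [lintegral_add_left (measurable_eLpNorm_section hX.1 r)]
  exact ENNReal.add_lt_top.2 ⟨hX.2 K hK, hY.2 K hK⟩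

lemma MixedInt.mul_bdd {r : ℝ≥0∞} {X g : ℝ → Heis n → ℝ} (hX : MixedInt ν r X)
    (hg : Measurable (Function.uncurry g)) {C : ℝ} (hC : ∀ t q, |g t q| ≤ C) :
    MixedInt ν r fun t q => X t q * g t q := by
  refine ⟨hX.1.mul hg, fun K hK => ?_⟩
  refine lt_of_le_of_lt (lintegral_mono fun t => eLpNorm_le_mul_eLpNorm_of_ae_le_mul (g := X t)
    (c := C) (Filter.Eventually.of_forall fun q => ?_) r) ?_
  · rw [norm_mul, mul_comm]
    exact mul_le_mul_of_nonneg_right (hC t q) (norm_nonneg _)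
  · rw [lintegral_const_mul' _ _ ENNReal.ofReal_ne_top]
    exact ENNReal.mul_lt_top ENNReal.ofReal_lt_top (hX.2 K hK)

lemma mixedInt_zero {r : ℝ≥0∞} : MixedInt (n := n) ν r fun _ _ => 0 :=
  ⟨measurable_const, fun K _ => by simp⟩

lemma MixedInt.sum {ι : Type*} (I : Finset ι) {r : ℝ≥0∞} (hr : 1 ≤ r) {X : ι → ℝ → Heis n → ℝ}
    (h : ∀ i ∈ I, MixedInt ν r (X i)) : MixedInt ν r fun t q => ∑ i ∈ I, X i t q := by
  classical
  induction I using Finset.induction_on with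
  | empty => simpa using mixedInt_zero
  | insert i I hi ih =>
    simp only [Finset.sum_insert hi]
    exact (h i (Finset.mem_insert_self _ _)).add hr
      (ih fun j hj => h j (Finset.mem_insert_of_mem hj))

lemma mixedBdd_const (r : ℝ≥0∞) (a : ℝ) : MixedBdd (n := n) ν r fun _ _ => a := by
  refine ⟨measurable_const, fun K hK => ?_⟩
  have : IsFiniteMeasure ((volume : Measure (Heis n)).restrict K) :=
    ⟨by simpa using hK.measure_lt_top⟩
  have h : eLpNorm (fun _ : Heis n => a) r (volume.restrict K) < ⊤ := (memLp_const a).2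
  exact ⟨_, Filter.Eventually.of_forall fun t => (ENNReal.ofReal_toReal h.ne).ge⟩

lemma mixedInt_const [IsFiniteMeasure ν] (r : ℝ≥0∞) (a : ℝ) :
    MixedInt (n := n) ν r fun _ _ => a := by
  refine ⟨measurable_const, fun K hK => ?_⟩
  have : IsFiniteMeasure ((volume : Measure (Heis n)).restrict K) :=
    ⟨by simpa using hK.measure_lt_top⟩
  have h : eLpNorm (fun _ : Heis n => a) r (volume.restrict K) < ⊤ := (memLp_const a).2
  rw [lintegral_const]
  exact ENNReal.mul_lt_top h (measure_lt_top _ _)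

lemma MixedBdd.lintegral_mul_lt_top {u X : ℝ → Heis n → ℝ} (hu : MixedBdd ν s u)
    (hX : MixedInt ν s' X) {K : Set (Heis n)} (hK : IsCompact K) :
    ∫⁻ t, eLpNorm (u t) s (volume.restrict K) * eLpNorm (X t) s' (volume.restrict K) ∂ν < ⊤ := by
  obtain ⟨N, hN⟩ := hu.2 K hK
  refine (lintegral_mono_ae (hN.mono fun t ht => mul_le_mul' ht le_rfl)).trans_lt ?_
  rw [lintegral_const_mul' _ _ ENNReal.ofReal_ne_top]
  exact ENNReal.mul_lt_top ENNReal.ofReal_lt_top (hX.2 K hK)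

/-- Hölder's inequality for the mixed spaces. -/
lemma MixedBdd.locInt_mul [SFinite ν] [ENNReal.HolderConjugate s s'] {u X : ℝ → Heis n → ℝ}
    (hu : MixedBdd ν s u) (hX : MixedInt ν s' X) : LocInt ν fun t q => u t q * X t q := by
  refine ⟨hu.1.mul hX.1, fun K hK => ⟨(hu.1.mul hX.1).aestronglyMeasurable, ?_⟩⟩
  have hm : Measurable fun z : ℝ × Heis n => ‖u z.1 z.2 * X z.1 z.2‖ₑ := (hu.1.mul hX.1).enorm
  change ∫⁻ z : ℝ × Heis n, ‖u z.1 z.2 * X z.1 z.2‖ₑ ∂_ < ⊤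
  rw [lintegral_prod _ hm.aemeasurable]
  refine (lintegral_mono fun t => ?_).trans_lt (hu.lintegral_mul_lt_top hX hK)
  simp only [enorm_mul]
  exact lintegral_enorm_mul_le (measurable_section hu.1 t).aestronglyMeasurable
    (measurable_section hX.1 t).aestronglyMeasurable

/-- Hölder's inequality against the constant 1, which lies in every local space. -/
lemma MixedInt.locInt [SFinite ν] {r : ℝ≥0∞} (hr : 1 ≤ r) {X : ℝ → Heis n → ℝ}
    (hX : MixedInt ν r X) : LocInt ν X := by
  have := ENNReal.HolderConjugate.conjExponent hr
  simpa using (mixedBdd_const (n := n) (ν := ν) (ENNReal.conjExponent r) 1).locInt_mul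
    (s := ENNReal.conjExponent r) (s' := r) hX

lemma MixedBdd.lintegral_le [ENNReal.HolderConjugate s s'] {u : ℝ → Heis n → ℝ}
    (hu : MixedBdd ν s u) {K : Set (Heis n)} (hK : IsCompact K) :
    ∃ N : ℝ, ∀ᵐ t ∂ν, ∫⁻ q in K, ‖u t q‖ₑ ≤ ENNReal.ofReal N := by
  obtain ⟨N, hN⟩ := hu.2 K hK
  have : IsFiniteMeasure ((volume : Measure (Heis n)).restrict K) :=
    ⟨by simpa using hK.measure_lt_top⟩
  have h : eLpNorm (fun _ : Heis n => (1 : ℝ)) s' (volume.restrict K) < ⊤ := (memLp_const 1).2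
  refine ⟨(ENNReal.ofReal N * eLpNorm (fun _ : Heis n => (1 : ℝ)) s' (volume.restrict K)).toReal,
    hN.mono fun t ht => ?_⟩
  rw [ENNReal.ofReal_toReal (by finiteness)]
  have := lintegral_enorm_mul_le (s := s) (s' := s') (μ := volume.restrict K)
    (measurable_section hu.1 t).aestronglyMeasurable
    (aestronglyMeasurable_const (b := (1 : ℝ)))
  simp only [enorm_one, mul_one] at this
  exact this.trans (mul_le_mul' ht le_rfl)

/-- A generating function with its weak derivatives, together with a vertical derivative. -/
structure ContactData {n : ℕ} (ν : Measure ℝ) (r : ℝ≥0∞) (ψ S : ℝ → Heis n → ℝ)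
    (G : Fin n ⊕ Fin n → ℝ → Heis n → ℝ)
    (H : Fin n ⊕ Fin n → Fin n ⊕ Fin n → ℝ → Heis n → ℝ) : Prop where
  mem : MixedInt ν r ψ
  mem_vert : MixedInt ν r S
  mem_grad : ∀ j, MixedInt ν r (G j)
  mem_hess : ∀ i j, MixedInt ν r (H i j)
  grad : ∀ j, ∀ᵐ t ∂ν, IsWeakDerivAlong (leftField (hbasis j)) (ψ t) (G j t)
  hess : ∀ i j, ∀ᵐ t ∂ν, IsWeakDerivAlong (leftField (hbasis i)) (G j t) (H i j t)
  vert : ∀ᵐ t ∂ν, IsWeakDerivAlong (leftField (vert 1)) (ψ t) (S t)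

/-- The components of the time-dependent contact field. -/
def contactField {n : ℕ} (ψ : ℝ → Heis n → ℝ) (G : Fin n ⊕ Fin n → ℝ → Heis n → ℝ)
    (t : ℝ) (q : Heis n) : Heis n := contactVec (ψ t) (fun j => G j t) q

/-- The divergence of the time-dependent contact field. -/
def contactFieldDiv {n : ℕ} (S : ℝ → Heis n → ℝ)
    (H : Fin n ⊕ Fin n → Fin n ⊕ Fin n → ℝ → Heis n → ℝ) (t : ℝ) (q : Heis n) : ℝ :=
  contactDiv (fun i j => H i j t) (S t) q

variable {ψ S : ℝ → Heis n → ℝ} {G : Fin n ⊕ Fin n → ℝ → Heis n → ℝ}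
    {H : Fin n ⊕ Fin n → Fin n ⊕ Fin n → ℝ → Heis n → ℝ} {r : ℝ≥0∞}

lemma MixedInt.const_mul {X : ℝ → Heis n → ℝ} (hX : MixedInt ν r X) (a : ℝ) :
    MixedInt ν r fun t q => a * X t q := by
  simpa only [mul_comm] using hX.mul_bdd (g := fun _ _ => a) measurable_const fun _ _ => le_rfl

lemma ContactData.mem_hor (h : ContactData ν r ψ S G H) (j : Fin n ⊕ Fin n) :
    MixedInt ν r fun t q => hcoord j (contactField ψ G t q) := by
  simp only [contactField, hcoord_contactVec]
  exact (h.mem_grad j.swap).const_mul _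

lemma ContactData.mem_ver (h : ContactData ν r ψ S G H) :
    MixedInt ν r fun t q => (contactField ψ G t q).2.2 := by
  simp only [contactField, contactVec, ← neg_mul]
  exact h.mem.const_mul _

lemma ContactData.mem_div (hr : 1 ≤ r) (h : ContactData ν r ψ S G H) :
    MixedInt ν r (contactFieldDiv S H) := by
  have e : contactFieldDiv S H
      = fun t q => ∑ i, contactSign i * H i i.swap t q + -4 * S t q := by
    funext t q
    simp only [contactFieldDiv, contactDiv]
    ring
  rw [e]
  exact (MixedInt.sum Finset.univ hr fun i _ => (h.mem_hess i i.swap).const_mul _).add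
    hr (h.mem_vert.const_mul (-4))

lemma measurable_iff_hcoord {X : Type*} [MeasurableSpace X] {B : X → Heis n}
    (h1 : ∀ j, Measurable fun x => hcoord j (B x)) (h2 : Measurable fun x => (B x).2.2) :
    Measurable B :=
  (measurable_pi_iff.2 fun j => h1 (Sum.inl j)).prodMk
    ((measurable_pi_iff.2 fun j => h1 (Sum.inr j)).prodMk h2)

/-- The divergence of a contact field with weak derivatives. -/
lemma isDivergence_contactVec {ψ S : Heis n → ℝ} {G : Fin n ⊕ Fin n → Heis n → ℝ}
    {H : Fin n ⊕ Fin n → Fin n ⊕ Fin n → Heis n → ℝ}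
    (hH : ∀ i j, IsWeakDerivAlong (leftField (hbasis i)) (G j) (H i j))
    (hS : IsWeakDerivAlong (leftField (vert 1)) ψ S) :
    IsDivergence (fun p => leftField (contactVec ψ G p) p) (contactDiv H S) := by
  have hb : (fun p => leftField (contactVec ψ G p) p) = fun p =>
      ∑ j, (contactSign j * G j.swap p) • leftField (hbasis j) p + (-4 * ψ p) • vert 1 := by
    funext p
    rw [leftField_eq_sum]
    simp only [hcoord_contactVec]
    simp [contactVec]
  have hsm : ∀ {f : Heis n → ℝ} {V : Heis n → Heis n}, LocallyIntegrable f → Continuous V →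
      LocallyIntegrable fun p => f p • V p := fun {f V} hf hV =>
    (locallyIntegrable_iff).2 fun K hK =>
      (hf.integrableOn_isCompact hK).smul_continuousOn hV.continuousOn hK
  refine ⟨?_, ?_, fun φ hφ hc => ?_⟩
  · rw [hb]
    refine LocallyIntegrable.add (locallyIntegrable_finsetSum _ fun j _ => hsm ?_ ?_) (hsm ?_ ?_)
    · exact (hH j.swap j.swap).1.smul (contactSign j)
    · fun_prop
    · exact hS.1.smul (-4 : ℝ)
    · fun_prop
  · refine LocallyIntegrable.sub (locallyIntegrable_finsetSum _ fun i _ => ?_) ?_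
    · exact (hH i i.swap).2.1.smul (contactSign i)
    · exact hS.2.1.smul (4 : ℝ)
  · have e : ∀ p, fderiv ℝ φ p (leftField (contactVec ψ G p) p)
        = ∑ j, contactSign j * (G j.swap p * fderiv ℝ φ p (leftField (hbasis j) p))
          - 4 * (ψ p * fderiv ℝ φ p (leftField (vert 1) p)) := by
      intro p
      rw [clm_leftField, leftField_vert_one]
      simp only [hcoord_contactVec]
      rw [sub_eq_add_neg]
      congr 1
      · exact Finset.sum_congr rfl fun j _ => by ring
      · simp only [contactVec]
        ring
    have i1 := fun j : Fin n ⊕ Fin n =>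
      (integrable_mul_fderiv (hH j j.swap).1 hφ hc (hbasis j)).const_mul (contactSign j)
    have i2 := (integrable_mul_fderiv hS.1 hφ hc (vert 1)).const_mul 4
    have i3 := fun j : Fin n ⊕ Fin n =>
      (integrable_mul_of_hasCompactSupport (hH j j.swap).2.1 hφ.continuous hc).const_mul
        (contactSign j)
    have i4 := (integrable_mul_of_hasCompactSupport hS.2.1 hφ.continuous hc).const_mul 4
    have e2 : ∀ p, φ p * contactDiv H S p
        = ∑ j, contactSign j * (H j j.swap p * φ p) - 4 * (S p * φ p) := by
      intro p
      rw [contactDiv, mul_sub, Finset.mul_sum]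
      congr 1
      · exact Finset.sum_congr rfl fun j _ => by ring
      · ring
    simp only [e, e2]
    rw [integral_sub (integrable_finsetSum _ fun j _ => i1 j) i2,
      integral_sub (integrable_finsetSum _ fun j _ => i3 j) i4,
      integral_finsetSum _ fun j _ => i1 j, integral_finsetSum _ fun j _ => i3 j]
    simp only [integral_const_mul]
    simp only [hS.2.2 φ hφ hc, fun j : Fin n ⊕ Fin n => (hH j j.swap).2.2 φ hφ hc, mul_neg,
      Finset.sum_neg_distrib]
    ring

lemma ContactData.isDivergence (h : ContactData ν r ψ S G H) : ∀ᵐ t ∂ν,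
    IsDivergence (fun p => leftField (contactField ψ G t p) p) (contactFieldDiv S H t) := by
  have h1 := ae_all_iff.2 fun i => ae_all_iff.2 fun j => h.hess i j
  filter_upwards [h1, h.vert] with t ht htv
  exact isDivergence_contactVec ht htv

lemma ContactData.transportIntegrability [IsFiniteMeasure ν] (hs' : 1 ≤ s')
    [ENNReal.HolderConjugate s s'] (h : ContactData ν s' ψ S G H) {c u : ℝ → Heis n → ℝ}
    {u₀ : Heis n → ℝ} (hu : MixedBdd ν s u) (hcu : LocInt ν fun t q => c t q * u t q)
    (hu₀ : LocallyIntegrable u₀) :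
    TransportIntegrability ν (contactField ψ G) (contactFieldDiv S H) c u u₀ where
  hor j := (h.mem_hor j).locInt hs'
  ver := h.mem_ver.locInt hs'
  div := (h.mem_div hs').locInt hs'
  sol := by simpa using hu.locInt_mul (s' := s') (mixedInt_const s' 1)
  sol_bound K hK := hu.lintegral_le (s' := s') hK
  sol_hor j := hu.locInt_mul (h.mem_hor j)
  sol_ver := hu.locInt_mul h.mem_ver
  sol_div := hu.locInt_mul (h.mem_div hs')
  sol_zero := hcu
  init := hu₀

/-- The commutator as an integral against the commutator kernel. -/
lemma mollifiedCommutator_eq [SFinite ν] {c u : ℝ → Heis n → ℝ} {u₀ : Heis n → ℝ}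
    (h : TransportIntegrability ν (contactField ψ G) (contactFieldDiv S H) c u u₀)
    {κ : Heis n → ℝ} (hκ : ContDiff ℝ ∞ κ) (hc : HasCompactSupport κ) :
    ∀ᵐ t ∂ν, ∀ p, mollifiedCommutator κ (contactField ψ G) (contactFieldDiv S H) u t p
      = ∫ q, u t q * commutatorKernel κ (ψ t) (fun j => G j t)
        (contactDiv (fun i j => H i j t) (S t)) q p := by
  have h1 := ae_all_iff.2 fun j => (h.sol_hor j).ae_locallyIntegrable
  filter_upwards [h.sol.ae_locallyIntegrable, h1, h.sol_ver.ae_locallyIntegrable,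
    h.sol_div.ae_locallyIntegrable] with t hu huh huv hud p
  have l : ∀ {f k : Heis n → ℝ}, LocallyIntegrable f → Continuous k → HasCompactSupport k →
      Integrable fun q => f q * k ((-q) ⊙ p) := fun hf hk hkc =>
    integrable_mul_of_hasCompactSupport hf (hk.comp (by fun_prop)) (hkc.comp_homeomorph (negHmul p))
  have lk := fun v : Heis n => l hu (continuous_leftKernel hκ v) (hasCompactSupport_leftKernel hc v)
  have j1 := fun j : Fin n ⊕ Fin n => (lk (hbasis j)).const_mul (hcoord j (contactField ψ G t p))
  have j2 := (lk (vert 1)).const_mul (contactField ψ G t p).2.2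
  have j3 := l hud hκ.continuous hc
  have j4 := fun j : Fin n ⊕ Fin n => l (huh j) (continuous_rightKernel hκ (hbasis j))
    (hasCompactSupport_rightKernel hc _)
  have j5 := l huv (continuous_leftKernel hκ (vert 1)) (hasCompactSupport_leftKernel hc _)
  have f1 := integral_add_sub_add ((integrable_finsetSum Finset.univ fun j _ => j1 j).add j2) j3
    (integrable_finsetSum Finset.univ fun j _ => j4 j) j5
  have f2 := integral_add (integrable_finsetSum Finset.univ fun j _ => j1 j) j2
  simp only [Pi.add_apply] at f1
  rw [f2, integral_finsetSum _ fun j _ => j1 j, integral_finsetSum _ fun j _ => j4 j] at f1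
  simp only [integral_const_mul] at f1
  refine Eq.trans ?_ (f1.symm.trans (integral_congr_ae (Filter.Eventually.of_forall fun q => ?_)))
  · rfl
  · simp only [commutatorKernel]
    change _ = u t q * (fderiv ℝ κ ((-q) ⊙ p) (leftField (contactField ψ G t p) ((-q) ⊙ p))
      - fderiv ℝ κ ((-q) ⊙ p) (rightField (contactField ψ G t q) ((-q) ⊙ p))
      + contactFieldDiv S H t q * κ ((-q) ⊙ p))
    rw [clm_leftField, clm_rightField]
    have e1 : ∑ j, hcoord j (contactField ψ G t p) * (u t q * leftKernel κ (hbasis j) ((-q) ⊙ p))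
        = u t q * ∑ j, hcoord j (contactField ψ G t p) * leftKernel κ (hbasis j) ((-q) ⊙ p) := by
      rw [Finset.mul_sum]
      exact Finset.sum_congr rfl fun j _ => by ring
    have e2 : ∑ j, u t q * hcoord j (contactField ψ G t q) * rightKernel κ (hbasis j) ((-q) ⊙ p)
        = u t q * ∑ j, hcoord j (contactField ψ G t q) * rightKernel κ (hbasis j) ((-q) ⊙ p) := by
      rw [Finset.mul_sum]
      exact Finset.sum_congr rfl fun j _ => by ring
    rw [e1, e2]
    simp only [leftKernel, rightKernel, leftField_vert_one]
    ring

end mixed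

/-! ### Convergence of mollifications and vanishing of the commutator. -/

section limits

open Filter Topology

variable {n : ℕ} {ν : Measure ℝ} {s s' : ℝ≥0∞}

lemma heisBox_subset_closedBall {ε r : ℝ} (h1 : ε ≤ r) (h2 : ε ^ 2 ≤ r) :
    heisBox n ε ⊆ Metric.closedBall 0 r := by
  intro h hh
  have hr : 0 ≤ r := (sq_nonneg ε).trans h2
  rw [mem_closedBall_zero_iff, Prod.norm_def, Prod.norm_def]
  refine max_le ((pi_norm_le_iff_of_nonneg hr).2 fun j => ?_)
    (max_le ((pi_norm_le_iff_of_nonneg hr).2 fun j => ?_) (hh.2.trans h2))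
  · exact (hh.1 (Sum.inl j)).trans h1
  · exact (hh.1 (Sum.inr j)).trans h1

lemma eventually_heisBox_subset {ε : ℕ → ℝ} (hε : Tendsto ε atTop (𝓝 0)) {U : Set (Heis n)}
    (hU : U ∈ 𝓝 0) : ∀ᶠ m in atTop, heisBox n (ε m) ⊆ U := by
  obtain ⟨r, hr, hrU⟩ := Metric.nhds_basis_closedBall.mem_iff.1 hU
  have h2 : Tendsto (fun m => ε m ^ 2) atTop (𝓝 0) := by simpa using hε.pow 2
  filter_upwards [hε.eventually (ge_mem_nhds hr), h2.eventually (ge_mem_nhds hr)] with m h1 h2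
  exact (heisBox_subset_closedBall h1 h2).trans hrU

lemma tendsto_zero_of_forall_le_mul {F : ℕ → ℝ≥0∞} {C : ℝ≥0∞} (hC : C ≠ ⊤)
    (h : ∀ δ : ℝ≥0∞, 0 < δ → ∀ᶠ m in atTop, F m ≤ C * δ) : Tendsto F atTop (𝓝 0) := by
  rw [ENNReal.tendsto_nhds_zero]
  intro δ hδ
  by_cases hC0 : C = 0
  · filter_upwards [h 1 one_pos] with m hm
    exact hm.trans (by simp [hC0])
  · filter_upwards [h (δ / C) (ENNReal.div_pos hδ.ne' hC)] with m hm
    exact hm.trans ENNReal.mul_div_le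

lemma tendsto_wInt_box {f g : ℝ → Heis n → ℝ}
    (h : Tendsto (fun h => wInt ν f fun t q => g t (q ⊙ h) - g t q) (𝓝 0) (𝓝 0)) {ε : ℕ → ℝ}
    (hε : Tendsto ε atTop (𝓝 0)) {δ : ℝ≥0∞} (hδ : 0 < δ) :
    ∀ᶠ m in atTop, ∀ w ∈ heisBox n (ε m), wInt ν f (fun t q => g t (q ⊙ w) - g t q) ≤ δ :=
  eventually_heisBox_subset hε ((ENNReal.tendsto_nhds_zero.1 h) δ hδ)

lemma MixedBdd.mul_bdd {r : ℝ≥0∞} {X g : ℝ → Heis n → ℝ} (hX : MixedBdd ν r X)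
    (hg : Measurable (Function.uncurry g)) {C : ℝ} (hC : ∀ t q, |g t q| ≤ C) :
    MixedBdd ν r fun t q => X t q * g t q := by
  refine ⟨hX.1.mul hg, fun K hK => ?_⟩
  obtain ⟨N, hN⟩ := hX.2 K hK
  have hC0 : 0 ≤ C := (abs_nonneg _).trans (hC 0 0)
  refine ⟨C * N, hN.mono fun t ht => (eLpNorm_le_mul_eLpNorm_of_ae_le_mul (g := X t)
    (c := C) (Eventually.of_forall fun q => ?_) r).trans ?_⟩
  · rw [norm_mul, mul_comm]
    exact mul_le_mul_of_nonneg_right (hC t q) (norm_nonneg _)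
  · rw [ENNReal.ofReal_mul hC0]
    exact mul_le_mul' le_rfl ht

lemma MixedInt.ae_lt_top {r : ℝ≥0∞} {X : ℝ → Heis n → ℝ} (hX : MixedInt ν r X)
    {K : Set (Heis n)} (hK : IsCompact K) : ∀ᵐ t ∂ν, eLpNorm (X t) r (volume.restrict K) < ⊤ :=
  MeasureTheory.ae_lt_top (measurable_eLpNorm_section hX.1 r) (hX.2 K hK).ne

lemma MixedBdd.ae_lt_top {r : ℝ≥0∞} {X : ℝ → Heis n → ℝ} (hX : MixedBdd ν r X)
    {K : Set (Heis n)} (hK : IsCompact K) : ∀ᵐ t ∂ν, eLpNorm (X t) r (volume.restrict K) < ⊤ := by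
  obtain ⟨N, hN⟩ := hX.2 K hK
  exact hN.mono fun t ht => ht.trans_lt ENNReal.ofReal_lt_top

lemma LocInt.mixedInt [SFinite ν] {F : ℝ → Heis n → ℝ} (h : LocInt ν F) : MixedInt ν 1 F := by
  refine ⟨h.1, fun K hK => ?_⟩
  have h1 := (h.2 K hK).hasFiniteIntegral
  have hm : Measurable fun z : ℝ × Heis n => ‖F z.1 z.2‖ₑ := h.1.enorm
  change ∫⁻ z : ℝ × Heis n, ‖F z.1 z.2‖ₑ ∂_ < ⊤ at h1
  rw [lintegral_prod _ hm.aemeasurable] at h1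
  simpa only [eLpNorm_one_eq_lintegral_enorm] using h1

lemma MixedBdd.tendsto_wInt [SFinite ν] [ENNReal.HolderConjugate s s'] {u X : ℝ → Heis n → ℝ}
    (hu : MixedBdd ν s u) (hX : MixedInt ν s' X) {K : Set (Heis n)} (hK : IsCompact K)
    (h0 : ∀ t, ∀ q ∉ K, u t q = 0) :
    Tendsto (fun h => wInt ν u fun t q => X t (q ⊙ h) - X t q) (𝓝 0) (𝓝 0) :=
  tendsto_wInt_translate (s := s) (s' := s') hu.1 hX.1 (fun _ hK => hu.ae_lt_top hK)
    (fun _ hK => hX.ae_lt_top hK) (fun _ hK => hu.lintegral_mul_lt_top hX hK) hK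
    fun t q hq => h0 t q hq

/-- The roles are exchanged: the factor integrable in time is the weight and u is the function being
translated. With the adjoint operator applied to φ as weight, this controls the limit of β(u_ε). -/
lemma MixedInt.tendsto_wInt [SFinite ν] [hss : ENNReal.HolderConjugate s s']
    {u X : ℝ → Heis n → ℝ} (hX : MixedInt ν s' X) (hu : MixedBdd ν s u) {K : Set (Heis n)}
    (hK : IsCompact K) (h0 : ∀ t, ∀ q ∉ K, X t q = 0) :
    Tendsto (fun h => wInt ν X fun t q => u t (q ⊙ h) - u t q) (𝓝 0) (𝓝 0) :=
  have := hss.symm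
  tendsto_wInt_translate (s := s') (s' := s) hX.1 hu.1 (fun _ hK => hX.ae_lt_top hK)
    (fun _ hK => hu.ae_lt_top hK) (fun _ hK => by
      simpa only [mul_comm] using hu.lintegral_mul_lt_top hX hK) hK fun t q hq => h0 t q hq

/-- The indicator function of a set of points in space, as a function on space-time. -/
def spaceIndicator {n : ℕ} (K : Set (Heis n)) (_ : ℝ) (q : Heis n) : ℝ := K.indicator 1 q

lemma measurable_spaceIndicator {K : Set (Heis n)} (hK : MeasurableSet K) :
    Measurable (Function.uncurry (spaceIndicator K)) :=
  (measurable_one.indicator hK).comp measurable_snd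

lemma abs_spaceIndicator_le (K : Set (Heis n)) (t : ℝ) (q : Heis n) :
    |spaceIndicator K t q| ≤ 1 := by
  by_cases hq : q ∈ K <;> simp [spaceIndicator, hq]

lemma mixedBdd_spaceIndicator {K : Set (Heis n)} (hK : MeasurableSet K) (r : ℝ≥0∞) :
    MixedBdd ν r (spaceIndicator K) := by
  simpa using (mixedBdd_const r 1).mul_bdd (measurable_spaceIndicator hK) (abs_spaceIndicator_le K)

/-- The exponent pair (∞, 1) with an indicator as weight: translation continuity in L¹_loc. -/
lemma LocInt.tendsto_wInt [SFinite ν] {X : ℝ → Heis n → ℝ} (hX : LocInt ν X) {K : Set (Heis n)}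
    (hK : IsCompact K) : Tendsto (fun h => wInt ν (spaceIndicator K)
      fun t q => X t (q ⊙ h) - X t q) (𝓝 0) (𝓝 0) :=
  (mixedBdd_spaceIndicator hK.measurableSet ⊤).tendsto_wInt (s' := 1) hX.mixedInt hK
    fun t q hq => by simp [spaceIndicator, hq]

section kernelSequence

variable {C : ℝ≥0∞} {ε : ℕ → ℝ} {κ : ℕ → Heis n → ℝ}

lemma mollify_sub_eq {C : ℝ≥0∞} {ε : ℝ} {κ g : Heis n → ℝ} (hκ : AdaptedKernel C ε κ)
    (hg : LocallyIntegrable g) (p : Heis n) :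
    mollify κ g p - g p = ∫ q, (g q - g p) * κ ((-q) ⊙ p) := by
  have hk : Continuous fun q => κ ((-q) ⊙ p) := hκ.contDiff.continuous.comp (by fun_prop)
  have hkc : HasCompactSupport fun q => κ ((-q) ⊙ p) :=
    hκ.hasCompactSupport.comp_homeomorph (negHmul p)
  have i1 := integrable_mul_of_hasCompactSupport hg hk hkc
  have i2 : Integrable fun q => g p * κ ((-q) ⊙ p) :=
    (hk.integrable_of_hasCompactSupport hkc).const_mul _
  simp only [sub_mul]
  rw [integral_sub i1 i2, integral_const_mul, integral_neg_hmul κ p, hκ.integral_eq_one, mul_one,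
    mollify]

/-- Convergence of mollifications in weighted `L¹`. -/
lemma tendsto_lintegral_mollify_sub [SFinite ν] (hC : C ≠ ⊤) (hε : Tendsto ε atTop (𝓝 0))
    (hκ : ∀ m, AdaptedKernel C (ε m) (κ m)) {f g : ℝ → Heis n → ℝ}
    (hf : Measurable (Function.uncurry f)) (hg : Measurable (Function.uncurry g))
    (hgl : ∀ᵐ t ∂ν, LocallyIntegrable (g t))
    (h : Tendsto (fun h => wInt ν f fun t q => g t (q ⊙ h) - g t q) (𝓝 0) (𝓝 0)) :
    Tendsto (fun m => ∫⁻ z : ℝ × Heis n, ‖f z.1 z.2‖ₑ *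
      ‖mollify (κ m) (g z.1) z.2 - g z.1 z.2‖ₑ ∂(ν.prod volume)) atTop (𝓝 0) := by
  refine tendsto_zero_of_forall_le_mul hC fun δ hδ => ?_
  filter_upwards [tendsto_wInt_box h hε hδ] with m hm
  have hκm := (hκ m).contDiff.continuous.measurable
  calc _ ≤ ∫⁻ z : ℝ × Heis n, ‖f z.1 z.2‖ₑ *
        (∫⁻ q, ‖(g z.1 q - g z.1 z.2) * κ m ((-q) ⊙ z.2)‖ₑ) ∂(ν.prod volume) := by
        refine lintegral_mono_ae ?_
        have h1 : ∀ᵐ z : ℝ × Heis n ∂(ν.prod volume), LocallyIntegrable (g z.1) :=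
          Measure.quasiMeasurePreserving_fst.ae hgl
        filter_upwards [h1] with z hz
        rw [mollify_sub_eq (hκ m) hz]
        gcongr
        exact enorm_integral_le_lintegral_enorm _
    _ ≤ ∫⁻ w, ‖κ m w‖ₑ * wInt ν f (fun t q => g t (q ⊙ (-w)) - g t q) :=
        lintegral_mollify_sub_le hf hg hκm
    _ ≤ (∫⁻ w, ‖κ m w‖ₑ) * δ := lintegral_kernel_mul_le hκm fun w hw =>
        hm _ (neg_mem_heisBox ((hκ m).mem_heisBox (subset_closure hw)))
    _ ≤ C * δ := mul_le_mul' (hκ m).lintegral_le le_rfl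

lemma commutatorConst_ne_top (n : ℕ) {C : ℝ≥0∞} (hC : C ≠ ⊤) : commutatorConst n C ≠ ⊤ := by
  unfold commutatorConst
  finiteness

/-- The commutator tends to zero in `L¹_loc`. -/
lemma tendsto_lintegral_commutator [IsFiniteMeasure ν] [ENNReal.HolderConjugate s s']
    (k : Fin n) (hC : C ≠ ⊤) (hε0 : ∀ m, 0 < ε m) (hε : Tendsto ε atTop (𝓝 0))
    (hκ : ∀ m, AdaptedKernel C (ε m) (κ m)) {u ψ S : ℝ → Heis n → ℝ}
    {G : Fin n ⊕ Fin n → ℝ → Heis n → ℝ} {H : Fin n ⊕ Fin n → Fin n ⊕ Fin n → ℝ → Heis n → ℝ}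
    (hu : MixedBdd ν s u) (h : ContactData ν s' ψ S G H) {c : ℝ → Heis n → ℝ} {u₀ : Heis n → ℝ}
    (hI : TransportIntegrability ν (contactField ψ G) (contactFieldDiv S H) c u u₀)
    {K : Set (Heis n)} (hK : IsCompact K) :
    Tendsto (fun m => ∫⁻ z : ℝ × Heis n, ‖spaceIndicator K z.1 z.2‖ₑ *
      ‖mollifiedCommutator (κ m) (contactField ψ G) (contactFieldDiv S H) u z.1 z.2‖ₑ
        ∂(ν.prod volume)) atTop (𝓝 0) := by
  refine tendsto_zero_of_forall_le_mul (commutatorConst_ne_top n hC) fun δ hδ => ?_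
  -- For kernels supported in the unit ball, the values of u that influence the commutator on K are
  -- those on K'.
  set K' := (fun z : Heis n × Heis n => z.1 ⊙ (-z.2)) '' (K ×ˢ Metric.closedBall 0 1) with hK'
  have hK'c : IsCompact K' := (hK.prod (isCompact_closedBall _ _)).image (by fun_prop)
  have hf : MixedBdd ν s fun t q => u t q * spaceIndicator K' t q :=
    hu.mul_bdd (measurable_spaceIndicator hK'c.measurableSet) (abs_spaceIndicator_le K')
  have hf0 : ∀ t, ∀ q ∉ K', u t q * spaceIndicator K' t q = 0 := fun t q hq => by
    simp [spaceIndicator, hq]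
  -- For the Taylor remainders the weight is u cut off to K', paired with second derivatives in
  -- L^{s'}.
  have t1 : ∀ i j, ∀ᶠ m in atTop, ∀ w ∈ heisBox n (ε m),
      wInt ν (fun t q => u t q * spaceIndicator K' t q)
        (fun t q => H i j t (q ⊙ w) - H i j t q) ≤ δ := fun i j =>
    tendsto_wInt_box (hf.tendsto_wInt (h.mem_hess i j) hK'c hf0) hε hδ
  have t2 : ∀ᶠ m in atTop, ∀ w ∈ heisBox n (ε m),
      wInt ν (fun t q => u t q * spaceIndicator K' t q) (fun t q => S t (q ⊙ w) - S t q) ≤ δ :=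
    tendsto_wInt_box (hf.tendsto_wInt h.mem_vert hK'c hf0) hε hδ
  -- For the mean-zero kernels the products u H and u S are translated as a whole. By Hölder they
  -- are in L¹_loc, so an indicator suffices as weight.
  have t3' : ∀ i j, Tendsto (fun h => wInt ν (spaceIndicator K)
      fun t q => u t (q ⊙ h) * H i j t (q ⊙ h) - u t q * H i j t q) (𝓝 0) (𝓝 0) := fun i j =>
    LocInt.tendsto_wInt (X := fun t q => u t q * H i j t q) (hu.locInt_mul (h.mem_hess i j)) hK
  have t4' : Tendsto (fun h => wInt ν (spaceIndicator K)
      fun t q => u t (q ⊙ h) * S t (q ⊙ h) - u t q * S t q) (𝓝 0) (𝓝 0) :=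
    LocInt.tendsto_wInt (X := fun t q => u t q * S t q) (hu.locInt_mul h.mem_vert) hK
  have t3 : ∀ i j, ∀ᶠ m in atTop, ∀ w ∈ heisBox n (ε m), wInt ν (spaceIndicator K)
      (fun t q => u t (q ⊙ w) * H i j t (q ⊙ w) - u t q * H i j t q) ≤ δ := fun i j =>
    tendsto_wInt_box (g := fun t q => u t q * H i j t q) (t3' i j) hε hδ
  have t4 : ∀ᶠ m in atTop, ∀ w ∈ heisBox n (ε m), wInt ν (spaceIndicator K)
      (fun t q => u t (q ⊙ w) * S t (q ⊙ w) - u t q * S t q) ≤ δ :=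
    tendsto_wInt_box (g := fun t q => u t q * S t q) t4' hε hδ
  filter_upwards [eventually_all.2 fun i => eventually_all.2 (t1 i), t2,
    eventually_all.2 fun i => eventually_all.2 (t3 i), t4, hε.eventually (ge_mem_nhds one_pos)]
    with m m1 m2 m3 m4 m5
  have hsupp : ∀ t p q, (-q) ⊙ p ∈ tsupport (κ m) →
      ‖spaceIndicator K t p‖ₑ * ‖u t q‖ₑ ≤ ‖u t q * spaceIndicator K' t q‖ₑ := by
    intro t p q hq
    by_cases hp : p ∈ K
    · have hqK : q ∈ K' := by
        refine ⟨(p, (-q) ⊙ p), ⟨hp, ?_⟩, by simp [neg_hmul_rev]⟩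
        refine heisBox_subset_closedBall m5 ?_ ((hκ m).mem_heisBox hq)
        have := hε0 m
        nlinarith
      simp [spaceIndicator, hp, hqK]
    · simp [spaceIndicator, hp]
  have key := lintegral_commutator_le k hf.1 (measurable_spaceIndicator hK.measurableSet) hu.1
    h.mem.1 h.mem_vert.1 (fun j => (h.mem_grad j).1) (fun i j => (h.mem_hess i j).1) h.grad h.hess
    h.vert (hε0 m) (hκ m) hsupp m1 m2 m3 m4
  refine le_trans (lintegral_mono_ae ?_) key
  have h1 := (Measure.quasiMeasurePreserving_fst (μ := ν) (ν := (volume : Measure (Heis n)))).ae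
    (mollifiedCommutator_eq hI (hκ m).contDiff (hκ m).hasCompactSupport)
  filter_upwards [h1] with z hz
  rw [hz]

end kernelSequence

end limits

/-! ### Limits of integrals with nonlinear factors. -/

section core

open Filter Topology

variable {n : ℕ} {s s' : ℝ≥0∞}

lemma tendsto_integral_of_lintegral_sub {α : Type*} [MeasurableSpace α] {μ : Measure α}
    {F : ℕ → α → ℝ} {f : α → ℝ} (hF : ∀ m, AEStronglyMeasurable (F m) μ) (hf : Integrable f μ)
    (h : Tendsto (fun m => ∫⁻ x, ‖F m x - f x‖ₑ ∂μ) atTop (𝓝 0)) :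
    Tendsto (fun m => ∫ x, F m x ∂μ) atTop (𝓝 (∫ x, f x ∂μ)) := by
  refine tendsto_integral_of_L1 f hf.aestronglyMeasurable ?_ h
  filter_upwards [h.eventually (gt_mem_nhds ENNReal.zero_lt_top)] with m hm
  have h1 : Integrable (fun x => F m x - f x) μ := ⟨(hF m).sub hf.aestronglyMeasurable, hm⟩
  exact (h1.add hf).congr (Eventually.of_forall fun x => by simp)

lemma enorm_sub_le_mul_of_abs_deriv_le {β : ℝ → ℝ} (hβ : ContDiff ℝ 1 β) {M : ℝ}
    (hM : ∀ x, |deriv β x| ≤ M) (x y : ℝ) : ‖β x - β y‖ₑ ≤ ENNReal.ofReal M * ‖x - y‖ₑ := by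
  have h := (lipschitzWith_of_abs_deriv_le hβ hM).dist_le_mul x y
  have hM0 : 0 ≤ M := (abs_nonneg _).trans (hM 0)
  rw [Real.coe_toNNReal _ hM0, dist_eq_norm, dist_eq_norm] at h
  rw [← ofReal_norm, ← ofReal_norm, ← ENNReal.ofReal_mul hM0]
  exact ENNReal.ofReal_le_ofReal h

/-- Convergence of nonlinear functions of the mollified solution, tested with an integrable
weight. -/
lemma tendsto_integral_comp_mollify {α : Type*} [MeasurableSpace α] {μ : Measure α}
    {v : ℕ → α → ℝ} {u w : α → ℝ} (hv : ∀ m, Measurable (v m)) (hw : Measurable w)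
    {β : ℝ → ℝ} (hβ : ContDiff ℝ 1 β) {M : ℝ} (hM : ∀ x, |deriv β x| ≤ M)
    (hi : Integrable (fun x => β (u x) * w x) μ)
    (h : Tendsto (fun m => ∫⁻ x, ‖w x‖ₑ * ‖v m x - u x‖ₑ ∂μ) atTop (𝓝 0)) :
    Tendsto (fun m => ∫ x, β (v m x) * w x ∂μ) atTop (𝓝 (∫ x, β (u x) * w x ∂μ)) := by
  refine tendsto_integral_of_lintegral_sub (fun m => ((hβ.continuous.measurable.comp
    (hv m)).mul hw).aestronglyMeasurable) hi ?_
  have h2 := ENNReal.Tendsto.const_mul (a := ENNReal.ofReal M) h (Or.inr ENNReal.ofReal_ne_top)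
  rw [mul_zero] at h2
  refine tendsto_of_tendsto_of_tendsto_of_le_of_le tendsto_const_nhds h2 (fun _ => bot_le)
    fun m => ?_
  change _ ≤ ENNReal.ofReal M * _
  rw [← lintegral_const_mul' _ _ ENNReal.ofReal_ne_top]
  refine lintegral_mono fun x => ?_
  rw [← sub_mul, enorm_mul]
  calc _ ≤ ENNReal.ofReal M * ‖v m x - u x‖ₑ * ‖w x‖ₑ :=
        mul_le_mul' (enorm_sub_le_mul_of_abs_deriv_le hβ hM _ _) le_rfl
    _ = _ := by ring

/-- Convergence of the zero order terms. -/
lemma tendsto_integral_deriv_mul {α : Type*} [MeasurableSpace α] {μ : Measure α}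
    {v g R : ℕ → α → ℝ} {u w f : α → ℝ} (hv : ∀ m, Measurable (v m)) (hg : ∀ m, Measurable (g m))
    (hR : ∀ m, Measurable (R m)) (hu : Measurable u) (hw : Measurable w) (hf : Measurable f)
    {β : ℝ → ℝ} (hβ : ContDiff ℝ 1 β) {M : ℝ} (hM : ∀ x, |deriv β x| ≤ M)
    (hi : Integrable (fun x => w x * f x) μ)
    (hae : ∀ᵐ x ∂μ, w x ≠ 0 → Tendsto (fun m => v m x) atTop (𝓝 (u x)))
    (h1 : Tendsto (fun m => ∫⁻ x, ‖w x‖ₑ * ‖g m x - f x‖ₑ ∂μ) atTop (𝓝 0))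
    (h2 : Tendsto (fun m => ∫⁻ x, ‖w x‖ₑ * ‖R m x‖ₑ ∂μ) atTop (𝓝 0)) :
    Tendsto (fun m => ∫ x, deriv β (v m x) * w x * (g m x + R m x) ∂μ) atTop
      (𝓝 (∫ x, deriv β (u x) * w x * f x ∂μ)) := by
  have hβ' := measurable_deriv_of_contDiff hβ
  have hMe : ∀ x, ‖deriv β x‖ₑ ≤ ENNReal.ofReal M := fun x => by
    rw [← ofReal_norm]
    exact ENNReal.ofReal_le_ofReal (hM x)
  have hi' : Integrable (fun x => deriv β (u x) * w x * f x) μ := by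
    refine (hi.bdd_mul (c := M) (hβ'.comp hu).aestronglyMeasurable
      (Eventually.of_forall fun x => hM _)).congr (Eventually.of_forall fun x => ?_)
    simp only [Function.comp_apply]
    ring
  refine tendsto_integral_of_lintegral_sub (fun m => (((hβ'.comp (hv m)).mul hw).mul
    ((hg m).add (hR m))).aestronglyMeasurable) hi' ?_
  -- β' is continuous and bounded but has no modulus of continuity to exploit. Weighted L¹
  -- convergence therefore does not suffice here, and pointwise convergence with domination is used.
  have h3 : Tendsto (fun m => ∫⁻ x, ‖deriv β (v m x) - deriv β (u x)‖ₑ * ‖w x * f x‖ₑ ∂μ) atTop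
      (𝓝 0) := by
    have := tendsto_lintegral_of_dominated_convergence (μ := μ)
      (F := fun m x => ‖deriv β (v m x) - deriv β (u x)‖ₑ * ‖w x * f x‖ₑ) (f := fun _ => 0)
      (fun x => (ENNReal.ofReal M + ENNReal.ofReal M) * ‖w x * f x‖ₑ)
      (fun m => ((((hβ'.comp (hv m)).sub (hβ'.comp hu)).enorm).mul (hw.mul hf).enorm))
      (fun m => Eventually.of_forall fun x => mul_le_mul' ((enorm_sub_le).trans
        (add_le_add (hMe _) (hMe _))) le_rfl) ?_ ?_
    · simpa using this
    · rw [lintegral_const_mul' _ _ (by finiteness)]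
      exact ENNReal.mul_ne_top (by finiteness) hi.hasFiniteIntegral.ne
    · filter_upwards [hae] with x hx
      by_cases hwx : w x = 0
      · simp [hwx]
      · have e1 : Tendsto (fun m => deriv β (v m x) - deriv β (u x)) atTop (𝓝 0) := by
          have := (((hβ.continuous_deriv le_rfl).tendsto (u x)).comp (hx hwx)).sub_const
            (deriv β (u x))
          simpa using this
        have e2 := ENNReal.Tendsto.mul_const (b := ‖w x * f x‖ₑ)
          (by simpa using e1.enorm) (Or.inr enorm_ne_top)
        simpa using e2
  have h4 := (ENNReal.Tendsto.const_mul (a := ENNReal.ofReal M) (h1.add h2)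
    (Or.inr ENNReal.ofReal_ne_top)).add h3
  simp only [add_zero, mul_zero] at h4
  refine tendsto_of_tendsto_of_tendsto_of_le_of_le tendsto_const_nhds h4 (fun _ => bot_le)
    fun m => ?_
  have a1 : Measurable fun x => ‖w x‖ₑ * ‖g m x - f x‖ₑ := hw.enorm.mul ((hg m).sub hf).enorm
  have a2 : Measurable fun x => ‖w x‖ₑ * ‖R m x‖ₑ := hw.enorm.mul (hR m).enorm
  have a3 : Measurable fun x => ENNReal.ofReal M *
      (‖w x‖ₑ * ‖g m x - f x‖ₑ + ‖w x‖ₑ * ‖R m x‖ₑ) := (a1.add a2).const_mul _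
  change _ ≤ ENNReal.ofReal M * ((∫⁻ x, ‖w x‖ₑ * ‖g m x - f x‖ₑ ∂μ) + ∫⁻ x, ‖w x‖ₑ * ‖R m x‖ₑ ∂μ)
    + ∫⁻ x, ‖deriv β (v m x) - deriv β (u x)‖ₑ * ‖w x * f x‖ₑ ∂μ
  rw [← lintegral_add_left a1, ← lintegral_const_mul' _ _ ENNReal.ofReal_ne_top,
    ← lintegral_add_left a3]
  refine lintegral_mono fun x => ?_
  -- The linear factors converge in weighted L¹ and are multiplied by the bounded β'(v). The
  -- nonlinear difference is left against the fixed integrable function w f.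
  have e : deriv β (v m x) * w x * (g m x + R m x) - deriv β (u x) * w x * f x
      = deriv β (v m x) * (w x * (g m x - f x) + w x * R m x)
        + (deriv β (v m x) - deriv β (u x)) * (w x * f x) := by ring
  rw [e]
  refine (enorm_add_le _ _).trans (add_le_add ?_ (by rw [enorm_mul]))
  rw [enorm_mul]
  refine mul_le_mul' (hMe _) ((enorm_add_le _ _).trans ?_)
  rw [enorm_mul, enorm_mul]

/-- Weighted `L¹` convergence gives a.e. convergence of a subsequence on the weight's support. -/
lemma exists_seq_ae_tendsto_of_lintegral {α : Type*} [MeasurableSpace α] {μ : Measure α}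
    {v : ℕ → α → ℝ} {u w : α → ℝ} (hv : ∀ m, Measurable (v m)) (hu : Measurable u)
    (hw : Measurable w)
    (h : Tendsto (fun m => ∫⁻ x, ‖w x‖ₑ * ‖v m x - u x‖ₑ ∂μ) atTop (𝓝 0)) :
    ∃ ns : ℕ → ℕ, StrictMono ns ∧
      ∀ᵐ x ∂μ, w x ≠ 0 → Tendsto (fun m => v (ns m) x) atTop (𝓝 (u x)) := by
  have h1 : Tendsto (fun m => eLpNorm ((fun x => w x * (v m x - u x)) - fun _ => 0) 1 μ) atTop
      (𝓝 0) := by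
    refine h.congr fun m => ?_
    rw [eLpNorm_one_eq_lintegral_enorm]
    exact lintegral_congr fun x => by simp [enorm_mul]
  obtain ⟨ns, hns, hae⟩ := (tendstoInMeasure_of_tendsto_eLpNorm one_ne_zero
    (fun m => (hw.mul ((hv m).sub hu)).aestronglyMeasurable) aestronglyMeasurable_const
    h1).exists_seq_tendsto_ae
  refine ⟨ns, hns, hae.mono fun x hx hwx => ?_⟩
  have := (hx.const_mul (w x)⁻¹).add_const (u x)
  simpa [hwx, ← mul_assoc] using this

end core

/-! ### Renormalization on a bounded time slab. -/

section core

open Filter Topology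

variable {n : ℕ} {ν : Measure ℝ} {s s' : ℝ≥0∞} {ψ S : ℝ → Heis n → ℝ}
  {G : Fin n ⊕ Fin n → ℝ → Heis n → ℝ}
  {H : Fin n ⊕ Fin n → Fin n ⊕ Fin n → ℝ → Heis n → ℝ}

lemma LocInt.integrable_of_support [SFinite ν] {F : ℝ → Heis n → ℝ} (h : LocInt ν F)
    {K : Set (Heis n)} (hK : IsCompact K) (h0 : ∀ t, ∀ q ∉ K, F t q = 0) :
    Integrable (fun z : ℝ × Heis n => F z.1 z.2) (ν.prod volume) := by
  refine (h.integrable_mul (measurable_spaceIndicator hK.measurableSet) (abs_spaceIndicator_le K)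
    hK fun t q hq => by simp [spaceIndicator, hq]).congr (Eventually.of_forall fun z => ?_)
  by_cases hz : z.2 ∈ K
  · simp [spaceIndicator, hz]
  · simp [h0 _ _ hz]

/-- The adjoint transport operator applied to a test function. -/
def adjointTransport {n : ℕ} (B : ℝ → Heis n → Heis n) (D : ℝ → Heis n → ℝ)
    (φ : ℝ × Heis n → ℝ) (t : ℝ) (q : Heis n) : ℝ :=
  -timeDeriv φ (t, q) + fderiv ℝ φ (t, q) (0, leftField (B t q) q) + D t q * φ (t, q)

lemma adjointTransport_eq_zero {B : ℝ → Heis n → Heis n} {D : ℝ → Heis n → ℝ}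
    {φ : ℝ × Heis n → ℝ} {t : ℝ} {q : Heis n} (h : (t, q) ∉ tsupport φ) :
    adjointTransport B D φ t q = 0 := by
  have h1 : fderiv ℝ φ (t, q) = 0 :=
    image_eq_zero_of_notMem_tsupport fun h2 => h (tsupport_fderiv_subset ℝ h2)
  simp [adjointTransport, timeDeriv, h1, image_eq_zero_of_notMem_tsupport h]

lemma ContactData.mixedInt_adjointTransport [IsFiniteMeasure ν] (hs' : 1 ≤ s')
    (h : ContactData ν s' ψ S G H) {φ : ℝ × Heis n → ℝ} (hφ : ContDiff ℝ ∞ φ)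
    (hφc : HasCompactSupport φ) :
    MixedInt ν s' (adjointTransport (contactField ψ G) (contactFieldDiv S H) φ) := by
  have hfc := hφ.continuous_fderiv (by simp)
  have hs : ∀ V : ℝ × Heis n → ℝ × Heis n, HasCompactSupport fun z => fderiv ℝ φ z (V z) :=
    fun V => (hφc.fderiv ℝ).mono fun z hz h0 => hz (by simp [h0])
  have key : ∀ {X : ℝ → Heis n → ℝ} {g : ℝ × Heis n → ℝ}, MixedInt ν s' X → Continuous g →
      HasCompactSupport g → MixedInt ν s' fun t q => X t q * g (t, q) := by
    intro X g hX hg hgc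
    obtain ⟨C, hC⟩ := hgc.exists_bound_of_continuous hg
    exact hX.mul_bdd (g := fun t q => g (t, q)) (C := C) hg.measurable fun t q => hC (t, q)
  have m1 := key (mixedInt_const (n := n) (ν := ν) s' (-1)) (g := fun z => fderiv ℝ φ z (1, 0))
    (hfc.clm_apply (by fun_prop)) (hs _)
  have m2 := fun j => key (h.mem_hor j) (g := fun z => fderiv ℝ φ z (0, leftField (hbasis j) z.2))
    (hfc.clm_apply (by fun_prop)) (hs _)
  have m3 := key h.mem_ver (g := fun z => fderiv ℝ φ z (0, _root_.vert 1))
    (hfc.clm_apply (by fun_prop)) (hs _)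
  have m4 := key (h.mem_div hs') hφ.continuous hφc
  have e : adjointTransport (contactField ψ G) (contactFieldDiv S H) φ = fun t q =>
      (-1 * fderiv ℝ φ (t, q) (1, 0)
        + (∑ j, hcoord j (contactField ψ G t q) * fderiv ℝ φ (t, q) (0, leftField (hbasis j) q)
        + (contactField ψ G t q).2.2 * fderiv ℝ φ (t, q) (0, _root_.vert 1)))
        + contactFieldDiv S H t q * φ (t, q) := by
    funext t q
    have := fderiv_space_leftField (φ := φ) (t, q) (contactField ψ G t q)
    simp only at this
    rw [adjointTransport, this, timeDeriv]
    ring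
  rw [e]
  exact (m1.add hs' ((MixedInt.sum Finset.univ hs' fun j _ => m2 j).add hs' m3)).add hs' m4

variable {T : ℝ} {c u : ℝ → Heis n → ℝ} {u₀ : Heis n → ℝ}

lemma integrable_comp_mul [SFinite ν] {u w : ℝ → Heis n → ℝ} (hu : Measurable (Function.uncurry u))
    (hw : LocInt ν w) (huw : LocInt ν fun t q => u t q * w t q) {K : Set (Heis n)}
    (hK : IsCompact K) (h0 : ∀ t, ∀ q ∉ K, w t q = 0) {β : ℝ → ℝ} (hβ : ContDiff ℝ 1 β) {M : ℝ}
    (hM : ∀ x, |deriv β x| ≤ M) :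
    Integrable (fun z : ℝ × Heis n => β (u z.1 z.2) * w z.1 z.2) (ν.prod volume) := by
  have i1 := (hw.integrable_of_support hK h0).norm.const_mul |β 0|
  have i2 := (huw.integrable_of_support hK fun t q hq => by simp [h0 t q hq]).norm.const_mul M
  refine (i1.add i2).mono' ((hβ.continuous.measurable.comp hu).mul hw.1).aestronglyMeasurable
    (Eventually.of_forall fun z => ?_)
  simp only [Pi.add_apply, norm_mul, Real.norm_eq_abs]
  calc |β (u z.1 z.2)| * |w z.1 z.2| ≤ (|β 0| + M * |u z.1 z.2|) * |w z.1 z.2| :=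
        mul_le_mul_of_nonneg_right (abs_le_of_abs_deriv_le hβ hM _) (abs_nonneg _)
    _ = _ := by ring

/-- Distributional solutions for contact fields are renormalized, for bounded time intervals and
measurable representatives. -/
theorem IsWeakTransport.renormalized (k : Fin n) (hT : 0 < T) (hs' : 1 ≤ s')
    [ENNReal.HolderConjugate s s'] (h : ContactData (volume.restrict (Ioc 0 T)) s' ψ S G H)
    (hu : MixedBdd (volume.restrict (Ioc 0 T)) s u)
    (hcu : LocInt (volume.restrict (Ioc 0 T)) fun t q => c t q * u t q)
    (hu₀ : LocallyIntegrable u₀) (hu₀m : Measurable u₀)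
    (hw : IsWeakTransport T (contactField ψ G) (contactFieldDiv S H) c u u₀)
    {β : ℝ → ℝ} (hβ : ContDiff ℝ 1 β) {M : ℝ} (hM : ∀ x, |deriv β x| ≤ M)
    {φ : ℝ × Heis n → ℝ} (hφ : ContDiff ℝ ∞ φ) (hφc : HasCompactSupport φ)
    (hφT : tsupport φ ⊆ {z | z.1 < T}) :
    Integrable (fun z : ℝ × Heis n => β (u z.1 z.2)
        * adjointTransport (contactField ψ G) (contactFieldDiv S H) φ z.1 z.2
        + c z.1 z.2 * u z.1 z.2 * deriv β (u z.1 z.2) * φ z)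
        ((volume.restrict (Ioc 0 T)).prod volume) ∧
      -(∫ p, β (u₀ p) * φ (0, p)) + ∫ z : ℝ × Heis n, (β (u z.1 z.2)
        * adjointTransport (contactField ψ G) (contactFieldDiv S H) φ z.1 z.2
        + c z.1 z.2 * u z.1 z.2 * deriv β (u z.1 z.2) * φ z)
        ∂((volume.restrict (Ioc 0 T)).prod volume) = 0 := by
  set ν : Measure ℝ := volume.restrict (Ioc 0 T) with hν
  set w := adjointTransport (contactField ψ G) (contactFieldDiv S H) φ with hwdef
  have hI := h.transportIntegrability hs' hu hcu hu₀
  set K : Set (Heis n) := Prod.snd '' tsupport φ with hKdef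
  have hK : IsCompact K := hφc.isCompact.image continuous_snd
  have hKφ : ∀ t, ∀ q ∉ K, (t, q) ∉ tsupport φ := fun t q hq hn => hq ⟨_, hn, rfl⟩
  have hw0 : ∀ t, ∀ q ∉ K, w t q = 0 := fun t q hq => adjointTransport_eq_zero (hKφ t q hq)
  have hφ0 : ∀ t, ∀ q ∉ K, φ (t, q) = 0 := fun t q hq =>
    image_eq_zero_of_notMem_tsupport (hKφ t q hq)
  have hwm : MixedInt ν s' w := h.mixedInt_adjointTransport hs' hφ hφc
  have iw : Integrable (fun z : ℝ × Heis n => β (u z.1 z.2) * w z.1 z.2) (ν.prod volume) :=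
    integrable_comp_mul hu.1 (hwm.locInt hs') (hu.locInt_mul hwm) hK hw0 hβ hM
  have icu : Integrable (fun z : ℝ × Heis n => φ z * (c z.1 z.2 * u z.1 z.2)) (ν.prod volume) :=
    (hcu.integrable_mul_of_hasCompactSupport hφ.continuous hφc).congr
      (Eventually.of_forall fun z => mul_comm _ _)
  have hβ'm := measurable_deriv_of_contDiff hβ
  have hum : Measurable fun z : ℝ × Heis n => u z.1 z.2 := hu.1
  have icu' : Integrable (fun z : ℝ × Heis n => deriv β (u z.1 z.2) * φ z * (c z.1 z.2 * u z.1 z.2))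
      (ν.prod volume) := by
    refine (icu.bdd_mul (c := M) (hβ'm.comp hum).aestronglyMeasurable
      (Eventually.of_forall fun x => hM _)).congr (Eventually.of_forall fun z => ?_)
    simp only [Function.comp_apply]
    ring
  have e : (fun z : ℝ × Heis n => β (u z.1 z.2) * w z.1 z.2
        + c z.1 z.2 * u z.1 z.2 * deriv β (u z.1 z.2) * φ z) = fun z => β (u z.1 z.2) * w z.1 z.2
        + deriv β (u z.1 z.2) * φ z * (c z.1 z.2 * u z.1 z.2) := funext fun z => by ring
  rw [e]
  refine ⟨iw.add icu', ?_⟩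
  rw [integral_add iw icu']
  -- the mollified equations
  obtain ⟨C, hC, hCκ⟩ := exists_adaptedKernel n
  set ε : ℕ → ℝ := fun m => 1 / ((m : ℝ) + 1) with hεdef
  have hε0 : ∀ m, 0 < ε m := fun m => by positivity
  have hε : Tendsto ε atTop (𝓝 0) := tendsto_one_div_add_atTop_nhds_zero_nat
  choose κ hκ using fun m => hCκ (ε m) (hε0 m)
  have hκc := fun m => (hκ m).contDiff.continuous
  have hφm : Measurable φ := hφ.continuous.measurable
  obtain ⟨N, hN⟩ := hφc.exists_bound_of_continuous hφ.continuous
  have hdom : ∀ z : ℝ × Heis n, ‖φ z‖ₑ ≤ ENNReal.ofReal N * ‖spaceIndicator K z.1 z.2‖ₑ := by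
    intro z
    by_cases hz : z.2 ∈ K
    · simp only [spaceIndicator, indicator_of_mem hz, Pi.one_apply, enorm_one, mul_one]
      rw [← ofReal_norm]
      exact ENNReal.ofReal_le_ofReal (hN z)
    · rw [show φ z = 0 from hφ0 z.1 z.2 hz]
      simp
  have squeeze : ∀ {μ : Measure ℝ} {R : ℕ → ℝ × Heis n → ℝ}, Tendsto (fun m =>
        ∫⁻ z : ℝ × Heis n, ‖spaceIndicator K z.1 z.2‖ₑ * ‖R m z‖ₑ ∂(μ.prod volume)) atTop (𝓝 0) →
      Tendsto (fun m => ∫⁻ z, ‖φ z‖ₑ * ‖R m z‖ₑ ∂(μ.prod volume)) atTop (𝓝 0) := by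
    intro μ R hR
    have h2 := ENNReal.Tendsto.const_mul (a := ENNReal.ofReal N) hR (Or.inr ENNReal.ofReal_ne_top)
    rw [mul_zero] at h2
    refine tendsto_of_tendsto_of_tendsto_of_le_of_le tendsto_const_nhds h2 (fun _ => bot_le)
      fun m => ?_
    change _ ≤ ENNReal.ofReal N * _
    rw [← lintegral_const_mul' _ _ ENNReal.ofReal_ne_top]
    refine lintegral_mono fun z => ?_
    rw [← mul_assoc]
    exact mul_le_mul' (hdom z) le_rfl
  have loc : ∀ {μ : Measure ℝ} [SFinite μ] {X : ℝ → Heis n → ℝ}, LocInt μ X → Tendsto (fun m =>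
      ∫⁻ z : ℝ × Heis n, ‖φ z‖ₑ * ‖mollify (κ m) (X z.1) z.2 - X z.1 z.2‖ₑ ∂(μ.prod volume))
      atTop (𝓝 0) := fun {μ} _ {X} hX => squeeze (R := fun m z =>
        mollify (κ m) (X z.1) z.2 - X z.1 z.2) (tendsto_lintegral_mollify_sub hC hε hκ
      (measurable_spaceIndicator hK.measurableSet) hX.1 hX.ae_locallyIntegrable
      (hX.tendsto_wInt hK))
  have tu := loc hI.sol
  have vm : ∀ m, Measurable fun z : ℝ × Heis n => mollify (κ m) (u z.1) z.2 := fun m =>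
    measurable_mollify hu.1 (hκc m)
  -- A subsequence is needed only for β'(u_ε). It depends on φ, which is harmless since φ is fixed.
  obtain ⟨ns, hns, hae⟩ := exists_seq_ae_tendsto_of_lintegral vm hum hφm tu
  -- passage to the limit
  have t1 : Tendsto (fun m => ∫ z : ℝ × Heis n, β (mollify (κ m) (u z.1) z.2) * w z.1 z.2
      ∂(ν.prod volume)) atTop (𝓝 (∫ z : ℝ × Heis n, β (u z.1 z.2) * w z.1 z.2 ∂(ν.prod volume))) :=
    -- The weight w is only L¹ in time with values in L^{s'}, so convergence of u_ε in L¹_loc would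
    -- not suffice. Convergence in L¹ weighted by w is used instead.
    tendsto_integral_comp_mollify vm hwm.1 hβ hM iw
      (tendsto_lintegral_mollify_sub hC hε hκ hwm.1 hu.1 hI.sol.ae_locallyIntegrable
        (hwm.tendsto_wInt hu hK hw0))
  have t2 : Tendsto (fun m => ∫ z : ℝ × Heis n, deriv β (mollify (κ (ns m)) (u z.1) z.2) * φ z *
        (mollify (κ (ns m)) (fun q => c z.1 q * u z.1 q) z.2
          + mollifiedCommutator (κ (ns m)) (contactField ψ G) (contactFieldDiv S H) u z.1 z.2)
        ∂(ν.prod volume)) atTop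
      (𝓝 (∫ z : ℝ × Heis n, deriv β (u z.1 z.2) * φ z * (c z.1 z.2 * u z.1 z.2)
        ∂(ν.prod volume))) :=
    tendsto_integral_deriv_mul (fun m => vm (ns m))
      (fun m => measurable_mollify hcu.1 (hκc (ns m)))
      (fun m => (hI.locInt_mollifiedCommutator (hκ (ns m)).contDiff
        (hκ (ns m)).hasCompactSupport).1) hum hφm hcu.1 hβ hM icu hae
      ((loc hcu).comp hns.tendsto_atTop)
      ((squeeze (R := fun m z => mollifiedCommutator (κ m) (contactField ψ G)
        (contactFieldDiv S H) u z.1 z.2) (tendsto_lintegral_commutator k hC hε0 hε hκ hu h hI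
        hK)).comp hns.tendsto_atTop)
  have t0 : Tendsto (fun m => ∫ p, β (mollify (κ m) u₀ p) * φ (0, p)) atTop
      (𝓝 (∫ p, β (u₀ p) * φ (0, p))) := by
    -- The initial datum is regarded as a function of space-time for the Dirac mass at time 0, so
    -- that the same convergence result covers it.
    have h0 : LocInt (Measure.dirac (0 : ℝ)) fun _ : ℝ => u₀ := by
      refine ⟨hu₀m.comp measurable_snd, fun L hL => ?_⟩
      exact (hu₀.integrableOn_isCompact hL).comp_snd (μ := Measure.dirac (0 : ℝ))
    have h1 := loc h0
    have h2 : LocallyIntegrable fun p => β (u₀ p) := by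
      rw [locallyIntegrable_iff]
      intro L hL
      have := h0.comp_lipschitz hβ hM
      have h3 := (this.2 L hL).prod_right_ae
      rw [ae_dirac_eq] at h3
      exact h3
    refine tendsto_integral_comp_mollify (fun m => ?_) (hφm.comp (by fun_prop)) hβ hM
      (integrable_mul_of_hasCompactSupport h2 (hφ.continuous.comp (by fun_prop))
        (hasCompactSupport_section hφc 0)) ?_
    · exact (contDiff_mollify hu₀ (hκ m).contDiff (hκ m).hasCompactSupport).continuous.measurable
    · refine h1.congr fun m => ?_
      have hm : Measurable fun z : ℝ × Heis n => ‖φ z‖ₑ * ‖mollify (κ m) u₀ z.2 - u₀ z.2‖ₑ :=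
        hφm.enorm.mul ((measurable_mollify h0.1 (hκc m)).sub h0.1).enorm
      rw [lintegral_prod _ hm.aemeasurable, lintegral_dirac]
      rfl
  have hz := fun m => hw.renormalized_mollified hT hI h.isDivergence (hκ m).contDiff
    (hκ m).hasCompactSupport hβ hM hφ hφc hφT
  have lim := ((t0.comp hns.tendsto_atTop).neg.add (t1.comp hns.tendsto_atTop)).add t2
  have := tendsto_nhds_unique (lim.congr fun m => (hz (ns m))) tendsto_const_nhds
  rw [← add_assoc]
  exact this

end core

/-! ### Measurable representatives and almost everywhere uniqueness. -/

section representatives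

open Filter Topology

variable {n : ℕ} {ν : Measure ℝ} {τ : EReal} {r : ℝ≥0∞}

lemma isOpen_timeInterval (τ : EReal) : IsOpen (timeInterval τ) :=
  (isOpen_Ioi (a := (0 : ℝ))).inter (isOpen_Iio.preimage continuous_coe_real_ereal)

/-- Agreement a.e. on almost every section gives agreement a.e. in the product only when the
coincidence set is measurable, hence the passage through strongly measurable representatives. -/
lemma ae_prod_of_ae_ae [SFinite ν] {E : Type*} [NormedAddCommGroup E]
    {f g : ℝ → Heis n → E} (hf : AEStronglyMeasurable (Function.uncurry f) (ν.prod volume))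
    (hg : AEStronglyMeasurable (Function.uncurry g) (ν.prod volume))
    (h : ∀ᵐ t ∂ν, f t =ᵐ[volume] g t) : ∀ᵐ z : ℝ × Heis n ∂(ν.prod volume), f z.1 z.2 = g z.1 z.2 := by
  have hf1 := Measure.ae_ae_of_ae_prod hf.ae_eq_mk
  have hg1 := Measure.ae_ae_of_ae_prod hg.ae_eq_mk
  have h1 : ∀ᵐ z ∂(ν.prod volume), hf.mk _ z = hg.mk _ z := by
    rw [Measure.ae_prod_iff_ae_ae
      (StronglyMeasurable.measurableSet_eq_fun hf.stronglyMeasurable_mk hg.stronglyMeasurable_mk)]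
    filter_upwards [h, hf1, hg1] with t ht hft hgt
    filter_upwards [ht, hft, hgt] with q hq hfq hgq
    rw [← hfq, ← hgq]
    exact hq
  filter_upwards [hf.ae_eq_mk, hg.ae_eq_mk, h1] with z h2 h3 h4
  exact h2.trans (h4.trans h3.symm)

/-- Measurable representatives on space-time. -/
lemma exists_measurable_representative [SFinite ν] {X : ℝ → Heis n → ℝ}
    (h : AEStronglyMeasurable (Function.uncurry X) (ν.prod volume)) :
    ∃ X' : ℝ → Heis n → ℝ, Measurable (Function.uncurry X') ∧
      ∀ᵐ z : ℝ × Heis n ∂(ν.prod volume), X z.1 z.2 = X' z.1 z.2 :=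
  ⟨Function.curry (h.mk _), by simpa using h.stronglyMeasurable_mk.measurable, h.ae_eq_mk⟩

lemma MemMixed.memMixedLoc {E : Type*} [NormedAddCommGroup E] {a : ℝ≥0∞} {X : ℝ → Heis n → E}
    (h : MemMixed τ a r X) : MemMixedLoc τ a r X :=
  ⟨h.1, fun K _ => lt_of_le_of_lt (eLpNorm_mono_enorm fun t => by
    simpa using eLpNorm_mono_measure (X t) Measure.restrict_le_self) h.2⟩

lemma MemMixedLoc.exists_mixedInt {X : ℝ → Heis n → ℝ} (h : MemMixedLoc τ 1 r X) :
    ∃ X' : ℝ → Heis n → ℝ, MixedInt (volume.restrict (timeInterval τ)) r X' ∧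
      ∀ᵐ z : ℝ × Heis n ∂(spaceTime n τ), X z.1 z.2 = X' z.1 z.2 := by
  obtain ⟨X', hm, he⟩ := exists_measurable_representative h.1
  refine ⟨X', ⟨hm, fun K hK => ?_⟩, he⟩
  have h1 := h.2 K hK
  rw [eLpNorm_one_eq_lintegral_enorm] at h1
  refine (lintegral_congr_ae ?_).trans_lt h1
  filter_upwards [Measure.ae_ae_of_ae_prod he] with t ht
  simp only [enorm_eq_self]
  exact eLpNorm_congr_ae (ae_restrict_of_ae (ht.mono fun q hq => hq.symm))

lemma MemMixedLoc.exists_mixedBdd {X : ℝ → Heis n → ℝ} (h : MemMixedLoc τ ⊤ r X) :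
    ∃ X' : ℝ → Heis n → ℝ, MixedBdd (volume.restrict (timeInterval τ)) r X' ∧
      ∀ᵐ z : ℝ × Heis n ∂(spaceTime n τ), X z.1 z.2 = X' z.1 z.2 := by
  obtain ⟨X', hm, he⟩ := exists_measurable_representative h.1
  refine ⟨X', ⟨hm, fun K hK => ⟨(eLpNorm (fun t => eLpNorm (X t) r (volume.restrict K)) ⊤
    (volume.restrict (timeInterval τ))).toReal, ?_⟩⟩, he⟩
  have h1 := h.2 K hK
  rw [ENNReal.ofReal_toReal h1.ne]
  rw [eLpNorm_exponent_top]
  filter_upwards [Measure.ae_ae_of_ae_prod he, ae_le_eLpNormEssSup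
    (f := fun t => eLpNorm (X t) r (volume.restrict K)) (μ := volume.restrict (timeInterval τ))]
    with t ht hb
  simp only [enorm_eq_self] at hb
  refine le_trans (eLpNorm_congr_ae (ae_restrict_of_ae (ht.mono fun q hq => hq.symm))).le hb

lemma IsDivergence.ae_unique {b b' : Heis n → Heis n} {D D' : Heis n → ℝ} (h : IsDivergence b D)
    (h' : IsDivergence b' D') (hb : b =ᵐ[volume] b') : D =ᵐ[volume] D' := by
  refine ae_eq_of_integral_contDiff_smul_eq h.2.1 h'.2.1 fun φ hφ hc => ?_
  simp only [smul_eq_mul]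
  have e : ∫ p, fderiv ℝ φ p (b p) = ∫ p, fderiv ℝ φ p (b' p) :=
    integral_congr_ae (hb.mono fun p hp => by simp only [hp])
  rw [h.2.2 φ hφ hc, h'.2.2 φ hφ hc] at e
  exact neg_injective e

lemma IsDivergence.congr_ae {b b' : Heis n → Heis n} {D D' : Heis n → ℝ} (h : IsDivergence b D)
    (hb : b =ᵐ[volume] b') (hD : D =ᵐ[volume] D') : IsDivergence b' D' := by
  refine ⟨h.1.congr hb, h.2.1.congr hD, fun φ hφ hc => ?_⟩
  have e1 : ∫ p, fderiv ℝ φ p (b' p) = ∫ p, fderiv ℝ φ p (b p) :=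
    integral_congr_ae (hb.mono fun p hp => by simp only [hp])
  have e2 : ∫ p, φ p * D' p = ∫ p, φ p * D p :=
    integral_congr_ae (hD.mono fun p hp => by simp only [hp])
  rw [e1, e2]
  exact h.2.2 φ hφ hc

lemma leftField_contactVec (ψ : Heis n → ℝ) (G : Fin n ⊕ Fin n → Heis n → ℝ) (p : Heis n) :
    leftField (contactVec ψ G p) p = -(4 * ψ p) • verticalField p +
      ∑ j : Fin n, (G (Sum.inr j) p • horizontalFrame (Sum.inl j) p -
        G (Sum.inl j) p • horizontalFrame (Sum.inr j) p) := by
  have hv : verticalField p = (vert 1 : Heis n) := rfl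
  rw [leftField_eq_sum, Fintype.sum_sum_type]
  simp only [horizontalFrame_eq, hcoord_contactVec, hv, Finset.sum_sub_distrib]
  simp only [contactSign, Sum.elim_inl, Sum.elim_inr, Sum.swap_inl, Sum.swap_inr, one_mul, neg_mul,
    neg_smul, Finset.sum_neg_distrib, contactVec]
  abel

/-- The derivatives that define the contact field are chosen at each time separately. Uniqueness of
weak derivatives identifies them with the jointly measurable ones. -/
lemma IsContactFieldOf.ae_eq {b : Heis n → Heis n} {ψ : Heis n → ℝ} (h : IsContactFieldOf b ψ)
    {ψ' : Heis n → ℝ} {G : Fin n ⊕ Fin n → Heis n → ℝ} (hψ : ψ =ᵐ[volume] ψ')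
    (hG : ∀ j, IsWeakDerivAlong (leftField (hbasis j)) ψ' (G j)) :
    b =ᵐ[volume] fun p => leftField (contactVec ψ' G p) p := by
  obtain ⟨G₀, hG₀, hb⟩ := h
  have h1 : ∀ j, G₀ j =ᵐ[volume] G j := fun j => by
    have := hG₀ j
    rw [horizontalFrame_eq] at this
    exact (this.congr_ae hψ (ae_eq_refl _)).ae_unique (hG j)
  filter_upwards [hb, hψ, ae_all_iff.2 h1] with p hp hψp h1p
  simp only [leftField_contactVec, hp, hψp, h1p]

lemma measurable_leftField_comp {X : Type*} [MeasurableSpace X] {a p : X → Heis n}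
    (ha : Measurable a) (hp : Measurable p) : Measurable fun x => leftField (a x) (p x) := by
  have : Measurable fun z : Heis n × Heis n => leftField z.1 z.2 := by
    have : Continuous fun z : Heis n × Heis n => leftField z.1 z.2 := by
      unfold leftField symplForm vert
      fun_prop
    exact this.measurable
  exact this.comp (ha.prodMk hp)

lemma ContactData.measurable_contactField {ψ S : ℝ → Heis n → ℝ}
    {G : Fin n ⊕ Fin n → ℝ → Heis n → ℝ} {H : Fin n ⊕ Fin n → Fin n ⊕ Fin n → ℝ → Heis n → ℝ}
    (h : ContactData ν r ψ S G H) : Measurable (Function.uncurry (contactField ψ G)) :=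
  measurable_iff_hcoord (fun j => (h.mem_hor j).1) h.mem_ver.1

lemma ContactData.mono {ν' : Measure ℝ} (hν : ν' ≤ ν) {ψ S : ℝ → Heis n → ℝ}
    {G : Fin n ⊕ Fin n → ℝ → Heis n → ℝ} {H : Fin n ⊕ Fin n → Fin n ⊕ Fin n → ℝ → Heis n → ℝ}
    (h : ContactData ν r ψ S G H) : ContactData ν' r ψ S G H := by
  have hm : ∀ {X : ℝ → Heis n → ℝ}, MixedInt ν r X → MixedInt ν' r X := fun hX =>
    ⟨hX.1, fun K hK => (lintegral_mono' hν le_rfl).trans_lt (hX.2 K hK)⟩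
  have ha := Measure.absolutelyContinuous_of_le hν
  exact ⟨hm h.mem, hm h.mem_vert, fun j => hm (h.mem_grad j), fun i j => hm (h.mem_hess i j),
    fun j => ha.ae_le (h.grad j), fun i j => ha.ae_le (h.hess i j), ha.ae_le h.vert⟩

/-- Measurable representatives of the generating function of a contact field. -/
lemma exists_contactData (k : Fin n) (hr : 1 ≤ r) {ψ : ℝ → Heis n → ℝ}
    {G : Fin n ⊕ Fin n → ℝ → Heis n → ℝ} {H : Fin n ⊕ Fin n → Fin n ⊕ Fin n → ℝ → Heis n → ℝ}
    (hψ : MemMixedLoc τ 1 r ψ) (hG : ∀ j, MemMixedLoc τ 1 r (G j) ∧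
      ∀ᵐ t ∂(volume.restrict (timeInterval τ)),
        IsWeakDerivAlong (horizontalFrame j) (ψ t) (G j t))
    (hH : ∀ i j, MemMixedLoc τ 1 r (H i j) ∧ ∀ᵐ t ∂(volume.restrict (timeInterval τ)),
      IsWeakDerivAlong (horizontalFrame i) (G j t) (H i j t))
    {b : ℝ → Heis n → Heis n} (hb : IsTimeContactFieldOf τ b ψ) :
    ∃ (ψ' S' : ℝ → Heis n → ℝ) (G' : Fin n ⊕ Fin n → ℝ → Heis n → ℝ)
      (H' : Fin n ⊕ Fin n → Fin n ⊕ Fin n → ℝ → Heis n → ℝ),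
      ContactData (volume.restrict (timeInterval τ)) r ψ' S' G' H' ∧
      ∀ᵐ z : ℝ × Heis n ∂(spaceTime n τ), b z.1 z.2 = leftField (contactField ψ' G' z.1 z.2) z.2 := by
  obtain ⟨ψ', mψ, eψ⟩ := hψ.exists_mixedInt
  choose G' mG eG using fun j => (hG j).1.exists_mixedInt
  choose H' mH eH using fun i j => (hH i j).1.exists_mixedInt
  have aψ := Measure.ae_ae_of_ae_prod eψ
  have aG := fun j => Measure.ae_ae_of_ae_prod (eG j)
  have aH := fun i j => Measure.ae_ae_of_ae_prod (eH i j)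
  have dG : ∀ j, ∀ᵐ t ∂(volume.restrict (timeInterval τ)),
      IsWeakDerivAlong (leftField (hbasis j)) (ψ' t) (G' j t) := fun j => by
    filter_upwards [(hG j).2, aψ, aG j] with t h1 h2 h3
    rw [horizontalFrame_eq] at h1
    exact h1.congr_ae h2 h3
  have dH : ∀ i j, ∀ᵐ t ∂(volume.restrict (timeInterval τ)),
      IsWeakDerivAlong (leftField (hbasis i)) (G' j t) (H' i j t) := fun i j => by
    filter_upwards [(hH i j).2, aG j, aH i j] with t h1 h2 h3
    rw [horizontalFrame_eq] at h1
    exact h1.congr_ae h2 h3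
  -- The vertical derivative is not assumed but obtained from the bracket of X_k and Y_k, so one
  -- such pair must exist.
  have hC : ContactData (volume.restrict (timeInterval τ)) r ψ' (fun t q => -(1 / 4) *
      (H' (Sum.inl k) (Sum.inr k) t q - H' (Sum.inr k) (Sum.inl k) t q)) G' H' :=
    { mem := mψ
      mem_vert := by
        have := (((mH (Sum.inl k) (Sum.inr k)).add hr
          ((mH (Sum.inr k) (Sum.inl k)).const_mul (-1))).const_mul (-(1 / 4)))
        simpa only [neg_mul, one_mul, ← sub_eq_add_neg] using this
      mem_grad := mG
      mem_hess := mH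
      grad := dG
      hess := dH
      vert := by
        filter_upwards [ae_all_iff.2 dG, ae_all_iff.2 fun i => ae_all_iff.2 (dH i)] with t h1 h2
        exact IsWeakDerivAlong.vertical h1 h2 k }
  refine ⟨ψ', _, G', H', hC, ?_⟩
  refine ae_prod_of_ae_ae hb.1 (g := fun t q => leftField (contactField ψ' G' t q) q)
    (measurable_leftField_comp hC.measurable_contactField measurable_snd).aestronglyMeasurable ?_
  filter_upwards [hb.2, aψ, ae_all_iff.2 dG] with t h1 h2 h3
  exact h1.ae_eq h2 h3

end representatives

/-! ### Reduction to a time slab (0,T] with T < τ. -/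

section slab

open Filter Topology

variable {n : ℕ} {τ : EReal} {s s' : ℝ≥0∞} {T : ℝ} {ψ S : ℝ → Heis n → ℝ}
  {G : Fin n ⊕ Fin n → ℝ → Heis n → ℝ}
  {H : Fin n ⊕ Fin n → Fin n ⊕ Fin n → ℝ → Heis n → ℝ}

lemma prod_restrict_left (A : Set ℝ) : ((volume : Measure ℝ).restrict A).prod
    (volume : Measure (Heis n)) = (volume : Measure (ℝ × Heis n)).restrict (A ×ˢ univ) := by
  rw [Measure.volume_eq_prod ℝ (Heis n), ← Measure.prod_restrict, Measure.restrict_univ]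

lemma Ioc_subset_timeInterval (hT : (T : EReal) < τ) : Ioc 0 T ⊆ timeInterval τ :=
  fun _ ht => ⟨ht.1, (EReal.coe_le_coe_iff.2 ht.2).trans_lt hT⟩

lemma restrict_Ioc_le (hT : (T : EReal) < τ) :
    (volume : Measure ℝ).restrict (Ioc 0 T) ≤ volume.restrict (timeInterval τ) :=
  Measure.restrict_mono (Ioc_subset_timeInterval hT) le_rfl

lemma slab_le (hT : (T : EReal) < τ) :
    ((volume : Measure ℝ).restrict (Ioc 0 T)).prod (volume : Measure (Heis n))
      ≤ spaceTime n τ := by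
  rw [spaceTime, prod_restrict_left, prod_restrict_left]
  exact Measure.restrict_mono (prod_mono_left (Ioc_subset_timeInterval hT)) le_rfl

lemma eq_zero_of_mem_diff {F : ℝ × Heis n → ℝ} (h0 : ∀ z, T ≤ z.1 → F z = 0) :
    ∀ z ∈ (timeInterval τ ×ˢ (univ : Set (Heis n))) \ (Ioc 0 T ×ˢ univ), F z = 0 := by
  intro z hz
  refine h0 z (le_of_not_gt fun h => hz.2 ⟨⟨hz.1.1.1, h.le⟩, mem_univ _⟩)

lemma integrable_spaceTime {F : ℝ × Heis n → ℝ}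
    (h0 : ∀ z, T ≤ z.1 → F z = 0)
    (h : Integrable F (((volume : Measure ℝ).restrict (Ioc 0 T)).prod volume)) :
    Integrable F (spaceTime n τ) := by
  rw [prod_restrict_left] at h
  rw [spaceTime, prod_restrict_left]
  exact IntegrableOn.of_forall_sdiff_eq_zero h
    ((isOpen_timeInterval τ).measurableSet.prod MeasurableSet.univ) (eq_zero_of_mem_diff h0)

lemma integral_spaceTime (hT : (T : EReal) < τ) {F : ℝ × Heis n → ℝ}
    (h0 : ∀ z, T ≤ z.1 → F z = 0) :
    ∫ z, F z ∂(spaceTime n τ)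
      = ∫ z, F z ∂(((volume : Measure ℝ).restrict (Ioc 0 T)).prod volume) := by
  rw [spaceTime, prod_restrict_left, prod_restrict_left]
  exact setIntegral_eq_of_subset_of_forall_sdiff_eq_zero
    ((isOpen_timeInterval τ).measurableSet.prod MeasurableSet.univ)
    (prod_mono_left (Ioc_subset_timeInterval hT)) (eq_zero_of_mem_diff h0)

lemma MixedBdd.mono {ν ν' : Measure ℝ} (hν : ν' ≤ ν) {r : ℝ≥0∞} {X : ℝ → Heis n → ℝ}
    (h : MixedBdd ν r X) : MixedBdd ν' r X :=
  ⟨h.1, fun K hK => (h.2 K hK).imp fun _ hN => (Measure.absolutelyContinuous_of_le hν).ae_le hN⟩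

/-- Test functions vanish near the final time. -/
lemma IsTestFunction.exists_time (hτ : 0 < τ) {φ : ℝ × Heis n → ℝ} (h : IsTestFunction τ φ) :
    ∃ T : ℝ, 0 < T ∧ (T : EReal) < τ ∧ tsupport φ ⊆ {z | z.1 < T} := by
  obtain ⟨z, hz, hmax⟩ := (h.2.1.isCompact.insert (0 : ℝ × Heis n)).exists_isMaxOn
    (insert_nonempty _ _) (f := Prod.fst) continuous_fst.continuousOn
  have hzτ : (z.1 : EReal) < τ := by
    rcases hz with rfl | hz
    · simpa using hτ
    · exact h.2.2 hz
  have hz0 : 0 ≤ z.1 := hmax (mem_insert _ _)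
  obtain ⟨T, hT1, hT2⟩ := EReal.lt_iff_exists_real_btwn.1 hzτ
  have hT1' : z.1 < T := EReal.coe_lt_coe_iff.1 hT1
  exact ⟨T, hz0.trans_lt hT1', hT2, fun w hw => (hmax (mem_insert_of_mem _ hw)).trans_lt hT1'⟩

lemma notMem_tsupport_of_le {φ : ℝ × Heis n → ℝ} (h : tsupport φ ⊆ {z | z.1 < T}) {z : ℝ × Heis n}
    (hz : T ≤ z.1) : z ∉ tsupport φ := fun hn => not_lt.2 hz (h hn)

/-- Integrability of the zero order term of the equation. -/
lemma locInt_zero_order (hT : 0 < T) (hTτ : (T : EReal) < τ) (hs' : 1 ≤ s')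
    [ENNReal.HolderConjugate s s'] (hC : ContactData (volume.restrict (timeInterval τ)) s' ψ S G H)
    {u c : ℝ → Heis n → ℝ} (hu : MixedBdd (volume.restrict (timeInterval τ)) s u)
    (hc : Measurable (Function.uncurry c))
    (h : ∀ φ : ℝ × Heis n → ℝ, IsTestFunction τ φ → Integrable (fun z : ℝ × Heis n =>
      u z.1 z.2 * (adjointTransport (contactField ψ G) (contactFieldDiv S H) φ z.1 z.2
        + c z.1 z.2 * φ z)) (spaceTime n τ)) :
    LocInt (volume.restrict (Ioc 0 T)) fun t q => c t q * u t q := by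
  refine ⟨hc.mul hu.1, fun K hK => ?_⟩
  obtain ⟨T', hT1, hT2⟩ := EReal.lt_iff_exists_real_btwn.1 hTτ
  -- The test function equals 1 on (0,T] × K and is supported in times at most T' < τ. In the
  -- integrand that is known to be integrable, all terms except c u are integrable by Hölder, so c u
  -- is integrable there as well.
  let η : ContDiffBump (0 : ℝ) := ⟨T, T', hT, EReal.coe_lt_coe_iff.1 hT1⟩
  obtain ⟨θ, hθ, hθc, -, hθ1⟩ := exists_contDiff_cutoff hK
  set φ : ℝ × Heis n → ℝ := fun z => η z.1 * θ z.2 with hφdef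
  have hφ : ContDiff ℝ ∞ φ := (η.contDiff.comp contDiff_fst).mul (hθ.comp contDiff_snd)
  have hsub : tsupport φ ⊆ Metric.closedBall 0 T' ×ˢ tsupport θ := by
    refine closure_minimal (fun z hz => ?_) (Metric.isClosed_closedBall.prod (isClosed_tsupport θ))
    have h1 := mul_ne_zero_iff.1 hz
    refine ⟨?_, subset_closure h1.2⟩
    have h2 : z.1 ∈ Function.support η := h1.1
    rw [η.support_eq] at h2
    exact Metric.ball_subset_closedBall h2
  have hφc : HasCompactSupport φ :=
    ((isCompact_closedBall _ _).prod hθc.isCompact).of_isClosed_subset (isClosed_tsupport _) hsub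
  have htest : IsTestFunction τ φ := by
    refine ⟨hφ, hφc, fun z hz => ?_⟩
    have h1 := (hsub hz).1
    rw [mem_closedBall_zero_iff, Real.norm_eq_abs] at h1
    exact (EReal.coe_le_coe_iff.2 ((le_abs_self _).trans h1)).trans_lt hT2
  have i1 := (h φ htest).mono_measure (slab_le hTτ)
  have hCT := hC.mono (restrict_Ioc_le hTτ)
  have hK' : IsCompact (Prod.snd '' tsupport φ) := hφc.isCompact.image continuous_snd
  have i2 := ((hu.mono (restrict_Ioc_le hTτ)).locInt_mul
    (hCT.mixedInt_adjointTransport hs' hφ hφc)).integrable_of_support hK' fun t q hq => by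
      rw [adjointTransport_eq_zero fun hn => hq ⟨_, hn, rfl⟩, mul_zero]
  have i3 := (i1.sub i2).mono_measure (Measure.prod_mono (le_refl (volume.restrict (Ioc 0 T)))
    (Measure.restrict_le_self (μ := (volume : Measure (Heis n))) (s := K)))
  refine i3.congr ?_
  have a1 : ∀ᵐ z : ℝ × Heis n ∂(((volume : Measure ℝ).restrict (Ioc 0 T)).prod
      (volume.restrict K)), z.1 ∈ Ioc 0 T :=
    Measure.quasiMeasurePreserving_fst.ae (ae_restrict_mem measurableSet_Ioc)
  have a2 : ∀ᵐ z : ℝ × Heis n ∂(((volume : Measure ℝ).restrict (Ioc 0 T)).prod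
      (volume.restrict K)), z.2 ∈ K :=
    Measure.quasiMeasurePreserving_snd.ae (ae_restrict_mem hK.measurableSet)
  filter_upwards [a1, a2] with z h1 h2
  have h3 : φ z = 1 := by
    simp only [hφdef, hθ1 _ h2, mul_one]
    refine η.one_of_mem_closedBall ?_
    rw [mem_closedBall_zero_iff, Real.norm_eq_abs, abs_of_pos h1.1]
    exact h1.2
  simp only [Pi.sub_apply, h3, Function.uncurry]
  ring

end slab

/-! ### From slab and representatives back to the original formulation. -/

section renormalization

open Filter Topology

variable {n : ℕ} {τ : EReal} {s : ℝ≥0∞} {ψ S : ℝ → Heis n → ℝ}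
  {G : Fin n ⊕ Fin n → ℝ → Heis n → ℝ}
  {H : Fin n ⊕ Fin n → Fin n ⊕ Fin n → ℝ → Heis n → ℝ}

/-- `C¹` functions agree on bounded intervals with `C¹` functions with bounded derivative. -/
lemma exists_bounded_deriv_truncation {β : ℝ → ℝ} (hβ : ContDiff ℝ 1 β) {N : ℝ} (hN : 0 ≤ N) :
    ∃ γ : ℝ → ℝ, ContDiff ℝ 1 γ ∧ (∃ M, ∀ x, |deriv γ x| ≤ M) ∧
      ∀ x, |x| ≤ N → γ x = β x ∧ deriv γ x = deriv β x := by
  have hβ' := hβ.continuous_deriv le_rfl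
  -- β' is frozen at its boundary values outside [−N, N], and the primitive of the result is the
  -- truncation. It stays C¹, unlike the result of freezing β itself.
  set g : ℝ → ℝ := fun y => deriv β (max (-N) (min N y)) with hg
  have hgc : Continuous g := hβ'.comp (by fun_prop)
  have hd : ∀ x, HasDerivAt (fun x => β 0 + ∫ y in (0 : ℝ)..x, g y) (g x) x := fun x =>
    (hgc.integral_hasStrictDerivAt 0 x).hasDerivAt.const_add _
  have hd' : deriv (fun x => β 0 + ∫ y in (0 : ℝ)..x, g y) = g := funext fun x => (hd x).deriv
  have hgβ : ∀ x, |x| ≤ N → g x = deriv β x := fun x hx => by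
    simp only [hg]
    rw [min_eq_right (abs_le.1 hx).2, max_eq_right (abs_le.1 hx).1]
  obtain ⟨M, hM⟩ := (isCompact_Icc (a := -N) (b := N)).exists_bound_of_continuousOn
    hβ'.continuousOn
  refine ⟨fun x => β 0 + ∫ y in (0 : ℝ)..x, g y, ?_, ⟨M, fun x => ?_⟩, fun x hx => ⟨?_, ?_⟩⟩
  · refine contDiff_one_iff_deriv.2 ⟨fun x => (hd x).differentiableAt, ?_⟩
    rw [hd']
    exact hgc
  · rw [hd']
    exact hM _ ⟨le_max_left _ _, max_le (by linarith) (min_le_left _ _)⟩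
  · have h1 : ∫ y in (0 : ℝ)..x, g y = ∫ y in (0 : ℝ)..x, deriv β y := by
      refine intervalIntegral.integral_congr fun y hy => hgβ y ?_
      have h2 := abs_sub_left_of_mem_uIcc hy
      simp only [sub_zero] at h2
      exact h2.trans hx
    change β 0 + _ = _
    rw [h1, intervalIntegral.integral_deriv_eq_sub (fun y _ => hβ.differentiable one_ne_zero y)
      (hβ'.intervalIntegrable _ _)]
    ring
  · rw [hd']
    exact hgβ x hx

lemma MemMixed.exists_bound {u : ℝ → Heis n → ℝ} (h : MemMixed τ ⊤ ⊤ u) :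
    ∃ N : ℝ, 0 ≤ N ∧ ∀ᵐ z : ℝ × Heis n ∂(spaceTime n τ), |u z.1 z.2| ≤ N := by
  obtain ⟨u', hm, he⟩ := exists_measurable_representative h.1
  have h1 := h.2
  rw [eLpNorm_exponent_top] at h1
  set N := (eLpNormEssSup (fun t => eLpNorm (u t) ⊤ volume)
    (volume.restrict (timeInterval τ))).toReal with hN
  refine ⟨N, ENNReal.toReal_nonneg, ?_⟩
  have h2 : ∀ᵐ z : ℝ × Heis n ∂(spaceTime n τ), |u' z.1 z.2| ≤ N := by
    have hs : MeasurableSet {z : ℝ × Heis n | |u' z.1 z.2| ≤ N} :=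
      measurableSet_le (measurable_norm.comp hm) measurable_const
    refine (Measure.ae_prod_iff_ae_ae hs).2 ?_
    filter_upwards [Measure.ae_ae_of_ae_prod he, ae_le_eLpNormEssSup
      (f := fun t => eLpNorm (u t) ⊤ volume) (μ := volume.restrict (timeInterval τ))] with t h3 h4
    rw [enorm_eq_self, ← ENNReal.ofReal_toReal h1.ne, ← hN, eLpNorm_exponent_top] at h4
    filter_upwards [h3, ae_le_eLpNormEssSup (f := u t) (μ := volume)] with q h5 h6
    rw [← h5]
    have h7 := h6.trans h4
    rw [← ofReal_norm, ENNReal.ofReal_le_ofReal_iff ENNReal.toReal_nonneg] at h7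
    exact h7
  filter_upwards [he, h2] with z h3 h4
  rw [h3]
  exact h4

/-- The definitions of solution provide some divergence D. As distributional divergences are unique,
it is the explicit one, whatever integrability D is declared to have. -/
lemma ContactData.ae_eq_div {r r' : ℝ≥0∞} (hr : 1 ≤ r)
    (hC : ContactData (volume.restrict (timeInterval τ)) r ψ S G H) {b : ℝ → Heis n → Heis n}
    (hb : ∀ᵐ z : ℝ × Heis n ∂(spaceTime n τ),
      b z.1 z.2 = leftField (contactField ψ G z.1 z.2) z.2)
    {D : ℝ → Heis n → ℝ} (hD : HasDivergenceInL1 τ r' b D) :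
    ∀ᵐ z : ℝ × Heis n ∂(spaceTime n τ), D z.1 z.2 = contactFieldDiv S H z.1 z.2 := by
  refine ae_prod_of_ae_ae hD.2.1.1 (hC.mem_div hr).1.aestronglyMeasurable ?_
  filter_upwards [hD.2.2, hC.isDivergence, Measure.ae_ae_of_ae_prod hb] with t h1 h2 h3
  exact h1.ae_unique h2 h3

/-- Distributional solutions of the transport equation along contact fields are renormalized. -/
theorem isRenormalizedSolution_of_contactData (k : Fin n) (hτ : 0 < τ) (hs : 1 ≤ s)
    (hC : ContactData (volume.restrict (timeInterval τ)) (ENNReal.conjExponent s) ψ S G H)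
    {b : ℝ → Heis n → Heis n} (hb : ∀ᵐ z : ℝ × Heis n ∂(spaceTime n τ),
      b z.1 z.2 = leftField (contactField ψ G z.1 z.2) z.2)
    {u₀ : Heis n → ℝ} {c u : ℝ → Heis n → ℝ} (hu₀ : MemLp u₀ s volume)
    (hc : MemL1LocSpaceTime τ c) (hu : MemMixed τ ⊤ s u)
    (h : IsDistributionalSolution τ s b c u₀ u) : IsRenormalizedSolution τ s b c u₀ u := by
  have hss := ENNReal.HolderConjugate.conjExponent hs
  have hs' : 1 ≤ ENNReal.conjExponent s := ENNReal.HolderConjugate.one_le _ s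
  obtain ⟨-, -, -, -, D, hD, hweak⟩ := h
  refine ⟨hc, hu₀, hu, D, hD, fun β hβ hβM φ hφ => ?_⟩
  obtain ⟨u', hu', eu⟩ := hu.memMixedLoc.exists_mixedBdd
  have hcm : AEStronglyMeasurable (Function.uncurry c) (spaceTime n τ) := by
    refine hc.aestronglyMeasurable.mono_measure ?_
    rw [spaceTime, prod_restrict_left]
    have hsub : timeInterval τ ×ˢ (univ : Set (Heis n)) ⊆ {q | 0 ≤ q.1 ∧ (q.1 : EReal) < τ} :=
      fun z hz => ⟨hz.1.1.le, hz.1.2⟩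
    exact Measure.restrict_mono hsub le_rfl
  obtain ⟨c', hc', ec⟩ := exists_measurable_representative hcm
  have hu₀l : LocallyIntegrable u₀ := hu₀.locallyIntegrable hs
  set u₀' := hu₀.1.aemeasurable.mk u₀ with hu₀'
  have hu₀m : Measurable u₀' := hu₀.1.aemeasurable.measurable_mk
  have eu₀ : u₀ =ᵐ[volume] u₀' := hu₀.1.aemeasurable.ae_eq_mk
  have eD := hC.ae_eq_div hs' hb hD
  have hweak' : ∀ φ : ℝ × Heis n → ℝ, IsTestFunction τ φ →
      Integrable (fun z : ℝ × Heis n => u' z.1 z.2 *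
        (adjointTransport (contactField ψ G) (contactFieldDiv S H) φ z.1 z.2
          + c' z.1 z.2 * φ z)) (spaceTime n τ) ∧
      -(∫ p, u₀' p * φ (0, p)) + ∫ z : ℝ × Heis n, u' z.1 z.2 *
        (adjointTransport (contactField ψ G) (contactFieldDiv S H) φ z.1 z.2
          + c' z.1 z.2 * φ z) ∂(spaceTime n τ) = 0 := by
    intro φ hφ
    have e : (fun q : ℝ × Heis n => u q.1 q.2 *
        (-timeDeriv φ q + spaceDerivAlong b φ q + (c q.1 q.2 + D q.1 q.2) * φ q))
        =ᵐ[spaceTime n τ] fun z : ℝ × Heis n => u' z.1 z.2 *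
        (adjointTransport (contactField ψ G) (contactFieldDiv S H) φ z.1 z.2
          + c' z.1 z.2 * φ z) := by
      filter_upwards [eu, ec, eD, hb] with z h1 h2 h3 h4
      have h2' : c z.1 z.2 = c' z.1 z.2 := h2
      simp only [spaceDerivAlong, adjointTransport, h1, h2', h3, h4]
      ring
    have e0 : ∫ p, u₀ p * φ (0, p) = ∫ p, u₀' p * φ (0, p) :=
      integral_congr_ae (eu₀.mono fun p hp => by simp only [hp])
    obtain ⟨h1, h2⟩ := hweak φ hφ
    exact ⟨h1.congr e, by rw [← e0, ← integral_congr_ae e]; exact h2⟩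
  -- The support of φ ends before some T < τ, so only a time interval of finite length matters even
  -- when τ = ∞.
  obtain ⟨T, hT, hTτ, hφT⟩ := hφ.exists_time hτ
  have hle := restrict_Ioc_le hTτ
  have hcu := locInt_zero_order hT hTτ hs' hC hu' hc' fun φ hφ => (hweak' φ hφ).1
  have hw : IsWeakTransport T (contactField ψ G) (contactFieldDiv S H) c' u' u₀' := by
    intro φ h1 h2 h3
    have h4 := (hweak' φ ⟨h1, h2, fun z hz => (EReal.coe_lt_coe_iff.2 (h3 hz)).trans hTτ⟩).2
    rw [integral_spaceTime hTτ] at h4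
    · refine Eq.trans ?_ h4
      congr 1
      refine integral_congr_ae (Eventually.of_forall fun z => ?_)
      simp only [adjointTransport]
      ring
    · intro z hz
      have hn := notMem_tsupport_of_le h3 hz
      rw [adjointTransport_eq_zero hn, image_eq_zero_of_notMem_tsupport hn]
      ring
  -- For s = ∞ the derivative of β may be unbounded, but only its values on the ranges of u and u₀
  -- enter, so β is replaced by a truncation.
  have hγ : ∃ γ : ℝ → ℝ, ContDiff ℝ 1 γ ∧ (∃ M, ∀ x, |deriv γ x| ≤ M) ∧
      (∀ᵐ z : ℝ × Heis n ∂(spaceTime n τ), γ (u z.1 z.2) = β (u z.1 z.2) ∧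
        deriv γ (u z.1 z.2) = deriv β (u z.1 z.2)) ∧ ∀ᵐ p, γ (u₀ p) = β (u₀ p) := by
    by_cases hst : s = ⊤
    · subst hst
      obtain ⟨N, hN, huN⟩ := hu.exists_bound
      have h0 : ∀ᵐ p, |u₀ p| ≤ (eLpNorm u₀ ⊤ volume).toReal := by
        have h1 := hu₀.2
        rw [eLpNorm_exponent_top] at h1 ⊢
        filter_upwards [ae_le_eLpNormEssSup (f := u₀) (μ := volume)] with p hp
        rwa [← ENNReal.ofReal_toReal h1.ne, ← ofReal_norm,
          ENNReal.ofReal_le_ofReal_iff ENNReal.toReal_nonneg] at hp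
      obtain ⟨γ, h1, h2, h3⟩ := exists_bounded_deriv_truncation hβ
        (N := max N (eLpNorm u₀ ⊤ volume).toReal) (le_max_of_le_left hN)
      exact ⟨γ, h1, h2, huN.mono fun z hz => h3 _ (le_max_of_le_left hz),
        h0.mono fun p hp => (h3 _ (le_max_of_le_right hp)).1⟩
    · exact ⟨β, hβ, hβM hst, Eventually.of_forall fun _ => ⟨rfl, rfl⟩,
        Eventually.of_forall fun _ => rfl⟩
  obtain ⟨γ, hγ, ⟨M, hM⟩, hγu, hγ0⟩ := hγ
  obtain ⟨h1, h2⟩ := hw.renormalized k hT hs' (hC.mono hle) (hu'.mono hle) hcu (hu₀l.congr eu₀)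
    hu₀m hγ hM hφ.1 hφ.2.1 hφT
  have h0 : ∀ z : ℝ × Heis n, T ≤ z.1 → γ (u' z.1 z.2)
      * adjointTransport (contactField ψ G) (contactFieldDiv S H) φ z.1 z.2
      + c' z.1 z.2 * u' z.1 z.2 * deriv γ (u' z.1 z.2) * φ z = 0 := by
    intro z hz
    have hn := notMem_tsupport_of_le hφT hz
    rw [adjointTransport_eq_zero hn, image_eq_zero_of_notMem_tsupport hn]
    ring
  have e : (fun z : ℝ × Heis n => γ (u' z.1 z.2)
      * adjointTransport (contactField ψ G) (contactFieldDiv S H) φ z.1 z.2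
      + c' z.1 z.2 * u' z.1 z.2 * deriv γ (u' z.1 z.2) * φ z) =ᵐ[spaceTime n τ]
      fun q : ℝ × Heis n => β (u q.1 q.2) *
              (-timeDeriv φ q + spaceDerivAlong b φ q + D q.1 q.2 * φ q) +
              c q.1 q.2 * u q.1 q.2 * deriv β (u q.1 q.2) * φ q := by
    filter_upwards [eu, ec, eD, hb, hγu] with z h1 h2 h3 h4 h5
    have h2' : c z.1 z.2 = c' z.1 z.2 := h2
    simp only [spaceDerivAlong, adjointTransport, h2', h3, h4, ← h5.1, ← h5.2]
    rw [h1]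
  have e0 : ∫ p, β (u₀ p) * φ (0, p) = ∫ p, γ (u₀' p) * φ (0, p) := by
    refine integral_congr_ae ?_
    filter_upwards [eu₀, hγ0] with p h1 h2
    rw [← h1, h2]
  refine ⟨(integrable_spaceTime h0 h1).congr e, ?_⟩
  rw [e0, ← integral_congr_ae e, integral_spaceTime hTτ h0]
  exact h2

end renormalization

/-! ### Local integrability of the contact field and of its divergence. -/

section divergence

open Filter

variable {n : ℕ} {τ : EReal} {r : ℝ≥0∞} {ψ S : ℝ → Heis n → ℝ}
  {G : Fin n ⊕ Fin n → ℝ → Heis n → ℝ}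
  {H : Fin n ⊕ Fin n → Fin n ⊕ Fin n → ℝ → Heis n → ℝ}

lemma memMixedLoc_one_of_integrable {E : Type*} [NormedAddCommGroup E] {X : ℝ → Heis n → E}
    (hX : AEStronglyMeasurable (Function.uncurry X) (spaceTime n τ))
    (h : ∀ K : Set (Heis n), IsCompact K → Integrable (Function.uncurry X)
      ((volume.restrict (timeInterval τ)).prod (volume.restrict K))) : MemMixedLoc τ 1 1 X := by
  refine ⟨hX, fun K hK => ?_⟩
  have h1 := (h K hK).hasFiniteIntegral
  rw [hasFiniteIntegral_iff_enorm, lintegral_prod _ (h K hK).1.enorm] at h1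
  simpa only [eLpNorm_one_eq_lintegral_enorm, enorm_eq_self, Function.uncurry_apply_pair] using h1

/-- On compact sets L^r embeds in L¹. The data are formulated with local norms so that they can be
weakened in this way and used with bounded solutions. -/
lemma ContactData.to_one {ν : Measure ℝ} [SFinite ν] (hr : 1 ≤ r) (h : ContactData ν r ψ S G H) :
    ContactData ν 1 ψ S G H :=
  ⟨(h.mem.locInt hr).mixedInt, (h.mem_vert.locInt hr).mixedInt,
    fun j => ((h.mem_grad j).locInt hr).mixedInt, fun i j => ((h.mem_hess i j).locInt hr).mixedInt,
    h.grad, h.hess, h.vert⟩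

lemma ContactData.hasDivergenceInL1 (hr : 1 ≤ r)
    (hC : ContactData (volume.restrict (timeInterval τ)) r ψ S G H) {b : ℝ → Heis n → Heis n}
    (hbm : AEStronglyMeasurable (Function.uncurry b) (spaceTime n τ))
    (hb : ∀ᵐ z : ℝ × Heis n ∂(spaceTime n τ),
      b z.1 z.2 = leftField (contactField ψ G z.1 z.2) z.2) :
    HasDivergenceInL1 τ 1 b (contactFieldDiv S H) := by
  refine ⟨memMixedLoc_one_of_integrable hbm fun K hK => ?_, memMixedLoc_one_of_integrable
    (hC.mem_div hr).1.aestronglyMeasurable fun K hK => ((hC.mem_div hr).locInt hr).2 K hK, ?_⟩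
  · set μ := ((volume : Measure ℝ).restrict (timeInterval τ)).prod
      ((volume : Measure (Heis n)).restrict K) with hμ
    have hle : μ ≤ spaceTime n τ := Measure.prod_mono le_rfl Measure.restrict_le_self
    have key : ∀ {X : ℝ → Heis n → ℝ} {V : Heis n → Heis n}, MixedInt (volume.restrict (timeInterval τ)) r X → Continuous V →
        Integrable (fun z : ℝ × Heis n => X z.1 z.2 • V z.2) μ := by
      intro X V hX hV
      obtain ⟨C, hCV⟩ := hK.exists_bound_of_continuousOn hV.continuousOn
      have i1 : Integrable (fun z : ℝ × Heis n => X z.1 z.2) μ := (hX.locInt hr).2 K hK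
      have a2 : ∀ᵐ z : ℝ × Heis n ∂μ, z.2 ∈ K :=
        Measure.quasiMeasurePreserving_snd.ae (ae_restrict_mem hK.measurableSet)
      refine (i1.norm.const_mul C).mono' (i1.1.smul
        (hV.comp continuous_snd).aestronglyMeasurable) (a2.mono fun z hz => ?_)
      rw [norm_smul, mul_comm]
      exact mul_le_mul_of_nonneg_right (hCV _ hz) (norm_nonneg _)
    have i1 : Integrable (fun z : ℝ × Heis n => ∑ j, hcoord j (contactField ψ G z.1 z.2)
        • leftField (hbasis j) z.2 + (contactField ψ G z.1 z.2).2.2 • _root_.vert 1) μ :=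
      (integrable_finsetSum _ fun j _ => key (hC.mem_hor j) (by fun_prop)).add
        (key hC.mem_ver continuous_const)
    refine i1.congr ?_
    filter_upwards [(Measure.absolutelyContinuous_of_le hle).ae_le hb] with z hz
    rw [← leftField_eq_sum]
    exact hz.symm
  · filter_upwards [hC.isDivergence, Measure.ae_ae_of_ae_prod hb] with t h1 h2
    exact h1.congr_ae (h2.mono fun q hq => hq.symm) (ae_eq_refl _)

end divergence

end

/-- Both assertions follow from one set of data for the generating function: the first with the
exponent s, the second with s = ∞ after the data are weakened to exponent 1. -/
theorem mainTheorem1 (n : ℕ) (hn : 0 < n) (τ : EReal) (hτ : 0 < τ) (s : ℝ≥0∞) (hs : 1 ≤ s)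
    (ψ : ℝ → Heis n → ℝ) (hψ : MemL1HorizontalW2 τ (ENNReal.conjExponent s) ψ)
    (b : ℝ → Heis n → Heis n) (hb : IsTimeContactFieldOf τ b ψ) :
    (∀ (u₀ : Heis n → ℝ) (c : ℝ → Heis n → ℝ) (u : ℝ → Heis n → ℝ),
      MemLp u₀ s volume → MemL1LocSpaceTime τ c → MemMixed τ ⊤ s u →
      IsDistributionalSolution τ s b c u₀ u → IsRenormalizedSolution τ s b c u₀ u) ∧
    HasRenormalizationProperty τ b := by
  have hss := ENNReal.HolderConjugate.conjExponent hs
  have hs' : 1 ≤ ENNReal.conjExponent s := ENNReal.HolderConjugate.one_le _ s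
  obtain ⟨hψ0, G, H, hG, hH⟩ := hψ
  obtain ⟨ψ', S, G', H', hC, hbC⟩ := exists_contactData ⟨0, hn⟩ hs' hψ0.memMixedLoc
    (fun j => ⟨(hG j).1.memMixedLoc, (hG j).2⟩) (fun i j => ⟨(hH i j).1.memMixedLoc, (hH i j).2⟩)
    hb
  refine ⟨fun u₀ c u hu₀ hc hu h =>
    isRenormalizedSolution_of_contactData ⟨0, hn⟩ hτ hs hC hbC hu₀ hc hu h,
    ⟨_, hC.hasDivergenceInL1 hs' hb.1 hbC⟩, fun u₀ c u hu₀ hc hu h => ?_⟩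
  -- Bounded solutions pair with the conjugate exponent 1, so only local L¹ bounds on ψ and its
  -- derivatives are needed.
  have hC1 : ContactData (volume.restrict (timeInterval τ)) (ENNReal.conjExponent ⊤) ψ' S G' H' := by
    have h1 : ENNReal.conjExponent ⊤ = 1 := by simp [ENNReal.conjExponent]
    rw [h1]
    exact hC.to_one hs'
  exact isRenormalizedSolution_of_contactData ⟨0, hn⟩ hτ le_top hC1 hbC hu₀ hc hu h
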